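/- For $n\in\mathbb N$ let $\mathsf{Grid}_{n,n}$ be the directed graph with vertices $(i,j)$, $0\le i,j\le n$ ($i$ is the layer of $(i,j)$), and with edges from $(i,j)$ to $(i+1,j)$, $(i+1,j+1)$ and $(i+1,j-1)$ whenever both endpoints are vertices. For edge weights $\mu:E(\mathsf{Grid}_{n,n})\to\mathbb N$ and vertices $u,v$ put $\mathcal W_{u,v}=\sum_{P}\prod_{e\in P}\mu(e)$, the sum over all directed paths $P$ from $u$ to $v$. A catalytic algorithm is a deterministic Turing machine with finitely many states, a read-only input tape, a write-only output tape, a binary read-write work tape of length $s$ and a binary read-write catalytic tape of length $c$. It has random access: the heads of the work and catalytic tapes can jump in one step to the cell whose number is written on an address tape of $\lceil\log_2(c+s)\rceil$ bits. It calls its oracle in one step through an oracle tape. For every initial contents $\tau$ of the catalytic tape, it must halt with the correct output and with $\tau$ on the catalytic tape. Free space is the total length of the work, address and oracle tapes. **Theorem.** For every real $\varepsilon>0$ there is a catalytic algorithm with the following property. Let $k\in\mathbb N$. Given (in binary) an integer $n\ge 2$, a prime $p\le n^k$ and two vertices $u=(\ell_u,i_u)$, $v=(\ell_v,i_v)$ of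 $\mathsf{Grid}_{n,n}$ such that $\ell_v-\ell_u$ is a power of two ($1,2,4,\dots$), and given an oracle $\mathcal D$ that on input an edge $e$ of $\mathsf{Grid}_{n,n}$ returns $\mu(e)\bmod p$, for arbitrary weights $\mu:E(\mathsf{Grid}_{n,n})\to\mathbb N$, the algorithm computes $\mathcal W_{u,v}\bmod p$. It runs in time $O(n^{3+\varepsilon})$, uses free space $O(\log n)$ and catalytic space $n/2^{\Omega(\sqrt{\log n})}$, and makes $O\!\left(n^{3+\varepsilon}/2^{3\sqrt{\log n}}\right)$ oracle calls. Here $\log$ is to base $2$, the tape lengths depend only on $n$, $k$ and $\varepsilon$, and the implied constants depend only on $\varepsilon$ and $k$. -/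

import Mathlib

/-! ### The layered grid graph and its total path weights -/

namespace CatalyticGrid

/-- A vertex `(i, j)` of the grid, `0 ≤ i ≤ n` (the layer) and `0 ≤ j ≤ n` (the index in it). -/
abbrev Vertex (n : ℕ) : Type := Fin (n + 1) × Fin (n + 1)

/-- The layered directed grid: edges go from `(i, j)` to `(i + 1, j)`, `(i + 1, j + 1)` and
`(i + 1, j - 1)`, whenever these are vertices. -/
def grid (n : ℕ) : Digraph (Vertex n) where
  Adj a b := (b.1 : ℕ) = a.1 + 1 ∧
    ((b.2 : ℕ) = a.2 ∨ (b.2 : ℕ) = a.2 + 1 ∨ (a.2 : ℕ) = b.2 + 1)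

/-- `l` is the vertex sequence of a directed path of `G` from `u` to `v`. -/
def IsPath {V : Type*} (G : Digraph V) (u v : V) (l : List V) : Prop :=
  l.IsChain G.Adj ∧ l.head? = some u ∧ l.getLast? = some v ∧ l.Nodup

/-- The weight of a vertex sequence: the product of the weights of consecutive pairs. -/
def pathWeight {V : Type*} (μ : V → V → ℕ) (l : List V) : ℕ :=
  ((l.zip l.tail).map fun e => μ e.1 e.2).prod

open Classical in
/-- The total path weight from `u` to `v`: the sum of the weights of all directed paths. -/
noncomputable def totalPathWeight {V : Type*} [Fintype V] (G : Digraph V) (μ : V → V → ℕ)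
    (u v : V) : ℕ :=
  ∑ P : {l : List V // l.Nodup} with IsPath G u v P.1, pathWeight μ P.1

/-! ### Binary encodings -/

/-- Self-delimiting binary code of a natural number: every binary digit `b`
(least significant first) becomes `1 b`, and a final `0` marks the end. -/
def encodeNat (m : ℕ) : List Bool :=
  (m.bits.flatMap fun b => [true, b]) ++ [false]

/-- Binary code of a finite sequence of natural numbers. -/
def encodeList (ms : List ℕ) : List Bool := ms.flatMap encodeNat

/-- Binary code of the edge from `a` to `b`, by the coordinates of its endpoints. -/
def encodeEdge {n : ℕ} (a b : Vertex n) : List Bool := encodeList [a.1, a.2, b.1, b.2]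

/-- `D` answers the code of each edge with the code of its weight modulo `p`. -/
def IsWeightOracle {n : ℕ} (μ : Vertex n → Vertex n → ℕ) (p : ℕ)
    (D : List Bool → List Bool) : Prop :=
  ∀ a b : Vertex n, (grid n).Adj a b → D (encodeEdge a b) = encodeNat (μ a b % p)

/-! ### Tapes -/

/-- A binary tape of fixed length between two end markers. The head is on the left end marker
(`head = 0`), on cell number `head - 1`, or on the right end marker (`head = cells.length + 1`). -/
structure Tape where
  cells : List Bool
  head : ℕ

/-- Head movements. -/
inductive Dir
  | left
  | stay
  | right

/-- Head movements on a tape with random access. -/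
inductive RMove
  | dir (d : Dir)
  | jump

namespace Tape

/-- A tape with the given contents and the head on the left end marker. -/
def init (w : List Bool) : Tape := ⟨w, 0⟩

/-- The scanned symbol; `none` is an end marker. -/
def read (t : Tape) : Option Bool := if t.head = 0 then none else t.cells[t.head - 1]?

/-- Overwrite the scanned cell; nothing happens on an end marker or if there is nothing to write. -/
def write (t : Tape) : Option Bool → Tape
  | none => t
  | some b => if t.head = 0 then t else { t with cells := t.cells.set (t.head - 1) b }

/-- Move the head by at most one position, never beyond the end markers. -/
def move (t : Tape) : Dir → Tape
  | .left => { t with head := t.head - 1 }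
  | .stay => t
  | .right => { t with head := min (t.head + 1) (t.cells.length + 1) }

/-- Move the head directly to cell number `k` (to the right end marker if there is no such cell). -/
def jump (t : Tape) (k : ℕ) : Tape := { t with head := min (k + 1) (t.cells.length + 1) }

/-- Perform a move, where `addr` is the target of a jump. -/
def rmove (t : Tape) (addr : ℕ) : RMove → Tape
  | .dir d => t.move d
  | .jump => t.jump addr

/-- The number written on the tape in binary, least significant digit first. -/
def value (t : Tape) : ℕ := Nat.ofDigits 2 (t.cells.map Bool.toNat)

/-- An oracle call: the query is the word to the left of the head; the answer overwrites the
beginning of the tape (it is cut off at the end of the tape), and the head returns to the left. -/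
def query (t : Tape) (D : List Bool → List Bool) : Tape :=
  let answer := D (t.cells.take (t.head - 1))
  ⟨(answer ++ t.cells.drop answer.length).take t.cells.length, 0⟩

end Tape

/-! ### Catalytic random access Turing machines with an oracle -/

/-- What the finite control sees: the scanned symbols of the readable tapes. -/
structure Scan where
  input : Option Bool
  work : Option Bool
  catalytic : Option Bool
  address : Option Bool
  oracle : Option Bool

/-- What is done on the oracle tape: an ordinary write and move, or an oracle call. -/
inductive OracleAct
  | act (w : Option Bool) (d : Dir)
  | query

/-- One instruction of the machine. -/
structure Instr (Q : Type) where
  next : Q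
  inputMove : Dir
  workWrite : Option Bool
  workMove : RMove
  catalyticWrite : Option Bool
  catalyticMove : RMove
  addressWrite : Option Bool
  addressMove : Dir
  oracleAct : OracleAct
  /-- the symbol appended to the output tape, if any -/
  output : Option Bool

/-- A deterministic catalytic Turing machine with random access and an oracle tape: finitely many
states, a start state, and a transition function, where `none` means that the machine halts. -/
structure Machine where
  State : Type
  finite : Finite State
  start : State
  trans : State → Scan → Option (Instr State)

/-- A configuration. The field `queries` counts the oracle calls; it is not visible to the
machine. -/
structure Config (Q : Type) where
  state : Q
  /-- the read-only input tape -/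
  input : Tape
  /-- the contents of the write-only output tape -/
  output : List Bool
  /-- the read-write work tape -/
  work : Tape
  /-- the read-write catalytic tape -/
  catalytic : Tape
  /-- the address tape, which holds the target of jumps on the work and the catalytic tape -/
  address : Tape
  /-- the oracle tape -/
  oracle : Tape
  queries : ℕ

/-- The length of the address tape for a work tape of length `s` and a catalytic tape of
length `c`. -/
def addressLength (s c : ℕ) : ℕ := Nat.clog 2 (c + s)

/-- The free space: all read-write cells outside the catalytic tape. -/
def freeSpace (s q c : ℕ) : ℕ := s + q + addressLength s c

namespace Machine

/-- The instruction to be executed next, if any. -/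
def instr (M : Machine) (x : Config M.State) : Option (Instr M.State) :=
  M.trans x.state
    ⟨x.input.read, x.work.read, x.catalytic.read, x.address.read, x.oracle.read⟩

/-- The machine has halted. -/
def Halted (M : Machine) (x : Config M.State) : Prop := M.instr x = none

/-- The result of one instruction. -/
def exec {Q : Type} (D : List Bool → List Bool) (x : Config Q) (i : Instr Q) : Config Q where
  state := i.next
  input := x.input.move i.inputMove
  output := x.output ++ i.output.toList
  work := (x.work.write i.workWrite).rmove x.address.value i.workMove
  catalytic := (x.catalytic.write i.catalyticWrite).rmove x.address.value i.catalyticMove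
  address := (x.address.write i.addressWrite).move i.addressMove
  oracle := match i.oracleAct with
    | .act w d => (x.oracle.write w).move d
    | .query => x.oracle.query D
  queries := match i.oracleAct with
    | .act _ _ => x.queries
    | .query => x.queries + 1

/-- One step with oracle `D`; a halted configuration does not change. -/
def step (M : Machine) (D : List Bool → List Bool) (x : Config M.State) : Config M.State :=
  match M.instr x with
  | none => x
  | some i => exec D x i

/-- The initial configuration on input `w` with work tape of length `s`, oracle tape of length `q`
and initial contents `τ` of the catalytic tape. -/
def init (M : Machine) (w : List Bool) (s q : ℕ) (τ : List Bool) : Config M.State where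
  state := M.start
  input := Tape.init w
  output := []
  work := Tape.init (List.replicate s false)
  catalytic := Tape.init τ
  address := Tape.init (List.replicate (addressLength s τ.length) false)
  oracle := Tape.init (List.replicate q false)
  queries := 0

/-- With a work tape of length `s`, an oracle tape of length `q` and a catalytic tape of length
`c`, the machine with oracle `D` maps the input `w` to the output `y` catalytically: for every
initial contents `τ` of the catalytic tape it halts within `T` steps and after at most `K` oracle
calls, with `y` on the output tape and with `τ` on the catalytic tape. -/
def ComputesCatalytically (M : Machine) (D : List Bool → List Bool) (w y : List Bool)
    (s q c T K : ℕ) : Prop :=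
  ∀ τ : List Bool, τ.length = c →
    ∃ t ≤ T, ∃ z : Config M.State, z = (M.step D)^[t] (M.init w s q τ) ∧
      M.Halted z ∧ z.output = y ∧ z.catalytic.cells = τ ∧ z.queries ≤ K

end Machine

end CatalyticGrid

namespace CatalyticGrid

/-! ### Program fragments with exit values -/

/-- The memory of a machine: a configuration without a control state. -/
abbrev Mem : Type := Config Unit

/-- What the finite control sees of a memory. -/
def Config.scan {Q : Type} (x : Config Q) : Scan :=
  ⟨x.input.read, x.work.read, x.catalytic.read, x.address.read, x.oracle.read⟩

/-- The memory of a configuration. -/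
def Config.mem {Q : Type} (x : Config Q) : Mem :=
  ⟨(), x.input, x.output, x.work, x.catalytic, x.address, x.oracle, x.queries⟩

/-- Attach a next state to an action. -/
def Instr.toState {Q : Type} (i : Instr Unit) (s : Q) : Instr Q :=
  ⟨s, i.inputMove, i.workWrite, i.workMove, i.catalyticWrite, i.catalyticMove, i.addressWrite,
    i.addressMove, i.oracleAct, i.output⟩

/-- A machine fragment that exits with a value in `α`. -/
structure Frag (α : Type) where
  State : Type
  finite : Finite State
  start : State
  trans : State → Scan → (State × Instr Unit) ⊕ α

attribute [instance] Frag.finite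

namespace Frag

variable {α β : Type} {D : List Bool → List Bool}

/-- `F.Exec D s m a m' t`: from state `s` and memory `m`, after `t` steps the fragment exits with
value `a` and memory `m'`. -/
inductive Exec (D : List Bool → List Bool) (F : Frag α) : F.State → Mem → α → Mem → ℕ → Prop
  | exit {s m a} : F.trans s m.scan = .inr a → Exec D F s m a m 0
  | step {s m s' i a m' t} : F.trans s m.scan = .inl (s', i) →
      Exec D F s' (Machine.exec D m i) a m' t → Exec D F s m a m' (t + 1)

/-- The fragment, run from its start state, exits within `t` steps. -/
def Run (D : List Bool → List Bool) (F : Frag α) (m : Mem) (a : α) (m' : Mem) (t : ℕ) : Prop :=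
  ∃ t' ≤ t, F.Exec D F.start m a m' t'

theorem Run.mono {F : Frag α} {m m' : Mem} {a : α} {t t' : ℕ} (h : F.Run D m a m' t)
    (htt : t ≤ t') : F.Run D m a m' t' := by
  obtain ⟨u, hu, h⟩ := h
  exact ⟨u, hu.trans htt, h⟩

theorem Run.cast {F : Frag α} {m m' m'' : Mem} {a : α} {t t' : ℕ} (h : F.Run D m a m' t)
    (hm : m' = m'') (htt : t ≤ t') : F.Run D m a m'' t' := hm ▸ h.mono htt

/-- The action that does nothing. -/
def idle : Instr Unit :=
  ⟨(), .stay, none, .dir .stay, none, .dir .stay, none, .stay, .act none .stay, none⟩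

theorem exec_idle (m : Mem) : Machine.exec D m idle = m := by
  cases m
  simp [Machine.exec, idle, Tape.write, Tape.rmove, Tape.move]

/-- Look at the scanned symbols and exit. -/
def peek (f : Scan → α) : Frag α where
  State := Unit
  finite := inferInstance
  start := ()
  trans _ sc := .inr (f sc)

theorem run_peek (f : Scan → α) (m : Mem) : (peek f).Run D m (f m.scan) m 0 :=
  ⟨0, le_rfl, .exit rfl⟩

/-- Exit at once. -/
def ret (a : α) : Frag α := peek fun _ => a

theorem run_ret (a : α) (m : Mem) : (ret a).Run D m a m 0 := run_peek (fun _ => a) m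

/-- Perform one action. -/
def act (i : Instr Unit) : Frag Unit where
  State := Bool
  finite := inferInstance
  start := false
  trans s _ := if s then .inr () else .inl (true, i)

theorem run_act (i : Instr Unit) (m : Mem) : (act i).Run D m () (Machine.exec D m i) 1 :=
  ⟨1, le_rfl, .step (s' := true) rfl (.exit rfl)⟩

/-- Run `F`, then the fragment determined by its exit value. -/
def bind [Finite α] (F : Frag α) (G : α → Frag β) : Frag β where
  State := F.State ⊕ Σ a, (G a).State
  finite := inferInstance
  start := .inl F.start
  trans s sc := match s with
    | .inl s => match F.trans s sc with
      | .inl (s', i) => .inl (.inl s', i)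
      | .inr a => .inl (.inr ⟨a, (G a).start⟩, idle)
    | .inr ⟨a, s⟩ => match (G a).trans s sc with
      | .inl (s', i) => .inl (.inr ⟨a, s'⟩, i)
      | .inr b => .inr b

theorem exec_bind_right [Finite α] {F : Frag α} {G : α → Frag β} {a : α} {s : (G a).State}
    {m m' : Mem} {b : β} {t : ℕ} (h : (G a).Exec D s m b m' t) :
    (bind F G).Exec D (.inr ⟨a, s⟩) m b m' t := by
  induction h with
  | exit h => exact .exit (by simp [bind, h])
  | step h _ ih => exact .step (by simp only [bind, h]) ih

theorem exec_bind_left [Finite α] {F : Frag α} {G : α → Frag β} {a : α} {s : F.State}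
    {m m₁ m' : Mem} {b : β} {t t' : ℕ} (h : F.Exec D s m a m₁ t)
    (h' : (G a).Exec D (G a).start m₁ b m' t') :
    (bind F G).Exec D (.inl s) m b m' (t + 1 + t') := by
  induction h with
  | @exit s m a h =>
    rw [zero_add, add_comm]
    refine .step (F := bind F G) (s' := Sum.inr ⟨a, (G a).start⟩) (i := idle) (by simp [bind, h]) ?_
    rw [exec_idle]
    exact exec_bind_right h'
  | @step s m s' i a m₁ t h _ ih =>
    rw [show t + 1 + 1 + t' = t + 1 + t' + 1 by ring]
    exact .step (by simp only [bind, h]) (ih h')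

theorem Run.bind [Finite α] {F : Frag α} {G : α → Frag β} {a : α} {m m₁ m' : Mem} {b : β}
    {t t' : ℕ} (h : F.Run D m a m₁ t) (h' : (G a).Run D m₁ b m' t') :
    (Frag.bind F G).Run D m b m' (t + 1 + t') := by
  obtain ⟨u, hu, h⟩ := h
  obtain ⟨u', hu', h'⟩ := h'
  exact ⟨u + 1 + u', by omega, exec_bind_left h h'⟩

/-- Run `F`, then `G`. -/
def seq (F : Frag Unit) (G : Frag β) : Frag β := bind F fun _ => G

theorem Run.seq {F : Frag Unit} {G : Frag β} {m m₁ m' : Mem} {b : β}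
    {t t' : ℕ} (h : F.Run D m () m₁ t) (h' : G.Run D m₁ b m' t') :
    (Frag.seq F G).Run D m b m' (t + 1 + t') := Run.bind h h'

/-- Run `F a` for a parameter `a`, which is updated as long as the exit value is on the left. -/
def loop [Finite α] (F : α → Frag (α ⊕ β)) (a : α) : Frag β where
  State := Σ a, (F a).State
  finite := inferInstance
  start := ⟨a, (F a).start⟩
  trans s sc := match (F s.1).trans s.2 sc with
    | .inl (s', i) => .inl (⟨s.1, s'⟩, i)
    | .inr (.inl a') => .inl (⟨a', (F a').start⟩, idle)
    | .inr (.inr b) => .inr b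

theorem exec_loop_inr [Finite α] {F : α → Frag (α ⊕ β)} {a a₀ : α} {s : (F a).State} {m m' : Mem}
    {b : β} {t : ℕ} (h : (F a).Exec D s m (.inr b) m' t) :
    (loop F a₀).Exec D ⟨a, s⟩ m b m' t := by
  generalize hc : (Sum.inr b : α ⊕ β) = c at h
  induction h with
  | exit h => subst hc; exact .exit (by simp [loop, h])
  | step h _ ih => exact .step (by simp only [loop, h]) (ih hc)

theorem exec_loop_inl [Finite α] {F : α → Frag (α ⊕ β)} {a a' a₀ : α} {s : (F a).State}
    {m m₁ m' : Mem} {b : β} {t t' : ℕ} (h : (F a).Exec D s m (.inl a') m₁ t)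
    (h' : (loop F a').Exec D (loop F a').start m₁ b m' t') :
    (loop F a₀).Exec D ⟨a, s⟩ m b m' (t + 1 + t') := by
  generalize hc : (Sum.inl a' : α ⊕ β) = c at h
  induction h with
  | @exit s m c h =>
    subst hc
    rw [zero_add, add_comm]
    refine .step (F := loop F a₀) (s' := (⟨a', (F a').start⟩ : Σ a, (F a).State)) (i := idle)
      (by simp [loop, h]) ?_
    rw [exec_idle]
    have aux : ∀ {s m b m' t}, (loop F a').Exec D s m b m' t → (loop F a₀).Exec D s m b m' t := by
      intro s m b m' t h
      induction h with
      | exit h => exact .exit h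
      | step h _ ih => exact .step h ih
    exact aux h'
  | @step s m s' i c m₁ t h _ ih =>
    rw [show t + 1 + 1 + t' = t + 1 + t' + 1 by ring]
    exact .step (by simp only [loop, h]) (ih h' hc)

theorem Run.loop_inr [Finite α] {F : α → Frag (α ⊕ β)} {a : α} {m m' : Mem} {b : β} {t : ℕ}
    (h : (F a).Run D m (.inr b) m' t) : (loop F a).Run D m b m' t := by
  obtain ⟨u, hu, h⟩ := h
  exact ⟨u, hu, exec_loop_inr h⟩

theorem Run.loop_inl [Finite α] {F : α → Frag (α ⊕ β)} {a a' : α} {m m₁ m' : Mem} {b : β}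
    {t t' : ℕ} (h : (F a).Run D m (.inl a') m₁ t) (h' : (loop F a').Run D m₁ b m' t') :
    (loop F a).Run D m b m' (t + 1 + t') := by
  obtain ⟨u, hu, h⟩ := h
  obtain ⟨u', hu', h'⟩ := h'
  exact ⟨u + 1 + u', by omega, exec_loop_inl h h'⟩

/-- The machine that runs a fragment and halts when the fragment exits. -/
def toMachine (F : Frag Unit) : Machine where
  State := F.State
  finite := F.finite
  start := F.start
  trans s sc := match F.trans s sc with
    | .inl (s', i) => some (i.toState s')
    | .inr _ => none

/-- A memory with a control state. -/
def _root_.CatalyticGrid.Config.withState {Q : Type} (m : Mem) (s : Q) : Config Q :=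
  ⟨s, m.input, m.output, m.work, m.catalytic, m.address, m.oracle, m.queries⟩

theorem exec_toMachine {F : Frag Unit} {s : F.State} {m m' : Mem} {t : ℕ}
    (h : F.Exec D s m () m' t) : ∃ s', (F.toMachine.step D)^[t] (Config.withState m s) =
      (Config.withState m' s' : Config F.toMachine.State) ∧
      F.toMachine.Halted (Config.withState m' s') := by
  generalize hc : () = c at h
  induction h with
  | @exit s m a h =>
    refine ⟨s, rfl, ?_⟩
    simp only [Config.scan] at h
    simp [Machine.Halted, Machine.instr, toMachine, Config.withState, h]
  | @step s m s' i a m' t h _ ih =>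
    obtain ⟨s'', h₁, h₂⟩ := ih hc
    refine ⟨s'', ?_, h₂⟩
    rw [Function.iterate_succ_apply, ← h₁]
    congr 1
    simp only [Config.scan] at h
    simp [Machine.step, Machine.instr, toMachine, Config.withState, h]
    rfl

theorem queries_exec {F : Frag α} {s : F.State} {m m' : Mem} {a : α} {t : ℕ}
    (h : F.Exec D s m a m' t) : m'.queries ≤ m.queries + t := by
  induction h with
  | exit => simp
  | @step s m s' i a m' t h _ ih =>
    have : (Machine.exec D m i).queries ≤ m.queries + 1 := by
      simp only [Machine.exec]
      split <;> omega
    omega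

end Frag
end CatalyticGrid

namespace CatalyticGrid

open Frag

/-! ### The work tape as a table with one column per variable -/

section Rows

variable {V : Type} [Fintype V] {D : List Bool → List Bool}

/-- The position of a variable in a row of the work tape. -/
noncomputable def column (x : V) : ℕ := Fintype.equivFin V x

theorem column_lt (x : V) : column x < Fintype.card V := (Fintype.equivFin V x).2

theorem column_inj {x y : V} : column x = column y ↔ x = y := by
  simp [column, Fin.val_inj]

/-- The cells hold `L` rows, and row `i` holds the bits `r i x`. -/
def HasRows (L : ℕ) (cells : List Bool) (r : ℕ → V → Bool) : Prop :=
  cells.length = L * Fintype.card V ∧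
    ∀ i < L, ∀ x, cells[i * Fintype.card V + column x]? = some (r i x)

theorem cell_lt {L i : ℕ} (hi : i < L) (x : V) :
    i * Fintype.card V + column x < L * Fintype.card V := by
  have := column_lt x
  nlinarith [Nat.mul_le_mul_right (Fintype.card V) (Nat.succ_le_of_lt hi)]

theorem cell_inj {i j : ℕ} {x y : V}
    (h : i * Fintype.card V + column x = j * Fintype.card V + column y) : i = j ∧ x = y := by
  have hx := column_lt x
  have hy := column_lt y
  have h1 : i = j := by
    rcases lt_trichotomy i j with hij | hij | hij
    · nlinarith [Nat.mul_le_mul_right (Fintype.card V) (Nat.succ_le_of_lt hij)]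
    · exact hij
    · nlinarith [Nat.mul_le_mul_right (Fintype.card V) (Nat.succ_le_of_lt hij)]
  subst h1
  exact ⟨rfl, column_inj.1 (by omega)⟩

theorem HasRows.congr {L : ℕ} {cells : List Bool} {r r' : ℕ → V → Bool} (h : HasRows L cells r)
    (hr : ∀ i < L, ∀ x, r i x = r' i x) : HasRows L cells r' :=
  ⟨h.1, fun i hi x => by rw [h.2 i hi x, hr i hi x]⟩

theorem HasRows.set [DecidableEq V] {L : ℕ} {cells : List Bool} {r : ℕ → V → Bool}
    (h : HasRows L cells r) {i : ℕ} (hi : i < L) (x : V) (b : Bool) :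
    HasRows L (cells.set (i * Fintype.card V + column x) b)
      (fun j y => if j = i ∧ y = x then b else r j y) := by
  refine ⟨by simpa using h.1, fun j hj y => ?_⟩
  rw [List.getElem?_set]
  have hlt := cell_lt hi x
  rw [← h.1] at hlt
  by_cases h1 : i * Fintype.card V + column x = j * Fintype.card V + column y
  · rw [if_pos h1, if_pos hlt]
    exact (congrArg some (if_pos ⟨(cell_inj h1).1.symm, (cell_inj h1).2.symm⟩)).symm
  · simp only [if_neg h1, h.2 j hj y]
    rw [if_neg]
    rintro ⟨rfl, rfl⟩
    exact h1 rfl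

/-! ### Moving on the work tape -/

/-- Replace the work tape. -/
abbrev Config.withWork (m : Mem) (t : Tape) : Mem := { m with work := t }

/-- Move the head of the work tape. -/
def workStep (d : Dir) : Instr Unit := { idle with workMove := .dir d }

theorem exec_workStep (m : Mem) (d : Dir) :
    Machine.exec D m (workStep d) = m.withWork (m.work.move d) := by
  cases m
  simp [Machine.exec, workStep, idle, Tape.write, Tape.rmove, Tape.move]

/-- Move the head of the work tape `k` times. -/
def moveWork (d : Dir) : ℕ → Frag Unit
  | 0 => ret ()
  | k + 1 => Frag.seq (act (workStep d)) (moveWork d k)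

theorem run_moveWork_right (k : ℕ) (m : Mem) (h : m.work.head + k ≤ m.work.cells.length + 1) :
    (moveWork .right k).Run D m () (m.withWork ⟨m.work.cells, m.work.head + k⟩) (2 * k) := by
  induction k generalizing m with
  | zero => exact run_ret () m
  | succ k ih =>
    have := Run.seq (run_act (D := D) (workStep .right) m)
      (ih (m.withWork ⟨m.work.cells, m.work.head + 1⟩ : Mem) (by simp; omega) |> fun h' => by
        rw [exec_workStep]
        have e : m.work.move .right = ⟨m.work.cells, m.work.head + 1⟩ := by
          simp only [Tape.move, Tape.mk.injEq, true_and]; omega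
        rw [e]; exact h')
    exact this.cast (by simp only [Config.withWork, add_right_comm, add_assoc]) (by omega)

theorem run_moveWork_left (k : ℕ) (m : Mem) :
    (moveWork .left k).Run D m () (m.withWork ⟨m.work.cells, m.work.head - k⟩) (2 * k) := by
  induction k generalizing m with
  | zero => exact run_ret () m
  | succ k ih =>
    have := Run.seq (run_act (D := D) (workStep .left) m)
      (ih (m.withWork ⟨m.work.cells, m.work.head - 1⟩ : Mem) |> fun h' => by
        rw [exec_workStep]; exact h')
    exact this.cast (by simp only [Config.withWork, Nat.sub_sub, add_comm]) (by omega)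

theorem read_of_rows {L : ℕ} {r : ℕ → V → Bool} {t : Tape} (h : HasRows L t.cells r) {i : ℕ}
    (hi : i < L) (x : V) (ht : t.head = i * Fintype.card V + column x + 1) :
    t.read = some (r i x) := by
  simp [Tape.read, ht, h.2 i hi x]

/-- From the start of a row, read the bit of a variable. -/
noncomputable def getBit (x : V) : Frag Bool :=
  Frag.seq (moveWork .right (column x)) <| Frag.bind (peek Scan.work) fun o =>
    Frag.seq (moveWork .left (column x)) (ret (o == some true))

theorem run_getBit {L : ℕ} {r : ℕ → V → Bool} {m : Mem} (h : HasRows L m.work.cells r) {i : ℕ}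
    (hi : i < L) (hm : m.work.head = i * Fintype.card V + 1) (x : V) :
    (getBit x).Run D m (r i x) m (4 * Fintype.card V + 3) := by
  have hc := column_lt x
  have hl := cell_lt hi x
  have h1 := run_moveWork_right (D := D) (column x) m (by rw [h.1]; omega)
  set m₁ := m.withWork ⟨m.work.cells, m.work.head + column x⟩ with hm₁
  have h2 := run_peek (D := D) Scan.work m₁
  have hr : Scan.work m₁.scan = some (r i x) :=
    read_of_rows (t := m₁.work) (by exact h) hi x (by simp [hm₁, hm]; omega)
  rw [hr] at h2
  have h3 := run_moveWork_left (D := D) (column x) m₁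
  have e : m₁.withWork ⟨m₁.work.cells, m₁.work.head - column x⟩ = m := by
    simp [hm₁]
  rw [e] at h3
  have := Run.seq h1 (Run.bind (G := fun o => Frag.seq (moveWork .left (column x))
    (ret (o == some true))) h2 (Run.seq h3 (run_ret (some (r i x) == some true) m)))
  simp only [Option.some_beq_some, beq_true] at this
  exact this.mono (by omega)

/-- Write on the work tape. -/
def workWrite (b : Bool) : Instr Unit := { idle with workWrite := some b }

theorem exec_workWrite (m : Mem) (b : Bool) :
    Machine.exec D m (workWrite b) = m.withWork (m.work.write (some b)) := by
  cases m
  simp [Machine.exec, workWrite, idle, Tape.write, Tape.rmove, Tape.move]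

/-- From the start of a row, write the bit of a variable. -/
noncomputable def putBit (x : V) (b : Bool) : Frag Unit :=
  Frag.seq (moveWork .right (column x)) <| Frag.seq (act (workWrite b))
    (moveWork .left (column x))

theorem run_putBit {L : ℕ} {r : ℕ → V → Bool} {m : Mem} (h : HasRows L m.work.cells r) {i : ℕ}
    (hi : i < L) (hm : m.work.head = i * Fintype.card V + 1) (x : V) (b : Bool) :
    (putBit x b).Run D m () (m.withWork
      ⟨m.work.cells.set (i * Fintype.card V + column x) b, m.work.head⟩)
      (4 * Fintype.card V + 3) := by
  have hc := column_lt x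
  have hl := cell_lt hi x
  have h1 := run_moveWork_right (D := D) (column x) m (by rw [h.1]; omega)
  set m₁ := m.withWork ⟨m.work.cells, m.work.head + column x⟩ with hm₁
  have h2 := run_act (D := D) (workWrite b) m₁
  rw [exec_workWrite] at h2
  have h3 := run_moveWork_left (D := D) (column x) (m₁.withWork (m₁.work.write (some b)))
  have := Run.seq h1 (Run.seq h2 h3)
  refine this.cast ?_ (by omega)
  have e : m.work.head + column x - 1 = i * Fintype.card V + column x := by omega
  simp [hm₁, Config.withWork, Tape.write, e]
  rw [if_neg (by omega)]
  simp

/-! ### Loops over the rows -/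

/-- Scan a tape to its left end. -/
def goHome (sel : Scan → Option Bool) (i : Instr Unit) : Frag Unit :=
  Frag.seq (act i) <| loop (fun _ : Unit => Frag.bind (peek sel) fun o =>
    if o = none then ret (.inr ()) else Frag.seq (act i) (ret (.inl ()))) ()

theorem run_goHome {sel : Scan → Option Bool} {i : Instr Unit} (get : Mem → Tape)
    (put : Mem → Tape → Mem) (hsel : ∀ m, sel m.scan = (get m).read)
    (hex : ∀ m, Machine.exec D m i = put m ((get m).move .left))
    (hgp : ∀ m t, get (put m t) = t) (hpp : ∀ m t t', put (put m t) t' = put m t')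
    (hpg : ∀ m, put m (get m) = m) (m : Mem) (hm : (get m).head ≤ (get m).cells.length + 1) :
    (goHome sel i).Run D m () (put m ⟨(get m).cells, 0⟩) (4 * (get m).cells.length + 6) := by
  have key : ∀ k m, (get m).head = k → k ≤ (get m).cells.length →
      (loop (fun _ : Unit => Frag.bind (peek sel) fun o =>
        if o = none then ret (.inr ()) else Frag.seq (act i) (ret (.inl ()))) () : Frag Unit).Run D m ()
        (put m ⟨(get m).cells, 0⟩) (4 * k + 1) := by
    intro k
    induction k with
    | zero =>
      intro m h0 _
      refine Run.loop_inr ?_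
      have e : sel m.scan = none := by rw [hsel]; simp [Tape.read, h0]
      have := Run.bind (G := fun o : Option Bool => if o = none then ret (.inr ()) else
        Frag.seq (act i) (ret (.inl ()))) (run_peek (D := D) sel m) (t' := 0)
        (b := (.inr () : Unit ⊕ Unit)) (m' := m) (by rw [e]; exact run_ret _ _)
      convert this using 1
      conv_rhs => rw [← hpg m]
      rw [← h0]
    | succ k ih =>
      intro m h0 hk
      have e : sel m.scan ≠ none := by
        rw [hsel]
        simp [Tape.read, h0]
        omega
      have h1 := ih (put m ((get m).move .left)) (by rw [hgp]; simp [Tape.move, h0])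
        (by rw [hgp]; simp [Tape.move]; omega)
      rw [hgp, hpp] at h1
      refine (Run.loop_inl (t := 3) (a' := ()) (m₁ := put m ((get m).move .left)) ?_ h1).mono
        (by omega)
      have := Run.bind (G := fun o : Option Bool => if o = none then ret (.inr ()) else
        Frag.seq (act i) (ret (.inl ()))) (run_peek (D := D) sel m) (t' := 2)
        (b := (.inl () : Unit ⊕ Unit)) (m' := put m ((get m).move .left)) (by
          rw [if_neg e]
          have := Run.seq (run_act (D := D) i m) (run_ret (.inl () : Unit ⊕ Unit) _)
          rw [hex] at this
          exact this)
      exact this.mono (by omega)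
  have h1 := run_act (D := D) i m
  rw [hex] at h1
  have h2 := key _ (put m ((get m).move .left)) rfl (by rw [hgp]; simp [Tape.move]; omega)
  rw [hpp, hgp] at h2
  refine (Run.seq h1 h2).mono ?_
  simp [Tape.move]
  omega

/-- Move the head of the work tape to the left end. -/
def homeWork : Frag Unit := goHome Scan.work (workStep .left)

theorem run_homeWork (m : Mem) (hm : m.work.head ≤ m.work.cells.length + 1) :
    homeWork.Run D m () (m.withWork ⟨m.work.cells, 0⟩) (4 * m.work.cells.length + 6) :=
  run_goHome (sel := Scan.work) (i := workStep .left) Config.work Config.withWork (fun _ => rfl)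
    (fun m => exec_workStep m .left) (fun _ _ => rfl) (fun _ _ _ => rfl) (fun _ => rfl) m hm

variable (V) in
/-- Run `body` at the start of every row, from top to bottom. -/
noncomputable def rowLoop {S : Type} [Finite S] (body : S → Frag S) : S → Frag S :=
  loop fun s => Frag.bind (peek Scan.work) fun o =>
    if o = none then ret (.inr s)
    else Frag.bind (body s) fun s' =>
      Frag.seq (moveWork .right (Fintype.card V)) (ret (.inl s'))

theorem run_rowLoop [Nonempty V] {S : Type} [Finite S] {body : S → Frag S} {L t : ℕ}
    (I : ℕ → S → Mem → Prop)
    (hI : ∀ i s m k, I i s m → I i s (m.withWork ⟨m.work.cells, k⟩))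
    (hb : ∀ i < L, ∀ s m, m.work.head = i * Fintype.card V + 1 →
      m.work.cells.length = L * Fintype.card V → I i s m → ∃ s' m', (body s).Run D m s' m' t ∧
        m'.work.head = i * Fintype.card V + 1 ∧ m'.work.cells.length = L * Fintype.card V ∧
        I (i + 1) s' m')
    {s : S} {m : Mem} (hm : m.work.head = 1) (hl : m.work.cells.length = L * Fintype.card V)
    (h0 : I 0 s m) : ∃ s' m', (rowLoop V body s).Run D m s' m'
      (L * (t + 2 * Fintype.card V + 4) + 1) ∧ m'.work.head = L * Fintype.card V + 1 ∧
      m'.work.cells.length = L * Fintype.card V ∧ I L s' m' := by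
  have hC : 0 < Fintype.card V := Fintype.card_pos
  have key : ∀ k ≤ L, ∀ s m, m.work.head = (L - k) * Fintype.card V + 1 →
      m.work.cells.length = L * Fintype.card V → I (L - k) s m →
      ∃ s' m', (rowLoop V body s).Run D m s' m' (k * (t + 2 * Fintype.card V + 4) + 1) ∧
        m'.work.head = L * Fintype.card V + 1 ∧
        m'.work.cells.length = L * Fintype.card V ∧ I L s' m' := by
    intro k
    induction k with
    | zero =>
      intro _ s m hm hl h
      refine ⟨s, m, Run.loop_inr ?_, by simpa using hm, hl, by simpa using h⟩
      have e : Scan.work m.scan = none := by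
        simp [Config.scan, Tape.read, hm, hl]
      have := Run.bind (G := fun o : Option Bool => if o = none then ret (.inr s)
        else Frag.bind (body s) fun s' =>
          Frag.seq (moveWork .right (Fintype.card V)) (ret (.inl s')))
        (run_peek (D := D) Scan.work m) (t' := 0) (b := (.inr s : S ⊕ S)) (m' := m)
        (by rw [e]; exact run_ret _ _)
      exact this.mono (by omega)
    | succ k ih =>
      intro hk s m hm hl h
      have hlt : L - (k + 1) < L := by omega
      have hmul : (L - (k + 1)) * Fintype.card V + Fintype.card V = (L - k) * Fintype.card V := by
        rw [show L - k = L - (k + 1) + 1 by omega]; ring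
      have hmul2 : (L - k) * Fintype.card V ≤ L * Fintype.card V :=
        Nat.mul_le_mul_right _ (Nat.sub_le _ _)
      obtain ⟨s₁, m₁, hr, hm₁, hl₁, h₁⟩ := hb _ hlt s m hm hl h
      have e : Scan.work m.scan ≠ none := by
        simp only [Config.scan, Tape.read, hm]
        rw [if_neg (by omega)]
        simp only [Nat.add_sub_cancel, ne_eq, List.getElem?_eq_none_iff, not_le]
        omega
      have hmv := run_moveWork_right (D := D) (Fintype.card V) m₁ (by omega)
      obtain ⟨s', m', hr', hf⟩ := ih (by omega) s₁
        (m₁.withWork ⟨m₁.work.cells, m₁.work.head + Fintype.card V⟩) (by simp [hm₁]; omega) hl₁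
        (by
          have := hI _ _ _ (m₁.work.head + Fintype.card V) h₁
          rwa [show L - (k + 1) + 1 = L - k by omega] at this)
      refine ⟨s', m', ?_, hf⟩
      have h3 := Run.bind (G := fun o : Option Bool => if o = none then ret (.inr s)
        else Frag.bind (body s) fun s' =>
          Frag.seq (moveWork .right (Fintype.card V)) (ret (.inl s')))
        (run_peek (D := D) Scan.work m) (b := (.inl s₁ : S ⊕ S))
        (by
          rw [if_neg e]
          exact Run.bind hr (Run.seq hmv (run_ret _ _)))
      refine (Run.loop_inl h3 hr').mono ?_
      rw [Nat.add_mul]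
      omega
  have := key L le_rfl s m (by simpa using hm) hl (by simpa using h0)
  simpa using this

end Rows
end CatalyticGrid

namespace CatalyticGrid

open Frag

section Sweeps

variable {V : Type} [Fintype V] {D : List Bool → List Bool}

/-- Sweep over the rows from top to bottom with a finite automaton that sees the bits of `x` and `y`
and replaces the bit of `x`. -/
noncomputable def sweep {S : Type} [Finite S] (x y : V) (f : S → Bool → Bool → S × Bool) (s : S) :
    Frag S :=
  Frag.seq (act (workStep .right)) <| Frag.bind (rowLoop V (fun s =>
    Frag.bind (getBit x) fun bx => Frag.bind (getBit y) fun bz =>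
      Frag.seq (putBit x (f s bx bz).2) (ret (f s bx bz).1)) s) fun s' =>
    Frag.seq homeWork (ret s')

theorem run_sweep [DecidableEq V] {S : Type} [Finite S] {x y : V}
    {f : S → Bool → Bool → S × Bool} {L : ℕ} {r : ℕ → V → Bool} {m : Mem}
    (h : HasRows L m.work.cells r) (hm : m.work.head = 0) (σ : ℕ → S) (nb : ℕ → Bool)
    (hf : ∀ i < L, f (σ i) (r i x) (r i y) = (σ (i + 1), nb i)) :
    ∃ cells', (sweep x y f (σ 0)).Run D m (σ L) (m.withWork ⟨cells', 0⟩)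
      (L * (18 * Fintype.card V + 16) + 12) ∧
      HasRows L cells' (fun i z => if z = x then nb i else r i z) := by
  have : Nonempty V := ⟨x⟩
  obtain ⟨s', m', hr, hh, hl, hs', hm', hrows⟩ := run_rowLoop (V := V) (D := D) (L := L)
    (t := 12 * Fintype.card V + 12) (s := σ 0)
    (body := fun s => Frag.bind (getBit x) fun bx => Frag.bind (getBit y) fun bz =>
      Frag.seq (putBit x (f s bx bz).2) (ret (f s bx bz).1))
    (m := m.withWork ⟨m.work.cells, 1⟩)
    (fun i s m' => s = σ i ∧ m' = m.withWork m'.work ∧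
      HasRows L m'.work.cells (fun j z => if j < i ∧ z = x then nb j else r j z))
    (by
      rintro i s m' k ⟨h1, h2, h3⟩
      refine ⟨h1, ?_, h3⟩
      rw [h2])
    (by
      rintro i hi s m' hh hl ⟨rfl, h2, h3⟩
      have hx := run_getBit (D := D) h3 hi hh x
      have hy := run_getBit (D := D) h3 hi hh y
      simp only [lt_irrefl, false_and, if_false] at hx hy
      have hp := run_putBit (D := D) h3 hi hh x (f (σ i) (r i x) (r i y)).2
      refine ⟨_, _, Run.mono (Run.bind hx (Run.bind hy (Run.seq hp (run_ret _ _))))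
        (by omega), ?_⟩
      rw [hf i hi]
      refine ⟨hh, by simpa using hl, rfl, ?_, (h3.set hi x (nb i)).congr ?_⟩
      · rw [h2]
      · intro j hj z
        by_cases hz : z = x
        · subst hz
          rcases lt_trichotomy j i with hji | hji | hji
          · simp [hji, hji.ne, Nat.lt_succ_of_lt hji]
          · simp [hji]
          · simp [hji.ne', show ¬ j < i by omega, show ¬ j < i + 1 by omega]
        · simp [hz])
    rfl h.1 ⟨rfl, rfl, by simpa using h⟩
  subst hs'
  refine ⟨m'.work.cells, ?_, hrows.congr fun i hi z => by simp [hi]⟩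
  have h1 := run_act (D := D) (workStep .right) m
  rw [exec_workStep] at h1
  have h2 := run_homeWork (D := D) m' (by rw [hl, hh])
  have e : m.work.move .right = ⟨m.work.cells, 1⟩ := by
    simp [Tape.move, hm]
  rw [e] at h1
  have := Run.seq h1 (Run.bind (G := fun s' => Frag.seq homeWork (ret s')) hr
    (Run.seq h2 (run_ret (σ L) _)))
  refine this.cast (by rw [hm']) ?_
  rw [hl]
  nlinarith

/-- Halve `x`: shift its column up by one row. -/
noncomputable def halve (x : V) : Frag Unit :=
  Frag.seq (act (workStep .right)) <| Frag.seq (rowLoop V (fun _ => ret ()) ()) <|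
    loop (fun s => Frag.seq (moveWork .left (Fintype.card V)) <|
      Frag.bind (peek Scan.work) fun o => if o = none then ret (.inr ()) else
        Frag.bind (getBit x) fun b => Frag.seq (putBit x s) (ret (.inl b))) false

theorem run_halve [DecidableEq V] {x : V} {L : ℕ} {r : ℕ → V → Bool} {m : Mem}
    (h : HasRows L m.work.cells r) (hm : m.work.head = 0) :
    ∃ cells', (halve x).Run D m () (m.withWork ⟨cells', 0⟩)
      (L * (14 * Fintype.card V + 16) + 2 * Fintype.card V + 10) ∧
      HasRows L cells' (fun i z => if z = x then (if i + 1 < L then r (i + 1) x else false)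
        else r i z) := by
  have : Nonempty V := ⟨x⟩
  have hC : 0 < Fintype.card V := Fintype.card_pos
  obtain ⟨⟨⟩, m', hr, hh, hl, hm', hcells⟩ := run_rowLoop (V := V) (D := D) (L := L)
    (t := 0) (s := ()) (body := fun _ => ret ()) (m := m.withWork ⟨m.work.cells, 1⟩)
    (fun i s m' => m' = m.withWork m'.work ∧ m'.work.cells = m.work.cells)
    (by
      rintro i s m' k ⟨h2, h3⟩
      refine ⟨?_, h3⟩
      rw [h2])
    (fun i hi s m' hh hl hI => ⟨(), m', run_ret _ _, hh, hl, hI⟩)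
    rfl h.1 ⟨rfl, rfl⟩
  have key : ∀ k ≤ L, ∀ m' : Mem, m' = m.withWork m'.work →
      m'.work.head = k * Fintype.card V + 1 →
      HasRows L m'.work.cells (fun i z => if z = x ∧ k ≤ i then
        (if i + 1 < L then r (i + 1) x else false) else r i z) →
      ∃ cells', (loop (fun s => Frag.seq (moveWork .left (Fintype.card V)) <|
        Frag.bind (peek Scan.work) fun o => if o = none then ret (.inr ()) else
        Frag.bind (getBit x) fun b => Frag.seq (putBit x s) (ret (.inl b)))
          (if k < L then r k x else false) : Frag Unit).Run D m' ()
        (m.withWork ⟨cells', 0⟩) (k * (10 * Fintype.card V + 12) + 2 * Fintype.card V + 3) ∧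
      HasRows L cells' (fun i z => if z = x then (if i + 1 < L then r (i + 1) x else false)
        else r i z) := by
    intro k
    induction k with
    | zero =>
      intro _ m' hm' hh hrows
      refine ⟨m'.work.cells, Run.loop_inr ?_, by simpa using hrows⟩
      have h1 := run_moveWork_left (D := D) (Fintype.card V) m'
      have e0 : m'.work.head - Fintype.card V = 0 := by omega
      rw [e0] at h1
      have := Run.seq h1 (Run.bind (G := fun o : Option Bool => if o = none then ret (.inr ()) else
        Frag.bind (getBit x) fun b => Frag.seq (putBit x (if 0 < L then r 0 x else false))
          (ret (.inl b))) (run_peek (D := D) Scan.work _) (t' := 0)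
          (b := (.inr () : Bool ⊕ Unit)) (m' := m'.withWork ⟨m'.work.cells, 0⟩) (by
            have : (m'.withWork ⟨m'.work.cells, 0⟩ : Mem).scan.work = none := by
              simp [Config.scan, Tape.read]
            rw [this]; exact run_ret _ _))
      exact this.cast (by rw [hm']) (by omega)
    | succ k ih =>
      intro hk m' hm' hh hrows
      have h1 := run_moveWork_left (D := D) (Fintype.card V) m'
      have e0 : m'.work.head - Fintype.card V = k * Fintype.card V + 1 := by
        rw [hh, Nat.add_mul]; omega
      rw [e0] at h1
      set m₁ : Mem := m'.withWork ⟨m'.work.cells, k * Fintype.card V + 1⟩ with hm₁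
      have hrows₁ : HasRows L m₁.work.cells _ := hrows
      have h2 := run_getBit (D := D) hrows₁ (show k < L by omega) rfl x
      have h3 := run_putBit (D := D) hrows₁ (show k < L by omega) rfl x
        (if k + 1 < L then r (k + 1) x else false)
      have hbit : (if x = x ∧ k + 1 ≤ k then (if k + 1 < L then r (k + 1) x else false)
          else r k x) = if k < L then r k x else false := by
        simp [show k < L by omega]
      rw [hbit] at h2
      have hsome : m₁.scan.work ≠ none := by
        have := read_of_rows (t := m₁.work) hrows₁ (show k < L by omega) x
        simp only [Config.scan, Tape.read, hm₁]
        rw [if_neg (by omega)]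
        simp only [Nat.add_sub_cancel, ne_eq, List.getElem?_eq_none_iff, not_le, hrows.1]
        have := cell_lt (show k < L by omega) x
        omega
      obtain ⟨cells', hrun, hc⟩ := ih (by omega)
        (m₁.withWork ⟨m₁.work.cells.set (k * Fintype.card V + column x)
          (if k + 1 < L then r (k + 1) x else false), m₁.work.head⟩)
        (by rw [hm₁, hm']) (by simp [hm₁])
        ((hrows₁.set (show k < L by omega) x _).congr fun i hi z => by
          by_cases hz : z = x
          · subst hz
            rcases lt_trichotomy i k with hik | hik | hik
            · simp [hik.ne, show ¬ k ≤ i by omega, show ¬ k + 1 ≤ i by omega]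
            · simp [hik]
            · simp [hik.ne', hik.le, Nat.succ_le_of_lt hik]
          · simp [hz])
      refine ⟨cells', ?_, hc⟩
      refine (Run.loop_inl (Run.seq h1 (Run.bind (G := fun o : Option Bool => if o = none then
        ret (.inr ()) else Frag.bind (getBit x) fun b => Frag.seq (putBit x
          (if k + 1 < L then r (k + 1) x else false)) (ret (.inl b)))
          (run_peek (D := D) Scan.work _) (b := (.inl _ : Bool ⊕ Unit)) (by
            rw [if_neg hsome]
            exact Run.bind h2 (Run.seq h3 (run_ret _ _))))) hrun).mono ?_
      rw [Nat.add_mul k 1]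
      omega
  obtain ⟨cells', hrun, hc⟩ := key L le_rfl m' hm' hh (by
    rw [hcells]
    exact h.congr fun i hi z => by simp [show ¬ L ≤ i by omega])
  refine ⟨cells', ?_, hc⟩
  simp only [lt_irrefl, if_false] at hrun
  have h1 := run_act (D := D) (workStep .right) m
  rw [exec_workStep] at h1
  have e : m.work.move .right = ⟨m.work.cells, 1⟩ := by
    simp [Tape.move, hm]
  rw [e] at h1
  refine (Run.seq h1 (Run.seq hr hrun)).mono ?_
  nlinarith

end Sweeps
end CatalyticGrid

namespace CatalyticGrid

open Frag

section Transfer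

variable {V : Type} [Fintype V] {D : List Bool → List Bool}

/-- Write a bit on the address tape and move on. -/
def addressPut (b : Bool) : Instr Unit :=
  { idle with addressWrite := some b, addressMove := .right }

/-- Move left on the address tape. -/
def addressLeft : Instr Unit := { idle with addressMove := .left }

/-- Jump on the catalytic tape. -/
def catalyticJump : Instr Unit := { idle with catalyticMove := .jump }

/-- Possibly write on the catalytic tape, and move on. -/
def catalyticPut (b : Option Bool) : Instr Unit :=
  { idle with catalyticWrite := b, catalyticMove := .dir .right }

theorem exec_addressPut (m : Mem) (b : Bool) : Machine.exec D m (addressPut b) =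
    { m with address := (m.address.write (some b)).move .right } := by
  cases m
  simp [Machine.exec, addressPut, idle, Tape.write, Tape.rmove, Tape.move]

theorem exec_addressLeft (m : Mem) : Machine.exec D m addressLeft =
    { m with address := m.address.move .left } := by
  cases m
  simp [Machine.exec, addressLeft, idle, Tape.write, Tape.rmove, Tape.move]

theorem exec_catalyticJump (m : Mem) : Machine.exec D m catalyticJump =
    { m with catalytic := m.catalytic.jump m.address.value } := by
  cases m
  simp [Machine.exec, catalyticJump, idle, Tape.write, Tape.rmove, Tape.move]

theorem exec_catalyticPut (m : Mem) (b : Option Bool) : Machine.exec D m (catalyticPut b) =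
    { m with catalytic := (m.catalytic.write b).move .right } := by
  cases m
  simp [Machine.exec, catalyticPut, idle, Tape.write, Tape.rmove, Tape.move]

theorem value_range (N : ℕ) : ∀ n : ℕ,
    Nat.ofDigits 2 (((List.range n).map (N.testBit ·)).map Bool.toNat) = N % 2 ^ n := by
  intro n
  induction n with
  | zero => simp [Nat.mod_one]
  | succ n ih =>
    rw [List.range_succ, List.map_append, List.map_append, Nat.ofDigits_append, ih,
      Nat.mod_pow_succ]
    simp only [Nat.testBit_eq_decide_div_mod_eq, List.length_map, List.length_range, List.map_cons, List.map_nil,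
      Nat.ofDigits_singleton]
    rcases Nat.mod_two_eq_zero_or_one (N / 2 ^ n) with h | h <;> simp [h]

/-- Copy `y` to the address tape. -/
noncomputable def setAddress (y : V) : Frag Unit :=
  Frag.seq (act { idle with workMove := .dir .right, addressMove := .right }) <|
    Frag.bind (rowLoop V (fun _ : Unit => Frag.bind (getBit y) fun b => act (addressPut b)) ())
      fun _ => Frag.seq homeWork (goHome Scan.address addressLeft)

theorem run_setAddress {y : V} {L : ℕ} {r : ℕ → V → Bool} {m : Mem}
    (h : HasRows L m.work.cells r) (hm : m.work.head = 0) (ha : m.address.head = 0)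
    (hal : m.address.cells.length ≤ L) :
    (setAddress y).Run D m () { m with
      address := ⟨(List.range m.address.cells.length).map (r · y), 0⟩ }
      (L * (10 * Fintype.card V + 13) + 17) := by
  have : Nonempty V := ⟨y⟩
  obtain ⟨⟨⟩, m', hr, hh, hl, hm', hcells, hah, hac, hav⟩ := run_rowLoop (V := V) (D := D) (L := L)
    (t := 4 * Fintype.card V + 5) (s := ())
    (body := fun _ : Unit => Frag.bind (getBit y) fun b => act (addressPut b))
    (m := { m with work := ⟨m.work.cells, 1⟩, address := ⟨m.address.cells, 1⟩ })
    (fun i s m' => m' = { m with work := m'.work, address := m'.address } ∧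
      m'.work.cells = m.work.cells ∧ m'.address.head = min i m.address.cells.length + 1 ∧
      m'.address.cells.length = m.address.cells.length ∧
      ∀ k < min i m.address.cells.length, m'.address.cells[k]? = some (r k y))
    (by
      rintro i s m' k ⟨h1, h2, h3⟩
      refine ⟨?_, h2, h3⟩
      rw [h1])
    (by
      rintro i hi ⟨⟩ m' hh hl ⟨h1, h2, h3, h4, h5⟩
      have hrows : HasRows L m'.work.cells r := by rw [h2]; exact h
      have hp := run_act (D := D) (addressPut (r i y)) m'
      rw [exec_addressPut] at hp
      refine ⟨_, _, Run.mono (Run.bind (run_getBit hrows hi hh y) hp) (by omega), hh, hl, ?_, h2,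
        ?_, ?_, ?_⟩
      · rw [h1]
      · simp only [Tape.write, h3, Tape.move]
        rw [if_neg (by omega)]
        simp only [List.length_set, h4]
        omega
      · simp only [Tape.write, h3, Tape.move]
        rw [if_neg (by omega)]
        simp [h4]
      · intro k hk
        simp only [Tape.write, h3, Tape.move]
        rw [if_neg (by omega)]
        simp only [Nat.add_sub_cancel, List.getElem?_set, h4]
        by_cases hki : k = min i m.address.cells.length
        · rw [if_pos hki.symm, if_pos (by omega)]
          congr 2
          omega
        · rw [if_neg (Ne.symm hki)]
          exact h5 k (by omega))
    rfl h.1 ⟨rfl, rfl, by simp, rfl, by simp⟩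
  have h0 := run_act (D := D) { idle with workMove := .dir .right, addressMove := .right } m
  have e0 : Machine.exec D m { idle with workMove := .dir .right, addressMove := .right } =
      { m with work := ⟨m.work.cells, 1⟩, address := ⟨m.address.cells, 1⟩ } := by
    simp only [Machine.exec, idle, Tape.write, Tape.rmove, Tape.move, hm, ha]
    simp
  rw [e0] at h0
  have h1 := run_homeWork (D := D) m' (by rw [hl, hh])
  have h2 := run_goHome (D := D) (sel := Scan.address) (i := addressLeft) Config.address
    (fun m t => { m with address := t }) (fun _ => rfl) exec_addressLeft
    (fun _ _ => rfl) (fun _ _ _ => rfl) (fun _ => rfl)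
    (m'.withWork ⟨m'.work.cells, 0⟩) (by simp only [hah, hac]; omega)
  have := Run.seq h0 (Run.bind (G := fun _ : Unit =>
    Frag.seq homeWork (goHome Scan.address addressLeft)) hr (Run.seq h1 h2))
  refine this.cast ?_ ?_
  · have e : m'.address.cells = (List.range m.address.cells.length).map (r · y) := by
      refine List.ext_getElem? fun k => ?_
      rcases lt_or_ge k m.address.cells.length with hk | hk
      · rw [hav k (by omega)]
        simp [hk]
      · rw [List.getElem?_eq_none (by omega), List.getElem?_eq_none (by simpa using hk)]
    simp only [e, hcells]
    rw [hm']
    have : (⟨m.work.cells, 0⟩ : Tape) = m.work := by rw [← hm]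
    simp only [this]
  · simp only [hl, hac]
    nlinarith

/-- Load the register at the address `y` of the catalytic tape into `x`. -/
noncomputable def loadReg (x y : V) : Frag Unit :=
  Frag.seq (setAddress y) <| Frag.seq (act catalyticJump) <| Frag.seq (act (workStep .right)) <|
    Frag.seq (rowLoop V (fun _ : Unit => Frag.bind (peek fun s => s.catalytic == some true)
      fun b => Frag.seq (putBit x b) (act (catalyticPut none))) ()) homeWork

/-- Store `x` into the register at the address `y` of the catalytic tape. -/
noncomputable def storeReg (x y : V) : Frag Unit :=
  Frag.seq (setAddress y) <| Frag.seq (act catalyticJump) <| Frag.seq (act (workStep .right)) <|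
    Frag.seq (rowLoop V (fun _ : Unit => Frag.bind (getBit x)
      fun b => act (catalyticPut (some b))) ()) homeWork

theorem run_jump {y : V} {L : ℕ} {r : ℕ → V → Bool} {m : Mem}
    (h : HasRows L m.work.cells r) (hm : m.work.head = 0) (ha : m.address.head = 0)
    (hal : m.address.cells.length ≤ L) {N : ℕ} (hy : ∀ i < L, r i y = N.testBit i)
    (hN : N < 2 ^ m.address.cells.length) (hc : N + L ≤ m.catalytic.cells.length)
    {F : Frag Unit} {t : ℕ} {m' : Mem}
    (hF : F.Run D { m with
      work := ⟨m.work.cells, 1⟩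
      catalytic := ⟨m.catalytic.cells, N + 1⟩
      address := ⟨(List.range m.address.cells.length).map (N.testBit ·), 0⟩ } () m' t) :
    (Frag.seq (setAddress y) <| Frag.seq (act catalyticJump) <|
      Frag.seq (act (workStep .right)) F).Run D m () m'
      (L * (10 * Fintype.card V + 13) + 22 + t) := by
  have h1 := run_setAddress (D := D) (y := y) h hm ha hal
  have e1 : (List.range m.address.cells.length).map (r · y) =
      (List.range m.address.cells.length).map (N.testBit ·) := by
    refine List.map_congr_left fun k hk => hy k ?_
    have := List.mem_range.1 hk
    omega
  rw [e1] at h1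
  set m₁ : Mem := { m with
    address := ⟨(List.range m.address.cells.length).map (N.testBit ·), 0⟩ } with hm₁
  have h2 := run_act (D := D) catalyticJump m₁
  rw [exec_catalyticJump] at h2
  have e2 : m₁.catalytic.jump m₁.address.value = ⟨m.catalytic.cells, N + 1⟩ := by
    simp only [hm₁, Tape.jump, Tape.value, value_range, Nat.mod_eq_of_lt hN]
    congr 1
    omega
  rw [e2] at h2
  have h3 := run_act (D := D) (workStep .right) { m₁ with catalytic := ⟨m.catalytic.cells, N + 1⟩ }
  rw [exec_workStep] at h3
  refine (Run.seq h1 (Run.seq h2 (Run.seq h3 ?_))).mono (t := _) (t' := _) (by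
    show _ + 1 + (1 + 1 + (1 + 1 + t)) ≤ _
    omega)
  have e3 : ({ m₁ with catalytic := ⟨m.catalytic.cells, N + 1⟩ } : Mem).work.move .right =
      ⟨m.work.cells, 1⟩ := by
    simp [hm₁, Tape.move, hm]
  rw [e3]
  exact hF

theorem run_loadReg [DecidableEq V] {x y : V} {L : ℕ} {r : ℕ → V → Bool} {m : Mem}
    (h : HasRows L m.work.cells r) (hm : m.work.head = 0) (ha : m.address.head = 0)
    (hal : m.address.cells.length ≤ L) {N : ℕ} (hy : ∀ i < L, r i y = N.testBit i)
    (hN : N < 2 ^ m.address.cells.length) (hc : N + L ≤ m.catalytic.cells.length)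
    {cb : ℕ → Bool} (hcb : ∀ k < L, m.catalytic.cells[N + k]? = some (cb k)) :
    ∃ m', (loadReg x y).Run D m () m' (L * (20 * Fintype.card V + 25) + 35) ∧
      m' = { m with work := m'.work, catalytic := m'.catalytic, address := m'.address } ∧
      m'.work.head = 0 ∧ HasRows L m'.work.cells (fun i z => if z = x then cb i else r i z) ∧
      m'.catalytic.cells = m.catalytic.cells ∧ m'.address.head = 0 ∧
      m'.address.cells.length = m.address.cells.length := by
  have : Nonempty V := ⟨y⟩
  obtain ⟨⟨⟩, m', hr, hh, hl, hm', hrows, hch, hcc⟩ := run_rowLoop (V := V) (D := D) (L := L)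
    (t := 4 * Fintype.card V + 7) (s := ())
    (body := fun _ : Unit => Frag.bind (peek fun s => s.catalytic == some true)
      fun b => Frag.seq (putBit x b) (act (catalyticPut none)))
    (m := { m with
      work := ⟨m.work.cells, 1⟩
      catalytic := ⟨m.catalytic.cells, N + 1⟩
      address := ⟨(List.range m.address.cells.length).map (N.testBit ·), 0⟩ })
    (fun i s m' => m' = { m with
        work := m'.work
        catalytic := m'.catalytic
        address := ⟨(List.range m.address.cells.length).map (N.testBit ·), 0⟩ } ∧
      HasRows L m'.work.cells (fun j z => if j < i ∧ z = x then cb j else r j z) ∧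
      m'.catalytic.head = N + i + 1 ∧ m'.catalytic.cells = m.catalytic.cells)
    (by
      rintro i s m' k ⟨h1, h2, h3⟩
      refine ⟨?_, h2, h3⟩
      rw [h1])
    (by
      rintro i hi ⟨⟩ m' hh hl ⟨h1, h2, h3, h4⟩
      have hpk := run_peek (D := D) (fun s => s.catalytic == some true) m'
      have e : (m'.scan.catalytic == some true) = cb i := by
        simp only [Config.scan, Tape.read, h3, h4]
        rw [if_neg (by omega), Nat.add_sub_cancel, hcb i hi]
        simp
      rw [e] at hpk
      have hp := run_putBit (D := D) h2 hi hh x (cb i)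
      have hq := run_act (D := D) (catalyticPut none) (m'.withWork
        ⟨m'.work.cells.set (i * Fintype.card V + column x) (cb i), m'.work.head⟩)
      rw [exec_catalyticPut] at hq
      refine ⟨_, _, Run.mono (Run.bind (G := fun b => Frag.seq (putBit x b)
        (act (catalyticPut none))) hpk (Run.seq hp hq)) (by omega), hh, by simpa using hl, ?_,
        (h2.set hi x (cb i)).congr ?_, ?_, h4⟩
      · rw [h1]
      · intro j hj z
        by_cases hz : z = x
        · subst hz
          rcases lt_trichotomy j i with hji | hji | hji
          · simp [hji, hji.ne, Nat.lt_succ_of_lt hji]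
          · simp [hji]
          · simp [hji.ne', show ¬ j < i by omega, show ¬ j < i + 1 by omega]
        · simp [hz]
      · simp only [Tape.write, Tape.move, h3, h4]
        omega)
    rfl h.1 ⟨rfl, by simpa using h, rfl, rfl⟩
  have h2 := run_homeWork (D := D) m' (by rw [hl, hh])
  refine ⟨_, (run_jump h hm ha hal hy hN hc (Run.seq hr h2)).mono ?_, ?_, rfl,
    hrows.congr fun i hi z => by simp [hi], hcc, ?_, ?_⟩
  · rw [hl]
    nlinarith
  · rw [hm']
  · rw [hm']
  · rw [hm']
    simp

theorem run_storeReg {x y : V} {L : ℕ} {r : ℕ → V → Bool} {m : Mem}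
    (h : HasRows L m.work.cells r) (hm : m.work.head = 0) (ha : m.address.head = 0)
    (hal : m.address.cells.length ≤ L) {N : ℕ} (hy : ∀ i < L, r i y = N.testBit i)
    (hN : N < 2 ^ m.address.cells.length) (hc : N + L ≤ m.catalytic.cells.length) :
    ∃ m', (storeReg x y).Run D m () m' (L * (20 * Fintype.card V + 25) + 35) ∧
      m' = { m with catalytic := m'.catalytic, address := m'.address } ∧
      m'.catalytic.cells.length = m.catalytic.cells.length ∧
      (∀ j, m'.catalytic.cells[j]? =
        if N ≤ j ∧ j < N + L then some (r (j - N) x) else m.catalytic.cells[j]?) ∧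
      m'.address.head = 0 ∧
      m'.address.cells.length = m.address.cells.length := by
  have : Nonempty V := ⟨y⟩
  obtain ⟨⟨⟩, m', hr, hh, hl, hm', hcells, hch, hcl, hcc⟩ := run_rowLoop (V := V) (D := D) (L := L)
    (t := 4 * Fintype.card V + 7) (s := ())
    (body := fun _ : Unit => Frag.bind (getBit x) fun b => act (catalyticPut (some b)))
    (m := { m with
      work := ⟨m.work.cells, 1⟩
      catalytic := ⟨m.catalytic.cells, N + 1⟩
      address := ⟨(List.range m.address.cells.length).map (N.testBit ·), 0⟩ })
    (fun i s m' => m' = { m with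
        work := m'.work
        catalytic := m'.catalytic
        address := ⟨(List.range m.address.cells.length).map (N.testBit ·), 0⟩ } ∧
      m'.work.cells = m.work.cells ∧
      m'.catalytic.head = N + i + 1 ∧
      m'.catalytic.cells.length = m.catalytic.cells.length ∧
      ∀ j, m'.catalytic.cells[j]? =
        if N ≤ j ∧ j < N + i then some (r (j - N) x) else m.catalytic.cells[j]?)
    (by
      rintro i s m' k ⟨h1, h2, h3⟩
      refine ⟨?_, h2, h3⟩
      rw [h1])
    (by
      rintro i hi ⟨⟩ m' hh hl ⟨h1, h2, h3, h4, h5⟩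
      have hrows : HasRows L m'.work.cells r := by rw [h2]; exact h
      have hp := run_getBit (D := D) hrows hi hh x
      have hq := run_act (D := D) (catalyticPut (some (r i x))) m'
      rw [exec_catalyticPut] at hq
      refine ⟨_, _, Run.mono (Run.bind hp hq) (by omega), hh, by simpa using hl, ?_, h2, ?_, ?_, ?_⟩
      · rw [h1]
      · simp only [Tape.write, Tape.move, h3]
        rw [if_neg (by omega)]
        simp only [List.length_set, h4]
        omega
      · simp only [Tape.write, Tape.move, h3]
        rw [if_neg (by omega)]
        simpa using h4
      · intro j
        simp only [Tape.write, Tape.move, h3]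
        rw [if_neg (by omega)]
        simp only [Nat.add_sub_cancel, List.getElem?_set, h4, h5]
        by_cases hj : N + i = j
        · rw [if_pos hj, if_pos (by omega), if_pos (by omega)]
          congr 2
          omega
        · rw [if_neg hj]
          by_cases hj2 : N ≤ j ∧ j < N + i
          · rw [if_pos hj2, if_pos (by omega)]
          · rw [if_neg hj2, if_neg (by omega)])
    rfl h.1 ⟨rfl, rfl, rfl, rfl, fun j => by rw [if_neg (by omega)]⟩
  have h2 := run_homeWork (D := D) m' (by rw [hl, hh])
  refine ⟨_, (run_jump h hm ha hal hy hN hc (Run.seq hr h2)).mono ?_, ?_, hcl,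
    hcc, ?_, ?_⟩
  · rw [hl]
    nlinarith
  · have : (⟨m.work.cells, 0⟩ : Tape) = m.work := by rw [← hm]
    simp only [Config.withWork, hcells, this]
    rw [hm']
  · rw [hm']
  · rw [hm']
    simp

end Transfer
end CatalyticGrid

namespace CatalyticGrid

open Frag

/-! ### A small imperative language -/

/-- Elementary operations on variables with values below `2 ^ L`, on the registers of the catalytic
tape, and on the input, oracle and output tapes. -/
inductive Op (V : Type)
  | zero (x : V)
  | copy (x y : V)
  | inc (x : V)
  | dec (x : V)
  | add (x y : V)
  | sub (x y : V)
  | half (x : V)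
  | load (x y : V)
  | store (x y : V)
  | device (d : Dir) (a : OracleAct) (o : Option Bool)

/-- Tests. -/
inductive Cond (V : Type)
  | lt (x y : V)
  | pos (x : V)
  | odd (x : V)
  | input (f : Option Bool → Bool)
  | oracle (f : Option Bool → Bool)

/-- Structured programs. -/
inductive Prog (V : Type)
  | op (o : Op V)
  | seq (p q : Prog V)
  | ite (c : Cond V) (p q : Prog V)
  | loop (c : Cond V) (p : Prog V)

/-- The state of a program. -/
structure St (V : Type) where
  v : V → ℕ
  reg : ℕ → ℕ
  input : Tape
  oracle : Tape
  output : List Bool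
  time : ℕ

/-- The number of bits of a variable, the number of registers, and the oracle. -/
structure Env where
  L : ℕ
  R : ℕ
  D : List Bool → List Bool

section Semantics

variable {V : Type}

namespace St

/-- Let time pass. -/
def tick (σ : St V) : St V := { σ with time := σ.time + 1 }

@[simp] theorem tick_v (σ : St V) : σ.tick.v = σ.v := rfl
@[simp] theorem tick_reg (σ : St V) : σ.tick.reg = σ.reg := rfl
@[simp] theorem tick_input (σ : St V) : σ.tick.input = σ.input := rfl
@[simp] theorem tick_oracle (σ : St V) : σ.tick.oracle = σ.oracle := rfl
@[simp] theorem tick_output (σ : St V) : σ.tick.output = σ.output := rfl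
@[simp] theorem tick_time (σ : St V) : σ.tick.time = σ.time + 1 := rfl

variable [DecidableEq V]

/-- Assign a value to a variable. -/
def set (σ : St V) (x : V) (a : ℕ) : St V :=
  { σ with v := Function.update σ.v x a, time := σ.time + 1 }

@[simp] theorem set_v (σ : St V) (x : V) (a : ℕ) (y : V) :
    (σ.set x a).v y = if y = x then a else σ.v y := by
  simp [set, Function.update_apply]

@[simp] theorem set_reg (σ : St V) (x : V) (a : ℕ) : (σ.set x a).reg = σ.reg := rfl
@[simp] theorem set_input (σ : St V) (x : V) (a : ℕ) : (σ.set x a).input = σ.input := rfl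
@[simp] theorem set_oracle (σ : St V) (x : V) (a : ℕ) : (σ.set x a).oracle = σ.oracle := rfl
@[simp] theorem set_output (σ : St V) (x : V) (a : ℕ) : (σ.set x a).output = σ.output := rfl
@[simp] theorem set_time (σ : St V) (x : V) (a : ℕ) : (σ.set x a).time = σ.time + 1 := rfl

end St

variable [DecidableEq V]

/-- The precondition of an operation. -/
def Op.Ok (E : Env) (σ : St V) : Op V → Prop
  | .load _ y => ∃ r < E.R, σ.v y = r * E.L
  | .store _ y => ∃ r < E.R, σ.v y = r * E.L
  | _ => True

/-- The effect of an operation. -/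
def Op.apply (E : Env) (σ : St V) : Op V → St V
  | .zero x => σ.set x 0
  | .copy x y => σ.set x (σ.v y)
  | .inc x => σ.set x ((σ.v x + 1) % 2 ^ E.L)
  | .dec x => σ.set x ((σ.v x + (2 ^ E.L - 1)) % 2 ^ E.L)
  | .add x y => σ.set x ((σ.v x + σ.v y) % 2 ^ E.L)
  | .sub x y => σ.set x ((σ.v x + (2 ^ E.L - σ.v y)) % 2 ^ E.L)
  | .half x => σ.set x (σ.v x / 2)
  | .load x y => σ.set x (σ.reg (σ.v y / E.L))
  | .store x y => { σ.tick with reg := Function.update σ.reg (σ.v y / E.L) (σ.v x) }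
  | .device d a o => { σ.tick with
      input := σ.input.move d
      output := σ.output ++ o.toList
      oracle := match a with
        | .act w d => (σ.oracle.write w).move d
        | .query => σ.oracle.query E.D }

/-- The value of a test. -/
def Cond.eval (σ : St V) : Cond V → Bool
  | .lt x y => decide (σ.v x < σ.v y)
  | .pos x => decide (0 < σ.v x)
  | .odd x => decide (σ.v x % 2 = 1)
  | .input f => f σ.input.read
  | .oracle f => f σ.oracle.read

/-- Evaluation of programs. -/
inductive Big (E : Env) : Prog V → St V → St V → Prop
  | op {o σ} : o.Ok E σ → Big E (.op o) σ (o.apply E σ)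
  | seq {p q σ σ₁ σ₂} : Big E p σ σ₁ → Big E q σ₁ σ₂ → Big E (.seq p q) σ σ₂
  | ite_true {c p q σ σ'} : c.eval σ = true → Big E p σ.tick σ' → Big E (.ite c p q) σ σ'
  | ite_false {c p q σ σ'} : c.eval σ = false → Big E q σ.tick σ' → Big E (.ite c p q) σ σ'
  | loop_true {c p σ σ₁ σ'} : c.eval σ = true → Big E p σ.tick σ₁ → Big E (.loop c p) σ₁ σ' →
      Big E (.loop c p) σ σ'
  | loop_false {c p σ} : c.eval σ = false → Big E (.loop c p) σ σ.tick

end Semantics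

section Compile

variable {V : Type} [Fintype V]

/-- The full adder, with the second bit modified by `g`. -/
def adder (g : Bool → Bool) (c a b : Bool) : Bool × Bool :=
  ((a && g b) || (a && c) || (g b && c), (a ^^ g b) ^^ c)

/-- The fragment of an operation. -/
noncomputable def Op.frag : Op V → Frag Unit
  | .zero x => Frag.bind (sweep x x (fun _ _ _ => ((), false)) ()) ret
  | .copy x y => Frag.bind (sweep x y (fun _ _ b => ((), b)) ()) ret
  | .inc x => Frag.bind (sweep x x (adder fun _ => false) true) fun _ => ret ()
  | .dec x => Frag.bind (sweep x x (adder fun _ => true) false) fun _ => ret ()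
  | .add x y => Frag.bind (sweep x y (adder id) false) fun _ => ret ()
  | .sub x y => Frag.bind (sweep x y (adder not) true) fun _ => ret ()
  | .half x => halve x
  | .load x y => loadReg x y
  | .store x y => storeReg x y
  | .device d a o => act { idle with inputMove := d, oracleAct := a, output := o }

/-- The fragment of a test. -/
noncomputable def Cond.frag : Cond V → Frag Bool
  | .lt x y => sweep x y (fun s a b => (if a == b then s else b, a)) false
  | .pos x => sweep x x (fun s a _ => (s || a, a)) false
  | .odd x => Frag.bind (sweep x x (fun s a _ => (some (s.getD a), a)) (none : Option Bool))
      fun s => ret (s == some true)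
  | .input f => peek fun s => f s.input
  | .oracle f => peek fun s => f s.oracle

/-- The fragment of a program. -/
noncomputable def Prog.frag : Prog V → Frag Unit
  | .op o => o.frag
  | .seq p q => Frag.seq p.frag q.frag
  | .ite c p q => Frag.bind c.frag fun b => if b = true then p.frag else q.frag
  | .loop c p => Frag.loop (fun _ : Unit => Frag.bind c.frag fun b =>
      if b = true then Frag.seq p.frag (ret (.inl ())) else ret (.inr ())) ()

/-- The memory `m` represents the state `σ`. -/
structure Rep (E : Env) (σ : St V) (m : Mem) : Prop where
  work_head : m.work.head = 0
  rows : HasRows E.L m.work.cells fun i x => (σ.v x).testBit i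
  lt : ∀ x, σ.v x < 2 ^ E.L
  cat_length : m.catalytic.cells.length = E.R * E.L
  cat : ∀ r < E.R, ∀ k < E.L, m.catalytic.cells[r * E.L + k]? = some ((σ.reg r).testBit k)
  reg_lt : ∀ r < E.R, σ.reg r < 2 ^ E.L
  address_head : m.address.head = 0
  address_le : m.address.cells.length ≤ E.L
  le_address : E.R * E.L ≤ 2 ^ m.address.cells.length
  input : m.input = σ.input
  output : m.output = σ.output
  oracle : m.oracle = σ.oracle

variable {E : Env}

theorem Rep.congr_v [DecidableEq V] {σ σ' : St V} {m : Mem} (h : Rep E σ m) {cells : List Bool}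
    (hr : HasRows E.L cells fun i x => (σ'.v x).testBit i) (hlt : ∀ x, σ'.v x < 2 ^ E.L)
    (h1 : σ'.reg = σ.reg) (h2 : σ'.input = σ.input) (h3 : σ'.output = σ.output)
    (h4 : σ'.oracle = σ.oracle) : Rep E σ' (m.withWork ⟨cells, 0⟩) where
  work_head := rfl
  rows := hr
  lt := hlt
  cat_length := h.cat_length
  cat := by rw [h1]; exact h.cat
  reg_lt := by rw [h1]; exact h.reg_lt
  address_head := h.address_head
  address_le := h.address_le
  le_address := h.le_address
  input := by rw [h2]; exact h.input
  output := by rw [h3]; exact h.output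
  oracle := by rw [h4]; exact h.oracle

theorem Rep.sweep [DecidableEq V] {S : Type} [Finite S] {σ : St V} {m : Mem} (h : Rep E σ m)
    {x y : V} {f : S → Bool → Bool → S × Bool} {a : ℕ} (ha : a < 2 ^ E.L) (s : ℕ → S)
    (hf : ∀ i < E.L, f (s i) ((σ.v x).testBit i) ((σ.v y).testBit i) = (s (i + 1), a.testBit i)) :
    ∃ m', (sweep x y f (s 0)).Run E.D m (s E.L) m' (E.L * (18 * Fintype.card V + 16) + 12) ∧
      Rep E (σ.set x a) m' := by
  obtain ⟨cells, hr, hc⟩ := run_sweep (D := E.D) h.rows h.work_head s a.testBit hf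
  refine ⟨_, hr, h.congr_v (hc.congr fun i hi z => ?_) (fun z => ?_) rfl rfl rfl rfl⟩
  · simp only [St.set_v]
    split_ifs <;> rfl
  · simp only [St.set_v]
    split_ifs
    exacts [ha, h.lt z]

theorem Rep.tick [DecidableEq V] {σ : St V} {m : Mem} (h : Rep E σ m) : Rep E σ.tick m :=
  ⟨h.1, h.2, h.3, h.4, h.5, h.6, h.7, h.8, h.9, h.10, h.11, h.12⟩

theorem Rep.of_set_self [DecidableEq V] {σ : St V} {m : Mem} {x : V}
    (h : Rep E (σ.set x (σ.v x)) m) : Rep E σ.tick m := by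
  have e : (σ.set x (σ.v x)) = σ.tick := by simp [St.set, St.tick]
  rwa [e] at h

theorem adder_spec (X Y : ℕ) (c : Bool) (i : ℕ) {g : Bool → Bool} {b : Bool}
    (hb : g b = Y.testBit i) :
    adder g (decide (2 ^ i ≤ X % 2 ^ i + Y % 2 ^ i + c.toNat)) (X.testBit i) b =
      (decide (2 ^ (i + 1) ≤ X % 2 ^ (i + 1) + Y % 2 ^ (i + 1) + c.toNat),
        (X + Y + c.toNat).testBit i) := by
  have hp : 0 < 2 ^ i := by positivity
  have hX := Nat.div_add_mod X (2 ^ i)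
  have hY := Nat.div_add_mod Y (2 ^ i)
  have hx := Nat.mod_lt X hp
  have hy := Nat.mod_lt Y hp
  have hc : c.toNat ≤ 1 := Bool.toNat_le c
  rw [Nat.mod_pow_succ, Nat.mod_pow_succ, pow_succ]
  simp only [adder, hb, Nat.testBit_eq_decide_div_mod_eq]
  have key : (X + Y + c.toNat) / 2 ^ i = X / 2 ^ i + Y / 2 ^ i +
      if 2 ^ i ≤ X % 2 ^ i + Y % 2 ^ i + c.toNat then 1 else 0 := by
    rw [Nat.div_eq_iff hp]
    rw [add_mul, add_mul, mul_comm (X / 2 ^ i), mul_comm (Y / 2 ^ i)]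
    split_ifs <;> constructor <;> omega
  rw [key]
  generalize X / 2 ^ i = u at *
  generalize Y / 2 ^ i = w at *
  generalize X % 2 ^ i = r at *
  generalize Y % 2 ^ i = s at *
  generalize 2 ^ i = P at *
  by_cases h : P ≤ r + s + c.toNat <;>
  rcases Nat.mod_two_eq_zero_or_one u with hu | hu <;>
  rcases Nat.mod_two_eq_zero_or_one w with hw | hw <;>
  simp [h, hu, hw, Nat.add_mod] <;> omega

theorem Rep.add [DecidableEq V] {σ : St V} {m : Mem} (h : Rep E σ m) {x y : V} {g : Bool → Bool}
    {c : Bool} {Y : ℕ} (hY : ∀ i < E.L, g ((σ.v y).testBit i) = Y.testBit i) :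
    ∃ m', (Frag.bind (CatalyticGrid.sweep x y (adder g) c) fun _ => ret ()).Run E.D m () m'
      (E.L * (18 * Fintype.card V + 16) + 13) ∧
      Rep E (σ.set x ((σ.v x + Y + c.toNat) % 2 ^ E.L)) m' := by
  obtain ⟨m', hr, hm'⟩ := h.sweep (x := x) (y := y) (f := adder g)
    (a := (σ.v x + Y + c.toNat) % 2 ^ E.L) (Nat.mod_lt _ (by positivity))
    (fun i => decide (2 ^ i ≤ σ.v x % 2 ^ i + Y % 2 ^ i + c.toNat)) (fun i hi => by
      rw [adder_spec _ Y c i (hY i hi), Nat.testBit_mod_two_pow]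
      simp [hi])
  have e : decide (2 ^ 0 ≤ σ.v x % 2 ^ 0 + Y % 2 ^ 0 + c.toNat) = c := by
    cases c <;> simp [Nat.mod_one]
  rw [e] at hr
  exact ⟨m', Run.bind (G := fun _ => ret ()) hr (run_ret () _), hm'⟩

/-- A bound on the time of an elementary operation. -/
def unitTime (V : Type) [Fintype V] (L : ℕ) : ℕ := L * (20 * Fintype.card V + 25) +
  2 * Fintype.card V + 40

variable [DecidableEq V]

theorem Rep.op {σ : St V} {m : Mem} (h : Rep E σ m) {o : Op V} (ho : o.Ok E σ) :
    ∃ m', o.frag.Run E.D m () m' (unitTime V E.L - 2) ∧ Rep E (o.apply E σ) m' := by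
  have hpos : 0 < 2 ^ E.L := by positivity
  have mono : E.L * (18 * Fintype.card V + 16) + 13 ≤ unitTime V E.L - 2 := by
    unfold unitTime
    have : E.L * (18 * Fintype.card V + 16) ≤ E.L * (20 * Fintype.card V + 25) :=
      Nat.mul_le_mul_left _ (by omega)
    omega
  have hone : ∀ i < E.L, (2 ^ E.L - 1).testBit i = true := fun i hi => by
    simp [hi]
  cases o with
  | zero x =>
    obtain ⟨m', hr, hm'⟩ := h.sweep (x := x) (y := x) (f := fun _ _ _ => ((), false)) hpos
      (fun _ => ()) (fun i _ => by simp)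
    exact ⟨m', (Run.bind hr (run_ret _ _)).mono mono, hm'⟩
  | copy x y =>
    obtain ⟨m', hr, hm'⟩ := h.sweep (x := x) (y := y) (f := fun _ _ b => ((), b)) (h.lt y)
      (fun _ => ()) (fun i _ => by simp)
    exact ⟨m', (Run.bind hr (run_ret _ _)).mono mono, hm'⟩
  | inc x =>
    obtain ⟨m', hr, hm'⟩ := h.add (x := x) (y := x) (g := fun _ => false) (c := true) (Y := 0)
      (fun i _ => by simp)
    exact ⟨m', hr.mono mono, by simpa [Op.apply] using hm'⟩
  | dec x =>
    obtain ⟨m', hr, hm'⟩ := h.add (x := x) (y := x) (g := fun _ => true) (c := false)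
      (Y := 2 ^ E.L - 1) (fun i hi => (hone i hi).symm)
    exact ⟨m', hr.mono mono, by simpa [Op.apply] using hm'⟩
  | add x y =>
    obtain ⟨m', hr, hm'⟩ := h.add (x := x) (y := y) (g := id) (c := false) (Y := σ.v y)
      (fun i _ => rfl)
    exact ⟨m', hr.mono mono, by simpa [Op.apply] using hm'⟩
  | sub x y =>
    obtain ⟨m', hr, hm'⟩ := h.add (x := x) (y := y) (g := not) (c := true)
      (Y := 2 ^ E.L - (σ.v y + 1)) (fun i hi => by
        rw [Nat.testBit_two_pow_sub_succ (h.lt y)]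
        simp [hi])
    refine ⟨m', hr.mono mono, ?_⟩
    have e : σ.v x + (2 ^ E.L - (σ.v y + 1)) + true.toNat = σ.v x + (2 ^ E.L - σ.v y) := by
      have := h.lt y
      simp only [Bool.toNat_true]
      omega
    rw [e] at hm'
    exact hm'
  | half x =>
    obtain ⟨cells, hr, hc⟩ := run_halve (D := E.D) (x := x) h.rows h.work_head
    refine ⟨_, hr.mono ?_, h.congr_v (hc.congr fun i hi z => ?_) (fun z => ?_) rfl rfl rfl rfl⟩
    · unfold unitTime
      have : E.L * (14 * Fintype.card V + 16) ≤ E.L * (20 * Fintype.card V + 25) :=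
        Nat.mul_le_mul_left _ (by omega)
      omega
    · simp only [Op.apply, St.set_v]
      split_ifs with h1 h2
      · rw [Nat.testBit_div_two]
      · rw [Nat.testBit_div_two, Nat.testBit_lt_two_pow]
        exact (h.lt x).trans_le (Nat.pow_le_pow_right (by omega) (by omega))
      · rfl
    · simp only [Op.apply, St.set_v]
      split_ifs
      · exact (Nat.div_le_self _ _).trans_lt (h.lt x)
      · exact h.lt z
  | load x y =>
    obtain ⟨r, hrR, hy⟩ := ho
    have hle : r * E.L + E.L ≤ E.R * E.L := by
      nlinarith [Nat.mul_le_mul_right E.L (Nat.succ_le_of_lt hrR)]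
    rcases Nat.eq_zero_or_pos E.L with hL | hL
    · have hz : ∀ z, σ.v z = 0 := fun z => by have := h.lt z; simpa [hL] using this
      obtain ⟨m', hr, h1, h2, h3, h4, h5, h6⟩ := run_loadReg (D := E.D) (x := x) (y := y)
        (N := 0) (cb := fun _ => false) h.rows h.work_head h.address_head h.address_le
        (fun i hi => by omega) (by positivity) (by simp [hL]) (fun k hk => by omega)
      refine ⟨m', hr.mono (by unfold unitTime; omega), ?_⟩
      have hreg := h.reg_lt r hrR
      have e : (Op.load x y).apply E σ = σ.set x 0 := by
        simp only [Op.apply, hz, hL, Nat.zero_div]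
        have := h.reg_lt 0 (by omega)
        rw [hL, pow_zero, Nat.lt_one_iff] at this
        rw [this]
      rw [e, h1]
      have hw : m'.work = ⟨m'.work.cells, 0⟩ := by rw [← h2]
      rw [hw]
      refine ⟨rfl, h3.congr fun i hi => by omega, fun z => ?_, by simp only [h4]; exact h.cat_length,
        fun r _ k hk => by omega, h.reg_lt, h5, by simp only [h6]; exact h.address_le,
        by simp only [h6]; exact h.le_address, h.input, h.output, h.oracle⟩
      simp only [St.set_v, hz]
      split_ifs <;> exact hpos
    have hlt : r * E.L < 2 ^ m.address.cells.length :=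
      lt_of_lt_of_le (by omega) h.le_address
    obtain ⟨m', hr, h1, h2, h3, h4, h5, h6⟩ := run_loadReg (D := E.D) (x := x) (y := y)
      (N := r * E.L) h.rows h.work_head h.address_head h.address_le
      (fun i hi => by rw [hy]) hlt (by rw [h.cat_length]; exact hle) (h.cat r hrR)
    refine ⟨m', hr.mono (by unfold unitTime; omega), ?_⟩
    have e : (Op.load x y).apply E σ = σ.set x (σ.reg r) := by
      simp only [Op.apply, hy, Nat.mul_div_cancel _ hL]
    rw [e, h1]
    have hw : m'.work = ⟨m'.work.cells, 0⟩ := by rw [← h2]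
    rw [hw]
    refine ⟨rfl, h3.congr fun i hi z => ?_, fun z => ?_, by simp only [h4]; exact h.cat_length,
      by simp only [h4]; exact h.cat, h.reg_lt, h5, by simp only [h6]; exact h.address_le,
      by simp only [h6]; exact h.le_address, h.input, h.output, h.oracle⟩
    · simp only [St.set_v]
      split_ifs <;> rfl
    · simp only [St.set_v]
      split_ifs
      exacts [h.reg_lt r hrR, h.lt z]
  | store x y =>
    obtain ⟨r, hrR, hy⟩ := ho
    have hle : r * E.L + E.L ≤ E.R * E.L := by
      nlinarith [Nat.mul_le_mul_right E.L (Nat.succ_le_of_lt hrR)]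
    rcases Nat.eq_zero_or_pos E.L with hL | hL
    · have hz : ∀ z, σ.v z = 0 := fun z => by have := h.lt z; simpa [hL] using this
      obtain ⟨m', hr, h1, h3, h4, h5, h6⟩ := run_storeReg (D := E.D) (x := x) (y := y)
        (N := 0) h.rows h.work_head h.address_head h.address_le
        (fun i hi => by omega) (by positivity) (by simp [hL])
      refine ⟨m', hr.mono (by unfold unitTime; omega), ?_⟩
      rw [h1]
      refine ⟨h.work_head, h.rows, h.lt, by simp only [h3]; exact h.cat_length,
        fun r _ k hk => by omega, fun r hr => ?_, h5, by simp only [h6]; exact h.address_le,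
        by simp only [h6]; exact h.le_address, h.input, h.output, h.oracle⟩
      simp only [Op.apply, Function.update_apply]
      split_ifs
      exacts [h.lt x, h.reg_lt r hr]
    have hlt : r * E.L < 2 ^ m.address.cells.length :=
      lt_of_lt_of_le (by omega) h.le_address
    obtain ⟨m', hr, h1, h3, h4, h5, h6⟩ := run_storeReg (D := E.D) (x := x) (y := y)
      (N := r * E.L) h.rows h.work_head h.address_head h.address_le
      (fun i hi => by rw [hy]) hlt (by rw [h.cat_length]; exact hle)
    refine ⟨m', hr.mono (by unfold unitTime; omega), ?_⟩
    rw [h1]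
    refine ⟨h.work_head, h.rows, h.lt, by simp only [h3]; exact h.cat_length,
      fun r' hr' k hk => ?_, fun r' hr' => ?_, h5, by simp only [h6]; exact h.address_le,
      by simp only [h6]; exact h.le_address, h.input, h.output, h.oracle⟩
    · simp only [Op.apply, Function.update_apply, hy, Nat.mul_div_cancel _ hL, h4]
      by_cases hrr : r' = r
      · subst hrr
        rw [if_pos ⟨by omega, by omega⟩, if_pos rfl]
        congr 2
        omega
      · rw [if_neg hrr, if_neg, h.cat r' hr' k hk]
        rcases lt_or_gt_of_ne hrr with hlt' | hlt'
        · have := Nat.mul_le_mul_right E.L (Nat.succ_le_of_lt hlt')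
          rw [Nat.succ_mul] at this
          omega
        · have := Nat.mul_le_mul_right E.L (Nat.succ_le_of_lt hlt')
          rw [Nat.succ_mul] at this
          omega
    · simp only [Op.apply, Function.update_apply]
      split_ifs
      exacts [h.lt x, h.reg_lt r' hr']
  | device d a o =>
    refine ⟨_, (run_act _ _).mono (by unfold unitTime; omega), ?_⟩
    refine ⟨?_, ?_, h.lt, ?_, ?_, h.reg_lt, ?_, ?_, ?_, ?_, ?_, ?_⟩
    · exact h.work_head
    · exact h.rows
    · exact h.cat_length
    · exact h.cat
    · exact h.address_head
    · exact h.address_le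
    · exact h.le_address
    · simp [Machine.exec, Op.apply, h.input]
    · simp [Machine.exec, Op.apply, h.output]
    · cases a <;> simp [Machine.exec, Op.apply, h.oracle]

theorem Rep.cond {σ : St V} {m : Mem} (h : Rep E σ m) (hL : 0 < E.L) (c : Cond V) :
    ∃ m', c.frag.Run E.D m (c.eval σ) m' (unitTime V E.L - 2) ∧ Rep E σ.tick m' := by
  have mono : E.L * (18 * Fintype.card V + 16) + 13 ≤ unitTime V E.L - 2 := by
    unfold unitTime
    have : E.L * (18 * Fintype.card V + 16) ≤ E.L * (20 * Fintype.card V + 25) :=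
      Nat.mul_le_mul_left _ (by omega)
    omega
  cases c with
  | lt x y =>
    obtain ⟨m', hr, hm'⟩ := h.sweep (x := x) (y := y)
      (f := fun s a b => (if a == b then s else b, a)) (h.lt x)
      (fun i => decide (σ.v x % 2 ^ i < σ.v y % 2 ^ i)) (fun i _ => by
        have hp : 0 < 2 ^ i := by positivity
        have hx := Nat.mod_lt (σ.v x) hp
        have hy := Nat.mod_lt (σ.v y) hp
        rw [Nat.mod_pow_succ, Nat.mod_pow_succ]
        simp only [Nat.testBit_eq_decide_div_mod_eq]
        rcases Nat.mod_two_eq_zero_or_one (σ.v x / 2 ^ i) with h1 | h1 <;>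
        rcases Nat.mod_two_eq_zero_or_one (σ.v y / 2 ^ i) with h2 | h2 <;>
        simp [h1, h2] <;> omega)
    refine ⟨m', ?_, hm'.of_set_self⟩
    simp only [Nat.mod_eq_of_lt (h.lt _), pow_zero, Nat.mod_one, lt_irrefl, decide_false] at hr
    exact hr.mono (by omega)
  | pos x =>
    obtain ⟨m', hr, hm'⟩ := h.sweep (x := x) (y := x)
      (f := fun s a _ => (s || a, a)) (h.lt x)
      (fun i => decide (0 < σ.v x % 2 ^ i)) (fun i _ => by
        have hp : 0 < 2 ^ i := by positivity
        rw [Nat.mod_pow_succ]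
        simp only [Nat.testBit_eq_decide_div_mod_eq]
        rcases Nat.mod_two_eq_zero_or_one (σ.v x / 2 ^ i) with h1 | h1 <;>
        simp [h1])
    refine ⟨m', ?_, hm'.of_set_self⟩
    simp only [Nat.mod_eq_of_lt (h.lt _), pow_zero, Nat.mod_one, lt_irrefl, decide_false] at hr
    exact hr.mono (by omega)
  | odd x =>
    obtain ⟨m', hr, hm'⟩ := h.sweep (x := x) (y := x)
      (f := fun (s : Option Bool) a _ => (some (s.getD a), a)) (h.lt x)
      (fun i => if i = 0 then none else some ((σ.v x).testBit 0)) (fun i _ => by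
        by_cases hi : i = 0 <;> simp [hi])
    refine ⟨m', ?_, hm'.of_set_self⟩
    simp only [if_true, if_neg hL.ne'] at hr
    have := Run.bind (G := fun s => ret (s == some true)) hr (run_ret _ _)
    have e : (some ((σ.v x).testBit 0) == some true) = (Cond.odd x).eval σ := by
      simp [Cond.eval]
    rw [e] at this
    exact this.mono mono
  | input f =>
    refine ⟨m, ?_, h.tick⟩
    have := run_peek (D := E.D) (fun s => f s.input) m
    simp only [Config.scan, h.input] at this
    exact this.mono (by omega)
  | oracle f =>
    refine ⟨m, ?_, h.tick⟩
    have := run_peek (D := E.D) (fun s => f s.oracle) m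
    simp only [Config.scan, h.oracle] at this
    exact this.mono (by omega)

/-- The fragment of a program does what the program does, with `unitTime` steps for each unit of
time. -/
theorem Big.run (hL : 0 < E.L) {p : Prog V} {σ σ' : St V} (hp : Big E p σ σ') :
    ∀ {m : Mem}, Rep E σ m → ∃ m' t, p.frag.Run E.D m () m' t ∧ Rep E σ' m' ∧
      t + 1 + unitTime V E.L * σ.time ≤ unitTime V E.L * σ'.time := by
  have hU : 40 ≤ unitTime V E.L := by unfold unitTime; omega
  induction hp with
  | @op o σ ho =>
    intro m h
    obtain ⟨m', hr, hm'⟩ := h.op ho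
    refine ⟨m', _, hr, hm', ?_⟩
    have : (o.apply E σ).time = σ.time + 1 := by cases o <;> rfl
    rw [this, Nat.mul_succ]
    omega
  | seq _ _ ih₁ ih₂ =>
    intro m h
    obtain ⟨m₁, t₁, hr₁, hm₁, ht₁⟩ := ih₁ h
    obtain ⟨m₂, t₂, hr₂, hm₂, ht₂⟩ := ih₂ hm₁
    exact ⟨m₂, _, Run.seq hr₁ hr₂, hm₂, by omega⟩
  | @ite_true c p q σ σ' hc _ ih =>
    intro m h
    obtain ⟨m₁, hr₁, hm₁⟩ := h.cond hL c
    obtain ⟨m₂, t₂, hr₂, hm₂, ht₂⟩ := ih hm₁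
    rw [hc] at hr₁
    refine ⟨m₂, _, Run.bind (G := fun b => if b = true then p.frag else q.frag) hr₁
      (by rw [if_pos rfl]; exact hr₂), hm₂, ?_⟩
    rw [St.tick_time, Nat.mul_succ] at ht₂
    omega
  | @ite_false c p q σ σ' hc _ ih =>
    intro m h
    obtain ⟨m₁, hr₁, hm₁⟩ := h.cond hL c
    obtain ⟨m₂, t₂, hr₂, hm₂, ht₂⟩ := ih hm₁
    rw [hc] at hr₁
    refine ⟨m₂, _, Run.bind (G := fun b => if b = true then p.frag else q.frag) hr₁
      (by rw [if_neg (by simp)]; exact hr₂), hm₂, ?_⟩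
    rw [St.tick_time, Nat.mul_succ] at ht₂
    omega
  | @loop_true c p σ σ₁ σ' hc _ _ ih₁ ih₂ =>
    intro m h
    obtain ⟨m₁, hr₁, hm₁⟩ := h.cond hL c
    obtain ⟨m₂, t₂, hr₂, hm₂, ht₂⟩ := ih₁ hm₁
    obtain ⟨m₃, t₃, hr₃, hm₃, ht₃⟩ := ih₂ hm₂
    rw [hc] at hr₁
    refine ⟨m₃, _, Run.loop_inl (Run.bind (G := fun b => if b = true then
      Frag.seq p.frag (ret (.inl ())) else ret (.inr ())) (b := (.inl () : Unit ⊕ Unit)) hr₁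
      (by rw [if_pos rfl]; exact Run.seq hr₂ (run_ret _ _))) hr₃, hm₃, ?_⟩
    rw [St.tick_time, Nat.mul_succ] at ht₂
    omega
  | @loop_false c p σ hc =>
    intro m h
    obtain ⟨m₁, hr₁, hm₁⟩ := h.cond hL c
    rw [hc] at hr₁
    refine ⟨m₁, _, Run.loop_inr (Run.bind (G := fun b => if b = true then
      Frag.seq p.frag (ret (.inl ())) else ret (.inr ())) (b := (.inr () : Unit ⊕ Unit)) hr₁
      (by rw [if_neg (by simp)]; exact run_ret _ _)), hm₁, ?_⟩
    rw [St.tick_time, Nat.mul_succ]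
    omega

end Compile
end CatalyticGrid

namespace CatalyticGrid

/-! ### Total correctness -/

section Wp

variable {V : Type} {E : Env}

@[simp] theorem eval_lt {σ : St V} {x y : V} :
    (Cond.lt x y).eval σ = true ↔ σ.v x < σ.v y := by simp [Cond.eval]
@[simp] theorem eval_pos {σ : St V} {x : V} :
    (Cond.pos x).eval σ = true ↔ 0 < σ.v x := by simp [Cond.eval]
@[simp] theorem eval_odd {σ : St V} {x : V} :
    (Cond.odd x).eval σ = true ↔ σ.v x % 2 = 1 := by simp [Cond.eval]

/-- Only the variables in `S` have changed. -/
def Frame (S : List V) (σ σ' : St V) : Prop := ∀ x, x ∉ S → σ'.v x = σ.v x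

/-- Nothing but the variables in `S` and the time has changed. -/
structure Pure (S : List V) (σ σ' : St V) : Prop where
  frame : Frame S σ σ'
  reg : σ'.reg = σ.reg
  input : σ'.input = σ.input
  oracle : σ'.oracle = σ.oracle
  output : σ'.output = σ.output

theorem Pure.trans {S : List V} {σ σ₁ σ₂ : St V} (h : Pure S σ σ₁) (h' : Pure S σ₁ σ₂) :
    Pure S σ σ₂ :=
  ⟨fun x hx => (h'.1 x hx).trans (h.1 x hx), h'.2.trans h.2, h'.3.trans h.3, h'.4.trans h.4,
    h'.5.trans h.5⟩

theorem Pure.mono {S S' : List V} {σ σ' : St V} (h : Pure S σ σ') (hS : S ⊆ S') :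
    Pure S' σ σ' :=
  ⟨fun x hx => h.1 x fun hx' => hx (hS hx'), h.2, h.3, h.4, h.5⟩

theorem Pure.tick {S : List V} {σ σ' : St V} (h : Pure S σ σ') : Pure S σ σ'.tick :=
  ⟨h.1, h.2, h.3, h.4, h.5⟩

theorem Pure.refl (S : List V) (σ : St V) : Pure S σ σ := ⟨fun _ _ => rfl, rfl, rfl, rfl, rfl⟩

variable [DecidableEq V]

/-- The program terminates in a state with the property `Q`. -/
def wp (E : Env) (p : Prog V) (Q : St V → Prop) (σ : St V) : Prop := ∃ σ', Big E p σ σ' ∧ Q σ'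

theorem wp_mono {p : Prog V} {Q Q' : St V → Prop} {σ : St V} (h : wp E p Q σ)
    (hQ : ∀ σ', Q σ' → Q' σ') : wp E p Q' σ := by
  obtain ⟨σ', h1, h2⟩ := h
  exact ⟨σ', h1, hQ σ' h2⟩

infixr:60 " ;; " => Prog.seq

@[simp] theorem wp_seq {p q : Prog V} {Q : St V → Prop} {σ : St V} :
    wp E (p ;; q) Q σ ↔ wp E p (wp E q Q) σ := by
  constructor
  · rintro ⟨σ', h, hQ⟩
    cases h with
    | seq h1 h2 => exact ⟨_, h1, _, h2, hQ⟩
  · rintro ⟨σ₁, h1, σ₂, h2, hQ⟩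
    exact ⟨_, .seq h1 h2, hQ⟩

theorem wp_op {o : Op V} {Q : St V → Prop} {σ : St V} :
    wp E (.op o) Q σ ↔ o.Ok E σ ∧ Q (o.apply E σ) := by
  constructor
  · rintro ⟨σ', h, hQ⟩
    cases h with
    | op h => exact ⟨h, hQ⟩
  · rintro ⟨h, hQ⟩
    exact ⟨_, .op h, hQ⟩

@[simp] theorem wp_zero {x : V} {Q : St V → Prop} {σ : St V} :
    wp E (.op (.zero x)) Q σ ↔ Q (σ.set x 0) := by simp [wp_op, Op.Ok, Op.apply]

@[simp] theorem wp_copy {x y : V} {Q : St V → Prop} {σ : St V} :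
    wp E (.op (.copy x y)) Q σ ↔ Q (σ.set x (σ.v y)) := by simp [wp_op, Op.Ok, Op.apply]

@[simp] theorem wp_inc {x : V} {Q : St V → Prop} {σ : St V} :
    wp E (.op (.inc x)) Q σ ↔ Q (σ.set x ((σ.v x + 1) % 2 ^ E.L)) := by
  simp [wp_op, Op.Ok, Op.apply]

@[simp] theorem wp_dec {x : V} {Q : St V → Prop} {σ : St V} :
    wp E (.op (.dec x)) Q σ ↔ Q (σ.set x ((σ.v x + (2 ^ E.L - 1)) % 2 ^ E.L)) := by
  simp [wp_op, Op.Ok, Op.apply]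

@[simp] theorem wp_add {x y : V} {Q : St V → Prop} {σ : St V} :
    wp E (.op (.add x y)) Q σ ↔ Q (σ.set x ((σ.v x + σ.v y) % 2 ^ E.L)) := by
  simp [wp_op, Op.Ok, Op.apply]

@[simp] theorem wp_sub {x y : V} {Q : St V → Prop} {σ : St V} :
    wp E (.op (.sub x y)) Q σ ↔ Q (σ.set x ((σ.v x + (2 ^ E.L - σ.v y)) % 2 ^ E.L)) := by
  simp [wp_op, Op.Ok, Op.apply]

@[simp] theorem wp_half {x : V} {Q : St V → Prop} {σ : St V} :
    wp E (.op (.half x)) Q σ ↔ Q (σ.set x (σ.v x / 2)) := by simp [wp_op, Op.Ok, Op.apply]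

theorem wp_load {x y : V} {Q : St V → Prop} {σ : St V} {r : ℕ} (hL : 0 < E.L) (hr : r < E.R)
    (hy : σ.v y = r * E.L) (hQ : Q (σ.set x (σ.reg r))) : wp E (.op (.load x y)) Q σ := by
  refine wp_op.2 ⟨⟨r, hr, hy⟩, ?_⟩
  simpa only [Op.apply, hy, Nat.mul_div_cancel _ hL] using hQ

/-- Assign a value to a register. -/
def St.setReg (σ : St V) (r a : ℕ) : St V :=
  { σ.tick with reg := Function.update σ.reg r a }

theorem wp_store {x y : V} {Q : St V → Prop} {σ : St V} {r : ℕ} (hL : 0 < E.L) (hr : r < E.R)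
    (hy : σ.v y = r * E.L) (hQ : Q (σ.setReg r (σ.v x))) : wp E (.op (.store x y)) Q σ := by
  refine wp_op.2 ⟨⟨r, hr, hy⟩, ?_⟩
  simp only [Op.apply, hy, Nat.mul_div_cancel _ hL]
  exact hQ

@[simp] theorem wp_ite {c : Cond V} {p q : Prog V} {Q : St V → Prop} {σ : St V} :
    wp E (.ite c p q) Q σ ↔ if c.eval σ = true then wp E p Q σ.tick else wp E q Q σ.tick := by
  constructor
  · rintro ⟨σ', h, hQ⟩
    cases h with
    | ite_true h1 h2 => rw [if_pos h1]; exact ⟨_, h2, hQ⟩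
    | ite_false h1 h2 => rw [if_neg (by simp [h1])]; exact ⟨_, h2, hQ⟩
  · intro h
    split_ifs at h with hc
    · obtain ⟨σ', h, hQ⟩ := h
      exact ⟨_, .ite_true hc h, hQ⟩
    · obtain ⟨σ', h, hQ⟩ := h
      exact ⟨_, .ite_false (by simpa using hc) h, hQ⟩

theorem wp_loop {c : Cond V} {p : Prog V} {Q : St V → Prop} {σ : St V} :
    wp E (.loop c p) Q σ ↔
      if c.eval σ = true then wp E p (wp E (.loop c p) Q) σ.tick else Q σ.tick := by
  constructor
  · rintro ⟨σ', h, hQ⟩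
    cases h with
    | loop_true h1 h2 h3 => rw [if_pos h1]; exact ⟨_, h2, _, h3, hQ⟩
    | loop_false h1 => rw [if_neg (by simp [h1])]; exact hQ
  · intro h
    split_ifs at h with hc
    · obtain ⟨σ₁, h1, σ', h2, hQ⟩ := h
      exact ⟨_, .loop_true hc h1 h2, hQ⟩
    · exact ⟨_, .loop_false (by simpa using hc), h⟩

/-- Invariant rule: `I k` holds when `k` more rounds are to come. -/
theorem wp_loop_of {c : Cond V} {p : Prog V} {Q : St V → Prop} (I : ℕ → St V → Prop)
    (hs : ∀ k σ, I (k + 1) σ → c.eval σ = true ∧ wp E p (I k) σ.tick)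
    (h0 : ∀ σ, I 0 σ → c.eval σ = false ∧ Q σ.tick) (k : ℕ) {σ : St V} (h : I k σ) :
    wp E (.loop c p) Q σ := by
  induction k generalizing σ with
  | zero =>
    rw [wp_loop, if_neg (by simp [(h0 σ h).1])]
    exact (h0 σ h).2
  | succ k ih =>
    rw [wp_loop, if_pos (hs k σ h).1]
    exact wp_mono (hs k σ h).2 fun σ' h' => ih h'

theorem Pure.set {S : List V} {σ σ' : St V} (h : Pure S σ σ') {x : V} (hx : x ∈ S) (a : ℕ) :
    Pure S σ (σ'.set x a) :=
  ⟨fun y hy => by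
    rw [St.set_v, if_neg (by rintro rfl; exact hy hx)]
    exact h.1 y hy, h.2, h.3, h.4, h.5⟩

end Wp

/-! ### Variables and arithmetic -/

/-- The variables of the program. -/
inductive Var
  | n | p | u1 | u2 | v1 | v2
  | lv | md | hb | b | g | h | w | m | a | a1 | ell | step | rr | sh | n1 | us | vs
  | ac | ma | mx | mm | mq
  | ctr | c | d | pw | cnt | tp | kq | lo | hi | cen | sd | slo | shi | td | tlo | thi | lay | sg
  | y | yy | wt | sv | tv | ptr | pt | acc | px | pp | bad | ri
  deriving DecidableEq

noncomputable instance : Fintype Var :=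
  have : Finite Var := Finite.of_injective (β := Fin 64)
    (fun x => ⟨x.ctorIdx, by cases x <;> decide⟩) fun u z h => by
      have h' : u.ctorIdx = z.ctorIdx := congrArg Fin.val h
      rw [← Var.ofNat_ctorIdx u, h', Var.ofNat_ctorIdx]
  Fintype.ofFinite Var

namespace Code

open Op Cond Prog Var

/-- Do nothing. -/
def skip : Prog Var := op (copy mq mq)

/-- Add `z` to `x` modulo `mm`. -/
def addMod (x z : Var) : Prog Var :=
  op (copy mq mm) ;; op (sub mq z) ;; ite (lt x mq) (op (add x z)) (op (sub x mq))

/-- Add the product of `ma` and `mx` to `ac` modulo `mm`. -/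
def mul : Prog Var :=
  loop (pos ma) (ite (odd ma) (addMod ac mx) skip ;; op (half ma) ;; addMod mx mx)

variable {E : Env}

theorem sub_wrap {x y N : ℕ} (h : y ≤ x) (hx : x < N) : (x + (N - y)) % N = x - y := by
  rw [show x + (N - y) = x - y + N by omega, Nat.add_mod_right, Nat.mod_eq_of_lt (by omega)]

theorem wp_addMod {x z : Var} {Q : St Var → Prop} {σ : St Var} (hx : x ≠ mq)
    (hz : z ≠ mq) (hm : σ.v mm < 2 ^ E.L) (h1 : σ.v x < σ.v mm) (h2 : σ.v z < σ.v mm)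
    (hQ : ∀ σ', Pure [x, mq] σ σ' → σ'.time = σ.time + 4 →
      σ'.v x = (σ.v x + σ.v z) % σ.v mm → Q σ') : wp E (addMod x z) Q σ := by
  have e : (σ.v mm + (2 ^ E.L - σ.v z)) % 2 ^ E.L = σ.v mm - σ.v z := sub_wrap h2.le hm
  simp only [addMod, wp_seq, wp_copy, wp_sub, wp_ite, wp_add, eval_lt, St.set_v, if_true, if_neg hz,
    if_neg hx, e, St.tick_v]
  split_ifs with h
  · refine hQ _ ?_ (by simp) ?_
    · exact ((((Pure.refl _ σ).set (by simp) _).set (by simp) _).tick).set (by simp) _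
    · simp only [St.set_v, if_true]
      rw [Nat.mod_eq_of_lt (by omega), Nat.mod_eq_of_lt (by omega)]
  · refine hQ _ ?_ (by simp) ?_
    · exact ((((Pure.refl _ σ).set (by simp) _).set (by simp) _).tick).set (by simp) _
    · simp only [St.set_v, if_true]
      rw [sub_wrap (by omega) (by omega), Nat.mod_eq_sub_mod (by omega),
        Nat.mod_eq_of_lt (by omega)]
      omega

theorem wp_mul {Q : St Var → Prop} {σ : St Var} (hm : σ.v mm < 2 ^ E.L) (ha : σ.v ma < 2 ^ E.L)
    (h1 : σ.v ac < σ.v mm) (h2 : σ.v mx < σ.v mm)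
    (hQ : ∀ σ', Pure [ac, ma, mx, mq] σ σ' → σ'.time ≤ σ.time + (11 * E.L + 1) →
      σ'.v ac = (σ.v ac + σ.v ma * σ.v mx) % σ.v mm → Q σ') : wp E mul Q σ := by
  have key : ∀ k (σ : St Var), σ.v ma < 2 ^ k → σ.v mm < 2 ^ E.L → σ.v ac < σ.v mm →
      σ.v mx < σ.v mm → wp E mul (fun σ' => Pure [ac, ma, mx, mq] σ σ' ∧
        σ'.time ≤ σ.time + (11 * k + 1) ∧
        σ'.v ac = (σ.v ac + σ.v ma * σ.v mx) % σ.v mm) σ := by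
    intro k
    induction k with
    | zero =>
      intro σ ha hm h1 h2
      have e : σ.v ma = 0 := by simpa using ha
      rw [mul, wp_loop, if_neg (by simp [e])]
      refine ⟨(Pure.refl _ σ).tick, by simp, ?_⟩
      simp [e, Nat.mod_eq_of_lt h1]
    | succ k ih =>
      intro σ ha hm h1 h2
      rw [mul, wp_loop]
      by_cases hpos : 0 < σ.v ma
      swap
      · have e : σ.v ma = 0 := by omega
        rw [if_neg (by simp [e])]
        refine ⟨(Pure.refl _ σ).tick, by simp, ?_⟩
        simp [e, Nat.mod_eq_of_lt h1]
      rw [if_pos (by simpa using hpos)]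
      have rest : ∀ σ₁ : St Var, Pure [ac, ma, mx, mq] σ σ₁ → σ₁.time ≤ σ.time + 6 →
          σ₁.v ma = σ.v ma → σ₁.v mx = σ.v mx →
          σ₁.v ac = (σ.v ac + σ.v ma % 2 * σ.v mx) % σ.v mm →
          wp E (op (half ma) ;; addMod mx mx) (wp E mul (fun σ' => Pure [ac, ma, mx, mq] σ σ' ∧
            σ'.time ≤ σ.time + (11 * (k + 1) + 1) ∧
            σ'.v ac = (σ.v ac + σ.v ma * σ.v mx) % σ.v mm)) σ₁ := by
        intro σ₁ hp ht hma hmx hac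
        have hmm : σ₁.v mm = σ.v mm := hp.1 _ (by simp)
        have hm0 : 0 < σ.v mm := by omega
        rw [wp_seq, wp_half]
        refine wp_addMod (by decide) (by decide) (by simpa [hmm] using hm)
          (by simpa [hmm, hmx] using h2) (by simpa [hmm, hmx] using h2) fun σ₂ hp₂ ht₂ hmx₂ => ?_
        have hma₂ : σ₂.v ma = σ.v ma / 2 := by rw [hp₂.1 _ (by simp)]; simp [hma]
        have hac₂ : σ₂.v ac = σ₁.v ac := by rw [hp₂.1 _ (by simp)]; simp
        have hmm₂ : σ₂.v mm = σ.v mm := by rw [hp₂.1 _ (by simp)]; simp [hmm]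
        simp only [St.set_v, reduceCtorEq, if_false, hmm, hmx] at hmx₂
        refine wp_mono (ih σ₂ (by rw [hma₂]; rw [pow_succ] at ha; omega) (by omega)
          (by rw [hac₂, hac, hmm₂]; exact Nat.mod_lt _ hm0)
          (by rw [hmx₂, hmm₂]; exact Nat.mod_lt _ hm0)) ?_
        rintro σ' ⟨hp', ht', hac'⟩
        refine ⟨((hp.set (by simp) _).trans (hp₂.mono (by simp))).trans hp', ?_, ?_⟩
        · simp only [St.set_time] at ht₂
          omega
        · rw [hac', hac₂, hac, hma₂, hmx₂, hmm₂, Nat.mod_add_mod, Nat.add_mod, Nat.mul_mod_mod,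
            ← Nat.add_mod]
          congr 1
          have := Nat.div_add_mod (σ.v ma) 2
          nlinarith
      rw [wp_seq, wp_ite]
      simp only [eval_odd, St.tick_v]
      split_ifs with hodd
      · refine wp_addMod (by decide) (by decide) hm h1 h2 fun σ₁ hp ht hac => ?_
        refine rest σ₁ (((Pure.refl _ σ).tick.tick).trans (hp.mono (by simp))) ?_
          (hp.1 _ (by simp)) (hp.1 _ (by simp)) ?_
        · simp at ht; omega
        · simpa [hodd] using hac
      · rw [skip, wp_copy]
        refine rest _ (((Pure.refl _ σ).tick.tick).set (by simp) _) (by simp) (by simp) (by simp) ?_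
        simp [show σ.v ma % 2 = 0 by omega, Nat.mod_eq_of_lt h1]
  exact wp_mono (key E.L σ ha hm h1 h2) fun σ' h => hQ σ' h.1 h.2.1 h.2.2

end Code
end CatalyticGrid

namespace CatalyticGrid

open Matrix

/-! ### Products of layer matrices by catalytic divide and conquer -/

section Recursion

variable {R : Type*} [CommRing R] {n : ℕ}

/-- The product of the matrices `M l, …, M (l + t - 1)`. -/
def prodFrom {ι : Type*} {R : Type*} [Semiring R] [Fintype ι] [DecidableEq ι]
    (M : ℕ → Matrix ι ι R) (l : ℕ) : ℕ → Matrix ι ι R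
  | 0 => 1
  | t + 1 => prodFrom M l t * M (l + t)

theorem prodFrom_add {ι : Type*} {R : Type*} [Semiring R] [Fintype ι] [DecidableEq ι]
    (M : ℕ → Matrix ι ι R) (l s t : ℕ) :
    prodFrom M l (s + t) = prodFrom M l s * prodFrom M (l + s) t := by
  induction t with
  | zero => simp [prodFrom]
  | succ t ih => rw [← add_assoc, prodFrom, ih, prodFrom, Matrix.mul_assoc, add_assoc]

/-- The projection to the indices `j` with `lo ≤ j + w < hi`. -/
def mask (n : ℕ) (R : Type*) [CommRing R] (w lo hi : ℕ) : Matrix (Fin (n + 1)) (Fin (n + 1)) R :=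
  diagonal fun j => if lo ≤ j + w ∧ j + w < hi then 1 else 0

/-- The vector of the values that an array of length `m` holds for the indices. -/
def gather (n w m : ℕ) (y : ℕ → R) : Fin (n + 1) → R := fun j => y ((j + w) % m)

/-- The array of length `m` that collects the entries of a vector. -/
def scatter (w m : ℕ) (t : Fin (n + 1) → R) : ℕ → R :=
  fun i => ∑ j : Fin (n + 1), if ((j : ℕ) + w) % m = i then t j else 0

/-- The sign of an operation. -/
def sgn (R : Type*) [CommRing R] (b : Bool) : R := if b then -1 else 1

/-- A task: add, up to the sign, the image of the part `[slo, shi)` of the array `sd` to the part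
`[tlo, thi)` of the array `td`, starting at layer `lay`. -/
structure Task where
  sd : ℕ
  slo : ℕ
  shi : ℕ
  td : ℕ
  tlo : ℕ
  thi : ℕ
  cen : ℕ
  lay : ℕ
  sg : Bool

/-- Perform a task with the matrix `N`. -/
def push (w m : ℕ) (N : Matrix (Fin (n + 1)) (Fin (n + 1)) R) (κ : Task) (Y : ℕ → ℕ → R) :
    ℕ → ℕ → R :=
  Function.update Y κ.td (Y κ.td + sgn R κ.sg • scatter w m (gather n w m (Y κ.sd) ᵥ*
    (mask n R w κ.slo κ.shi * N * mask n R w κ.tlo κ.thi)))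

theorem gather_add (w m : ℕ) (y z : ℕ → R) :
    gather n w m (y + z) = gather n w m y + gather n w m z := rfl

theorem scatter_add (w m : ℕ) (y z : Fin (n + 1) → R) :
    scatter w m (y + z) = scatter w m y + scatter w m z := by
  funext i
  simp only [scatter, Pi.add_apply, ← Finset.sum_add_distrib]
  refine Finset.sum_congr rfl fun j _ => ?_
  split_ifs <;> simp

theorem scatter_zero (w m : ℕ) : scatter w m (0 : Fin (n + 1) → R) = 0 := by
  funext i
  simp [scatter]

theorem mask_mul_of_le {w lo hi lo' hi' : ℕ} (h : lo' ≤ lo) (h' : hi ≤ hi') :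
    mask n R w lo hi * mask n R w lo' hi' = mask n R w lo hi := by
  rw [mask, mask, diagonal_mul_diagonal]
  congr 1
  funext j
  split_ifs <;> first | (simp; done) | (exfalso; omega)

theorem gather_scatter {w m lo hi : ℕ} (h : hi ≤ lo + m) (t : Fin (n + 1) → R)
    (B : Matrix (Fin (n + 1)) (Fin (n + 1)) R) :
    gather n w m (scatter w m (t ᵥ* mask n R w lo hi)) ᵥ* (mask n R w lo hi * B) =
      t ᵥ* (mask n R w lo hi * B) := by
  rw [← vecMul_vecMul, ← vecMul_vecMul]
  congr 1
  have e : ∀ (t : Fin (n + 1) → R) k, (t ᵥ* mask n R w lo hi) k =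
      if lo ≤ (k : ℕ) + w ∧ (k : ℕ) + w < hi then t k else 0 :=
    fun t k => by simp [mask, vecMul_diagonal]
  funext j
  simp only [e, gather, scatter]
  split_ifs with hj
  · rw [Finset.sum_eq_single j]
    · simp [hj]
    · intro k _ hkj
      split_ifs with h1 h2
      · exfalso
        apply hkj
        have h3 : (k : ℕ) + w ≡ j + w [MOD m] := h1
        ext
        rcases le_total (k : ℕ) j with hle | hle
        · have := (Nat.modEq_iff_dvd' (show (k : ℕ) + w ≤ j + w by omega)).1 h3
          have := Nat.eq_zero_of_dvd_of_lt this (by omega)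
          omega
        · have := (Nat.modEq_iff_dvd' (show (j : ℕ) + w ≤ k + w by omega)).1 h3.symm
          have := Nat.eq_zero_of_dvd_of_lt this (by omega)
          omega
      · rfl
      · rfl
    · simp
  · rfl

theorem push_push {w m : ℕ} {N N' : Matrix (Fin (n + 1)) (Fin (n + 1)) R} {κ : Task}
    (h : κ.sd ≠ κ.td) (Y : ℕ → ℕ → R) :
    push w m N' κ (push w m N κ Y) = push w m (N + N') κ Y := by
  simp only [push, Function.update_self, Function.update_of_ne h, Function.update_idem]
  rw [Matrix.mul_add, Matrix.add_mul, Matrix.vecMul_add, scatter_add, smul_add, add_assoc]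

theorem push_zero {w m : ℕ} {κ : Task} (Y : ℕ → ℕ → R) :
    push w m (0 : Matrix (Fin (n + 1)) (Fin (n + 1)) R) κ Y = Y := by
  simp [push, scatter_zero]

theorem sgn_not (b : Bool) : sgn R (!b) = - sgn R b := by cases b <;> simp [sgn]

/-- Compute, use, uncompute, unuse. -/
theorem push_four {w m d lo hi c₁ c₂ c₃ c₄ l₁ l₂ : ℕ}
    {N₁ N₂ : Matrix (Fin (n + 1)) (Fin (n + 1)) R} {κ : Task} (h : κ.sd ≠ κ.td) (hs : d ≠ κ.sd)
    (ht : d ≠ κ.td) (hm : hi ≤ lo + m) (Y : ℕ → ℕ → R) :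
    push w m N₂ ⟨d, lo, hi, κ.td, κ.tlo, κ.thi, c₄, l₂, !κ.sg⟩
      (push w m N₁ ⟨κ.sd, κ.slo, κ.shi, d, lo, hi, c₃, l₁, true⟩
        (push w m N₂ ⟨d, lo, hi, κ.td, κ.tlo, κ.thi, c₂, l₂, κ.sg⟩
          (push w m N₁ ⟨κ.sd, κ.slo, κ.shi, d, lo, hi, c₁, l₁, false⟩ Y))) =
      push w m (N₁ * mask n R w lo hi * N₂) κ Y := by
  simp only [push, Function.update_self, Function.update_of_ne h, Function.update_of_ne ht,
    Function.update_of_ne ht.symm, Function.update_of_ne hs.symm]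
  have e : ∀ s : R, s = 1 → Y d + s • scatter w m (gather n w m (Y κ.sd) ᵥ*
      (mask n R w κ.slo κ.shi * N₁ * mask n R w lo hi)) =
      Y d + scatter w m (gather n w m (Y κ.sd) ᵥ*
      (mask n R w κ.slo κ.shi * N₁ * mask n R w lo hi)) := by
    rintro s rfl
    rw [one_smul]
  rw [e _ (by simp [sgn])]
  set z := scatter w m (gather n w m (Y κ.sd) ᵥ*
      (mask n R w κ.slo κ.shi * N₁ * mask n R w lo hi)) with hz
  have e2 : Y d + z + sgn R true • z = Y d := by simp [sgn]
  rw [e2]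
  have e3 : gather n w m z ᵥ* (mask n R w lo hi * N₂ * mask n R w κ.tlo κ.thi) =
      gather n w m (Y κ.sd) ᵥ* (mask n R w κ.slo κ.shi * (N₁ * mask n R w lo hi * N₂) *
        mask n R w κ.tlo κ.thi) := by
    rw [hz, ← vecMul_vecMul (gather n w m (Y κ.sd)), Matrix.mul_assoc (mask n R w lo hi),
      gather_scatter hm, vecMul_vecMul]
    simp only [Matrix.mul_assoc]
  rw [gather_add, Matrix.add_vecMul, scatter_add, smul_add, e3, sgn_not]
  funext e
  by_cases h1 : e = κ.td
  · subst h1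
    simp only [Function.update_self]
    module
  · by_cases h2 : e = d
    · subst h2
      simp [Function.update_of_ne ht]
    · simp [Function.update_of_ne h1, Function.update_of_ne h2]

/-- The number of bits of a digit at level `d`. -/
def digitBits (h g d : ℕ) : ℕ := 2 + if h < d then g else 0

/-- The number of bits of all digits up to level `d`. -/
def counterBits (h g : ℕ) : ℕ → ℕ
  | 0 => 0
  | d + 1 => counterBits h g d + digitBits h g (d + 1)

/-- The subtask of a task that the digit `T` at level `d` selects. -/
def Task.child (h d T : ℕ) (κ : Task) : Task :=
  let lo := if h < d then T / 4 * 2 ^ h + 2 ^ h else κ.cen - 2 ^ h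
  let hi := if h < d then T / 4 * 2 ^ h + 2 ^ h + 2 ^ h else κ.cen + 2 ^ h + 2 ^ h
  if T % 2 = 1 then
    ⟨d, lo, hi, κ.td, κ.tlo, κ.thi, if h < d then lo else κ.cen, κ.lay + 2 ^ (d - 1),
      κ.sg ^^ decide (T / 2 % 2 = 1)⟩
  else ⟨κ.sd, κ.slo, κ.shi, d, lo, hi, κ.cen, κ.lay, decide (T / 2 % 2 = 1)⟩

/-- The elementary task with number `c` of a task at level `d`. -/
def Task.decode (h g : ℕ) : ℕ → ℕ → Task → Task
  | 0, _, κ => κ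
  | d + 1, c, κ => Task.decode h g d (c % 2 ^ counterBits h g d)
      (κ.child h (d + 1) (c / 2 ^ counterBits h g d))

/-- Perform all elementary tasks of a task at level `d`. -/
def runTask (M : ℕ → Matrix (Fin (n + 1)) (Fin (n + 1)) R) (h g d : ℕ) (κ : Task)
    (Y : ℕ → ℕ → R) : ℕ → ℕ → R :=
  (List.range (2 ^ counterBits h g d)).foldl (fun Y c =>
    push (2 ^ h) (4 * 2 ^ h) (M (Task.decode h g d c κ).lay) (Task.decode h g d c κ) Y) Y

theorem foldl_range_mul {α : Type*} (f : α → ℕ → α) (A B : ℕ) (x : α) :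
    (List.range (A * B)).foldl f x =
      (List.range A).foldl (fun y i => (List.range B).foldl (fun y j => f y (i * B + j)) y) x := by
  induction A with
  | zero => simp
  | succ A ih =>
    rw [Nat.succ_mul, List.range_add, List.foldl_append, ih, List.range_succ, List.foldl_append,
      List.foldl_map]
    rfl

theorem foldl_congr_range {α : Type*} {f g : α → ℕ → α} {A : ℕ} {x : α}
    (h : ∀ y, ∀ i < A, f y i = g y i) :
    (List.range A).foldl f x = (List.range A).foldl g x :=
  List.foldl_ext _ _ _ fun y i hi => h y i (List.mem_range.1 hi)

theorem runTask_succ (M : ℕ → Matrix (Fin (n + 1)) (Fin (n + 1)) R) (h g d : ℕ) (κ : Task)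
    (Y : ℕ → ℕ → R) : runTask M h g (d + 1) κ Y =
      (List.range (2 ^ digitBits h g (d + 1))).foldl
        (fun Y T => runTask M h g d (κ.child h (d + 1) T) Y) Y := by
  have hp : 0 < 2 ^ counterBits h g d := by positivity
  simp only [runTask, counterBits]
  rw [add_comm (counterBits h g d), pow_add, foldl_range_mul]
  refine foldl_congr_range fun y i _ => foldl_congr_range fun y j hj => ?_
  have e1 : (i * 2 ^ counterBits h g d + j) / 2 ^ counterBits h g d = i := by
    rw [mul_comm, Nat.mul_add_div hp, Nat.div_eq_of_lt hj, add_zero]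
  have e2 : (i * 2 ^ counterBits h g d + j) % 2 ^ counterBits h g d = j := by
    rw [mul_comm, Nat.mul_add_mod, Nat.mod_eq_of_lt hj]
  rw [Task.decode, e1, e2]

theorem foldl_digits {α : Type*} (f : α → ℕ → α) (h g d : ℕ) (x : α) :
    (List.range (2 ^ digitBits h g d)).foldl f x =
      (List.range (2 ^ (if h < d then g else 0))).foldl
        (fun y K => f (f (f (f y (K * 4)) (K * 4 + 1)) (K * 4 + 2)) (K * 4 + 3)) x := by
  rw [digitBits, add_comm, pow_add, show 2 ^ 2 = 4 from rfl, foldl_range_mul]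
  rfl

/-- Below level `h`, the paths are confined to a window. -/
theorem runTask_low (M : ℕ → Matrix (Fin (n + 1)) (Fin (n + 1)) R) {h g d : ℕ} (hd : d ≤ h)
    {κ : Task} (hst : κ.sd ≠ κ.td) (hs : κ.sd = 0 ∨ d < κ.sd) (ht : κ.td = 0 ∨ d < κ.td)
    (hlo : κ.cen - 2 ^ h ≤ κ.slo) (hhi : κ.shi ≤ κ.cen + 2 ^ h + 2 ^ h) (Y : ℕ → ℕ → R) :
    runTask M h g d κ Y = push (2 ^ h) (4 * 2 ^ h) (prodFrom (fun l =>
      mask n R (2 ^ h) (κ.cen - 2 ^ h) (κ.cen + 2 ^ h + 2 ^ h) * M l) κ.lay (2 ^ d)) κ Y := by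
  induction d generalizing κ Y with
  | zero =>
    simp only [runTask, counterBits, pow_zero, List.range_one, List.foldl_cons, List.foldl_nil,
      Task.decode, prodFrom, Matrix.one_mul, add_zero, push]
    rw [← Matrix.mul_assoc (mask n R _ κ.slo κ.shi), mask_mul_of_le hlo hhi]
  | succ d ih =>
    have hnd : ¬ h < d + 1 := by omega
    rw [runTask_succ, foldl_digits]
    simp only [hnd, if_false, pow_zero, List.range_one, List.foldl_cons, List.foldl_nil, zero_mul,
      zero_add, Task.child, Nat.zero_mod, Nat.add_sub_cancel]
    norm_num
    have hpos : 0 < 2 ^ h := by positivity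
    rw [ih (by omega) (by first | omega | (dsimp only; omega))
        (by first | omega | (dsimp only; omega)) (by first | omega | (dsimp only; omega))
        (by first | omega | (dsimp only; omega)) (by first | omega | (dsimp only; omega)),
      ih (by omega) (by first | omega | (dsimp only; omega))
        (by first | omega | (dsimp only; omega)) (by first | omega | (dsimp only; omega))
        (by omega) (by omega),
      ih (by omega) (by first | omega | (dsimp only; omega))
        (by first | omega | (dsimp only; omega)) (by first | omega | (dsimp only; omega))
        (by first | omega | (dsimp only; omega)) (by first | omega | (dsimp only; omega)),
      ih (by omega) (by first | omega | (dsimp only; omega))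
        (by first | omega | (dsimp only; omega)) (by first | omega | (dsimp only; omega))
        (by omega) (by omega)]
    rw [push_four hst (by omega) (by omega) (by omega), pow_succ, mul_two, prodFrom_add]
    congr 1
    obtain ⟨t, ht⟩ := Nat.exists_eq_add_of_le' (show 1 ≤ 2 ^ d from Nat.one_le_two_pow)
    have key : ∀ l t, mask n R (2 ^ h) (κ.cen - 2 ^ h) (κ.cen + 2 ^ h + 2 ^ h) *
        prodFrom (fun l => mask n R (2 ^ h) (κ.cen - 2 ^ h) (κ.cen + 2 ^ h + 2 ^ h) * M l) l (t + 1) =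
        prodFrom (fun l => mask n R (2 ^ h) (κ.cen - 2 ^ h) (κ.cen + 2 ^ h + 2 ^ h) * M l) l
          (t + 1) := by
      intro l t
      rw [add_comm t 1, prodFrom_add]
      simp only [prodFrom, Matrix.one_mul]
      rw [← Matrix.mul_assoc, ← Matrix.mul_assoc (mask n R _ _ _), mask_mul_of_le le_rfl le_rfl]
    rw [Matrix.mul_assoc, ht, key]

/-- Within `2 ^ h` layers, a path does not leave the window. -/
theorem prodFrom_window (M : ℕ → Matrix (Fin (n + 1)) (Fin (n + 1)) R)
    (hM : ∀ l i j, M l i j ≠ 0 → (i : ℕ) ≤ j + 1 ∧ (j : ℕ) ≤ i + 1) {w cen lo hi l t : ℕ}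
    (ht : t ≤ w) (hlo : cen ≤ lo) (hhi : hi ≤ cen + w) :
    mask n R w lo hi * prodFrom (fun l => mask n R w (cen - w) (cen + w + w) * M l) l t =
      mask n R w lo hi * prodFrom M l t := by
  have key : ∀ t ≤ w, ∀ j : Fin (n + 1), cen ≤ j + w → j + w < cen + w → ∀ k,
      prodFrom (fun l => mask n R w (cen - w) (cen + w + w) * M l) l t j k = prodFrom M l t j k ∧
      (prodFrom M l t j k ≠ 0 → (j : ℕ) ≤ k + t ∧ (k : ℕ) ≤ j + t) := by
    intro t
    induction t with
    | zero =>
      intro _ j _ _ k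
      refine ⟨rfl, fun h => ?_⟩
      have : j = k := by
        by_contra hjk
        exact h (Matrix.one_apply_ne hjk)
      subst this
      simp
    | succ t ih =>
      intro htw j h1 h2 k
      have ih' := ih (by omega) j h1 h2
      refine ⟨?_, fun h => ?_⟩
      · rw [prodFrom, prodFrom, Matrix.mul_apply, Matrix.mul_apply]
        refine Finset.sum_congr rfl fun i _ => ?_
        rw [(ih' i).1]
        by_cases h0 : prodFrom M l t j i = 0
        · rw [h0, zero_mul, zero_mul]
        · have := (ih' i).2 h0
          rw [mask, Matrix.diagonal_mul, if_pos (by omega), one_mul]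
      · rw [prodFrom, Matrix.mul_apply] at h
        obtain ⟨i, _, hi⟩ := Finset.exists_ne_zero_of_sum_ne_zero h
        have h3 := (ih' i).2 (left_ne_zero_of_mul hi)
        have h4 := hM _ _ _ (right_ne_zero_of_mul hi)
        omega
  ext j k
  rw [mask, Matrix.diagonal_mul, Matrix.diagonal_mul]
  split_ifs with h
  · rw [((key t ht j (by omega) (by omega)) k).1]
  · simp

theorem sum_mask {h g : ℕ} (hn : n < 2 ^ g * 2 ^ h) :
    ∑ K ∈ Finset.range (2 ^ g), mask n R (2 ^ h) (K * 2 ^ h + 2 ^ h) (K * 2 ^ h + 2 ^ h + 2 ^ h) =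
      1 := by
  have hp : 0 < 2 ^ h := by positivity
  ext i j
  rw [Matrix.sum_apply]
  by_cases hij : i = j
  · subst hij
    simp only [mask, Matrix.diagonal_apply_eq, Matrix.one_apply_eq]
    rw [Finset.sum_eq_single ((i : ℕ) / 2 ^ h)]
    · have h1 := Nat.div_add_mod (i : ℕ) (2 ^ h)
      have h2 := Nat.mod_lt (i : ℕ) hp
      rw [mul_comm] at h1
      rw [if_pos (by omega)]
    · intro K _ hK
      rw [if_neg]
      rintro ⟨h1, h2⟩
      apply hK
      symm
      rw [Nat.div_eq_iff hp]
      omega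
    · intro hni
      exact absurd (Finset.mem_range.2 (by
        rw [Nat.div_lt_iff_lt_mul hp]
        have := i.2
        omega)) hni
  · simp [mask, Matrix.diagonal_apply_ne _ hij, Matrix.one_apply_ne hij]

theorem foldl_push {w m : ℕ} {κ : Task} (hst : κ.sd ≠ κ.td)
    (N : ℕ → Matrix (Fin (n + 1)) (Fin (n + 1)) R) (A : ℕ) (Y : ℕ → ℕ → R) :
    (List.range A).foldl (fun Y K => push w m (N K) κ Y) Y =
      push w m (∑ K ∈ Finset.range A, N K) κ Y := by
  induction A with
  | zero => simp [push_zero]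
  | succ A ih =>
    rw [List.range_succ, List.foldl_append, ih, Finset.sum_range_succ, List.foldl_cons,
      List.foldl_nil, push_push hst]

/-- The divide and conquer computes the product of the layer matrices. -/
theorem runTask_eq (M : ℕ → Matrix (Fin (n + 1)) (Fin (n + 1)) R)
    (hM : ∀ l i j, M l i j ≠ 0 → (i : ℕ) ≤ j + 1 ∧ (j : ℕ) ≤ i + 1) {h g d : ℕ}
    (hn : n < 2 ^ g * 2 ^ h) {κ : Task} (hst : κ.sd ≠ κ.td) (hs : κ.sd = 0 ∨ d < κ.sd)
    (ht : κ.td = 0 ∨ d < κ.td) (hlo : κ.slo = κ.cen) (hhi : κ.shi ≤ κ.cen + 2 ^ h)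
    (Y : ℕ → ℕ → R) :
    runTask M h g d κ Y = push (2 ^ h) (4 * 2 ^ h) (prodFrom M κ.lay (2 ^ d)) κ Y := by
  have hpos : 0 < 2 ^ h := by positivity
  induction d generalizing κ Y with
  | zero =>
    simp only [runTask, counterBits, pow_zero, List.range_one, List.foldl_cons, List.foldl_nil,
      Task.decode, prodFrom, Matrix.one_mul, add_zero]
  | succ d ih =>
    by_cases hd : h < d + 1
    swap
    · rw [runTask_low M (by omega) hst hs ht (by omega) (by omega)]
      unfold push
      rw [prodFrom_window M hM (Nat.pow_le_pow_right (by omega) (by omega)) hlo.ge hhi]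
    rw [runTask_succ, foldl_digits]
    simp only [hd, if_true]
    have step : ∀ Y : ℕ → ℕ → R, ∀ K < 2 ^ g,
        runTask M h g d (κ.child h (d + 1) (K * 4 + 3)) (runTask M h g d
          (κ.child h (d + 1) (K * 4 + 2)) (runTask M h g d (κ.child h (d + 1) (K * 4 + 1))
            (runTask M h g d (κ.child h (d + 1) (K * 4)) Y))) =
        push (2 ^ h) (4 * 2 ^ h) (prodFrom M κ.lay (2 ^ d) *
          mask n R (2 ^ h) (K * 2 ^ h + 2 ^ h) (K * 2 ^ h + 2 ^ h + 2 ^ h) *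
            prodFrom M (κ.lay + 2 ^ d) (2 ^ d)) κ Y := by
      intro Y K _
      have a0 : K * 4 % 2 = 0 ∧ K * 4 / 2 % 2 = 0 ∧ K * 4 / 4 = K := by omega
      have a1 : (K * 4 + 1) % 2 = 1 ∧ (K * 4 + 1) / 2 % 2 = 0 ∧ (K * 4 + 1) / 4 = K := by omega
      have a2 : (K * 4 + 2) % 2 = 0 ∧ (K * 4 + 2) / 2 % 2 = 1 ∧ (K * 4 + 2) / 4 = K := by omega
      have a3 : (K * 4 + 3) % 2 = 1 ∧ (K * 4 + 3) / 2 % 2 = 1 ∧ (K * 4 + 3) / 4 = K := by omega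
      simp only [Task.child, hd, if_true, a0, a1, a2, a3, Nat.add_sub_cancel, zero_ne_one, if_false,
        decide_false, decide_true, Bool.xor_false, Bool.xor_true]
      rw [ih (by first | omega | (dsimp only; omega)) (by first | omega | (dsimp only; omega))
        (by first | omega | (dsimp only; omega))
        (by first | omega | dsimp only) (by first | omega | (dsimp only; omega)),
        ih (by first | omega | (dsimp only; omega)) (by first | omega | (dsimp only; omega))
        (by first | omega | (dsimp only; omega))
        (by omega) (by omega),
        ih (by first | omega | (dsimp only; omega)) (by first | omega | (dsimp only; omega))
        (by first | omega | (dsimp only; omega))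
        (by first | omega | dsimp only) (by first | omega | (dsimp only; omega)),
        ih (by first | omega | (dsimp only; omega)) (by first | omega | (dsimp only; omega))
        (by first | omega | (dsimp only; omega))
        (by omega) (by omega)]
      exact push_four hst (by omega) (by omega) (by omega) Y
    rw [foldl_congr_range step, foldl_push hst, ← Finset.sum_mul, ← Finset.mul_sum, sum_mask hn,
      Matrix.mul_one, pow_succ, mul_two, prodFrom_add]

end Recursion
end CatalyticGrid

namespace CatalyticGrid

/-! ### Path weights as matrix products -/

section Paths

variable {n : ℕ}

/-- The weights of the edges from layer `l` to layer `l + 1`. -/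
def layerMatrix (μ : Vertex n → Vertex n → ℕ) (l : ℕ) : Matrix (Fin (n + 1)) (Fin (n + 1)) ℕ :=
  fun i j => if h : l < n ∧ ((j : ℕ) = i ∨ (j : ℕ) = i + 1 ∨ (i : ℕ) = j + 1) then
    μ (⟨l, by omega⟩, i) (⟨l + 1, by omega⟩, j) else 0

theorem layer_le_of_chain {u : Vertex n} {r : List (Vertex n)}
    (h : (u :: r).IsChain (grid n).Adj) : ∀ x ∈ r, (u.1 : ℕ) < x.1 := by
  induction r generalizing u with
  | nil => simp
  | cons b r ih =>
    rw [List.isChain_cons_cons] at h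
    have hb : (b.1 : ℕ) = u.1 + 1 := h.1.1
    intro x hx
    rcases List.mem_cons.1 hx with rfl | hx
    · omega
    · have := ih h.2 x hx
      omega

theorem isPath_iff {u v : Vertex n} {l : List (Vertex n)} (huv : (u.1 : ℕ) < v.1) :
    IsPath (grid n) u v l ↔ ∃ b, (grid n).Adj u b ∧ ∃ l', IsPath (grid n) b v l' ∧ u :: l' = l := by
  constructor
  · rintro ⟨h1, h2, h3, h4⟩
    match l, h1, h2, h3, h4 with
    | [x], _, h2, h3, _ =>
      simp only [List.head?_cons, Option.some.injEq, List.getLast?_singleton] at h2 h3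
      rw [← h2, h3] at huv
      exact absurd huv (lt_irrefl _)
    | x :: b :: r, h1, h2, h3, h4 =>
      simp only [List.head?_cons, Option.some.injEq] at h2
      subst h2
      rw [List.isChain_cons_cons] at h1
      refine ⟨b, h1.1, b :: r, ⟨h1.2, rfl, ?_, (List.nodup_cons.1 h4).2⟩, rfl⟩
      rwa [List.getLast?_cons_cons] at h3
  · rintro ⟨b, hb, l', ⟨h1, h2, h3, h4⟩, rfl⟩
    match l', h1, h2, h3, h4 with
    | x :: r, h1, h2, h3, h4 =>
      simp only [List.head?_cons, Option.some.injEq] at h2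
      subst h2
      have hc : (u :: x :: r).IsChain (grid n).Adj := List.isChain_cons_cons.2 ⟨hb, h1⟩
      refine ⟨hc, rfl, by rwa [List.getLast?_cons_cons], List.nodup_cons.2 ⟨fun hm => ?_, h4⟩⟩
      exact lt_irrefl _ (layer_le_of_chain hc u hm)

open Classical in
/-- The set of paths. -/
noncomputable def paths (u v : Vertex n) : Finset (List (Vertex n)) :=
  (Finset.univ.filter fun P : {l : List (Vertex n) // l.Nodup} => IsPath (grid n) u v P.1).map
    (Function.Embedding.subtype _)

theorem mem_paths {u v : Vertex n} {l : List (Vertex n)} :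
    l ∈ paths u v ↔ IsPath (grid n) u v l := by
  simp only [paths, Finset.mem_map, Finset.mem_filter, Finset.mem_univ, true_and,
    Function.Embedding.subtype_apply, Subtype.exists, exists_and_left, exists_prop]
  exact ⟨fun ⟨_, h, _, e⟩ => e ▸ h, fun h => ⟨l, h, h.2.2.2, rfl⟩⟩

theorem totalPathWeight_eq_sum (μ : Vertex n → Vertex n → ℕ) (u v : Vertex n) :
    totalPathWeight (grid n) μ u v = ∑ l ∈ paths u v, pathWeight μ l := by
  rw [totalPathWeight, paths, Finset.sum_map]
  rfl

theorem pathWeight_cons (μ : Vertex n → Vertex n → ℕ) {u b v : Vertex n} {l : List (Vertex n)}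
    (h : IsPath (grid n) b v l) : pathWeight μ (u :: l) = μ u b * pathWeight μ l := by
  match l, h with
  | x :: r, ⟨_, h2, _, _⟩ =>
    simp only [List.head?_cons, Option.some.injEq] at h2
    subst h2
    simp [pathWeight]

open Classical in
theorem totalPathWeight_succ (μ : Vertex n → Vertex n → ℕ) {u v : Vertex n}
    (huv : (u.1 : ℕ) < v.1) : totalPathWeight (grid n) μ u v =
      ∑ b with (grid n).Adj u b, μ u b * totalPathWeight (grid n) μ b v := by
  have e : paths u v = (Finset.univ.filter ((grid n).Adj u)).biUnion
      fun b => (paths b v).image (u :: ·) := by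
    ext l
    simp only [mem_paths, isPath_iff huv, Finset.mem_biUnion, Finset.mem_filter, Finset.mem_univ,
      true_and, Finset.mem_image]
  rw [totalPathWeight_eq_sum, e, Finset.sum_biUnion]
  · refine Finset.sum_congr rfl fun b _ => ?_
    rw [Finset.sum_image (by simp), totalPathWeight_eq_sum, Finset.mul_sum]
    exact Finset.sum_congr rfl fun l hl => pathWeight_cons μ (mem_paths.1 hl)
  · intro b _ b' _ hbb'
    rw [Function.onFun, Finset.disjoint_left]
    intro l hl hl'
    simp only [Finset.mem_image, mem_paths] at hl hl'
    obtain ⟨r, hr, rfl⟩ := hl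
    obtain ⟨r', hr', e'⟩ := hl'
    rw [List.cons.injEq] at e'
    rw [← e'.2] at hr
    exact hbb' (Option.some.inj (hr.2.1.symm.trans hr'.2.1))

theorem totalPathWeight_same_layer (μ : Vertex n → Vertex n → ℕ) {u v : Vertex n}
    (huv : u.1 = v.1) : totalPathWeight (grid n) μ u v = if u.2 = v.2 then 1 else 0 := by
  have e : ∀ l, IsPath (grid n) u v l ↔ u = v ∧ l = [u] := by
    intro l
    constructor
    · rintro ⟨h1, h2, h3, h4⟩
      match l, h1, h2, h3, h4 with
      | [x], _, h2, h3, _ =>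
        simp only [List.head?_cons, Option.some.injEq, List.getLast?_singleton] at h2 h3
        subst h2
        exact ⟨h3, rfl⟩
      | x :: b :: r, h1, h2, h3, _ =>
        simp only [List.head?_cons, Option.some.injEq] at h2
        subst h2
        rw [List.getLast?_cons_cons] at h3
        have := layer_le_of_chain h1 v (List.mem_of_getLast? h3)
        rw [huv] at this
        exact absurd this (lt_irrefl _)
    · rintro ⟨rfl, rfl⟩
      exact ⟨List.isChain_singleton _, rfl, rfl, by simp⟩
  rw [totalPathWeight_eq_sum]
  by_cases h : u.2 = v.2
  · have huv' : u = v := Prod.ext huv h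
    have : paths u v = {[u]} := by
      ext l
      rw [mem_paths, e, Finset.mem_singleton]
      exact and_iff_right huv'
    rw [this, if_pos h]
    simp [pathWeight]
  · have : paths u v = ∅ := by
      ext l
      simp only [mem_paths, e, Finset.notMem_empty, iff_false, not_and]
      rintro rfl
      exact absurd rfl h
    rw [this, if_neg h, Finset.sum_empty]

theorem totalPathWeight_eq (μ : Vertex n → Vertex n → ℕ) {t : ℕ} {u v : Vertex n}
    (huv : (v.1 : ℕ) = u.1 + t) :
    totalPathWeight (grid n) μ u v = prodFrom (layerMatrix μ) u.1 t u.2 v.2 := by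
  classical
  induction t generalizing u with
  | zero =>
    rw [totalPathWeight_same_layer μ (Fin.ext (by simpa using huv.symm)), prodFrom,
      Matrix.one_apply]
  | succ t ih =>
    have hv := v.1.2
    rw [totalPathWeight_succ μ (by omega), add_comm t 1, prodFrom_add]
    simp only [prodFrom, Matrix.one_mul, add_zero, Matrix.mul_apply]
    rw [Finset.sum_filter, Fintype.sum_prod_type, Finset.sum_eq_single
      (⟨u.1 + 1, by omega⟩ : Fin (n + 1))]
    · refine Finset.sum_congr rfl fun j _ => ?_
      by_cases hj : (j : ℕ) = u.2 ∨ (j : ℕ) = u.2 + 1 ∨ (u.2 : ℕ) = j + 1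
      · rw [if_pos ⟨rfl, hj⟩, ih (by simp; omega), layerMatrix, dif_pos ⟨by omega, hj⟩]
      · rw [if_neg fun h => hj h.2, layerMatrix, dif_neg fun h => hj h.2, zero_mul]
    · intro i _ hi
      refine Finset.sum_eq_zero fun j _ => if_neg fun h => hi (Fin.ext h.1)
    · simp

theorem prodFrom_map {ι R S : Type*} [CommSemiring R] [CommSemiring S] [Fintype ι] [DecidableEq ι]
    (f : R →+* S) (M : ℕ → Matrix ι ι R) (l t : ℕ) :
    (prodFrom M l t).map f = prodFrom (fun l => (M l).map f) l t := by
  induction t with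
  | zero => simp [prodFrom]
  | succ t ih => rw [prodFrom, Matrix.map_mul, ih, prodFrom]

/-- The layer matrices with entries reduced modulo `p`, in a ring. -/
def reducedMatrix (R : Type*) [CommRing R] (μ : Vertex n → Vertex n → ℕ) (p l : ℕ) :
    Matrix (Fin (n + 1)) (Fin (n + 1)) R :=
  fun i j => ((layerMatrix μ l i j % p : ℕ) : R)

theorem reducedMatrix_tridiagonal {R : Type*} [CommRing R] (μ : Vertex n → Vertex n → ℕ)
    (p l : ℕ) (i j : Fin (n + 1)) (h : reducedMatrix R μ p l i j ≠ 0) :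
    (i : ℕ) ≤ j + 1 ∧ (j : ℕ) ≤ i + 1 := by
  rw [reducedMatrix, layerMatrix] at h
  split_ifs at h with h1
  · omega
  · simp at h

theorem mod_eq_of_prodFrom (μ : Vertex n → Vertex n → ℕ) {p P t r : ℕ} (hpP : p ∣ P)
    {u v : Vertex n} (huv : (v.1 : ℕ) = u.1 + t)
    (hr : (r : ZMod P) = prodFrom (reducedMatrix (ZMod P) μ p) u.1 t u.2 v.2) :
    r % p = totalPathWeight (grid n) μ u v % p := by
  have h1 := congrArg (ZMod.castHom hpP (ZMod p)) hr
  rw [map_natCast] at h1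
  rw [totalPathWeight_eq μ huv]
  change r ≡ _ [MOD p]
  rw [← ZMod.natCast_eq_natCast_iff, h1]
  have h2 := congrFun (congrFun (prodFrom_map (Nat.castRingHom (ZMod p)) (layerMatrix μ) u.1 t)
    u.2) v.2
  have h3 := congrFun (congrFun (prodFrom_map (ZMod.castHom hpP (ZMod p))
    (reducedMatrix (ZMod P) μ p) u.1 t) u.2) v.2
  rw [Matrix.map_apply] at h2 h3
  rw [h3]
  change _ = (Nat.castRingHom (ZMod p)) _
  rw [h2]
  congr 2
  funext l
  ext i j
  simp [reducedMatrix, Matrix.map_apply]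

end Paths
end CatalyticGrid

namespace CatalyticGrid

/-! ### Reading and writing numbers on the input, oracle and output tapes -/

theorem bits_cons {k : ℕ} (hk : 0 < k) : Nat.bits k = decide (k % 2 = 1) :: Nat.bits (k / 2) := by
  have e : Nat.bit (decide (k % 2 = 1)) (k / 2) = k := by
    rw [Nat.bit_val]
    have := Nat.div_add_mod k 2
    by_cases h : k % 2 = 1 <;> simp [h] <;> omega
  conv_lhs => rw [← e]
  rw [Nat.bits_append_bit]
  intro h
  simp only [decide_eq_true_eq]
  omega

theorem ofDigits_bits (k : ℕ) : Nat.ofDigits 2 ((Nat.bits k).map Bool.toNat) = k := by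
  have := Nat.ofDigits_digits 2 k
  rw [Nat.digits_two_eq_bits] at this
  convert this using 3
  funext b
  cases b <;> rfl

theorem length_bits_le {k L : ℕ} (h : k < 2 ^ L) : (Nat.bits k).length ≤ L := by
  rw [Nat.size_eq_bits_len]
  exact Nat.size_le.2 h

/-- The code of a number with the given binary digits. -/
def encodeBits (bs : List Bool) : List Bool := (bs.flatMap fun b => [true, b]) ++ [false]

theorem encodeBits_cons (b : Bool) (bs : List Bool) :
    encodeBits (b :: bs) = true :: b :: encodeBits bs := rfl

theorem length_encodeBits (bs : List Bool) : (encodeBits bs).length = 2 * bs.length + 1 := by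
  induction bs with
  | nil => rfl
  | cons b bs ih => rw [encodeBits_cons, List.length_cons, List.length_cons, ih, List.length_cons]; ring

theorem length_encodeNat_le {k L : ℕ} (h : k < 2 ^ L) : (encodeNat k).length ≤ 2 * L + 1 := by
  have := length_bits_le h
  have := length_encodeBits (Nat.bits k)
  rw [show encodeNat k = encodeBits (Nat.bits k) from rfl]
  omega

namespace Tape

/-- The head is at the beginning of the word `w`. -/
def At (t : Tape) (w : List Bool) : Prop :=
  1 ≤ t.head ∧ ∃ rest, t.cells.drop (t.head - 1) = w ++ rest

theorem At.cons {t : Tape} {b : Bool} {w : List Bool} (h : t.At (b :: w)) :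
    t.read = some b ∧ (t.move .right).At w ∧ (t.move .right) = ⟨t.cells, t.head + 1⟩ := by
  obtain ⟨h1, rest, h2⟩ := h
  have hlt : t.head - 1 < t.cells.length := by
    by_contra hc
    rw [List.drop_eq_nil_of_le (by omega)] at h2
    simp at h2
  have e : t.move .right = ⟨t.cells, t.head + 1⟩ := by
    simp only [move, Tape.mk.injEq, true_and]
    omega
  refine ⟨?_, ?_, e⟩
  · rw [read, if_neg (by omega)]
    have := congrArg (·[0]?) h2
    simpa using this
  · rw [e]
    refine ⟨by simp, rest, ?_⟩
    have := congrArg List.tail h2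
    simp only [List.tail_drop, List.cons_append, List.tail_cons] at this
    rw [← this]
    congr 1
    simp only
    omega

/-- The word to the left of the head is `w`. -/
def Wrote (t : Tape) (w : List Bool) : Prop :=
  t.head = w.length + 1 ∧ t.cells.take w.length = w

theorem Wrote.put {t : Tape} {w : List Bool} (h : t.Wrote w) (hl : w.length < t.cells.length)
    (b : Bool) : ((t.write (some b)).move .right).Wrote (w ++ [b]) ∧
      ((t.write (some b)).move .right).cells.length = t.cells.length := by
  obtain ⟨h1, h2⟩ := h
  have hne : t.head ≠ 0 := by omega
  simp only [write, if_neg hne, move, Wrote, List.length_set, List.length_append,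
    List.length_cons, List.length_nil, zero_add, and_true]
  refine ⟨by omega, ?_⟩
  rw [h1, Nat.add_sub_cancel]
  have e : (t.cells.set w.length b).take (w.length + 1) = (t.cells.take w.length) ++ [b] := by
    rw [List.take_add_one, List.take_set_of_le (by omega)]
    simp [hl]
  rw [e, h2]

theorem query_at {t : Tape} {w : List Bool} {D : List Bool → List Bool} (h : t.Wrote w)
    (hl : (D w).length ≤ t.cells.length) :
    ((t.query D).move .right).At (D w) ∧
      ((t.query D).move .right).cells.length = t.cells.length ∧
      ((t.query D).move .right).head = 1 := by
  obtain ⟨h1, h2⟩ := h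
  have e : t.query D = ⟨D w ++ t.cells.drop (D w).length, 0⟩ := by
    simp only [query, h1, Nat.add_sub_cancel, h2]
    rw [List.take_of_length_le]
    simp only [List.length_append, List.length_drop]
    omega
  rw [e]
  have hlen : (D w ++ t.cells.drop (D w).length).length = t.cells.length := by
    simp only [List.length_append, List.length_drop]
    omega
  refine ⟨⟨?_, t.cells.drop (D w).length, ?_⟩, ?_, ?_⟩
  · simp [move]
  · simp [move]
  · simp only [move, hlen]
  · simp only [move, hlen]
    omega

end Tape

namespace St

variable {V : Type}

/-- The oracle tape or the input tape. -/
def tape (σ : St V) (s : Bool) : Tape := if s then σ.oracle else σ.input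

/-- Replace the oracle tape or the input tape. -/
def setTape (σ : St V) (s : Bool) (t : Tape) : St V :=
  if s then { σ.tick with oracle := t } else { σ.tick with input := t }

@[simp] theorem setTape_v (σ : St V) (s : Bool) (t : Tape) : (σ.setTape s t).v = σ.v := by
  cases s <;> rfl
@[simp] theorem setTape_time (σ : St V) (s : Bool) (t : Tape) :
    (σ.setTape s t).time = σ.time + 1 := by cases s <;> rfl
@[simp] theorem setTape_reg (σ : St V) (s : Bool) (t : Tape) : (σ.setTape s t).reg = σ.reg := by
  cases s <;> rfl
@[simp] theorem setTape_output (σ : St V) (s : Bool) (t : Tape) :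
    (σ.setTape s t).output = σ.output := by cases s <;> rfl
@[simp] theorem setTape_tape (σ : St V) (s : Bool) (t : Tape) : (σ.setTape s t).tape s = t := by
  cases s <;> rfl
@[simp] theorem setTape_tape_not (σ : St V) (s : Bool) (t : Tape) :
    (σ.setTape s t).tape (!s) = σ.tape (!s) := by cases s <;> rfl
@[simp] theorem tick_tape (σ : St V) (s : Bool) : σ.tick.tape s = σ.tape s := rfl
@[simp] theorem set_tape [DecidableEq V] (σ : St V) (x : V) (a : ℕ) (s : Bool) :
    (σ.set x a).tape s = σ.tape s := rfl

end St

/-- Only the variables in `S`, the time and the tape `s` have changed. -/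
structure Moves {V : Type} (s : Bool) (S : List V) (σ σ' : St V) : Prop where
  frame : Frame S σ σ'
  reg : σ'.reg = σ.reg
  other : σ'.tape (!s) = σ.tape (!s)
  output : σ'.output = σ.output

section Moves

variable {V : Type} {s : Bool} {S : List V} {σ σ' : St V}

theorem Moves.trans {σ₁ σ₂ : St V} (h : Moves s S σ σ₁) (h' : Moves s S σ₁ σ₂) :
    Moves s S σ σ₂ :=
  ⟨fun x hx => (h'.1 x hx).trans (h.1 x hx), h'.2.trans h.2, h'.3.trans h.3, h'.4.trans h.4⟩

theorem Moves.refl : Moves s S σ σ := ⟨fun _ _ => rfl, rfl, rfl, rfl⟩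

theorem Moves.tick (h : Moves s S σ σ') : Moves s S σ σ'.tick := ⟨h.1, h.2, h.3, h.4⟩

theorem Moves.mono {S' : List V} (h : Moves s S σ σ') (hS : S ⊆ S') : Moves s S' σ σ' :=
  ⟨fun x hx => h.1 x fun hx' => hx (hS hx'), h.2, h.3, h.4⟩

theorem Moves.setTape (h : Moves s S σ σ') (t : Tape) : Moves s S σ (σ'.setTape s t) :=
  ⟨by simpa [Frame] using h.1, by simpa using h.2, by simpa using h.3, by simpa using h.4⟩

theorem Moves.set [DecidableEq V] (h : Moves s S σ σ') {x : V} (hx : x ∈ S) (a : ℕ) :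
    Moves s S σ (σ'.set x a) :=
  ⟨fun y hy => by
    rw [St.set_v, if_neg (by rintro rfl; exact hy hx)]
    exact h.1 y hy, h.2, by simpa using h.3, h.4⟩

theorem Pure.moves (h : Pure S σ σ') : Moves s S σ σ' :=
  ⟨h.1, h.2, by cases s <;> simp [St.tape, h.3, h.4], h.5⟩

end Moves

namespace Code

open Op Cond Prog Var

variable {E : Env} {Q : St Var → Prop} {σ : St Var}

/-- Move right on the oracle tape or the input tape. -/
def right (s : Bool) : Prog Var :=
  if s then op (device .stay (.act none .right) none) else op (device .right (.act none .stay) none)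

/-- Test the scanned symbol of the oracle tape or the input tape. -/
def sees (s : Bool) (f : Option Bool → Bool) : Cond Var := if s then oracle f else input f

/-- Write on the oracle tape. -/
def put (b : Bool) : Prog Var := op (device .stay (.act (some b) .right) none)

/-- Move left on the oracle tape. -/
def left : Prog Var := op (device .stay (.act none .left) none)

/-- Call the oracle. -/
def ask : Prog Var := op (device .stay .query none)

/-- Write on the output tape. -/
def out (b : Bool) : Prog Var := op (device .stay (.act none .stay) (some b))

@[simp] theorem wp_right {s : Bool} :
    wp E (right s) Q σ ↔ Q (σ.setTape s ((σ.tape s).move .right)) := by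
  cases s <;> simp [right, wp_op, Op.Ok, Op.apply, St.setTape, St.tape, Tape.move, Tape.write,
    St.tick]

@[simp] theorem eval_sees {s : Bool} {f : Option Bool → Bool} :
    (sees s f).eval σ = f (σ.tape s).read := by cases s <;> rfl

@[simp] theorem wp_put {b : Bool} :
    wp E (put b) Q σ ↔ Q (σ.setTape true ((σ.oracle.write (some b)).move .right)) := by
  simp [put, wp_op, Op.Ok, Op.apply, St.setTape, Tape.move, St.tick]

@[simp] theorem wp_left :
    wp E left Q σ ↔ Q (σ.setTape true (σ.oracle.move .left)) := by
  simp [left, wp_op, Op.Ok, Op.apply, St.setTape, Tape.move, Tape.write, St.tick]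

@[simp] theorem wp_ask :
    wp E ask Q σ ↔ Q (σ.setTape true (σ.oracle.query E.D)) := by
  simp [ask, wp_op, Op.Ok, Op.apply, St.setTape, Tape.move, St.tick]

@[simp] theorem wp_out {b : Bool} :
    wp E (out b) Q σ ↔ Q { σ.tick with output := σ.output ++ [b] } := by
  simp [out, wp_op, Op.Ok, Op.apply, Tape.move, Tape.write, St.tick]

@[simp] theorem wp_skip : wp E skip Q σ ↔ Q (σ.set mq (σ.v mq)) := by simp [skip]

/-- Read the digits of a number. -/
def parseLoop (s : Bool) : Prog Var :=
  loop (sees s (· == some true))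
    (right s ;; ite (sees s (· == some true)) (op (add px pp)) skip ;; op (add pp pp) ;; right s)

/-- Read a number into `px`. -/
def parse (s : Bool) : Prog Var :=
  op (zero px) ;; op (zero pp) ;; op (inc pp) ;; parseLoop s ;; right s

theorem wp_parseLoop {s : Bool} {bs : List Bool} {w : List Bool}
    (h : (σ.tape s).At (encodeBits bs ++ w)) (hp : σ.v px < 2 ^ E.L) :
    wp E (parseLoop s) (fun σ' => Moves s [px, pp, mq] σ σ' ∧ σ'.time ≤ σ.time + (6 * bs.length + 1) ∧
      σ'.v px = (σ.v px + σ.v pp * Nat.ofDigits 2 (bs.map Bool.toNat)) % 2 ^ E.L ∧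
      (σ'.tape s) = ⟨(σ.tape s).cells, (σ.tape s).head + 2 * bs.length⟩ ∧
      (σ'.tape s).At (false :: w)) σ := by
  induction bs generalizing σ with
  | nil =>
    have h' : (σ.tape s).At (false :: w) := h
    rw [parseLoop, wp_loop, if_neg (by simp [h'.cons.1])]
    exact ⟨Moves.refl.tick, by simp, by simp [Nat.mod_eq_of_lt hp], by simp, by simpa using h'⟩
  | cons b bs ih =>
    have h1 : (σ.tape s).At (true :: b :: (encodeBits bs ++ w)) := h
    obtain ⟨r1, h2, e2⟩ := h1.cons
    obtain ⟨r2, h3, e3⟩ := h2.cons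
    rw [parseLoop, wp_loop, if_pos (by simp [r1])]
    simp only [wp_seq, wp_right, wp_ite, eval_sees, St.setTape_tape, St.tick_tape, r2, wp_add,
      wp_skip]
    have fin : ∀ σ₁ : St Var, Moves s [px, pp, mq] σ σ₁ → σ₁.time = σ.time + 4 →
        σ₁.v px = (σ.v px + σ.v pp * b.toNat) % 2 ^ E.L → σ₁.v pp = σ.v pp →
        σ₁.tape s = (σ.tape s).move .right →
        wp E (parseLoop s) (fun σ' => Moves s [px, pp, mq] σ σ' ∧
          σ'.time ≤ σ.time + (6 * (b :: bs).length + 1) ∧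
          σ'.v px = (σ.v px + σ.v pp * Nat.ofDigits 2 ((b :: bs).map Bool.toNat)) % 2 ^ E.L ∧
          (σ'.tape s) = ⟨(σ.tape s).cells, (σ.tape s).head + 2 * (b :: bs).length⟩ ∧
          (σ'.tape s).At (false :: w))
          ((σ₁.set pp ((σ₁.v pp + σ₁.v pp) % 2 ^ E.L)).setTape s ((σ₁.tape s).move .right)) := by
      intro σ₁ hm ht hpx hpp htp
      refine wp_mono (ih (by simpa [htp] using h3) (by
        simp only [St.setTape_v, St.set_v, reduceCtorEq, if_false, hpx]
        exact Nat.mod_lt _ (by positivity))) ?_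
      rintro σ' ⟨g1, g2, g3, g4, g5⟩
      refine ⟨((hm.set (by simp) _).setTape _).trans g1, ?_, ?_, ?_, g5⟩
      · simp only [St.setTape_time, St.set_time, ht, List.length_cons] at g2 ⊢
        omega
      · rw [g3]
        simp only [St.setTape_v, St.set_v, reduceCtorEq, if_false, if_true, hpx, hpp, List.map_cons,
          Nat.ofDigits_cons]
        rw [Nat.mod_add_mod, Nat.add_mod, Nat.mod_mul_mod, ← Nat.add_mod]
        congr 1
        ring
      · rw [g4]
        simp only [St.setTape_tape, htp]
        rw [e3, e2]
        simp only [List.length_cons, Tape.mk.injEq, true_and]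
        ring
    cases b with
    | true =>
      rw [if_pos (by simp)]
      refine fin _ ((((Moves.refl.tick).setTape _).tick).set (by simp) _) (by simp) ?_ (by simp)
        (by simp)
      simp
    | false =>
      rw [if_neg (by simp)]
      refine fin _ ((((Moves.refl.tick).setTape _).tick).set (by simp) _) (by simp) ?_ (by simp)
        (by simp)
      simp [Nat.mod_eq_of_lt hp]

theorem wp_parse {s : Bool} {k : ℕ} {w : List Bool} (hL : 0 < E.L)
    (h : (σ.tape s).At (encodeNat k ++ w)) (hk : k < 2 ^ E.L)
    (hQ : ∀ σ', Moves s [px, pp, mq] σ σ' → σ'.time ≤ σ.time + (6 * E.L + 5) → σ'.v px = k →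
      (σ'.tape s).At w → (σ'.tape s).cells = (σ.tape s).cells →
      (σ'.tape s).head = (σ.tape s).head + (encodeNat k).length → Q σ') : wp E (parse s) Q σ := by
  simp only [parse, wp_seq, wp_zero, wp_inc]
  have h1 : 1 % 2 ^ E.L = 1 := Nat.mod_eq_of_lt (Nat.one_lt_two_pow hL.ne')
  refine wp_mono (wp_parseLoop (bs := Nat.bits k) (w := w)
    (by simp only [St.set_tape]; exact h) (by simp)) ?_
  rintro σ' ⟨g1, g2, g3, g4, g5⟩
  have hlen := length_bits_le hk
  rw [wp_right]
  have g0 := ((((Moves.refl (s := s) (S := [px, pp, mq]) (σ := σ)).set (x := px) (by simp) 0).set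
    (x := pp) (by simp) 0).set (x := pp) (by simp) ((0 + 1) % 2 ^ E.L))
  refine hQ _ ((g0.trans (by simpa using g1)).setTape _) ?_ ?_ ?_ ?_ ?_
  · simp only [St.set_time, St.setTape_time] at g2 ⊢
    omega
  · simp only [St.setTape_v, g3, St.set_v, reduceCtorEq, if_true, if_false, zero_add, h1,
      ofDigits_bits, one_mul]
    exact Nat.mod_eq_of_lt hk
  · rw [St.setTape_tape]
    exact g5.cons.2.1
  · rw [St.setTape_tape, g5.cons.2.2]
    simp [g4]
  · rw [St.setTape_tape, g5.cons.2.2, show encodeNat k = encodeBits (Nat.bits k) from rfl,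
      length_encodeBits]
    simp only [g4, St.set_tape]
    omega

/-- Write the number `pt` on the oracle tape. -/
def pushNat : Prog Var :=
  loop (pos pt) (put true ;; ite (odd pt) (put true) (put false) ;; op (half pt)) ;; put false

theorem wp_pushNat {w : List Bool} {k : ℕ} (hpt : σ.v pt = k) (hk : k < 2 ^ E.L)
    (h : σ.oracle.Wrote w) (hl : w.length + (2 * E.L + 1) ≤ σ.oracle.cells.length)
    (hQ : ∀ σ', Moves true [pt] σ σ' → σ'.time ≤ σ.time + (5 * E.L + 2) →
      σ'.oracle.Wrote (w ++ encodeNat k) → σ'.oracle.cells.length = σ.oracle.cells.length → Q σ') :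
    wp E pushNat Q σ := by
  have key : ∀ N k w (σ : St Var), k < 2 ^ N → σ.v pt = k → σ.oracle.Wrote w →
      w.length + (2 * N + 1) ≤ σ.oracle.cells.length →
      wp E pushNat (fun σ' => Moves true [pt] σ σ' ∧ σ'.time ≤ σ.time + (5 * N + 2) ∧
        σ'.oracle.Wrote (w ++ encodeNat k) ∧
        σ'.oracle.cells.length = σ.oracle.cells.length) σ := by
    intro N
    induction N with
    | zero =>
      intro k w σ hk hpt h hl
      have hk0 : k = 0 := by simpa using hk
      rw [pushNat, wp_seq, wp_loop, if_neg (by simp [hpt, hk0]), wp_put]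
      have := h.put (by omega) false
      refine ⟨(Moves.refl.tick).setTape _, by simp, ?_, ?_⟩
      · subst hk0
        exact this.1
      · exact this.2
    | succ N ih =>
      intro k w σ hk hpt h hl
      rw [pushNat, wp_seq, wp_loop]
      by_cases hpos : 0 < k
      swap
      · have hk0 : k = 0 := by omega
        rw [if_neg (by simp [hpt, hk0]), wp_put]
        have := h.put (by omega) false
        refine ⟨(Moves.refl.tick).setTape _, by simp, ?_, ?_⟩
        · subst hk0
          exact this.1
        · exact this.2
      rw [if_pos (by simpa [hpt] using hpos)]
      have p1 := h.put (by omega) true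
      have p2 := fun b => p1.1.put (by rw [p1.2, List.length_append, List.length_singleton]; omega) b
      simp only [wp_seq, wp_put, wp_ite, eval_odd, St.setTape_v, St.tick_v, hpt, wp_half]
      have fin : ∀ b : Bool, b = decide (k % 2 = 1) → wp E (loop (pos pt) (put true ;;
          ite (odd pt) (put true) (put false) ;; op (half pt))) (wp E (put false)
          (fun σ' => Moves true [pt] σ σ' ∧
          σ'.time ≤ σ.time + (5 * (N + 1) + 2) ∧ σ'.oracle.Wrote (w ++ encodeNat k) ∧
          σ'.oracle.cells.length = σ.oracle.cells.length))
          (((σ.tick.setTape true ((σ.oracle.write (some true)).move .right)).tick.setTape true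
            ((((σ.oracle.write (some true)).move .right).write (some b)).move .right)).set pt
              (k / 2)) := by
        intro b hb
        rw [← wp_seq]
        refine wp_mono (ih (k / 2) (w ++ [true] ++ [b]) _ (by rw [pow_succ] at hk; omega)
          (by simp) (p2 b).1 ?_) ?_
        · simp only [List.length_append, List.length_singleton]
          refine le_trans ?_ (le_of_eq ((p2 b).2.trans p1.2).symm)
          omega
        · rintro σ' ⟨g1, g2, g3, g4⟩
          refine ⟨((((Moves.refl.tick.setTape _).tick).setTape _).set (by simp) _).trans g1,
            ?_, ?_, ?_⟩
          · simp only [St.set_time, St.setTape_time, St.tick_time] at g2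
            omega
          · have e : encodeNat k = [true] ++ [b] ++ encodeNat (k / 2) := by
              rw [encodeNat, bits_cons hpos, hb]
              rfl
            rw [e]
            simpa only [List.append_assoc] using g3
          · exact g4.trans ((p2 b).2.trans p1.2)
      split_ifs with hodd
      · exact fin true (by simp [hodd])
      · exact fin false (by simp [hodd])
  exact wp_mono (key E.L k w σ hk hpt h hl) fun σ' h => hQ σ' h.1 h.2.1 h.2.2.1 h.2.2.2

/-- Move the head of the oracle tape to the first cell. -/
def rewind : Prog Var := left ;; loop (oracle Option.isSome) left ;; right true

theorem wp_rewind (h : σ.oracle.head ≤ σ.oracle.cells.length + 1)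
    (hQ : ∀ σ', Moves true [] σ σ' → σ'.time ≤ σ.time + (2 * σ.oracle.cells.length + 4) →
      σ'.oracle = ⟨σ.oracle.cells, 1⟩ → Q σ') : wp E rewind Q σ := by
  have key : ∀ N (σ : St Var), σ.oracle.head = N → N ≤ σ.oracle.cells.length →
      wp E (loop (oracle Option.isSome) left) (fun σ' => Moves true [] σ σ' ∧
        σ'.time ≤ σ.time + (2 * N + 1) ∧ σ'.oracle = ⟨σ.oracle.cells, 0⟩) σ := by
    intro N
    induction N with
    | zero =>
      intro σ h0 _
      rw [wp_loop, if_neg (by simp [Cond.eval, Tape.read, h0])]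
      refine ⟨Moves.refl.tick, by simp, ?_⟩
      rw [← h0]
      rfl
    | succ N ih =>
      intro σ h0 hle
      rw [wp_loop, if_pos (by simp [Cond.eval, Tape.read, h0]; omega), wp_left]
      refine wp_mono (ih _ ?_ ?_) ?_
      · simp [St.setTape, Tape.move, h0]
      · simp [St.setTape, Tape.move]
        omega
      · rintro σ' ⟨g1, g2, g3⟩
        refine ⟨(Moves.refl.tick.setTape _).trans g1, ?_, g3⟩
        simp only [St.setTape_time, St.tick_time] at g2
        omega
  rw [rewind, wp_seq, wp_left, wp_seq]
  refine wp_mono (key (σ.oracle.head - 1) _ rfl ?_) ?_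
  · simp [St.setTape, Tape.move]
    omega
  · rintro σ' ⟨g1, g2, g3⟩
    rw [wp_right]
    refine hQ _ ((Moves.refl.setTape _).trans (g1.setTape _)) ?_ ?_
    · simp only [St.setTape_time] at g2 ⊢
      omega
    · have : σ'.tape true = ⟨σ.oracle.cells, 0⟩ := g3
      rw [this]
      simp [St.setTape, Tape.move]

end Code
end CatalyticGrid

namespace CatalyticGrid

open Var

set_option linter.unusedSimpArgs false

/-! ### The parameters of a computation -/

/-- The parameters of a computation: variables have `L` bits, and the catalytic tape holds numbers
modulo `P`, in arrays of length `4 * 2 ^ h`. -/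
structure Params where
  n : ℕ
  p : ℕ
  u1 : ℕ
  u2 : ℕ
  v1 : ℕ
  v2 : ℕ
  L : ℕ
  P : ℕ
  b : ℕ
  g : ℕ
  h : ℕ
  a : ℕ
  two_le_p : 2 ≤ p
  dvd : p ∣ P
  P_lt : P < 2 ^ L
  lt_P : 2 ^ L ≤ P + p
  u2_le : u2 ≤ n
  v2_le : v2 ≤ n
  v1_eq : v1 = u1 + 2 ^ a
  v1_le : v1 ≤ n
  b_eq : h + g = b
  n_lt : n < 2 ^ b
  le_n : 2 ^ b ≤ 2 * n
  size : (4 * 2 ^ h * b + 2) * (L + p) + 8 * 2 ^ h + 2 * n + 4 ≤ P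
  bits_le : counterBits h g a ≤ L

namespace Params

variable (π : Params)

/-- The width of a block. -/
def w : ℕ := 2 ^ π.h

/-- The length of an array. -/
def m : ℕ := 4 * 2 ^ π.h

/-- The number of registers. -/
def R : ℕ := π.m * π.b

/-- The environment. -/
def env (D : List Bool → List Bool) : Env := ⟨π.L, π.R, D⟩

@[simp] theorem env_L (D : List Bool → List Bool) : (π.env D).L = π.L := rfl
@[simp] theorem env_R (D : List Bool → List Bool) : (π.env D).R = π.R := rfl
@[simp] theorem env_D (D : List Bool → List Bool) : (π.env D).D = D := rfl

/-- The variables that keep their values. -/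
def const : Var → Option ℕ
  | .n => some π.n
  | .p => some π.p
  | .u1 => some π.u1
  | .lv => some π.L
  | .md => some π.P
  | .hb => some (2 ^ (π.L - 1))
  | .g => some π.g
  | .h => some π.h
  | .w => some π.w
  | .m => some π.m
  | .a => some π.a
  | .a1 => some (π.a + 1)
  | .ell => some (2 ^ π.a)
  | .step => some (2 ^ (π.L - counterBits π.h π.g π.a) % 2 ^ π.L)
  | .rr => some π.R
  | .n1 => some (π.n + π.w + 1)
  | .us => some (π.u2 + π.w)
  | .vs => some (π.v2 + π.w)
  | _ => none

/-- The state assigns the parameters to their variables. -/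
def Holds (σ : St Var) : Prop := ∀ x k, π.const x = some k → σ.v x = k

variable {π}

theorem Holds.frame {σ σ' : St Var} {S : List Var} (h : π.Holds σ) (hf : Frame S σ σ')
    (hS : ∀ x ∈ S, π.const x = none) : π.Holds σ' := fun x k hx => by
  rw [hf x fun hm => by simp [hS x hm] at hx]
  exact h x k hx

theorem w_pos : 0 < π.w := by unfold w; positivity
theorem m_eq : π.m = 4 * π.w := rfl
theorem m_pos : 0 < π.m := by unfold m; positivity

theorem a_lt : π.a < π.b := by
  have h1 := π.v1_eq
  have h2 := π.v1_le
  have h3 := π.n_lt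
  exact (Nat.pow_lt_pow_iff_right (by norm_num : 1 < 2)).1 (show 2 ^ π.a < 2 ^ π.b by omega)

theorem size' : π.R * π.L + 2 * π.L + (π.R + 2) * π.p + 8 * π.w + 2 * π.n + 4 ≤ π.P := by
  have := π.size
  unfold R m w
  linarith

theorem m_le_R : π.m ≤ π.R := Nat.le_mul_of_pos_right _ (lt_of_le_of_lt (Nat.zero_le _) a_lt)

theorem L_pos : 0 < π.L := by
  by_contra hL
  have h1 := π.P_lt
  rw [show π.L = 0 by omega, pow_zero] at h1
  have := π.size'
  omega

theorem R_lt : π.R < π.P := by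
  have h1 := π.size'
  have h2 := π.two_le_p
  have : π.R + 2 ≤ (π.R + 2) * π.p := Nat.le_mul_of_pos_right _ (by omega)
  have : 0 ≤ π.R * π.L := Nat.zero_le _
  omega

theorem index_lt {d i : ℕ} (hd : d ≤ π.a) (hi : i < π.m) : d * π.m + i < π.R := by
  have h1 := a_lt (π := π)
  calc d * π.m + i < (d + 1) * π.m := by rw [Nat.succ_mul]; omega
    _ ≤ π.b * π.m := Nat.mul_le_mul_right _ (by omega)
    _ = π.R := by rw [R, mul_comm]

end Params

namespace Code

open Op Cond Prog Var

variable {π : Params} {D : List Bool → List Bool} {Q : St Var → Prop} {σ : St Var}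

/-- Compute the address of an array entry in `ptr`. -/
def addr (dl yv : Var) : Prog Var :=
  op (zero ac) ;; op (copy ma yv) ;; op (zero mx) ;; op (inc mx) ;; op (copy mm m) ;; mul ;;
  op (copy ma dl) ;; op (copy mx m) ;; op (copy mm md) ;; mul ;;
  op (copy ma ac) ;; op (zero ac) ;; op (copy mx lv) ;; mul ;; op (copy ptr ac)

theorem wp_addr {dl yv : Var} {dv yw : ℕ} (hh : π.Holds σ)
    (hdl : dl ∉ [ac, ma, mx, mm, mq]) (hyv : yv ∉ [ac, ma, mx, mm, mq]) (hd : σ.v dl = dv)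
    (hy : σ.v yv = yw) (hda : dv ≤ π.a) (hyw : yw < 2 ^ π.L)
    (hQ : ∀ σ', Pure [ac, ma, mx, mm, mq, ptr] σ σ' → σ'.time ≤ σ.time + (33 * π.L + 15) →
      σ'.v ptr = (dv * π.m + yw % π.m) * π.L → Q σ') : wp (π.env D) (addr dl yv) Q σ := by
  have vm : σ.v m = π.m := hh m _ rfl
  have vmd : σ.v md = π.P := hh md _ rfl
  have vlv : σ.v lv = π.L := hh lv _ rfl
  have hP := π.P_lt
  have hR := π.R_lt
  have hmR := π.m_le_R
  have hsz := π.size'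
  have hw := π.w_pos
  have hm := π.m_eq
  have hi : dv * π.m + yw % π.m < π.R := Params.index_lt hda (Nat.mod_lt _ π.m_pos)
  have hiL : (dv * π.m + yw % π.m) * π.L ≤ π.R * π.L := Nat.mul_le_mul_right _ hi.le
  have hdR : dv < π.R := lt_of_le_of_lt hda (lt_of_lt_of_le (Params.a_lt)
    (Nat.le_mul_of_pos_left _ π.m_pos))
  have h1 : 1 % 2 ^ π.L = 1 := Nat.mod_eq_of_lt (by omega)
  simp only [List.mem_cons, List.not_mem_nil, or_false, not_or] at hdl hyv
  obtain ⟨d1, d2, d3, d4, d5⟩ := hdl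
  obtain ⟨y1, y2, y3, y4, y5⟩ := hyv
  rw [addr]
  simp only [wp_seq, wp_zero, wp_copy, wp_inc, St.set_v, reduceCtorEq, if_false, if_true, if_neg y1,
    hy, vm, zero_add, Params.env_L, h1]
  refine wp_mul (by simp; omega) (by simpa) (by simp; omega) (by simp; omega) fun σ₁ p₁ t₁ e₁ => ?_
  simp only [St.set_v, St.set_time, reduceCtorEq, if_false, if_true, zero_add, mul_one,
    Params.env_L] at e₁ t₁
  have f₁ : ∀ x, x ∉ [ac, ma, mx, mm, mq] → σ₁.v x = σ.v x := fun x hx => by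
    simp only [List.mem_cons, List.not_mem_nil, or_false, not_or] at hx
    rw [p₁.1 x (by simp [hx])]
    simp [hx]
  simp only [wp_seq, wp_copy, St.set_v, reduceCtorEq, if_false, if_true, if_neg d1, f₁ dl (by simp [d1, d2, d3, d4, d5]), f₁ m (by simp), f₁ md (by simp), hd, vm, vmd]
  refine wp_mul (by simp; omega) (by simp; omega) (by simp [e₁]; have := Nat.mod_lt yw π.m_pos; omega)
    (by simp; omega) fun σ₂ p₂ t₂ e₂ => ?_
  simp only [St.set_v, St.set_time, reduceCtorEq, if_false, if_true, e₁, Params.env_L] at e₂ t₂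
  rw [add_comm, Nat.mod_eq_of_lt (by omega)] at e₂
  have f₂ : ∀ x, x ∉ [ac, ma, mx, mm, mq] → σ₂.v x = σ.v x := fun x hx => by
    rw [← f₁ x hx]
    simp only [List.mem_cons, List.not_mem_nil, or_false, not_or] at hx
    rw [p₂.1 x (by simp [hx])]
    simp [hx]
  have g₂ : σ₂.v mm = π.P := by rw [p₂.1 mm (by simp)]; simp
  simp only [wp_seq, wp_copy, wp_zero, St.set_v, reduceCtorEq, if_false, if_true, f₂ lv (by simp), e₂, vlv]
  refine wp_mul (by simp [g₂]; omega) (by simp; omega) (by simp [g₂]; omega)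
    (by simp [g₂]; omega) fun σ₃ p₃ t₃ e₃ => ?_
  rw [wp_copy]
  simp only [St.set_v, St.set_time, reduceCtorEq, if_false, if_true, zero_add, g₂,
    Params.env_L] at e₃ t₃
  rw [Nat.mod_eq_of_lt (by omega)] at e₃
  refine hQ _ ?_ ?_ ?_
  · refine Pure.set ?_ (by simp) _
    refine Pure.trans ?_ (p₃.mono (by simp))
    repeat refine Pure.set ?_ (by simp) _
    refine Pure.trans ?_ (p₂.mono (by simp))
    repeat refine Pure.set ?_ (by simp) _
    refine Pure.trans ?_ (p₁.mono (by simp))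
    repeat refine Pure.set ?_ (by simp) _
    exact Pure.refl _ _
  · simp only [St.set_time]
    omega
  · simp [e₃]

end Code
end CatalyticGrid

namespace CatalyticGrid

open Var

set_option linter.unusedSimpArgs false

/-! ### Elementary updates of the arrays -/

/-- The registers, shifted by `s`, and the accumulator hold the arrays `Y`; all other registers are
as in `ρ`, and the oracle tape has length `q`. -/
structure Sim (π : Params) (q : ℕ) (ρ : ℕ → ℕ) (s : ℕ) (Y : ℕ → ℕ → ZMod π.P) (σ : St Var) :
    Prop where
  holds : π.Holds σ
  sh : σ.v sh = s
  outside : ∀ r, (∀ d i, 1 ≤ d → d ≤ π.a → i < π.m → r ≠ d * π.m + i) → σ.reg r = ρ r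
  inside : ∀ d i, 1 ≤ d → d ≤ π.a → i < π.m → σ.reg (d * π.m + i) < 2 ^ π.L ∧
    (σ.reg (d * π.m + i) + s) % 2 ^ π.L < π.P ∧
    (((σ.reg (d * π.m + i) + s) % 2 ^ π.L : ℕ) : ZMod π.P) = Y d i
  acc_lt : σ.v acc < π.P
  acc_eq : (σ.v acc : ZMod π.P) = Y 0 ((π.v2 + π.w) % π.m)
  one : ∀ i, Y (π.a + 1) i = 1
  cells : σ.oracle.cells.length = q
  head : σ.oracle.head ≤ q + 1
  output : σ.output = []

/-- The variables that hold a task. -/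
structure HoldsTask (κ : Task) (σ : St Var) : Prop where
  sd : σ.v sd = κ.sd
  slo : σ.v slo = κ.slo
  shi : σ.v shi = κ.shi
  td : σ.v td = κ.td
  tlo : σ.v tlo = κ.tlo
  thi : σ.v thi = κ.thi
  cen : σ.v cen = κ.cen
  lay : σ.v lay = κ.lay
  sg : σ.v sg = κ.sg.toNat

theorem HoldsTask.frame {κ : Task} {σ σ' : St Var} {S : List Var} (h : HoldsTask κ σ)
    (hf : Frame S σ σ')
    (hS : ∀ x ∈ S, x ∉ [Var.sd, Var.slo, Var.shi, Var.td, Var.tlo, Var.thi, Var.cen, Var.lay, Var.sg]) :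
    HoldsTask κ σ' := by
  have e : ∀ x ∈ [Var.sd, Var.slo, Var.shi, Var.td, Var.tlo, Var.thi, Var.cen, Var.lay, Var.sg],
      σ'.v x = σ.v x := fun x hx => hf x fun hx' => hS x hx' hx
  exact ⟨(e _ (by simp)).trans h.1, (e _ (by simp)).trans h.2, (e _ (by simp)).trans h.3,
    (e _ (by simp)).trans h.4, (e _ (by simp)).trans h.5, (e _ (by simp)).trans h.6,
    (e _ (by simp)).trans h.7, (e _ (by simp)).trans h.8, (e _ (by simp)).trans h.9⟩

/-- A task of the computation with the parameters `π`. -/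
structure Task.Valid (π : Params) (κ : Task) : Prop where
  sd_pos : 1 ≤ κ.sd
  sd_le : κ.sd ≤ π.a + 1
  td_le : κ.td ≤ π.a
  ne : κ.sd ≠ κ.td
  tlo : κ.td = 0 → κ.tlo = π.v2 + π.w
  thi : κ.td = 0 → κ.thi = π.v2 + π.w + 1
  lay : κ.lay < π.n

/-- Add the multiple by `c` of the entry `i` of the source to the entry `i'` of the target. -/
def entryUpdate {R : Type*} [CommRing R] (κ : Task) (c : R) (i i' : ℕ) (Y : ℕ → ℕ → R) :
    ℕ → ℕ → R :=
  Function.update Y κ.td fun k => Y κ.td k + if k = i' then sgn R κ.sg * (c * Y κ.sd i) else 0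

variable {π : Params} {q s : ℕ} {ρ : ℕ → ℕ} {Y : ℕ → ℕ → ZMod π.P} {D : List Bool → List Bool}
  {Q : St Var → Prop} {σ : St Var} {κ : Task}

theorem Sim.moves {σ' : St Var} {S : List Var} (h : Sim π q ρ s Y σ) (hm : Moves true S σ σ')
    (hS : ∀ x ∈ S, π.const x = none ∧ x ≠ Var.sh ∧ x ≠ Var.acc) (hc : σ'.oracle.cells.length = q)
    (hh : σ'.oracle.head ≤ q + 1) : Sim π q ρ s Y σ' where
  holds := h.holds.frame hm.1 fun x hx => (hS x hx).1
  sh := (hm.1 _ fun hx => (hS _ hx).2.1 rfl).trans h.sh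
  outside := by rw [hm.reg]; exact h.outside
  inside := by rw [hm.reg]; exact h.inside
  acc_lt := by rw [hm.1 acc fun hx => (hS _ hx).2.2 rfl]; exact h.acc_lt
  acc_eq := by rw [hm.1 acc fun hx => (hS _ hx).2.2 rfl]; exact h.acc_eq
  one := h.one
  cells := hc
  head := hh
  output := hm.output.trans h.output

theorem Sim.pure {σ' : St Var} {S : List Var} (h : Sim π q ρ s Y σ) (hm : Pure S σ σ')
    (hS : ∀ x ∈ S, π.const x = none ∧ x ≠ Var.sh ∧ x ≠ Var.acc) : Sim π q ρ s Y σ' :=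
  h.moves hm.moves hS (by rw [hm.oracle]; exact h.cells) (by rw [hm.oracle]; exact h.head)

namespace Code

open Op Cond Prog Var

/-- Ask for the weight of the edge from `y` in layer `lay` to `yy`; the answer is in `px`. -/
def query : Prog Var :=
  rewind ;;
  op (copy pt lay) ;; pushNat ;;
  op (copy pt y) ;; op (sub pt w) ;; pushNat ;;
  op (copy pt lay) ;; op (inc pt) ;; pushNat ;;
  op (copy pt yy) ;; op (sub pt w) ;; pushNat ;;
  ask ;; right true ;; parse true

theorem wp_query {l j j' k : ℕ} (hh : π.Holds σ) (hlay : σ.v lay = l) (hy : σ.v y = j + π.w)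
    (hyy : σ.v yy = j' + π.w) (hl : l < π.n) (hj : j ≤ π.n) (hj' : j' ≤ π.n)
    (hq : 20 * π.L = q) (hc : σ.oracle.cells.length = q) (hhead : σ.oracle.head ≤ q + 1)
    (hD : D (encodeList [l, j, l + 1, j']) = encodeNat k) (hk : k < π.p)
    (hQ : ∀ σ', Moves true [px, pp, mq, pt] σ σ' → σ'.time ≤ σ.time + (66 * π.L + 30) →
      σ'.v px = k → σ'.oracle.cells.length = q → σ'.oracle.head ≤ q + 1 → Q σ') :
    wp (π.env D) query Q σ := by
  have hsz := π.size'
  have hP := π.P_lt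
  have hL := π.L_pos
  have hp : (1 : ℕ) * π.p ≤ (π.R + 2) * π.p := Nat.mul_le_mul_right _ (by omega)
  have vw : σ.v w = π.w := hh w _ rfl
  have b1 : l < 2 ^ π.L := by omega
  have b2 : j < 2 ^ π.L := by omega
  have b3 : l + 1 < 2 ^ π.L := by omega
  have b4 : j' < 2 ^ π.L := by omega
  have bk : k < 2 ^ π.L := by omega
  have l1 := length_encodeNat_le b1
  have l2 := length_encodeNat_le b2
  have l3 := length_encodeNat_le b3
  have l4 := length_encodeNat_le b4
  have lk := length_encodeNat_le bk
  rw [query, wp_seq]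
  refine wp_rewind (by omega) fun σ₀ g₀ t₀ o₀ => ?_
  rw [hc] at t₀
  have f₀ : ∀ x, σ₀.v x = σ.v x := fun x => g₀.frame x (by simp)
  have c₀ : σ₀.oracle.cells.length = q := by rw [o₀]; exact hc
  rw [wp_seq, wp_copy, wp_seq]
  refine wp_pushNat (w := []) (k := l) (by simp [f₀, hlay]) b1 ?_ ?_ fun σ₁ g₁ t₁ o₁ c₁ => ?_
  · simp [o₀, Tape.Wrote]
  · simp only [St.set_oracle, c₀, List.length_nil, Params.env_L]
    omega
  have f₁ : ∀ x, x ≠ pt → σ₁.v x = σ.v x := fun x hx => by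
    rw [g₁.frame x (by simpa using hx), St.set_v, if_neg hx, f₀]
  simp only [St.set_oracle, c₀, St.set_time, List.nil_append, Params.env_L] at c₁ t₁ o₁
  rw [wp_seq, wp_copy, wp_seq, wp_sub, wp_seq]
  refine wp_pushNat (k := j) ?_ b2 (by simpa using o₁) ?_ fun σ₂ g₂ t₂ o₂ c₂ => ?_
  · simp only [St.set_v, if_true, reduceCtorEq, if_false, f₁ y (by simp), f₁ w (by simp), hy, vw,
      Params.env_L]
    rw [sub_wrap (by omega) (by omega)]
    omega
  · simp only [St.set_oracle, c₁, Params.env_L]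
    omega
  have f₂ : ∀ x, x ≠ pt → σ₂.v x = σ.v x := fun x hx => by
    rw [g₂.frame x (by simpa using hx), St.set_v, if_neg hx, St.set_v, if_neg hx, f₁ x hx]
  simp only [St.set_oracle, c₁, St.set_time, Params.env_L] at c₂ t₂
  rw [wp_seq, wp_copy, wp_seq, wp_inc, wp_seq]
  refine wp_pushNat (k := l + 1) ?_ b3 (by simpa using o₂) ?_ fun σ₃ g₃ t₃ o₃ c₃ => ?_
  · simp only [St.set_v, if_true, f₂ lay (by simp), hlay, Params.env_L]
    exact Nat.mod_eq_of_lt b3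
  · simp only [St.set_oracle, c₂, Params.env_L, List.length_append]
    omega
  have f₃ : ∀ x, x ≠ pt → σ₃.v x = σ.v x := fun x hx => by
    rw [g₃.frame x (by simpa using hx), St.set_v, if_neg hx, St.set_v, if_neg hx, f₂ x hx]
  simp only [St.set_oracle, c₂, St.set_time, Params.env_L] at c₃ t₃
  rw [wp_seq, wp_copy, wp_seq, wp_sub, wp_seq]
  refine wp_pushNat (k := j') ?_ b4 (by simpa using o₃) ?_ fun σ₄ g₄ t₄ o₄ c₄ => ?_
  · simp only [St.set_v, if_true, reduceCtorEq, if_false, f₃ yy (by simp), f₃ w (by simp), hyy, vw,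
      Params.env_L]
    rw [sub_wrap (by omega) (by omega)]
    omega
  · simp only [St.set_oracle, c₃, Params.env_L, List.length_append]
    omega
  simp only [St.set_oracle, c₃, St.set_time, Params.env_L] at c₄ t₄
  replace o₄ : σ₄.oracle.Wrote (encodeList [l, j, l + 1, j']) := by
    simpa [encodeList, List.append_assoc] using o₄
  obtain ⟨a1, a2, a3⟩ := Tape.query_at (D := D) o₄ (by rw [hD, c₄]; omega)
  rw [hD] at a1
  rw [wp_seq, wp_ask, wp_seq, wp_right]
  simp only [St.setTape_tape, Params.env_D]
  refine wp_parse hL (w := []) (k := k) (by simpa using a1) bk fun σ₅ g₅ t₅ e₅ _ c₅ h₅ => ?_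
  simp only [St.setTape_tape, St.setTape_time, Params.env_L] at c₅ h₅ t₅
  refine hQ σ₅ ?_ (by omega) e₅ ?_ ?_
  · have m₁ : Moves true [px, pp, mq, pt] σ σ₁ :=
      ((g₀.mono (by simp)).set (by simp) _).trans (g₁.mono (by simp))
    have m₂ : Moves true [px, pp, mq, pt] σ₁ σ₂ :=
      ((Moves.refl.set (by simp) _).set (by simp) _).trans (g₂.mono (by simp))
    have m₃ : Moves true [px, pp, mq, pt] σ₂ σ₃ :=
      ((Moves.refl.set (by simp) _).set (by simp) _).trans (g₃.mono (by simp))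
    have m₄ : Moves true [px, pp, mq, pt] σ₃ σ₄ :=
      ((Moves.refl.set (by simp) _).set (by simp) _).trans (g₄.mono (by simp))
    exact (m₁.trans (m₂.trans (m₃.trans m₄))).trans
      (((Moves.refl.setTape _).setTape _).trans (g₅.mono (by simp)))
  · change (σ₅.tape true).cells.length = q
    rw [c₅, a2, c₄]
  · change (σ₅.tape true).head ≤ q + 1
    rw [h₅, a3]
    omega

/-- Read the entry `y` of the source into `sv`. -/
def getS : Prog Var :=
  ite (lt a sd) (op (zero sv) ;; op (inc sv)) (addr sd y ;; op (load sv ptr) ;; op (add sv sh))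

theorem wp_getS {i : ℕ} (h : Sim π q ρ s Y σ) (ht : HoldsTask κ σ) (hv : κ.Valid π)
    (hy : σ.v y = i) (hi : i < 2 ^ π.L)
    (hQ : ∀ σ', Pure [ac, ma, mx, mm, mq, ptr, sv] σ σ' → σ'.time ≤ σ.time + (33 * π.L + 18) →
      σ'.v sv < π.P → (σ'.v sv : ZMod π.P) = Y κ.sd (i % π.m) → Q σ') :
    wp (π.env D) getS Q σ := by
  have hP := π.P_lt
  have hsz := π.size'
  have va : σ.v a = π.a := h.holds a _ rfl
  have h1 : 1 % 2 ^ π.L = 1 := Nat.mod_eq_of_lt (by omega)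
  rw [getS, wp_ite]
  simp only [eval_lt, va, ht.sd]
  have hle := hv.sd_le
  split_ifs with hc
  · simp only [wp_seq, wp_zero, wp_inc, St.set_v, if_true, zero_add, Params.env_L, h1]
    refine hQ _ ?_ (by simp; omega) (by simp; omega) ?_
    · exact (((Pure.refl _ _).tick).set (by simp) _).set (by simp) _
    · rw [show κ.sd = π.a + 1 by omega, h.one]
      simp
  · rw [wp_seq]
    refine wp_addr (dv := κ.sd) (yw := i) h.holds (by simp) (by simp) ht.sd hy (by omega) hi
      fun σ₁ p₁ t₁ e₁ => ?_
    have hm := Nat.mod_lt i π.m_pos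
    rw [wp_seq]
    refine wp_load π.L_pos (Params.index_lt (by omega) hm) e₁ ?_
    obtain ⟨i1, i2, i3⟩ := h.inside κ.sd _ hv.sd_pos (by omega) hm
    have hsh : σ₁.v sh = s := by rw [p₁.1 sh (by simp)]; exact h.sh
    simp only [St.tick_time] at t₁
    have hr : σ₁.reg = σ.reg := p₁.reg
    rw [wp_add]
    refine hQ _ ?_ ?_ ?_ ?_
    · exact (((Pure.refl _ _).tick.trans (p₁.mono (by simp))).set (by simp) _).set (by simp) _
    · simp only [St.set_time]
      omega
    · simpa [hr, hsh] using i2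
    · simpa [hr, hsh] using i3

/-- Read the entry `yy` of the target into `tv`. -/
def getT : Prog Var :=
  ite (pos td) (addr td yy ;; op (load tv ptr) ;; op (add tv sh)) (op (copy tv acc))

theorem wp_getT {i : ℕ} (h : Sim π q ρ s Y σ) (ht : HoldsTask κ σ) (hv : κ.Valid π)
    (hy : σ.v yy = i) (hi : i < 2 ^ π.L) (hi₀ : κ.td = 0 → i = π.v2 + π.w)
    (hQ : ∀ σ', Pure [ac, ma, mx, mm, mq, ptr, tv] σ σ' → σ'.time ≤ σ.time + (33 * π.L + 18) →
      σ'.v tv < π.P → (σ'.v tv : ZMod π.P) = Y κ.td (i % π.m) →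
      (0 < κ.td → σ'.v ptr = (κ.td * π.m + i % π.m) * π.L) → Q σ') :
    wp (π.env D) getT Q σ := by
  rw [getT, wp_ite]
  simp only [eval_pos, ht.td]
  have hle := hv.td_le
  split_ifs with hc
  · rw [wp_seq]
    refine wp_addr (dv := κ.td) (yw := i) h.holds (by simp) (by simp) ht.td hy (by omega) hi
      fun σ₁ p₁ t₁ e₁ => ?_
    have hm := Nat.mod_lt i π.m_pos
    rw [wp_seq]
    refine wp_load π.L_pos (Params.index_lt (by omega) hm) e₁ ?_
    obtain ⟨i1, i2, i3⟩ := h.inside κ.td _ hc (by omega) hm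
    have hsh : σ₁.v sh = s := by rw [p₁.1 sh (by simp)]; exact h.sh
    simp only [St.tick_time] at t₁
    have hr : σ₁.reg = σ.reg := p₁.reg
    rw [wp_add]
    refine hQ _ ?_ ?_ ?_ ?_ ?_
    · exact (((Pure.refl _ _).tick.trans (p₁.mono (by simp))).set (by simp) _).set (by simp) _
    · simp only [St.set_time]
      omega
    · simpa [hr, hsh] using i2
    · simpa [hr, hsh] using i3
    · intro _
      simpa using e₁
  · rw [wp_copy]
    refine hQ _ ((Pure.refl _ _).tick.set (by simp) _) (by simp) ?_ ?_ ?_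
    · simpa using h.acc_lt
    · have e : κ.td = 0 := by omega
      rw [e, hi₀ e]
      simpa using h.acc_eq
    · exact fun h => absurd h hc

/-- Write `ac` to the entry `yy` of the target, whose address is in `ptr`. -/
def putT : Prog Var :=
  ite (pos td) (op (copy tv ac) ;; op (sub tv sh) ;; op (store tv ptr)) (op (copy acc ac))

theorem wp_putT {i : ℕ} (h : Sim π q ρ s Y σ) (hs : s < 2 ^ π.L) (ht : HoldsTask κ σ)
    (hv : κ.Valid π) (hi₀ : κ.td = 0 → i = π.v2 + π.w) {x : ZMod π.P}
    (hptr : 0 < κ.td → σ.v ptr = (κ.td * π.m + i % π.m) * π.L) (hac : σ.v ac < π.P)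
    (hx : (σ.v ac : ZMod π.P) = Y κ.td (i % π.m) + x)
    (hQ : ∀ σ', Frame [tv, acc] σ σ' → σ'.time ≤ σ.time + 4 → Sim π q ρ s (Function.update Y κ.td
      fun k => Y κ.td k + if k = i % π.m then x else 0) σ' → Q σ') :
    wp (π.env D) putT Q σ := by
  have hP := π.P_lt
  have hle := hv.td_le
  have hm := Nat.mod_lt i π.m_pos
  rw [putT, wp_ite]
  simp only [eval_pos, ht.td]
  split_ifs with hc
  · have hidx := Params.index_lt hle hm
    have vsh : σ.v sh = s := h.sh
    simp only [wp_seq, wp_copy, wp_sub, St.set_v, if_true, reduceCtorEq, if_false, St.tick_v,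
      Params.env_L, vsh]
    refine wp_store π.L_pos hidx (by simpa using hptr hc) ?_
    refine hQ _ ?_ (by simp [St.setReg]) ?_
    · intro z hz
      simp only [List.mem_cons, List.not_mem_nil, or_false, not_or] at hz
      simp [St.setReg, hz]
    · have hval : ((σ.v ac + (2 ^ π.L - s)) % 2 ^ π.L + s) % 2 ^ π.L = σ.v ac := by
        rw [Nat.mod_add_mod, add_assoc, Nat.sub_add_cancel hs.le, Nat.add_mod_right,
          Nat.mod_eq_of_lt (by omega)]
      refine ⟨h.holds.frame (S := [tv]) ?_ (by simp [Params.const]), ?_, ?_, ?_, ?_, ?_, ?_, ?_, ?_,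
        ?_⟩
      · intro z hz
        simp only [List.mem_cons, List.not_mem_nil, or_false] at hz
        simp [St.setReg, hz]
      · simpa [St.setReg] using vsh
      · intro r hr
        have : r ≠ κ.td * π.m + i % π.m := hr _ _ hc hle hm
        simpa [St.setReg, this] using h.outside r hr
      · intro d i' h1 h2 h3
        by_cases hd : d = κ.td ∧ i' = i % π.m
        · obtain ⟨rfl, rfl⟩ := hd
          simp only [St.setReg, Function.update_self, St.set_v, if_true, hval, hac, true_and]
          exact ⟨Nat.mod_lt _ (by positivity), hx⟩
        · have hne : d * π.m + i' ≠ κ.td * π.m + i % π.m := by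
            intro he
            apply hd
            have e1 := congrArg (· / π.m) he
            have e2 := congrArg (· % π.m) he
            simp only [mul_comm _ π.m, Nat.mul_add_div π.m_pos, Nat.mul_add_mod,
              Nat.div_eq_of_lt h3, Nat.div_eq_of_lt hm, Nat.mod_eq_of_lt h3, Nat.mod_mod,
              add_zero] at e1 e2
            exact ⟨e1, e2⟩
          have e3 : Function.update Y κ.td (fun k => Y κ.td k + if k = i % π.m then x else 0) d i' =
              Y d i' := by
            by_cases hd' : d = κ.td
            · subst hd'
              simp [show i' ≠ i % π.m from fun he => hd ⟨rfl, he⟩]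
            · simp [hd']
          rw [e3]
          simpa [St.setReg, hne] using h.inside d i' h1 h2 h3
      · simpa [St.setReg] using h.acc_lt
      · rw [Function.update_of_ne (by omega)]
        simpa [St.setReg] using h.acc_eq
      · intro k
        rw [Function.update_of_ne (by omega)]
        exact h.one k
      · exact h.cells
      · exact h.head
      · exact h.output
  · have e : κ.td = 0 := by omega
    rw [wp_copy]
    refine hQ _ ?_ (by simp) ?_
    · intro z hz
      simp only [List.mem_cons, List.not_mem_nil, or_false, not_or] at hz
      simp [hz]
    · refine ⟨h.holds.frame (S := [acc]) ?_ (by simp [Params.const]), ?_, h.outside, ?_, ?_, ?_, ?_,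
        h.cells, h.head, h.output⟩
      · intro z hz
        simp only [List.mem_cons, List.not_mem_nil, or_false] at hz
        simp [hz]
      · simpa using h.sh
      · intro d i' h1 h2 h3
        rw [Function.update_of_ne (by omega)]
        exact h.inside d i' h1 h2 h3
      · simpa using hac
      · rw [e, hi₀ e] at hx
        simp [e, hi₀ e, hx]
      · intro k
        rw [Function.update_of_ne (by omega)]
        exact h.one k

/-- The variables that the update for an edge changes. -/
def edgeVars : List Var := [px, pp, mq, pt, wt, ac, ma, mx, mm, ptr, sv, tv, acc]

/-- Perform the update for the edge from `y` to `yy`. -/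
def edge : Prog Var :=
  query ;; op (copy wt px) ;; ite (pos sg) (op (copy wt md) ;; op (sub wt px)) skip ;;
  getS ;; getT ;;
  op (copy ac tv) ;; op (copy ma wt) ;; op (copy mx sv) ;; op (copy mm md) ;; mul ;; putT

theorem wp_edge {j j' k : ℕ} (h : Sim π q ρ s Y σ) (hs : s < 2 ^ π.L) (ht : HoldsTask κ σ)
    (hv : κ.Valid π) (hq : 20 * π.L = q) (hy : σ.v y = j + π.w) (hyy : σ.v yy = j' + π.w)
    (hj : j ≤ π.n) (hj' : j' ≤ π.n) (hi₀ : κ.td = 0 → j' = π.v2)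
    (hD : D (encodeList [κ.lay, j, κ.lay + 1, j']) = encodeNat k) (hk : k < π.p)
    (hQ : ∀ σ', Frame edgeVars σ σ' → σ'.time ≤ σ.time + (150 * π.L + 100) →
      Sim π q ρ s (entryUpdate κ (k : ZMod π.P) ((j + π.w) % π.m) ((j' + π.w) % π.m) Y) σ' →
      Q σ') : wp (π.env D) edge Q σ := by
  have hP := π.P_lt
  have hsz := π.size'
  have hp : (1 : ℕ) * π.p ≤ (π.R + 2) * π.p := Nat.mul_le_mul_right _ (by omega)
  have hkP : k < π.P := by omega
  rw [edge, wp_seq]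
  refine wp_query h.holds ht.lay hy hyy hv.lay hj hj' hq h.cells h.head hD hk
    fun σ₁ m₁ t₁ e₁ c₁ h₁ => ?_
  have S₁ : Sim π q ρ s Y σ₁ := h.moves m₁ (by simp [Params.const]) c₁ h₁
  have T₁ : HoldsTask κ σ₁ := ht.frame m₁.frame (by simp)
  have vmd : σ₁.v md = π.P := S₁.holds md _ rfl
  rw [wp_seq, wp_copy, wp_seq, wp_ite]
  have next : ∀ σ₂, Pure [wt, mq] σ₁ σ₂ → σ₂.time ≤ σ₁.time + 4 → σ₂.v wt ≤ π.P →
      (σ₂.v wt : ZMod π.P) = sgn (ZMod π.P) κ.sg * k →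
      wp (π.env D) (getS ;; getT ;; op (copy ac tv) ;; op (copy ma wt) ;; op (copy mx sv) ;;
        op (copy mm md) ;; mul ;; putT) Q σ₂ := by
    intro σ₂ p₂ t₂ l₂ e₂
    have S₂ : Sim π q ρ s Y σ₂ := S₁.pure p₂ (by simp [Params.const])
    have T₂ : HoldsTask κ σ₂ := T₁.frame p₂.frame (by simp)
    have f₂ : ∀ x, x ∉ [px, pp, mq, pt, wt] → σ₂.v x = σ.v x := fun x hx => by
      simp only [List.mem_cons, List.not_mem_nil, or_false, not_or] at hx
      rw [p₂.frame x (by simp [hx]), m₁.frame x (by simp [hx])]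
    rw [wp_seq]
    refine wp_getS S₂ T₂ hv ((f₂ y (by simp)).trans hy) (by omega) fun σ₃ p₃ t₃ l₃ e₃ => ?_
    have S₃ : Sim π q ρ s Y σ₃ := S₂.pure p₃ (by simp [Params.const])
    have T₃ : HoldsTask κ σ₃ := T₂.frame p₃.frame (by simp)
    rw [wp_seq]
    refine wp_getT S₃ T₃ hv (i := j' + π.w) ?_ (by omega) (fun h => by rw [hi₀ h])
      fun σ₄ p₄ t₄ l₄ e₄ a₄ => ?_
    · rw [p₃.frame yy (by simp), f₂ yy (by simp), hyy]
    have S₄ : Sim π q ρ s Y σ₄ := S₃.pure p₄ (by simp [Params.const])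
    have T₄ : HoldsTask κ σ₄ := T₃.frame p₄.frame (by simp)
    have w₄ : σ₄.v wt = σ₂.v wt := by rw [p₄.frame wt (by simp), p₃.frame wt (by simp)]
    have s₄ : σ₄.v sv = σ₃.v sv := p₄.frame sv (by simp)
    have d₄ : σ₄.v md = π.P := S₄.holds md _ rfl
    simp only [wp_seq, wp_copy, St.set_v, reduceCtorEq, if_false, w₄, s₄, d₄]
    refine wp_mul (by simpa) (by simp; omega) (by simpa) (by simpa) fun σ₅ p₅ t₅ e₅ => ?_
    simp only [St.set_v, reduceCtorEq, if_false, if_true, St.set_time, Params.env_L] at e₅ t₅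
    have P₅ : Pure [ac, ma, mx, mm, mq] σ₄ σ₅ := by
      refine Pure.trans ?_ (p₅.mono (by simp))
      repeat refine Pure.set ?_ (by simp) _
      exact Pure.refl _ _
    have S₅ : Sim π q ρ s Y σ₅ := S₄.pure P₅ (by simp [Params.const])
    have T₅ : HoldsTask κ σ₅ := T₄.frame P₅.frame (by simp)
    refine wp_putT (x := sgn (ZMod π.P) κ.sg * (k * Y κ.sd ((j + π.w) % π.m))) S₅ hs T₅ hv
      (fun h => by rw [hi₀ h]) (fun h => (P₅.frame ptr (by simp)).trans (a₄ h)) ?_ ?_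
      fun σ₆ p₆ t₆ S₆ => ?_
    · rw [e₅]
      exact Nat.mod_lt _ (by omega)
    · rw [e₅, ZMod.natCast_mod]
      push_cast
      rw [e₄, e₂, e₃]
      ring
    · refine hQ σ₆ (fun x hx => ?_) ?_ S₆
      · simp only [edgeVars, List.mem_cons, List.not_mem_nil, or_false, not_or] at hx
        rw [p₆ x (by simp [hx]), P₅.frame x (by simp [hx]), p₄.frame x (by simp [hx]),
          p₃.frame x (by simp [hx]), f₂ x (by simp [hx])]
      · omega
  simp only [eval_pos, St.set_v, reduceCtorEq, if_false, T₁.sg]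
  cases hsg : κ.sg with
  | true =>
    simp only [Bool.toNat_true, Nat.lt_one_iff, pos_of_gt, if_true, wp_seq, wp_copy, wp_sub,
      St.set_v, reduceCtorEq, if_false, St.tick_v, vmd, e₁, Params.env_L]
    have e : (π.P + (2 ^ π.L - k)) % 2 ^ π.L = π.P - k := sub_wrap hkP.le hP
    refine wp_seq.1 (next _ ?_ ?_ ?_ ?_)
    · exact ((((Pure.refl _ _).set (by simp) _).tick).set (by simp) _).set (by simp) _
    · simp
    · simp [e]
    · simp [e, hsg, sgn, Nat.cast_sub hkP.le]
  | false =>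
    simp only [Bool.toNat_false, lt_irrefl, if_false, wp_skip]
    refine next _ ?_ ?_ ?_ ?_
    · exact ((((Pure.refl _ _).set (by simp) _).tick).set (by simp) _)
    · simp
    · simp [e₁, hkP.le]
    · simp [e₁, hsg, sgn]

end Code
end CatalyticGrid

namespace CatalyticGrid

open Var

set_option linter.unusedSimpArgs false

/-! ### Performing a task with one layer -/

section Push

open Matrix

variable {n : ℕ} {R : Type*} [CommRing R]

theorem push_congr {w m : ℕ} {κ : Task} {N N' : Matrix (Fin (n + 1)) (Fin (n + 1)) R}
    (h : ∀ i k : Fin (n + 1), κ.slo ≤ i + w → i + w < κ.shi → κ.tlo ≤ k + w → k + w < κ.thi →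
      N i k = N' i k) (Y : ℕ → ℕ → R) : push w m N κ Y = push w m N' κ Y := by
  have e : mask n R w κ.slo κ.shi * N * mask n R w κ.tlo κ.thi =
      mask n R w κ.slo κ.shi * N' * mask n R w κ.tlo κ.thi := by
    ext i k
    simp only [mask, mul_diagonal, diagonal_mul]
    by_cases h1 : κ.slo ≤ i + w ∧ i + w < κ.shi
    · by_cases h2 : κ.tlo ≤ k + w ∧ k + w < κ.thi
      · rw [h i k h1.1 h1.2 h2.1 h2.2]
      · simp [h2]
    · simp [h1]
  rw [push, push, e]

theorem push_single {w m : ℕ} {κ : Task} {j k : Fin (n + 1)} (c : R)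
    (h1 : κ.slo ≤ j + w) (h2 : j + w < κ.shi) (h3 : κ.tlo ≤ k + w) (h4 : k + w < κ.thi)
    (Y : ℕ → ℕ → R) : push w m (Matrix.single j k c) κ Y =
      entryUpdate κ c ((j + w) % m) ((k + w) % m) Y := by
  have e : mask n R w κ.slo κ.shi * Matrix.single j k c * mask n R w κ.tlo κ.thi =
      Matrix.single j k c := by
    ext i l
    simp only [mask, mul_diagonal, diagonal_mul, single_apply]
    by_cases h : j = i ∧ k = l
    · obtain ⟨rfl, rfl⟩ := h
      simp [h1, h2, h3, h4]
    · simp [h]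
  rw [push, e, entryUpdate]
  congr 1
  funext i
  rw [Pi.add_apply, Pi.smul_apply]
  congr 1
  have e2 : gather n w m (Y κ.sd) ᵥ* Matrix.single j k c =
      Pi.single k (c * Y κ.sd ((j + w) % m)) := by
    funext l
    rw [vecMul, dotProduct]
    simp only [single_apply, mul_ite, mul_zero]
    by_cases hl : k = l
    · subst hl
      simp [gather, mul_comm]
    · simp [hl, Pi.single_apply, Ne.symm hl]
  rw [e2, scatter, Finset.sum_eq_single k]
  · simp [eq_comm]
  · intro l _ hl
    simp [hl]
  · simp

/-- The entries of a matrix that precede the position `(r, c)`. -/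
def upTo (w : ℕ) (M : Matrix (Fin (n + 1)) (Fin (n + 1)) R) (r c : ℕ) :
    Matrix (Fin (n + 1)) (Fin (n + 1)) R :=
  fun i k => if i + w < r ∨ (i + w = r ∧ k + w < c) then M i k else 0

theorem upTo_succ {w : ℕ} (M : Matrix (Fin (n + 1)) (Fin (n + 1)) R) (j k : Fin (n + 1)) :
    upTo w M (j + w) (k + w + 1) = upTo w M (j + w) (k + w) + Matrix.single j k (M j k) := by
  ext i l
  simp only [upTo, Matrix.add_apply, single_apply, Fin.ext_iff]
  by_cases h : (j : ℕ) = i ∧ (k : ℕ) = l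
  · obtain ⟨h1, h2⟩ := h
    obtain rfl := Fin.ext h1
    obtain rfl := Fin.ext h2
    simp
  · rw [if_neg h, add_zero]
    split_ifs <;> first | rfl | omega

end Push

variable {π : Params} {q s : ℕ} {ρ : ℕ → ℕ} {Y : ℕ → ℕ → ZMod π.P} {D : List Bool → List Bool}
  {Q : St Var → Prop} {σ : St Var} {κ : Task} {μ : Vertex π.n → Vertex π.n → ℕ}

namespace Code

open Op Cond Prog Var

/-- Perform the update for the edge from `y` to `yy` if it exists and ends in the target. -/
def tryEdge : Prog Var :=
  ite (lt yy w) skip (ite (lt yy n1) (ite (lt yy tlo) skip (ite (lt yy thi) edge skip)) skip)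

theorem wp_tryEdge {j : Fin (π.n + 1)} {c : ℕ} (hD : IsWeightOracle μ π.p D) (hs : s < 2 ^ π.L)
    (ht : HoldsTask κ σ) (hv : κ.Valid π) (hq : 20 * π.L = q) (hy : σ.v y = j + π.w)
    (hyy : σ.v yy = c) (h1 : κ.slo ≤ j + π.w) (h2 : j + π.w < κ.shi) (hc1 : j + π.w ≤ c + 1)
    (hc2 : c ≤ j + π.w + 1)
    (h : Sim π q ρ s (push π.w π.m (upTo π.w (reducedMatrix (ZMod π.P) μ π.p κ.lay) (j + π.w) c)
      κ Y) σ)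
    (hQ : ∀ σ', Frame edgeVars σ σ' → σ'.time ≤ σ.time + (150 * π.L + 104) →
      Sim π q ρ s (push π.w π.m (upTo π.w (reducedMatrix (ZMod π.P) μ π.p κ.lay) (j + π.w) (c + 1))
        κ Y) σ' → Q σ') : wp (π.env D) tryEdge Q σ := by
  have vw : σ.v w = π.w := h.holds w _ rfl
  have vn1 : σ.v n1 = π.n + π.w + 1 := h.holds n1 _ rfl
  have skip_of : ∀ σ₁, Pure [] σ σ₁ → σ₁.time ≤ σ.time + 4 →
      (∀ k : Fin (π.n + 1), κ.tlo ≤ k + π.w → k + π.w < κ.thi → k + π.w ≠ c) →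
      wp (π.env D) skip Q σ₁ := by
    intro σ₁ p₁ t₁ hk
    rw [wp_skip]
    have p₂ : Pure [mq] σ (σ₁.set mq (σ₁.v mq)) := (p₁.mono (by simp)).set (by simp) _
    refine hQ _ (fun x hx => p₂.frame x ?_) (by simp; omega) ?_
    · simp only [edgeVars, List.mem_cons, List.not_mem_nil, or_false, not_or] at hx
      simp [hx]
    · have e := push_congr (w := π.w) (m := π.m) (κ := κ)
        (N := upTo π.w (reducedMatrix (ZMod π.P) μ π.p κ.lay) (j + π.w) c)
        (N' := upTo π.w (reducedMatrix (ZMod π.P) μ π.p κ.lay) (j + π.w) (c + 1))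
        (fun i k _ _ g1 g2 => by
          have := hk k g1 g2
          simp only [upTo]
          split_ifs <;> first | rfl | omega) Y
      rw [← e]
      exact h.pure p₂ (by simp [Params.const])
  rw [tryEdge, wp_ite]
  simp only [eval_lt, hyy, vw]
  split_ifs with c1
  · exact skip_of _ (Pure.refl _ _).tick (by simp) fun k _ _ => by omega
  rw [wp_ite]
  simp only [eval_lt, St.tick_v, hyy, vn1]
  split_ifs with c2
  swap
  · exact skip_of _ (Pure.refl _ _).tick.tick (by simp) fun k _ _ => by omega
  rw [wp_ite]
  simp only [eval_lt, St.tick_v, hyy, ht.tlo]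
  split_ifs with c3
  · exact skip_of _ (Pure.refl _ _).tick.tick.tick (by simp) fun k _ _ => by omega
  rw [wp_ite]
  simp only [eval_lt, St.tick_v, hyy, ht.thi]
  split_ifs with c4
  swap
  · exact skip_of _ (Pure.refl _ _).tick.tick.tick.tick (by simp) fun k _ _ => by omega
  obtain ⟨k, rfl⟩ : ∃ k : Fin (π.n + 1), (k : ℕ) + π.w = c := ⟨⟨c - π.w, by omega⟩, by simp; omega⟩
  have pure₀ : Pure [] σ σ.tick.tick.tick.tick := (Pure.refl _ _).tick.tick.tick.tick
  have hlay := hv.lay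
  have hk' : (k : ℕ) = j ∨ (k : ℕ) = j + 1 ∨ (j : ℕ) = k + 1 := by omega
  have hM : reducedMatrix (ZMod π.P) μ π.p κ.lay j k =
      ((μ (⟨κ.lay, by omega⟩, j) (⟨κ.lay + 1, by omega⟩, k) % π.p : ℕ) : ZMod π.P) := by
    rw [reducedMatrix, layerMatrix, dif_pos ⟨hlay, hk'⟩]
  refine wp_edge (j := j) (j' := k) (h.pure pure₀ (by simp)) hs (ht.frame pure₀.frame (by simp)) hv
    hq (by simpa using hy) (by simpa using hyy) (by omega) (by omega) (fun h0 => ?_)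
    (hD (⟨κ.lay, by omega⟩, j) (⟨κ.lay + 1, by omega⟩, k) ⟨rfl, hk'⟩)
    (Nat.mod_lt _ (by have := π.two_le_p; omega)) fun σ' f' t' s' => hQ σ' f' ?_ ?_
  · have e1 := hv.tlo h0
    have e2 := hv.thi h0
    omega
  · simp only [St.tick_time] at t'
    omega
  · rw [upTo_succ, ← push_push hv.ne, push_single _ h1 h2 (by omega) (by omega), hM]
    exact s'

/-- Perform the updates for the edges from `y`. -/
def row : Prog Var :=
  ite (lt y slo) skip (ite (lt y shi)
    (op (copy yy y) ;; op (dec yy) ;; tryEdge ;; op (inc yy) ;; tryEdge ;; op (inc yy) ;; tryEdge)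
    skip)

/-- The variables that a task changes. -/
def rowVars : List Var := yy :: edgeVars

theorem wp_row {j : Fin (π.n + 1)} (hD : IsWeightOracle μ π.p D) (hs : s < 2 ^ π.L)
    (ht : HoldsTask κ σ) (hv : κ.Valid π) (hq : 20 * π.L = q) (hy : σ.v y = j + π.w)
    (h : Sim π q ρ s (push π.w π.m (upTo π.w (reducedMatrix (ZMod π.P) μ π.p κ.lay) (j + π.w) 0)
      κ Y) σ)
    (hQ : ∀ σ', Frame rowVars σ σ' → σ'.time ≤ σ.time + (450 * π.L + 320) →
      Sim π q ρ s (push π.w π.m (upTo π.w (reducedMatrix (ZMod π.P) μ π.p κ.lay) (j + π.w + 1) 0)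
        κ Y) σ' → Q σ') : wp (π.env D) row Q σ := by
  have skip_of : ∀ σ₁, Pure [] σ σ₁ → σ₁.time ≤ σ.time + 4 →
      (¬ (κ.slo ≤ j + π.w ∧ j + π.w < κ.shi)) → wp (π.env D) skip Q σ₁ := by
    intro σ₁ p₁ t₁ hk
    rw [wp_skip]
    have p₂ : Pure [mq] σ (σ₁.set mq (σ₁.v mq)) := (p₁.mono (by simp)).set (by simp) _
    refine hQ _ (fun x hx => p₂.frame x ?_) (by simp; omega) ?_
    · simp only [rowVars, edgeVars, List.mem_cons, List.not_mem_nil, or_false, not_or] at hx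
      simp [hx]
    · have e := push_congr (w := π.w) (m := π.m) (κ := κ)
        (N := upTo π.w (reducedMatrix (ZMod π.P) μ π.p κ.lay) (j + π.w) 0)
        (N' := upTo π.w (reducedMatrix (ZMod π.P) μ π.p κ.lay) (j + π.w + 1) 0)
        (fun i k g1 g2 _ _ => by
          have : (i : ℕ) ≠ j := fun he => hk (by omega)
          simp only [upTo]
          split_ifs <;> first | rfl | omega) Y
      rw [← e]
      exact h.pure p₂ (by simp [Params.const])
  rw [row, wp_ite]
  simp only [eval_lt, hy, ht.slo]
  split_ifs with c1
  · exact skip_of _ (Pure.refl _ _).tick (by simp) (by omega)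
  rw [wp_ite]
  simp only [eval_lt, St.tick_v, hy, ht.shi]
  split_ifs with c2
  swap
  · exact skip_of _ (Pure.refl _ _).tick.tick (by simp) (by omega)
  have hw := π.w_pos
  have hsz := π.size'
  have hP := π.P_lt
  have hj := j.2
  simp only [wp_seq, wp_copy, wp_dec, St.set_v, if_true, St.tick_v, hy, Params.env_L]
  have ed : (j + π.w + (2 ^ π.L - 1)) % 2 ^ π.L = j + π.w - 1 := sub_wrap (by omega) (by omega)
  rw [ed]
  have p₀ : Pure [yy] σ ((σ.tick.tick.set yy (j + π.w)).set yy (j + π.w - 1)) :=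
    ((Pure.refl _ _).tick.tick.set (by simp) _).set (by simp) _
  have e₀ : upTo π.w (reducedMatrix (ZMod π.P) μ π.p κ.lay) (j + π.w) 0 =
      upTo π.w (reducedMatrix (ZMod π.P) μ π.p κ.lay) (j + π.w) (j + π.w - 1) := by
    ext i k
    simp only [upTo]
    have := reducedMatrix_tridiagonal (R := ZMod π.P) μ π.p κ.lay i k
    by_cases hz : reducedMatrix (ZMod π.P) μ π.p κ.lay i k = 0
    · simp [hz]
    · have := this hz
      split_ifs <;> first | rfl | omega
  have e₃ : upTo π.w (reducedMatrix (ZMod π.P) μ π.p κ.lay) (j + π.w) (j + π.w + 1 + 1) =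
      upTo π.w (reducedMatrix (ZMod π.P) μ π.p κ.lay) (j + π.w + 1) 0 := by
    ext i k
    simp only [upTo]
    have := reducedMatrix_tridiagonal (R := ZMod π.P) μ π.p κ.lay i k
    by_cases hz : reducedMatrix (ZMod π.P) μ π.p κ.lay i k = 0
    · simp [hz]
    · have := this hz
      split_ifs <;> first | rfl | omega
  have S₀ := h.pure p₀ (by simp [Params.const])
  rw [e₀] at S₀
  have T₀ := ht.frame p₀.frame (by simp)
  refine wp_tryEdge (c := j + π.w - 1) hD hs T₀ hv hq (by simpa using hy) (by simp) (by omega) c2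
    (by omega) (by omega) S₀ fun σ₁ f₁ t₁ s₁ => ?_
  rw [Nat.sub_add_cancel (by omega)] at s₁
  have g₁ : ∀ x, x ∉ rowVars → σ₁.v x = σ.v x := fun x hx => by
    simp only [rowVars, List.mem_cons, not_or] at hx
    rw [f₁ x hx.2, p₀.frame x (by simp [hx.1])]
  have y₁ : σ₁.v yy = j + π.w - 1 := by rw [f₁ yy (by simp [edgeVars])]; simp
  have T₁ : HoldsTask κ σ₁ := T₀.frame f₁ (by simp [edgeVars])
  have i₁ : (j + π.w - 1 + 1) % 2 ^ π.L = j + π.w := by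
    rw [Nat.sub_add_cancel (by omega), Nat.mod_eq_of_lt (by omega)]
  rw [wp_seq, wp_inc, wp_seq, y₁, Params.env_L, i₁]
  have p₁ : Pure [yy] σ₁ (σ₁.set yy (j + π.w)) := (Pure.refl _ _).set (by simp) _
  have T₁' := T₁.frame p₁.frame (by simp)
  refine wp_tryEdge (c := j + π.w) hD hs T₁' hv hq (by simp [g₁ y (by simp [rowVars, edgeVars]), hy])
    (by simp) (by omega) c2 (by omega) (by omega) (s₁.pure p₁ (by simp [Params.const]))
    fun σ₂ f₂ t₂ s₂ => ?_
  have g₂ : ∀ x, x ∉ rowVars → σ₂.v x = σ.v x := fun x hx => by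
    rw [← g₁ x hx]
    simp only [rowVars, List.mem_cons, not_or] at hx
    rw [f₂ x hx.2, p₁.frame x (by simp [hx.1])]
  have y₂ : σ₂.v yy = j + π.w := by rw [f₂ yy (by simp [edgeVars])]; simp
  have T₂ : HoldsTask κ σ₂ := T₁'.frame f₂ (by simp [edgeVars])
  have i₂ : (j + π.w + 1) % 2 ^ π.L = j + π.w + 1 := Nat.mod_eq_of_lt (by omega)
  rw [wp_seq, wp_inc, y₂, Params.env_L, i₂]
  have p₂ : Pure [yy] σ₂ (σ₂.set yy (j + π.w + 1)) := (Pure.refl _ _).set (by simp) _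
  have T₂' := T₂.frame p₂.frame (by simp)
  refine wp_tryEdge (c := j + π.w + 1) hD hs T₂' hv hq
    (by simp [g₂ y (by simp [rowVars, edgeVars]), hy])
    (by simp) (by omega) c2 (by omega) (by omega) (s₂.pure p₂ (by simp [Params.const]))
    fun σ₃ f₃ t₃ s₃ => ?_
  rw [e₃] at s₃
  refine hQ σ₃ (fun x hx => ?_) ?_ s₃
  · rw [← g₂ x hx]
    simp only [rowVars, List.mem_cons, not_or] at hx
    rw [f₃ x hx.2, p₂.frame x (by simp [hx.1])]
  · simp only [St.set_time, St.tick_time] at t₁ t₂ t₃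
    omega

/-- Perform a task. -/
def leaf : Prog Var := op (copy y w) ;; loop (lt y n1) (row ;; op (inc y))

theorem wp_leaf (hD : IsWeightOracle μ π.p D) (hs : s < 2 ^ π.L) (ht : HoldsTask κ σ)
    (hv : κ.Valid π) (hq : 20 * π.L = q) (h : Sim π q ρ s Y σ)
    (hQ : ∀ σ', Frame (y :: rowVars) σ σ' →
      σ'.time ≤ σ.time + ((π.n + 1) * (450 * π.L + 322) + 2) →
      Sim π q ρ s (push π.w π.m (reducedMatrix (ZMod π.P) μ π.p κ.lay) κ Y) σ' → Q σ') :
    wp (π.env D) leaf Q σ := by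
  have hsz := π.size'
  have hP := π.P_lt
  have vw : σ.v w = π.w := h.holds w _ rfl
  rw [leaf, wp_seq, wp_copy, vw]
  refine wp_loop_of (fun k σ' => k ≤ π.n + 1 ∧ Frame (y :: rowVars) σ σ' ∧
    σ'.time + k * (450 * π.L + 322) ≤ σ.time + ((π.n + 1) * (450 * π.L + 322) + 1) ∧
    σ'.v y = π.n + 1 - k + π.w ∧
    Sim π q ρ s (push π.w π.m (upTo π.w (reducedMatrix (ZMod π.P) μ π.p κ.lay)
      (π.n + 1 - k + π.w) 0) κ Y) σ') ?_ ?_ (π.n + 1) ?_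
  · rintro k σ₁ ⟨hk, f, t, e, S⟩
    have vn1 : σ₁.v n1 = π.n + π.w + 1 := S.holds n1 _ rfl
    refine ⟨by simp [e, vn1], ?_⟩
    rw [wp_seq]
    have T₁ : HoldsTask κ σ₁.tick := (ht.frame f (by simp [rowVars, edgeVars]))
    have p₁ : Pure [] σ₁ σ₁.tick := (Pure.refl _ _).tick
    refine wp_row (ρ := ρ) (Y := Y) (j := ⟨π.n - k, by omega⟩) hD hs T₁ hv hq ?_ ?_ fun σ₂ f₂ t₂ S₂ => ?_
    · simp only [St.tick_v, e]
      omega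
    · rw [show π.n - k + π.w = π.n + 1 - (k + 1) + π.w by omega]
      exact S.pure p₁ (by simp)
    · have y₂ : σ₂.v y = π.n + 1 - (k + 1) + π.w := by
        rw [f₂ y (by simp [rowVars, edgeVars])]
        exact e
      have i₂ : (π.n + 1 - (k + 1) + π.w + 1) % 2 ^ π.L = π.n + 1 - k + π.w := by
        rw [Nat.mod_eq_of_lt (by omega)]
        omega
      rw [wp_inc, y₂, Params.env_L, i₂]
      refine ⟨by omega, fun x hx => ?_, ?_, by simp, ?_⟩
      · rw [← f x hx]
        simp only [List.mem_cons, not_or] at hx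
        simp only [St.set_v, if_neg hx.1, f₂ x hx.2, St.tick_v]
      · simp only [St.set_time, St.tick_time] at t₂ ⊢
        rw [Nat.succ_mul] at t
        omega
      · rw [show π.n - k + π.w + 1 = π.n + 1 - k + π.w by omega] at S₂
        exact S₂.pure ((Pure.refl _ _).set (S := [y]) (by simp) _) (by simp [Params.const])
  · rintro σ₁ ⟨-, f, t, e, S⟩
    have vn1 : σ₁.v n1 = π.n + π.w + 1 := S.holds n1 _ rfl
    refine ⟨by simp [Cond.eval, e, vn1], hQ _ f (by simp; omega) ?_⟩
    have e' : upTo π.w (reducedMatrix (ZMod π.P) μ π.p κ.lay) (π.n + 1 - 0 + π.w) 0 =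
        reducedMatrix (ZMod π.P) μ π.p κ.lay := by
      ext i k
      rw [upTo, if_pos (by omega)]
    rw [e'] at S
    exact S.pure (Pure.refl [] _).tick (by simp)
  · refine ⟨le_rfl, fun x hx => ?_, by simp; omega, by simp, ?_⟩
    · simp only [List.mem_cons, not_or] at hx
      simp [hx]
    · have e' : push π.w π.m (upTo π.w (reducedMatrix (ZMod π.P) μ π.p κ.lay)
          (π.n + 1 - (π.n + 1) + π.w) 0) κ Y = Y := by
        have : upTo π.w (reducedMatrix (ZMod π.P) μ π.p κ.lay) (π.n + 1 - (π.n + 1) + π.w) 0 =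
            0 := by
          ext i k
          rw [upTo, if_neg (by omega)]
          rfl
        rw [this, push_zero]
      rw [e']
      exact h.pure ((Pure.refl _ _).set (S := [y]) (by simp) _) (by simp [Params.const])

end Code
end CatalyticGrid

namespace CatalyticGrid

open Var

set_option linter.unusedSimpArgs false

/-! ### Decoding the counter -/

theorem counterBits_mono (h g : ℕ) {d d' : ℕ} (hd : d ≤ d') :
    counterBits h g d ≤ counterBits h g d' := by
  induction hd with
  | refl => rfl
  | step _ ih => exact ih.trans (Nat.le_add_right _ _)

/-- What holds of the tasks at level `d`. -/
structure Task.Inv (π : Params) (d : ℕ) (κ : Task) : Prop where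
  lt_sd : d < κ.sd
  sd_le : κ.sd ≤ π.a + 1
  td_le : κ.td ≤ π.a
  lt_td : κ.td = 0 ∨ d < κ.td
  ne : κ.sd ≠ κ.td
  tlo : κ.td = 0 → κ.tlo = π.v2 + π.w
  thi : κ.td = 0 → κ.thi = π.v2 + π.w + 1
  lay : κ.lay + 2 ^ d ≤ π.n
  w_le : π.w ≤ κ.cen
  cen_le : κ.cen ≤ 2 * π.n + π.w

variable {π : Params} {κ : Task}

theorem Task.Inv.valid (h : κ.Inv π 0) : κ.Valid π where
  sd_pos := h.lt_sd
  sd_le := h.sd_le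
  td_le := h.td_le
  ne := h.ne
  tlo := h.tlo
  thi := h.thi
  lay := by simpa using h.lay

theorem Params.block_le {T d : ℕ} (hT : T < 2 ^ digitBits π.h π.g d) (hd : π.h < d) :
    T / 4 * π.w + π.w ≤ 2 * π.n := by
  rw [digitBits, if_pos hd, pow_add] at hT
  have h1 : T / 4 + 1 ≤ 2 ^ π.g := by omega
  calc T / 4 * π.w + π.w = (T / 4 + 1) * π.w := by ring
    _ ≤ 2 ^ π.g * 2 ^ π.h := Nat.mul_le_mul_right _ h1
    _ = 2 ^ π.b := by rw [← pow_add, add_comm, π.b_eq]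
    _ ≤ 2 * π.n := π.le_n

theorem Task.Inv.child {d T : ℕ} (h : κ.Inv π (d + 1)) (hd : d + 1 ≤ π.a)
    (hT : T < 2 ^ digitBits π.h π.g (d + 1)) : (κ.child π.h (d + 1) T).Inv π d := by
  have e1 := h.lt_sd
  have e2 := h.lt_td
  have e3 := h.lay
  rw [pow_succ] at e3
  rw [Task.child]
  split_ifs with h1 h2
  · exact ⟨by simp, by simp; omega, h.td_le, by simp; omega, by simp; omega, h.tlo, h.thi,
      by simp; omega, by simp [Params.w],
      (Params.block_le hT h2).trans (Nat.le_add_right _ _)⟩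
  · exact ⟨by simp, by simp; omega, h.td_le, by simp; omega, by simp; omega, h.tlo, h.thi,
      by simp; omega, h.w_le, h.cen_le⟩
  all_goals exact ⟨by simp; omega, h.sd_le, hd, by simp, by simp; omega, by simp, by simp,
      by simp; omega, h.w_le, h.cen_le⟩

namespace Code

open Op Cond Prog Var

variable {D : List Bool → List Bool} {Q : St Var → Prop} {σ : St Var}

/-- Split off the `cnt` leading digits of `c`. -/
def shift : Prog Var :=
  op (zero tp) ;; loop (pos cnt)
    (op (add tp tp) ;; ite (lt c hb) skip (op (inc tp)) ;; op (add c c) ;; op (dec cnt))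

theorem wp_shift {c₀ k : ℕ} (hh : π.Holds σ) (hc : σ.v c = c₀) (hc₀ : c₀ < 2 ^ π.L)
    (hcnt : σ.v cnt = k) (hk : k ≤ π.L)
    (hQ : ∀ σ', Pure [tp, c, cnt, mq] σ σ' → σ'.time ≤ σ.time + (6 * π.L + 2) →
      σ'.v tp = c₀ * 2 ^ k / 2 ^ π.L → σ'.v c = c₀ * 2 ^ k % 2 ^ π.L → Q σ') :
    wp (π.env D) shift Q σ := by
  have hL := π.L_pos
  have hkL : 2 ^ k ≤ 2 ^ π.L := Nat.pow_le_pow_right (by norm_num) hk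
  have hP : 0 < 2 ^ π.L := by positivity
  have hhb : 2 ^ π.L = 2 * 2 ^ (π.L - 1) := by rw [← pow_succ']; congr 1; omega
  have hlt : k < 2 ^ π.L := lt_of_le_of_lt hk Nat.lt_two_pow_self
  rw [shift, wp_seq, wp_zero]
  refine wp_loop_of (fun j σ' => j ≤ k ∧ Pure [tp, c, cnt, mq] σ σ' ∧
    σ'.time + 6 * j ≤ σ.time + (6 * k + 1) ∧ σ'.v cnt = j ∧ σ'.v c < 2 ^ π.L ∧
    (σ'.v tp * 2 ^ π.L + σ'.v c) * 2 ^ j = c₀ * 2 ^ k) ?_ ?_ k ?_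
  · rintro j σ₁ ⟨h1, p, t, e, hlt₁, he⟩
    have vhb : σ₁.v hb = 2 ^ (π.L - 1) := by
      rw [p.frame hb (by simp)]
      exact hh hb _ rfl
    have bound : ∀ x y : ℕ, (x * 2 ^ π.L + y) * 2 ^ j = c₀ * 2 ^ k → x < 2 ^ π.L := by
      intro x y hxy
      by_contra hx
      have h2 : c₀ * 2 ^ k < 2 ^ π.L * 2 ^ π.L :=
        lt_of_lt_of_le (Nat.mul_lt_mul_of_pos_right hc₀ (by positivity))
          (Nat.mul_le_mul_left _ hkL)
      have h3 : 2 ^ π.L * 2 ^ π.L ≤ x * 2 ^ π.L := Nat.mul_le_mul_right _ (by omega)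
      have h4 : x * 2 ^ π.L + y ≤ (x * 2 ^ π.L + y) * 2 ^ j :=
        Nat.le_mul_of_pos_right _ (by positivity)
      omega
    refine ⟨by simp [e], ?_⟩
    rw [wp_seq, wp_add, wp_seq, wp_ite]
    simp only [eval_lt, St.set_v, reduceCtorEq, if_false, if_true, St.tick_v, vhb, Params.env_L]
    rw [pow_succ] at he
    have dec : (j + 1 + (2 ^ π.L - 1)) % 2 ^ π.L = j := by
      rw [sub_wrap (by omega) (by omega)]
      omega
    split_ifs with hc1
    · have h5 : ((σ₁.v tp + σ₁.v tp) * 2 ^ π.L + (σ₁.v c + σ₁.v c)) * 2 ^ j = c₀ * 2 ^ k := by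
        rw [← he]
        ring
      have h6 := bound _ _ h5
      have e1 : (σ₁.v tp + σ₁.v tp) % 2 ^ π.L = σ₁.v tp + σ₁.v tp := Nat.mod_eq_of_lt h6
      have e2 : (σ₁.v c + σ₁.v c) % 2 ^ π.L = σ₁.v c + σ₁.v c := Nat.mod_eq_of_lt (by omega)
      simp only [wp_skip, wp_seq, wp_add, wp_dec, St.set_v, reduceCtorEq, if_false, if_true,
        St.tick_v, Params.env_L, e1, e2, e, dec]
      refine ⟨by omega, ?_, ?_, by simp, ?_, ?_⟩
      · exact ((((p.tick.set (by simp) _).tick).set (by simp) _).set (by simp) _).set (by simp) _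
      · simp only [St.set_time, St.tick_time]
        omega
      · omega
      · exact h5
    · have h5 : ((σ₁.v tp + σ₁.v tp + 1) * 2 ^ π.L + (σ₁.v c + σ₁.v c - 2 ^ π.L)) * 2 ^ j =
          c₀ * 2 ^ k := by
        rw [← he, show (σ₁.v tp + σ₁.v tp + 1) * 2 ^ π.L + (σ₁.v c + σ₁.v c - 2 ^ π.L) =
          (σ₁.v tp + σ₁.v tp) * 2 ^ π.L + (σ₁.v c + σ₁.v c) by
            rw [Nat.succ_mul]
            omega]
        ring
      have h6 := bound _ _ h5
      have e1 : (σ₁.v tp + σ₁.v tp) % 2 ^ π.L = σ₁.v tp + σ₁.v tp := Nat.mod_eq_of_lt (by omega)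
      have e1' : (σ₁.v tp + σ₁.v tp + 1) % 2 ^ π.L = σ₁.v tp + σ₁.v tp + 1 := Nat.mod_eq_of_lt h6
      have e2 : (σ₁.v c + σ₁.v c) % 2 ^ π.L = σ₁.v c + σ₁.v c - 2 ^ π.L := by
        rw [Nat.mod_eq_sub_mod (by omega), Nat.mod_eq_of_lt (by omega)]
      simp only [wp_inc, wp_seq, wp_add, wp_dec, St.set_v, reduceCtorEq, if_false, if_true,
        St.tick_v, Params.env_L, e1, e1', e2, e, dec]
      refine ⟨by omega, ?_, ?_, by simp, ?_, ?_⟩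
      · exact ((((p.tick.set (by simp) _).tick).set (by simp) _).set (by simp) _).set (by simp) _
      · simp only [St.set_time, St.tick_time]
        omega
      · omega
      · exact h5
  · rintro σ₁ ⟨-, p, t, e, hlt₁, he⟩
    rw [pow_zero, mul_one] at he
    refine ⟨by simp [Cond.eval, e], hQ _ p.tick (by simp; omega) ?_ ?_⟩
    · rw [← he, St.tick_v, mul_comm, Nat.mul_add_div hP, Nat.div_eq_of_lt hlt₁, add_zero]
    · rw [← he, St.tick_v, mul_comm, Nat.mul_add_mod, Nat.mod_eq_of_lt hlt₁]
  · exact ⟨le_rfl, (Pure.refl _ _).set (by simp) _, by simp; omega, by simpa, by simpa [hc],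
      by simp [hc]⟩

/-- Compute the interval that the digit `tp` selects. -/
def window : Prog Var :=
  ite (lt h d)
    (op (copy ma kq) ;; op (half ma) ;; op (zero ac) ;; op (copy mx w) ;; op (copy mm md) ;; mul ;;
      op (copy lo ac) ;; op (add lo w) ;; op (copy hi lo) ;; op (add hi w))
    (op (copy lo cen) ;; op (sub lo w) ;; op (copy hi cen) ;; op (add hi w) ;; op (add hi w))

theorem wp_window {d₀ T : ℕ} (hh : π.Holds σ) (hd : σ.v d = d₀) (hT : σ.v kq = T / 2)
    (hcen : σ.v cen = κ.cen) (hw : π.w ≤ κ.cen) (hcen' : κ.cen ≤ 2 * π.n + π.w)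
    (hT' : T < 2 ^ digitBits π.h π.g d₀)
    (hQ : ∀ σ', Pure [ma, ac, mx, mm, mq, lo, hi] σ σ' → σ'.time ≤ σ.time + (11 * π.L + 11) →
      σ'.v lo = (if π.h < d₀ then T / 4 * π.w + π.w else κ.cen - π.w) →
      σ'.v hi = (if π.h < d₀ then T / 4 * π.w + π.w + π.w else κ.cen + π.w + π.w) → Q σ') :
    wp (π.env D) window Q σ := by
  have hP := π.P_lt
  have hsz := π.size'
  have hwp := π.w_pos
  have vh : σ.v h = π.h := hh h _ rfl
  have vw : σ.v w = π.w := hh w _ rfl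
  have vmd : σ.v md = π.P := hh md _ rfl
  rw [window, wp_ite]
  simp only [eval_lt, vh, hd]
  split_ifs with hc
  · rw [if_pos hc, if_pos hc] at hQ
    have hb := Params.block_le hT' hc
    have h4 : T / 2 / 2 = T / 4 := by omega
    have h5 : T / 4 ≤ T / 4 * π.w := Nat.le_mul_of_pos_right _ hwp
    simp only [wp_seq, wp_copy, wp_half, wp_zero, St.set_v, reduceCtorEq, if_false, if_true,
      St.tick_v, vw, vmd, hT, h4]
    refine wp_mul (by simpa) (by simp; omega) (by simp; omega) (by simp; omega)
      fun σ₁ p₁ t₁ e₁ => ?_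
    simp only [St.set_v, reduceCtorEq, if_false, if_true, St.set_time, St.tick_time, Params.env_L,
      zero_add] at e₁ t₁
    rw [Nat.mod_eq_of_lt (by omega)] at e₁
    have vw₁ : σ₁.v w = π.w := by rw [p₁.frame w (by simp)]; simp [vw]
    have e2 : (T / 4 * π.w + π.w) % 2 ^ π.L = T / 4 * π.w + π.w := Nat.mod_eq_of_lt (by omega)
    have e3 : (T / 4 * π.w + π.w + π.w) % 2 ^ π.L = T / 4 * π.w + π.w + π.w :=
      Nat.mod_eq_of_lt (by omega)
    simp only [wp_seq, wp_copy, wp_add, St.set_v, reduceCtorEq, if_false, if_true, e₁, vw₁, e2, e3,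
      Params.env_L]
    refine hQ _ ?_ (by simp only [St.set_time]; omega) (by simp) (by simp)
    have : Pure [ma, ac, mx, mm, mq, lo, hi] σ σ₁ := by
      refine Pure.trans ?_ (p₁.mono (by simp))
      exact ((((((Pure.refl _ _).tick).set (by simp) _).set (by simp) _).set (by simp) _).set
        (by simp) _).set (by simp) _
    exact (((this.set (by simp) _).set (by simp) _).set (by simp) _).set (by simp) _
  · rw [if_neg hc, if_neg hc] at hQ
    have e1 : (κ.cen + (2 ^ π.L - π.w)) % 2 ^ π.L = κ.cen - π.w := sub_wrap hw (by omega)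
    have e2 : (κ.cen + π.w) % 2 ^ π.L = κ.cen + π.w := Nat.mod_eq_of_lt (by omega)
    have e3 : (κ.cen + π.w + π.w) % 2 ^ π.L = κ.cen + π.w + π.w := Nat.mod_eq_of_lt (by omega)
    simp only [wp_seq, wp_copy, wp_sub, wp_add, St.set_v, reduceCtorEq, if_false, if_true,
      St.tick_v, vw, hcen, e1, e2, e3, Params.env_L]
    refine hQ _ ?_ (by simp only [St.set_time, St.tick_time]; omega) (by simp) (by simp)
    exact ((((((Pure.refl _ _).tick).set (by simp) _).set (by simp) _).set (by simp) _).set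
        (by simp) _).set (by simp) _

/-- Negate `sg` if `kq` is odd. -/
def toggle : Prog Var :=
  ite (odd kq) (ite (pos sg) (op (zero sg)) (op (zero sg) ;; op (inc sg))) skip

theorem wp_toggle {b : Bool} {T : ℕ} (hT : σ.v kq = T) (hb : σ.v sg = b.toNat)
    (hQ : ∀ σ', Pure [sg, mq] σ σ' → σ'.time ≤ σ.time + 4 →
      σ'.v sg = (b ^^ decide (T % 2 = 1)).toNat → Q σ') : wp (π.env D) toggle Q σ := by
  have h1 : 1 % 2 ^ π.L = 1 := Nat.mod_eq_of_lt (Nat.one_lt_two_pow π.L_pos.ne')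
  rw [toggle, wp_ite]
  simp only [eval_odd, hT]
  split_ifs with hc
  · rw [wp_ite]
    simp only [eval_pos, St.tick_v, hb]
    cases b with
    | true =>
      rw [if_pos (by simp), wp_zero]
      exact hQ _ ((Pure.refl _ _).tick.tick.set (by simp) _) (by simp) (by simp [hc])
    | false =>
      rw [if_neg (by simp), wp_seq, wp_zero, wp_inc]
      exact hQ _ (((Pure.refl _ _).tick.tick.set (by simp) _).set (by simp) _) (by simp)
        (by simp [hc, h1])
  · rw [wp_skip]
    exact hQ _ ((Pure.refl _ _).tick.set (by simp) _) (by simp) (by simp [hc, hb])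

/-- Select the subtask. -/
def select : Prog Var :=
  ite (odd tp)
    (op (copy sd d) ;; op (copy slo lo) ;; op (copy shi hi) ;; op (add lay pw) ;;
      ite (lt h d) (op (copy cen lo)) skip ;; toggle)
    (op (copy td d) ;; op (copy tlo lo) ;; op (copy thi hi) ;; op (zero sg) ;; toggle)

theorem wp_select {d₀ T : ℕ} (hh : π.Holds σ) (hd : σ.v d = d₀ + 1) (hT : σ.v kq = T / 2)
    (htp : σ.v tp = T) (ht : HoldsTask κ σ) (hlay : κ.lay + 2 ^ d₀ < 2 ^ π.L)
    (hpw : σ.v pw = 2 ^ d₀)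
    (hlo : σ.v lo = (if π.h < d₀ + 1 then T / 4 * π.w + π.w else κ.cen - π.w))
    (hhi : σ.v hi = (if π.h < d₀ + 1 then T / 4 * π.w + π.w + π.w else κ.cen + π.w + π.w))
    (hQ : ∀ σ', Pure [sd, slo, shi, td, tlo, thi, cen, lay, sg, mq] σ σ' →
      σ'.time ≤ σ.time + 11 → HoldsTask (κ.child π.h (d₀ + 1) T) σ' → Q σ') :
    wp (π.env D) select Q σ := by
  have vh : σ.v h = π.h := hh h _ rfl
  obtain ⟨t1, t2, t3, t4, t5, t6, t7, t8, t9⟩ := ht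
  have e8 : (κ.lay + 2 ^ d₀) % 2 ^ π.L = κ.lay + 2 ^ d₀ := Nat.mod_eq_of_lt hlay
  rw [select, wp_ite]
  simp only [eval_odd, htp]
  by_cases hc : T % 2 = 1
  · rw [if_pos hc]
    simp only [wp_seq, wp_copy, wp_add, wp_ite, wp_skip, eval_lt, St.set_v, St.tick_v, reduceCtorEq,
      if_false, if_true, hd, hpw, vh, t8, e8, Params.env_L]
    have fin : ∀ (σ₁ : St Var), Pure [sd, slo, shi, td, tlo, thi, cen, lay, sg, mq] σ σ₁ →
        σ₁.time ≤ σ.time + 7 → σ₁.v sd = d₀ + 1 →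
        σ₁.v slo = (if π.h < d₀ + 1 then T / 4 * π.w + π.w else κ.cen - π.w) →
        σ₁.v shi = (if π.h < d₀ + 1 then T / 4 * π.w + π.w + π.w else κ.cen + π.w + π.w) →
        σ₁.v lay = κ.lay + 2 ^ d₀ → σ₁.v sg = κ.sg.toNat →
        σ₁.v td = κ.td → σ₁.v tlo = κ.tlo → σ₁.v thi = κ.thi →
        σ₁.v cen = (if π.h < d₀ + 1 then T / 4 * π.w + π.w else κ.cen) →
        wp (π.env D) toggle Q σ₁ := by
      intro σ₁ p₁ q₀ q₁ q₂ q₃ q₄ q₅ q₆ q₇ q₈ q₉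
      refine wp_toggle ((p₁.frame kq (by simp)).trans hT) q₅ fun σ₂ p₂ r₂ s₂ => ?_
      have e : ∀ x, x ≠ sg → x ≠ mq → σ₂.v x = σ₁.v x := fun x h1 h2 =>
        p₂.frame x (by simp [h1, h2])
      refine hQ σ₂ (p₁.trans (p₂.mono (by simp))) (by omega) ?_
      rw [Task.child, if_pos hc]
      exact ⟨(e _ (by simp) (by simp)).trans q₁, (e _ (by simp) (by simp)).trans q₂,
        (e _ (by simp) (by simp)).trans q₃, (e _ (by simp) (by simp)).trans q₆,
        (e _ (by simp) (by simp)).trans q₇, (e _ (by simp) (by simp)).trans q₈,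
        ((e _ (by simp) (by simp)).trans q₉).trans (by simp only [Params.w]; split_ifs <;> rfl),
        (e _ (by simp) (by simp)).trans q₄, s₂⟩
    have p₀ := ((((((Pure.refl [sd, slo, shi, td, tlo, thi, cen, lay, sg, mq] σ).tick).set
      (x := sd) (by simp) (d₀ + 1)).set (x := slo) (by simp) (σ.v lo)).set (x := shi) (by simp)
      (σ.v hi)).set (x := lay) (by simp) (κ.lay + 2 ^ d₀)).tick
    by_cases hlt : π.h < d₀ + 1
    · rw [if_pos hlt]
      exact fin _ (p₀.set (by simp) _) (by simp) (by simp) (by simp [hlo]) (by simp [hhi]) (by simp)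
        (by simp [t9]) (by simp [t4]) (by simp [t5]) (by simp [t6]) (by simp [hlo, hlt])
    · rw [if_neg hlt]
      exact fin _ (p₀.set (by simp) _) (by simp) (by simp) (by simp [hlo]) (by simp [hhi]) (by simp)
        (by simp [t9]) (by simp [t4]) (by simp [t5]) (by simp [t6]) (by simp [t7, hlt])
  · rw [if_neg hc]
    simp only [wp_seq, wp_copy, wp_zero, St.set_v, St.tick_v, reduceCtorEq, if_false, if_true, hd]
    refine wp_toggle (b := false) (T := T / 2) (by simp [hT]) (by simp) fun σ₂ p₂ r₂ s₂ => ?_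
    have e : ∀ x, x ≠ sg → x ≠ mq → x ≠ td → x ≠ tlo → x ≠ thi → σ₂.v x = σ.v x :=
      fun x h1 h2 h3 h4 h5 => by rw [p₂.frame x (by simp [h1, h2])]; simp [h1, h3, h4, h5]
    refine hQ σ₂ ?_ ?_ ?_
    · exact (((((Pure.refl _ σ).tick.set (by simp) _).set (by simp) _).set (by simp) _).set
        (by simp) _).trans (p₂.mono (by simp))
    · simp only [St.set_time, St.tick_time] at r₂
      omega
    · rw [Task.child, if_neg hc]
      have f : ∀ x, x ≠ sg → x ≠ mq → σ₂.v x = _ := fun x h1 h2 => p₂.frame x (by simp [h1, h2])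
      refine ⟨(e _ (by simp) (by simp) (by simp) (by simp) (by simp)).trans t1,
        (e _ (by simp) (by simp) (by simp) (by simp) (by simp)).trans t2,
        (e _ (by simp) (by simp) (by simp) (by simp) (by simp)).trans t3, ?_, ?_, ?_,
        (e _ (by simp) (by simp) (by simp) (by simp) (by simp)).trans t7,
        (e _ (by simp) (by simp) (by simp) (by simp) (by simp)).trans t8, by simpa using s₂⟩
      · rw [f td (by simp) (by simp)]
        simp
      · rw [f tlo (by simp) (by simp)]
        simp [hlo, Params.w]
      · rw [f thi (by simp) (by simp)]
        simp [hhi, Params.w]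

/-- The variables that decoding changes. -/
def decodeVars : List Var := [pw, cnt, tp, c, mq, kq, ma, ac, mx, mm, lo, hi, sd, slo, shi, td, tlo,
  thi, cen, lay, sg, d]

/-- Decode the digit for level `d`. -/
def level : Prog Var :=
  op (half pw) ;; op (zero cnt) ;; op (inc cnt) ;; op (inc cnt) ;;
  ite (lt h d) (op (add cnt g)) skip ;;
  shift ;; op (copy kq tp) ;; op (half kq) ;; window ;; select ;; op (dec d)

theorem wp_level {d₀ r : ℕ} (hh : π.Holds σ) (hd : σ.v d = d₀ + 1) (hda : d₀ + 1 ≤ π.a)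
    (hpw : σ.v pw = 2 ^ (d₀ + 1)) (ht : HoldsTask κ σ) (hi : κ.Inv π (d₀ + 1))
    (hr : r < 2 ^ counterBits π.h π.g (d₀ + 1))
    (hc : σ.v c = r * 2 ^ (π.L - counterBits π.h π.g (d₀ + 1)))
    (hQ : ∀ σ', Pure decodeVars σ σ' → σ'.time ≤ σ.time + (17 * π.L + 34) → σ'.v d = d₀ →
      σ'.v pw = 2 ^ d₀ → HoldsTask (κ.child π.h (d₀ + 1) (r / 2 ^ counterBits π.h π.g d₀)) σ' →
      σ'.v c = r % 2 ^ counterBits π.h π.g d₀ * 2 ^ (π.L - counterBits π.h π.g d₀) → Q σ') :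
    wp (π.env D) level Q σ := by
  have hbits : counterBits π.h π.g (d₀ + 1) ≤ π.L :=
    (counterBits_mono _ _ hda).trans π.bits_le
  have hb0 : counterBits π.h π.g (d₀ + 1) =
    counterBits π.h π.g d₀ + digitBits π.h π.g (d₀ + 1) := rfl
  set B := counterBits π.h π.g d₀ with hB
  set k := digitBits π.h π.g (d₀ + 1) with hk
  rw [hb0] at hr hc hbits
  have hsz := π.size'
  have hP := π.P_lt
  have hlay := hi.lay
  rw [pow_succ] at hlay
  have hkL : k < 2 ^ π.L := lt_of_le_of_lt (by omega) Nat.lt_two_pow_self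
  have vg : σ.v g = π.g := hh g _ rfl
  have vh : σ.v h = π.h := hh h _ rfl
  have dlt : d₀ < 2 ^ π.L := by
    have : d₀ < 2 ^ d₀ := Nat.lt_two_pow_self
    omega
  have i1 : (0 + 1) % 2 ^ π.L = 1 := Nat.mod_eq_of_lt (Nat.one_lt_two_pow π.L_pos.ne')
  have hk2 : 2 ≤ k := by rw [hk, digitBits]; omega
  have i2 : (1 + 1) % 2 ^ π.L = 2 := Nat.mod_eq_of_lt (by omega)
  have hpw' : 2 ^ (d₀ + 1) / 2 = 2 ^ d₀ := by rw [pow_succ]; omega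
  have hT : r / 2 ^ B < 2 ^ k := by
    rw [Nat.div_lt_iff_lt_mul (by positivity), mul_comm, ← pow_add]
    exact hr
  have epow : r * 2 ^ (π.L - (B + k)) * 2 ^ k = r * 2 ^ (π.L - B) := by
    rw [mul_assoc, ← pow_add]
    congr 2
    omega
  have eL : 2 ^ π.L = 2 ^ B * 2 ^ (π.L - B) := by
    rw [← pow_add]
    congr 1
    omega
  have ed : r * 2 ^ (π.L - (B + k)) * 2 ^ k / 2 ^ π.L = r / 2 ^ B := by
    rw [epow, eL, Nat.mul_div_mul_right _ _ (by positivity)]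
  have em : r * 2 ^ (π.L - (B + k)) * 2 ^ k % 2 ^ π.L = r % 2 ^ B * 2 ^ (π.L - B) := by
    rw [epow, eL, Nat.mul_mod_mul_right]
  have hc₀ : r * 2 ^ (π.L - (B + k)) < 2 ^ π.L := by
    calc r * 2 ^ (π.L - (B + k)) < 2 ^ (B + k) * 2 ^ (π.L - (B + k)) :=
          Nat.mul_lt_mul_of_pos_right hr (by positivity)
      _ = 2 ^ π.L := by rw [← pow_add]; congr 1; omega
  simp only [level, wp_seq, wp_half, wp_zero, wp_inc, St.set_v, if_true, hpw, hpw', i1, i2,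
    Params.env_L]
  have next : ∀ σ₁, Pure [pw, cnt, mq] σ σ₁ → σ₁.time ≤ σ.time + 6 → σ₁.v cnt = k →
      σ₁.v pw = 2 ^ d₀ → wp (π.env D) (shift ;; op (copy kq tp) ;; op (half kq) ;; window ;;
        select ;; op (dec d)) Q σ₁ := by
    intro σ₁ p₁ t₁ c₁ w₁
    have H₁ : π.Holds σ₁ := hh.frame p₁.frame (by simp [Params.const])
    rw [wp_seq]
    refine wp_shift H₁ ((p₁.frame c (by simp)).trans hc) hc₀ c₁ (by omega)
      fun σ₂ p₂ t₂ e₂ f₂ => ?_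
    rw [ed] at e₂
    rw [em] at f₂
    have H₂ : π.Holds σ₂ := H₁.frame p₂.frame (by simp [Params.const])
    rw [wp_seq, wp_copy, wp_seq, wp_half, wp_seq]
    have pure₃ : Pure [kq] σ₂ ((σ₂.set kq (σ₂.v tp)).set kq ((σ₂.set kq (σ₂.v tp)).v kq / 2)) :=
      ((Pure.refl _ _).set (by simp) _).set (by simp) _
    have g₂ : ∀ x, x ∉ decodeVars → σ₂.v x = σ.v x := fun x hx => by
      simp only [decodeVars, List.mem_cons, List.not_mem_nil, or_false, not_or] at hx
      rw [p₂.frame x (by simp [hx]), p₁.frame x (by simp [hx])]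
    have T₂ : HoldsTask κ σ₂ :=
      (ht.frame p₁.frame (by simp)).frame p₂.frame (by simp)
    have d₂ : σ₂.v d = d₀ + 1 := by rw [p₂.frame d (by simp), p₁.frame d (by simp), hd]
    refine wp_window (d₀ := d₀ + 1) (T := r / 2 ^ B) (H₂.frame pure₃.frame (by simp [Params.const]))
      (by simpa using d₂) (by simp [e₂]) (T₂.frame pure₃.frame (by simp)).cen hi.w_le hi.cen_le hT
      fun σ₄ p₄ t₄ e₄ f₄ => ?_
    rw [wp_seq]
    have H₄ : π.Holds σ₄ :=
      (H₂.frame pure₃.frame (by simp [Params.const])).frame p₄.frame (by simp [Params.const])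
    refine wp_select (d₀ := d₀) (T := r / 2 ^ B) H₄ ?_ ?_ ?_
      ((T₂.frame pure₃.frame (by simp)).frame p₄.frame (by simp)) (by omega) ?_ e₄ f₄
      fun σ₅ p₅ t₅ T₅ => ?_
    · rw [p₄.frame d (by simp)]
      simpa using d₂
    · rw [p₄.frame kq (by simp)]
      simp [e₂]
    · rw [p₄.frame tp (by simp)]
      simp [e₂]
    · rw [p₄.frame pw (by simp)]
      simp [p₂.frame pw (by simp), w₁]
    have d₅ : σ₅.v d = d₀ + 1 := by
      rw [p₅.frame d (by simp), p₄.frame d (by simp)]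
      simpa using d₂
    have dd : (d₀ + 1 + (2 ^ π.L - 1)) % 2 ^ π.L = d₀ := by
      have : d₀ + 1 < 2 ^ π.L := by
        have : d₀ + 1 ≤ 2 ^ d₀ := Nat.lt_two_pow_self
        omega
      rw [sub_wrap (by omega) this]
      omega
    rw [wp_dec, d₅, Params.env_L, dd]
    refine hQ _ ?_ ?_ (by simp) ?_ ?_ ?_
    · refine Pure.set ?_ (by simp [decodeVars]) _
      refine Pure.trans ?_ (p₅.mono (by simp [decodeVars]))
      refine Pure.trans ?_ (p₄.mono (by simp [decodeVars]))
      refine Pure.trans ?_ (pure₃.mono (by simp [decodeVars]))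
      exact (p₁.mono (by simp [decodeVars])).trans (p₂.mono (by simp [decodeVars]))
    · simp only [St.set_time] at t₄ ⊢
      omega
    · simp [p₅.frame pw (by simp), p₄.frame pw (by simp), p₂.frame pw (by simp), w₁]
    · exact T₅.frame (S := [d]) ((Pure.refl _ _).set (by simp) _).frame (by simp)
    · simp [p₅.frame c (by simp), p₄.frame c (by simp), f₂]
  rw [wp_ite]
  simp only [eval_lt, St.set_v, reduceCtorEq, if_false, vh, hd]
  have p₀ := ((((Pure.refl [pw, cnt, mq] σ).set (x := pw) (by simp) (2 ^ d₀)).set (x := cnt)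
    (by simp) 0).set (x := cnt) (by simp) 1).set (x := cnt) (by simp) 2
  split_ifs with hlt
  · have e : (2 + π.g) % 2 ^ π.L = k := by
      rw [hk, digitBits, if_pos hlt] at hkL ⊢
      exact Nat.mod_eq_of_lt hkL
    simp only [wp_add, St.tick_v, St.set_v, if_true, reduceCtorEq, if_false, vg, Params.env_L, e]
    refine next _ ?_ ?_ ?_ ?_
    · exact (p₀.tick).set (by simp) _
    all_goals simp
  · simp only [wp_skip]
    refine next _ ?_ ?_ ?_ ?_
    · exact (p₀.tick).set (by simp) _
    all_goals simp [hk, digitBits, hlt]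

theorem wp_levels {d₀ r : ℕ} (hh : π.Holds σ) (hd : σ.v d = d₀) (hda : d₀ ≤ π.a)
    (hpw : σ.v pw = 2 ^ d₀) (ht : HoldsTask κ σ) (hi : κ.Inv π d₀)
    (hr : r < 2 ^ counterBits π.h π.g d₀)
    (hc : σ.v c = r * 2 ^ (π.L - counterBits π.h π.g d₀)) :
    wp (π.env D) (loop (pos d) level) (fun σ' => Pure decodeVars σ σ' ∧
      σ'.time ≤ σ.time + (d₀ * (17 * π.L + 35) + 1) ∧
      HoldsTask (Task.decode π.h π.g d₀ r κ) σ' ∧ (Task.decode π.h π.g d₀ r κ).Valid π) σ := by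
  induction d₀ generalizing κ r σ with
  | zero =>
    rw [wp_loop, if_neg (by simp [hd])]
    exact ⟨(Pure.refl _ _).tick, by simp, ht.frame (S := []) (Pure.refl _ _).tick.frame (by simp),
      hi.valid⟩
  | succ d₀ ih =>
    rw [wp_loop, if_pos (by simp [hd])]
    have p₀ : Pure [] σ σ.tick := (Pure.refl _ _).tick
    refine wp_level (d₀ := d₀) (r := r) (hh.frame p₀.frame (by simp)) hd hda hpw
      (ht.frame p₀.frame (by simp)) hi hr hc fun σ₁ p₁ t₁ d₁ w₁ T₁ c₁ => ?_
    have hT : r / 2 ^ counterBits π.h π.g d₀ < 2 ^ digitBits π.h π.g (d₀ + 1) := by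
      rw [Nat.div_lt_iff_lt_mul (by positivity), mul_comm, ← pow_add]
      exact hr
    refine wp_mono (ih (hh.frame (p₀.mono (by simp) |>.trans p₁).frame
      (by simp [Params.const, decodeVars])) d₁ (by omega) w₁ T₁ (hi.child hda hT)
      (Nat.mod_lt _ (by positivity)) c₁) ?_
    rintro σ' ⟨q1, q2, q3, q4⟩
    refine ⟨(p₀.mono (by simp)).trans (p₁.trans q1), ?_, q3, q4⟩
    simp only [St.tick_time] at t₁
    rw [Nat.succ_mul]
    omega

/-- Find the task with the number `ctr`. -/
def decode : Prog Var :=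
  op (copy c ctr) ;; op (copy d a) ;; op (copy sd a1) ;; op (copy slo us) ;; op (copy shi us) ;;
  op (inc shi) ;; op (zero td) ;; op (copy tlo vs) ;; op (copy thi vs) ;; op (inc thi) ;;
  op (copy cen us) ;; op (copy lay u1) ;; op (zero sg) ;; op (copy pw ell) ;; loop (pos d) level

/-- The task of the whole computation. -/
def task (π : Params) : Task :=
  ⟨π.a + 1, π.u2 + π.w, π.u2 + π.w + 1, 0, π.v2 + π.w, π.v2 + π.w + 1, π.u2 + π.w, π.u1, false⟩

theorem inv_task (π : Params) : (task π).Inv π π.a := by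
  have h1 := π.v1_eq
  have h2 := π.v1_le
  have h3 := π.u2_le
  exact ⟨by simp [task], by simp [task], by simp [task], by simp [task], by simp [task],
    by simp [task], by simp [task], by simp [task]; omega, by simp [task], by simp [task]; omega⟩

theorem wp_decode {r : ℕ} (hh : π.Holds σ) (hr : r < 2 ^ counterBits π.h π.g π.a)
    (hc : σ.v ctr = r * 2 ^ (π.L - counterBits π.h π.g π.a))
    (hQ : ∀ σ', Pure decodeVars σ σ' → σ'.time ≤ σ.time + (π.a * (17 * π.L + 35) + 15) →
      HoldsTask (Task.decode π.h π.g π.a r (task π)) σ' →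
      (Task.decode π.h π.g π.a r (task π)).Valid π → Q σ') : wp (π.env D) decode Q σ := by
  have hsz := π.size'
  have hP := π.P_lt
  have h3 := π.u2_le
  have h4 := π.v2_le
  have va : σ.v a = π.a := hh a _ rfl
  have va1 : σ.v a1 = π.a + 1 := hh a1 _ rfl
  have vus : σ.v us = π.u2 + π.w := hh us _ rfl
  have vvs : σ.v vs = π.v2 + π.w := hh vs _ rfl
  have vu1 : σ.v u1 = π.u1 := hh u1 _ rfl
  have vell : σ.v ell = 2 ^ π.a := hh ell _ rfl
  have e1 : (π.u2 + π.w + 1) % 2 ^ π.L = π.u2 + π.w + 1 := Nat.mod_eq_of_lt (by omega)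
  have e2 : (π.v2 + π.w + 1) % 2 ^ π.L = π.v2 + π.w + 1 := Nat.mod_eq_of_lt (by omega)
  simp only [decode, wp_seq, wp_copy, wp_inc, wp_zero, St.set_v, reduceCtorEq, if_false, if_true,
    va, va1, vus, vvs, vu1, vell, e1, e2, Params.env_L]
  have p₀ : Pure decodeVars σ ((((((((((((((σ.set c (σ.v ctr)).set d π.a).set sd (π.a + 1)).set slo
      (π.u2 + π.w)).set shi (π.u2 + π.w)).set shi (π.u2 + π.w + 1)).set td 0).set tlo
      (π.v2 + π.w)).set thi (π.v2 + π.w)).set thi (π.v2 + π.w + 1)).set cen (π.u2 + π.w)).set lay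
      π.u1).set sg 0).set pw (2 ^ π.a)) := by
    repeat refine Pure.set ?_ (by simp [decodeVars]) _
    exact Pure.refl _ _
  refine wp_mono (wp_levels (κ := task π) (d₀ := π.a) (r := r)
    (hh.frame p₀.frame (by simp [Params.const, decodeVars])) (by simp) le_rfl (by simp) ?_
    (inv_task π) hr (by simp [hc])) ?_
  · constructor <;> simp [task]
  · rintro σ' ⟨q1, q2, q3, q4⟩
    refine hQ σ' (p₀.trans q1) ?_ q3 q4
    simp only [St.set_time] at q2
    omega

end Code

/-! ### Performing all elementary tasks -/

namespace Code

open Op Cond Prog Var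

variable {q s : ℕ} {ρ : ℕ → ℕ} {Y : ℕ → ℕ → ZMod π.P} {D : List Bool → List Bool}
  {Q : St Var → Prop} {σ : St Var} {μ : Vertex π.n → Vertex π.n → ℕ}

/-- Perform the task with the number `ctr` and increase this number. -/
def round : Prog Var := decode ;; leaf ;; op (add ctr step)

/-- The time for one task. -/
def roundTime (π : Params) : ℕ :=
  π.a * (17 * π.L + 35) + (π.n + 1) * (450 * π.L + 322) + 18

theorem wp_round {r : ℕ} (hD : IsWeightOracle μ π.p D) (hs : s < 2 ^ π.L) (hq : 20 * π.L = q)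
    (h : Sim π q ρ s Y σ) (hr : r < 2 ^ counterBits π.h π.g π.a)
    (hc : σ.v ctr = r * 2 ^ (π.L - counterBits π.h π.g π.a))
    (hQ : ∀ σ', σ'.time ≤ σ.time + roundTime π →
      σ'.v ctr = (r + 1) * 2 ^ (π.L - counterBits π.h π.g π.a) % 2 ^ π.L →
      Sim π q ρ s (push (2 ^ π.h) (4 * 2 ^ π.h) (reducedMatrix (ZMod π.P) μ π.p
        (Task.decode π.h π.g π.a r (task π)).lay) (Task.decode π.h π.g π.a r (task π)) Y) σ' →
      Q σ') : wp (π.env D) round Q σ := by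
  rw [round, wp_seq]
  refine wp_decode h.holds hr hc fun σ₁ p₁ t₁ T₁ V₁ => ?_
  have S₁ := h.pure p₁ (by simp [Params.const, decodeVars])
  rw [wp_seq]
  refine wp_leaf hD hs T₁ V₁ hq S₁ fun σ₂ f₂ t₂ S₂ => ?_
  have c₂ : σ₂.v ctr = r * 2 ^ (π.L - counterBits π.h π.g π.a) := by
    rw [f₂ ctr (by simp [rowVars, edgeVars]), p₁.frame ctr (by simp [decodeVars]), hc]
  have v₂ : σ₂.v step = 2 ^ (π.L - counterBits π.h π.g π.a) % 2 ^ π.L := S₂.holds step _ rfl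
  rw [wp_add, c₂, v₂, Params.env_L, Nat.add_mod_mod]
  refine hQ _ ?_ (by simp [Nat.succ_mul]) ?_
  · simp only [St.set_time, roundTime]
    omega
  · exact S₂.pure (S := [ctr]) ((Pure.refl _ _).set (by simp) _) (by simp [Params.const])

/-- Perform all tasks. -/
def walk : Prog Var := op (zero ctr) ;; round ;; loop (pos ctr) round

theorem wp_walk (hD : IsWeightOracle μ π.p D) (hs : s < 2 ^ π.L) (hq : 20 * π.L = q)
    (h : Sim π q ρ s Y σ)
    (hQ : ∀ σ', σ'.time ≤ σ.time +
        (2 ^ counterBits π.h π.g π.a * (roundTime π + 1) + 1) →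
      Sim π q ρ s (runTask (reducedMatrix (ZMod π.P) μ π.p) π.h π.g π.a (task π) Y) σ' → Q σ') :
    wp (π.env D) walk Q σ := by
  set N := 2 ^ counterBits π.h π.g π.a with hN
  have hN0 : 0 < N := by positivity
  set U := 2 ^ (π.L - counterBits π.h π.g π.a) with hU
  have hU0 : 0 < U := by positivity
  have hNU : N * U = 2 ^ π.L := by
    rw [hN, hU, ← pow_add]
    congr 1
    have := π.bits_le
    omega
  set f : (ℕ → ℕ → ZMod π.P) → ℕ → (ℕ → ℕ → ZMod π.P) := fun Y c =>
    push (2 ^ π.h) (4 * 2 ^ π.h) (reducedMatrix (ZMod π.P) μ π.p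
      (Task.decode π.h π.g π.a c (task π)).lay) (Task.decode π.h π.g π.a c (task π)) Y with hf
  have succ : ∀ i, (List.range (i + 1)).foldl f Y = f ((List.range i).foldl f Y) i := fun i => by
    rw [List.range_succ, List.foldl_append]
    rfl
  rw [walk, wp_seq, wp_zero, wp_seq]
  have S₀ : Sim π q ρ s Y (σ.set ctr 0) :=
    h.pure (S := [ctr]) ((Pure.refl _ _).set (by simp) _) (by simp [Params.const])
  refine wp_round (r := 0) hD hs hq S₀ hN0 (by simp) fun σ₁ t₁ c₁ S₁ => ?_
  refine wp_loop_of (fun k σ' => k + 1 ≤ N ∧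
    σ'.time + k * (roundTime π + 1) ≤ σ.time + N * (roundTime π + 1) ∧
    σ'.v ctr = (N - k) * U % 2 ^ π.L ∧ Sim π q ρ s ((List.range (N - k)).foldl f Y) σ') ?_ ?_
    (N - 1) ?_
  · rintro k σ₂ ⟨hk, t₂, c₂, S₂⟩
    have lt : (N - (k + 1)) * U < 2 ^ π.L := by
      rw [← hNU]
      exact Nat.mul_lt_mul_of_pos_right (by omega) hU0
    rw [Nat.mod_eq_of_lt lt] at c₂
    refine ⟨?_, ?_⟩
    · simp only [eval_pos, c₂]
      exact Nat.mul_pos (by omega) hU0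
    · refine wp_round (r := N - (k + 1)) hD hs hq (S₂.pure (Pure.refl [] _).tick (by simp))
        (by omega) c₂ fun σ₃ t₃ c₃ S₃ => ⟨by omega, ?_, ?_, ?_⟩
      · rw [St.tick_time] at t₃
        rw [Nat.succ_mul] at t₂
        omega
      · rw [c₃, show N - (k + 1) + 1 = N - k by omega]
      · rw [show N - k = N - (k + 1) + 1 by omega, succ]
        exact S₃
  · rintro σ₂ ⟨-, t₂, c₂, S₂⟩
    rw [Nat.sub_zero, hNU, Nat.mod_self] at c₂
    refine ⟨by simp [Cond.eval, c₂], hQ _ (by simp; omega) ?_⟩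
    exact S₂.pure (Pure.refl [] _).tick (by simp)
  · refine ⟨by omega, ?_, ?_, ?_⟩
    · simp only [St.set_time] at t₁
      have : (N - 1) * (roundTime π + 1) + (roundTime π + 1) = N * (roundTime π + 1) := by
        rw [← Nat.succ_mul]
        congr 1
        omega
      omega
    · rw [c₁, show N - (N - 1) = 1 by omega, zero_add]
    · rw [show N - (N - 1) = 0 + 1 by omega, succ]
      exact S₁

end Code
end CatalyticGrid

namespace CatalyticGrid

open Var

set_option linter.unusedSimpArgs false

/-! ### Computing the parameters -/

namespace Code

open Op Cond Prog Var

variable {E : Env} {π : Params} {D : List Bool → List Bool} {Q : St Var → Prop} {σ : St Var}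

/-- Read an input number into `x`. -/
def readVar (x : Var) : Prog Var := parse false ;; op (copy x px)

theorem wp_readVar {x : Var} {k : ℕ} {w : List Bool} (hL : 0 < E.L)
    (h : σ.input.At (encodeNat k ++ w)) (hk : k < 2 ^ E.L)
    (hQ : ∀ σ', Moves false [px, pp, mq, x] σ σ' → σ'.time ≤ σ.time + (6 * E.L + 6) → σ'.v x = k →
      σ'.input.At w → Q σ') : wp E (readVar x) Q σ := by
  rw [readVar, wp_seq]
  refine wp_parse hL (s := false) h hk fun σ₁ m₁ t₁ e₁ a₁ _ _ => ?_
  rw [wp_copy]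
  refine hQ _ ((m₁.mono (by simp)).set (by simp) _) (by simp; omega) (by simp [e₁]) a₁

/-- Read the input. -/
def readInput : Prog Var :=
  right false ;; readVar n ;; readVar p ;; readVar u1 ;; readVar u2 ;; readVar v1 ;; readVar v2

theorem wp_readInput {k₁ k₂ k₃ k₄ k₅ k₆ : ℕ} (hL : 0 < E.L)
    (h : σ.input = Tape.init (encodeList [k₁, k₂, k₃, k₄, k₅, k₆])) (h₁ : k₁ < 2 ^ E.L)
    (h₂ : k₂ < 2 ^ E.L) (h₃ : k₃ < 2 ^ E.L) (h₄ : k₄ < 2 ^ E.L) (h₅ : k₅ < 2 ^ E.L)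
    (h₆ : k₆ < 2 ^ E.L)
    (hQ : ∀ σ', σ'.reg = σ.reg → σ'.oracle = σ.oracle → σ'.output = σ.output →
      σ'.time ≤ σ.time + (36 * E.L + 37) → σ'.v n = k₁ → σ'.v p = k₂ → σ'.v u1 = k₃ →
      σ'.v u2 = k₄ → σ'.v v1 = k₅ → σ'.v v2 = k₆ → Q σ') : wp E readInput Q σ := by
  rw [readInput, wp_seq, wp_right]
  have a₀ : (σ.setTape false ((σ.tape false).move .right)).input.At
      (encodeNat k₁ ++ (encodeNat k₂ ++ (encodeNat k₃ ++ (encodeNat k₄ ++ (encodeNat k₅ ++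
        (encodeNat k₆ ++ [])))))) := by
    change ((σ.tape false).move .right).At _
    have e : σ.tape false = Tape.init (encodeList [k₁, k₂, k₃, k₄, k₅, k₆]) := h
    rw [e]
    refine ⟨by simp [Tape.move, Tape.init], [], ?_⟩
    simp [Tape.move, Tape.init, encodeList]
  rw [wp_seq]
  refine wp_readVar hL a₀ h₁ fun σ₁ m₁ t₁ e₁ a₁ => ?_
  rw [wp_seq]
  refine wp_readVar hL a₁ h₂ fun σ₂ m₂ t₂ e₂ a₂ => ?_
  rw [wp_seq]
  refine wp_readVar hL a₂ h₃ fun σ₃ m₃ t₃ e₃ a₃ => ?_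
  rw [wp_seq]
  refine wp_readVar hL a₃ h₄ fun σ₄ m₄ t₄ e₄ a₄ => ?_
  rw [wp_seq]
  refine wp_readVar hL a₄ h₅ fun σ₅ m₅ t₅ e₅ a₅ => ?_
  refine wp_readVar hL a₅ h₆ fun σ₆ m₆ t₆ e₆ a₆ => ?_
  have o : ∀ {S : List Var} {σ σ' : St Var}, Moves false S σ σ' → σ'.oracle = σ.oracle :=
    fun m => m.other
  refine hQ σ₆ ?_ ?_ ?_ ?_ ?_ ?_ ?_ ?_ ?_ e₆
  · rw [m₆.reg, m₅.reg, m₄.reg, m₃.reg, m₂.reg, m₁.reg, St.setTape_reg]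
  · rw [o m₆, o m₅, o m₄, o m₃, o m₂, o m₁]
    rfl
  · rw [m₆.output, m₅.output, m₄.output, m₃.output, m₂.output, m₁.output, St.setTape_output]
  · simp only [St.setTape_time] at t₁
    omega
  · rw [m₆.frame n (by simp), m₅.frame n (by simp), m₄.frame n (by simp), m₃.frame n (by simp),
      m₂.frame n (by simp), e₁]
  · rw [m₆.frame p (by simp), m₅.frame p (by simp), m₄.frame p (by simp), m₃.frame p (by simp), e₂]
  · rw [m₆.frame u1 (by simp), m₅.frame u1 (by simp), m₄.frame u1 (by simp), e₃]
  · rw [m₆.frame u2 (by simp), m₅.frame u2 (by simp), e₄]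
  · rw [m₆.frame v1 (by simp), e₅]

/-- Compute the number of bits of a variable, and half the number of values. -/
def wordSize : Prog Var :=
  op (zero d) ;; op (dec d) ;; op (zero lv) ;; loop (pos d) (op (half d) ;; op (inc lv)) ;;
  op (zero hb) ;; op (dec hb) ;; op (half hb) ;; op (inc hb)

theorem wp_wordSize (hL : 0 < E.L)
    (hQ : ∀ σ', Pure [d, lv, hb] σ σ' → σ'.time ≤ σ.time + (3 * E.L + 8) → σ'.v lv = E.L →
      σ'.v hb = 2 ^ (E.L - 1) → Q σ') : wp E wordSize Q σ := by
  have hpos : 0 < 2 ^ E.L := by positivity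
  have e1 : (0 + (2 ^ E.L - 1)) % 2 ^ E.L = 2 ^ E.L - 1 := by
    rw [zero_add]
    exact Nat.mod_eq_of_lt (by omega)
  simp only [wordSize, wp_seq, wp_zero, wp_dec, St.set_v, if_true, e1]
  refine wp_loop_of (fun j σ' => j ≤ E.L ∧ Pure [d, lv, hb] σ σ' ∧
    σ'.time + 3 * j ≤ σ.time + (3 * E.L + 3) ∧ σ'.v d = 2 ^ j - 1 ∧ σ'.v lv = E.L - j) ?_ ?_ E.L ?_
  · rintro j σ₁ ⟨hj, p₁, t₁, d₁, l₁⟩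
    have h2 : 2 ^ (j + 1) = 2 * 2 ^ j := pow_succ' 2 j
    have hj0 := Nat.two_pow_pos j
    have hlt : E.L < 2 ^ E.L := Nat.lt_two_pow_self
    refine ⟨by simp only [eval_pos, d₁]; omega, ?_⟩
    simp only [wp_seq, wp_half, wp_inc, St.set_v, reduceCtorEq, if_false, St.tick_v, d₁, l₁]
    refine ⟨by omega, (p₁.tick.set (by simp) _).set (by simp) _, ?_, ?_, ?_⟩
    · simp only [St.set_time, St.tick_time]
      omega
    · simp
      omega
    · simp only [if_true]
      rw [Nat.mod_eq_of_lt (by omega)]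
      omega
  · rintro σ₁ ⟨-, p₁, t₁, d₁, l₁⟩
    refine ⟨by simp [Cond.eval, d₁], ?_⟩
    simp only [wp_seq, wp_zero, wp_dec, wp_half, wp_inc, St.set_v, if_true, e1]
    refine hQ _ ?_ ?_ (by simpa using l₁) ?_
    · exact (((p₁.tick.set (by simp) _).set (by simp) _).set (by simp) _).set (by simp) _
    · simp only [St.set_time, St.tick_time]
      omega
    · have h2 : 2 ^ E.L = 2 * 2 ^ (E.L - 1) := by
        rw [← pow_succ']
        congr 1
        omega
      simp only [if_true, St.set_v]
      rw [Nat.mod_eq_of_lt (by omega)]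
      omega
  · refine ⟨le_rfl, ((Pure.refl _ _ |>.set (by simp) _).set (by simp) _).set (by simp) _, ?_, ?_, ?_⟩
    · simp only [St.set_time]
      omega
    · simp
    · simp

/-- Compute the modulus. -/
def modulus : Prog Var :=
  op (zero ac) ;; op (zero ma) ;; op (dec ma) ;; op (zero mx) ;; op (inc mx) ;; op (copy mm p) ;;
  mul ;; op (inc ac) ;; op (zero md) ;; op (sub md ac)

theorem wp_modulus {k : ℕ} (hp : σ.v p = k) (h2 : 2 ≤ k) (hk : k < 2 ^ E.L)
    (hQ : ∀ σ', Pure [ac, ma, mx, mm, mq, md] σ σ' → σ'.time ≤ σ.time + (11 * E.L + 10) →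
      σ'.v md = 2 ^ E.L - ((2 ^ E.L - 1) % k + 1) → Q σ') : wp E modulus Q σ := by
  have e1 : (2 ^ E.L - 1) % 2 ^ E.L = 2 ^ E.L - 1 := Nat.mod_eq_of_lt (by omega)
  have e2 : 1 % 2 ^ E.L = 1 := Nat.mod_eq_of_lt (by omega)
  simp only [modulus, wp_seq, wp_zero, wp_dec, wp_inc, wp_copy, St.set_v, if_true, reduceCtorEq,
    if_false, zero_add, e1, e2, hp]
  refine wp_mul (by simpa) (by simp) (by simp; omega) (by simp; omega) fun σ₁ p₁ t₁ r₁ => ?_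
  simp only [St.set_v, if_true, reduceCtorEq, if_false, zero_add, mul_one, St.set_time] at r₁ t₁
  have hlt := Nat.mod_lt (2 ^ E.L - 1) (show 0 < k by omega)
  have e3 : ((2 ^ E.L - 1) % k + 1) % 2 ^ E.L = (2 ^ E.L - 1) % k + 1 :=
    Nat.mod_eq_of_lt (by omega)
  have e4 : (2 ^ E.L - ((2 ^ E.L - 1) % k + 1)) % 2 ^ E.L =
    2 ^ E.L - ((2 ^ E.L - 1) % k + 1) := Nat.mod_eq_of_lt (by omega)
  simp only [wp_seq, wp_inc, wp_zero, wp_sub, St.set_v, if_true, reduceCtorEq, if_false, r₁, e3,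
    zero_add, e4]
  refine hQ _ ?_ (by simp only [St.set_time]; omega) (by simp)
  refine Pure.set (Pure.set (Pure.set ?_ (by simp) _) (by simp) _) (by simp) _
  refine Pure.trans ?_ (p₁.mono (by simp))
  repeat refine Pure.set ?_ (by simp) _
  exact Pure.refl _ _

/-- Compute the length of `n`. -/
def bitLength : Prog Var :=
  op (zero b) ;; op (zero pw) ;; op (inc pw) ;; op (copy tp n) ;; op (inc tp) ;;
  loop (lt pw tp) (op (add pw pw) ;; op (inc b))

theorem wp_bitLength {k : ℕ} (hn : σ.v n = k) (hk : 2 * k + 1 < 2 ^ E.L)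
    (hQ : ∀ σ', Pure [b, pw, tp] σ σ' → σ'.time ≤ σ.time + (3 * E.L + 6) → σ'.v b = Nat.size k →
      Q σ') : wp E bitLength Q σ := by
  have e1 : 1 % 2 ^ E.L = 1 := Nat.mod_eq_of_lt (by omega)
  have e2 : (k + 1) % 2 ^ E.L = k + 1 := Nat.mod_eq_of_lt (by omega)
  have hs : Nat.size k ≤ E.L := Nat.size_le.2 (by omega)
  have hlt := Nat.lt_size_self k
  simp only [bitLength, wp_seq, wp_zero, wp_inc, wp_copy, St.set_v, if_true, reduceCtorEq, if_false,
    zero_add, e1, e2, hn]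
  refine wp_loop_of (fun j σ' => j ≤ Nat.size k ∧ Pure [b, pw, tp] σ σ' ∧
    σ'.time + 3 * j ≤ σ.time + (3 * Nat.size k + 5) ∧ σ'.v pw = 2 ^ (Nat.size k - j) ∧
    σ'.v b = Nat.size k - j ∧ σ'.v tp = k + 1) ?_ ?_ (Nat.size k) ?_
  · rintro j σ₁ ⟨hj, p₁, t₁, w₁, b₁, s₁⟩
    have hle : 2 ^ (Nat.size k - (j + 1)) ≤ k := Nat.lt_size.1 (by omega)
    have h2 : 2 ^ (Nat.size k - j) = 2 ^ (Nat.size k - (j + 1)) + 2 ^ (Nat.size k - (j + 1)) := by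
      rw [← two_mul, ← pow_succ']
      congr 1
      omega
    have h3 : E.L < 2 ^ E.L := Nat.lt_two_pow_self
    refine ⟨by simp only [eval_lt, w₁, s₁]; omega, ?_⟩
    simp only [wp_seq, wp_add, wp_inc, St.set_v, reduceCtorEq, if_false, St.tick_v, w₁, b₁]
    refine ⟨by omega, (p₁.tick.set (by simp) _).set (by simp) _, ?_, ?_, ?_, by simpa using s₁⟩
    · simp only [St.set_time, St.tick_time]
      omega
    · simp only [if_true]
      rw [Nat.mod_eq_of_lt (by omega), h2]
    · simp only [if_true]
      rw [Nat.mod_eq_of_lt (by omega)]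
      omega
  · rintro σ₁ ⟨-, p₁, t₁, w₁, b₁, s₁⟩
    refine ⟨by simp only [Cond.eval, w₁, s₁, decide_eq_false_iff_not, Nat.sub_zero]; omega,
      hQ _ p₁.tick (by simp; omega) (by simpa using b₁)⟩
  · refine ⟨le_rfl, ?_, ?_, by simp, by simp, by simp⟩
    · repeat refine Pure.set ?_ (by simp) _
      exact Pure.refl _ _
    · simp only [St.set_time]
      omega

/-- Increase a variable by a constant. -/
def incBy (x : Var) : ℕ → Prog Var
  | 0 => skip
  | k + 1 => op (inc x) ;; incBy x k

theorem wp_incBy {x : Var} {k : ℕ} (hx : x ≠ mq) (hk : σ.v x + k < 2 ^ E.L)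
    (hQ : ∀ σ', Pure [x, mq] σ σ' → σ'.time ≤ σ.time + (k + 1) → σ'.v x = σ.v x + k → Q σ') :
    wp E (incBy x k) Q σ := by
  induction k generalizing σ with
  | zero =>
    rw [incBy, wp_skip]
    exact hQ _ ((Pure.refl _ _).set (by simp) _) (by simp) (by simp [hx])
  | succ k ih =>
    rw [incBy, wp_seq, wp_inc, Nat.mod_eq_of_lt (by omega)]
    refine ih (by simp; omega) fun σ₁ p₁ t₁ e₁ => hQ σ₁ (((Pure.refl _ _).set (by simp) _).trans p₁)
      ?_ ?_
    · simp only [St.set_time] at t₁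
      omega
    · rw [e₁]
      simp
      omega

/-- Compute the largest `g` with `e * g ^ 2 ≤ b`. -/
def blockBits (e : ℕ) : Prog Var :=
  op (zero g) ;; op (zero tp) ;; incBy tp e ;; op (copy px tp) ;; op (copy kq tp) ;;
  op (add kq kq) ;; op (copy cnt b) ;; op (inc cnt) ;;
  loop (lt tp cnt) (op (inc g) ;; op (add px kq) ;; op (add tp px))

theorem wp_blockBits {e k : ℕ} (he : 0 < e) (hb : σ.v b = k) (hk : 4 * k + 4 * e + 1 < 2 ^ E.L)
    (hQ : ∀ σ', Pure [g, tp, mq, px, kq, cnt] σ σ' → σ'.time ≤ σ.time + (4 * k + e + 9) →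
      σ'.v g = Nat.sqrt (k / e) → Q σ') : wp E (blockBits e) Q σ := by
  set G := Nat.sqrt (k / e) with hG
  have h1 : e * G ^ 2 ≤ k := by
    rw [mul_comm]
    exact (Nat.le_div_iff_mul_le he).1 (Nat.sqrt_le' _)
  have h2 : k < e * (G + 1) ^ 2 := by
    rw [mul_comm]
    exact (Nat.div_lt_iff_lt_mul he).1 (Nat.lt_succ_sqrt' _)
  have hGk : G ≤ k := le_trans (by nlinarith) h1
  have hlt : E.L < 2 ^ E.L := Nat.lt_two_pow_self
  have bound : ∀ x ≤ G, e * (x + 1) ^ 2 ≤ 4 * k + 4 * e ∧ e * (2 * x + 1) ≤ 4 * k + 4 * e := by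
    intro x hx
    have h3 : e * x ^ 2 ≤ k := le_trans (by gcongr) h1
    have h4 : e * x ≤ e * x ^ 2 := by
      refine Nat.mul_le_mul_left _ ?_
      nlinarith [Nat.le_mul_self x]
    constructor <;> nlinarith
  simp only [blockBits, wp_seq, wp_zero]
  refine wp_incBy (by decide) (by simp; omega) fun σ₁ p₁ t₁ e₁ => ?_
  simp only [St.set_v, if_true, zero_add, St.set_time] at e₁ t₁
  have b₁ : σ₁.v b = k := by rw [p₁.frame b (by simp)]; simpa using hb
  have g₁ : σ₁.v g = 0 := by rw [p₁.frame g (by simp)]; simp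
  have i1 : (e + e) % 2 ^ E.L = 2 * e := by rw [Nat.mod_eq_of_lt (by omega)]; ring
  have i2 : (k + 1) % 2 ^ E.L = k + 1 := Nat.mod_eq_of_lt (by omega)
  simp only [wp_seq, wp_copy, wp_add, wp_inc, St.set_v, if_true, reduceCtorEq, if_false, e₁, b₁,
    i1, i2]
  have p₀ : Pure [g, tp, mq, px, kq, cnt] σ σ₁ :=
    (((Pure.refl _ _).set (by simp) _).set (by simp) _).trans (p₁.mono (by simp))
  refine wp_loop_of (fun j σ' => j ≤ G ∧ Pure [g, tp, mq, px, kq, cnt] σ σ' ∧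
    σ'.time + 4 * j ≤ σ.time + (4 * G + e + 8) ∧ σ'.v g = G - j ∧
    σ'.v px = e * (2 * (G - j) + 1) ∧ σ'.v tp = e * (G - j + 1) ^ 2 ∧ σ'.v cnt = k + 1 ∧
    σ'.v kq = 2 * e) ?_ ?_ G ?_
  · rintro j σ₂ ⟨hj, p₂, t₂, q1, q2, q3, q4, q5⟩
    obtain ⟨x, hx⟩ : ∃ x, G = x + j + 1 := ⟨G - (j + 1), by omega⟩
    rw [show G - (j + 1) = x by omega] at q1 q2 q3
    have hxk : e * (x + 1) ^ 2 ≤ k := le_trans (by gcongr; omega) h1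
    obtain ⟨b1, b2⟩ := bound (x + 1) (by omega)
    refine ⟨by simp only [eval_lt, q3, q4]; omega, ?_⟩
    have i3 : (x + 1) % 2 ^ E.L = G - j := by
      rw [Nat.mod_eq_of_lt (by omega)]
      omega
    have i4 : (e * (2 * x + 1) + 2 * e) % 2 ^ E.L = e * (2 * (G - j) + 1) := by
      rw [show G - j = x + 1 by omega, Nat.mod_eq_of_lt (by linarith)]
      ring
    have i5 : (e * (x + 1) ^ 2 + e * (2 * (G - j) + 1)) % 2 ^ E.L = e * (G - j + 1) ^ 2 := by
      rw [show G - j = x + 1 by omega, Nat.mod_eq_of_lt (by linarith)]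
      ring
    simp only [wp_seq, wp_add, wp_inc, St.set_v, reduceCtorEq, if_false, if_true, St.tick_v, q1, q2,
      q3, q4, q5, i3, i4, i5]
    refine ⟨by omega, ((p₂.tick.set (by simp) _).set (by simp) _).set (by simp) _, ?_, trivial,
      trivial, trivial, trivial, trivial⟩
    simp only [St.set_time, St.tick_time]
    omega
  · rintro σ₂ ⟨-, p₂, t₂, q1, q2, q3, q4, q5⟩
    rw [Nat.sub_zero] at q1 q3
    refine ⟨by simp only [Cond.eval, q3, q4, decide_eq_false_iff_not]; omega,
      hQ _ p₂.tick (by simp; omega) (by simpa using q1)⟩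
  · refine ⟨le_rfl, ?_, ?_, ?_, ?_, ?_, ?_, ?_⟩
    · exact ((((p₀.set (by simp) _).set (by simp) _).set (by simp) _).set (by simp) _).set
        (by simp) _
    · simp only [St.set_time]
      omega
    all_goals simp [g₁]
    exact e₁

/-- Double `x` a number of `cnt` times. -/
def double (x : Var) : Prog Var := loop (pos cnt) (op (add x x) ;; op (dec cnt))

theorem wp_double {x : Var} {y k : ℕ} (hx : x ≠ cnt) (hy : σ.v x = y % 2 ^ E.L) (hk : σ.v cnt = k)
    (hkL : k ≤ E.L)
    (hQ : ∀ σ', Pure [x, cnt] σ σ' → σ'.time ≤ σ.time + (3 * k + 1) →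
      σ'.v x = y * 2 ^ k % 2 ^ E.L → Q σ') : wp E (double x) Q σ := by
  have hlt : E.L < 2 ^ E.L := Nat.lt_two_pow_self
  refine wp_loop_of (fun j σ' => j ≤ k ∧ Pure [x, cnt] σ σ' ∧
    σ'.time + 3 * j ≤ σ.time + 3 * k ∧ σ'.v cnt = j ∧ σ'.v x = y * 2 ^ (k - j) % 2 ^ E.L)
    ?_ ?_ k ?_
  · rintro j σ₁ ⟨hj, p₁, t₁, c₁, x₁⟩
    have i1 : (j + 1 + (2 ^ E.L - 1)) % 2 ^ E.L = j := by
      rw [sub_wrap (by omega) (by omega)]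
      omega
    refine ⟨by simp [c₁], ?_⟩
    simp only [wp_seq, wp_add, wp_dec, St.set_v, if_neg hx.symm, St.tick_v, c₁, i1]
    refine ⟨by omega, (p₁.tick.set (by simp) _).set (by simp) _, ?_, by simp, ?_⟩
    · simp only [St.set_time, St.tick_time]
      omega
    · simp only [if_neg hx, if_true, x₁]
      rw [← Nat.add_mod, show k - j = k - (j + 1) + 1 by omega, pow_succ]
      congr 1
      ring
  · rintro σ₁ ⟨-, p₁, t₁, c₁, x₁⟩
    exact ⟨by simp [Cond.eval, c₁], hQ _ p₁.tick (by simp; omega) (by simpa using x₁)⟩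
  · exact ⟨le_rfl, Pure.refl _ _, le_rfl, hk, by simpa using hy⟩

end Code
end CatalyticGrid

namespace CatalyticGrid

open Var

set_option linter.unusedSimpArgs false

/-! ### Initialization -/

namespace Params

variable (π : Params)

theorem b_lt_L : π.b < π.L := by
  refine (Nat.pow_lt_pow_iff_right (by norm_num : 1 < 2)).1 ?_
  have := π.le_n
  have := π.size'
  have := π.P_lt
  omega

theorem p_lt : π.p < 2 ^ π.L := by
  have h1 := π.size'
  have h2 := π.P_lt
  have : (1 : ℕ) * π.p ≤ (π.R + 2) * π.p := Nat.mul_le_mul_right _ (by omega)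
  omega

end Params

namespace Code

open Op Cond Prog Var

variable {π : Params} {D : List Bool → List Bool} {Q : St Var → Prop} {σ : St Var}

/-- Compute the sizes of blocks and arrays and the number of registers. -/
def sizes : Prog Var :=
  op (copy h b) ;; op (sub h g) ;; op (zero w) ;; op (inc w) ;; op (copy cnt h) ;; double w ;;
  op (copy m w) ;; op (add m m) ;; op (add m m) ;;
  op (zero ac) ;; op (copy ma b) ;; op (copy mx m) ;; op (copy mm md) ;; mul ;; op (copy rr ac)

theorem wp_sizes (hb : σ.v b = π.b) (hg : σ.v g = π.g) (hmd : σ.v md = π.P)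
    (hQ : ∀ σ', Pure [h, w, cnt, m, ac, ma, mx, mm, mq, rr] σ σ' →
      σ'.time ≤ σ.time + (14 * π.L + 20) → σ'.v h = π.h → σ'.v w = π.w → σ'.v m = π.m →
      σ'.v rr = π.R → Q σ') : wp (π.env D) sizes Q σ := by
  have hbL := π.b_lt_L
  have hL := π.L_pos
  have hlt : π.L < 2 ^ π.L := Nat.lt_two_pow_self
  have hP := π.P_lt
  have hsz := π.size'
  have hbe := π.b_eq
  have hmR := π.m_le_R
  have hR := π.R_lt
  have hm := π.m_eq
  have hwp := π.w_pos
  have hbR : π.b ≤ π.R := Nat.le_mul_of_pos_left _ π.m_pos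
  have i1 : (π.b + (2 ^ π.L - π.g)) % 2 ^ π.L = π.h := by
    rw [sub_wrap (by omega) (by omega)]
    omega
  have i2 : 1 % 2 ^ π.L = 1 := Nat.mod_eq_of_lt (by omega)
  simp only [sizes, wp_seq, wp_copy, wp_sub, wp_zero, wp_inc, St.set_v, if_true, reduceCtorEq,
    if_false, Params.env_L, hb, hg, zero_add, i1, i2]
  refine wp_double (y := 1) (k := π.h) (by decide) (by simp [i2]) (by simp)
    (by simp only [Params.env_L]; omega) fun σ₁ p₁ t₁ w₁ => ?_
  have p₁' : Pure [h, w, cnt, m, ac, ma, mx, mm, mq, rr] σ σ₁ :=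
    ((((((Pure.refl _ _).set (by simp) _).set (by simp) _).set (by simp) _).set (by simp) _).set
      (by simp) _).trans (p₁.mono (by simp))
  simp only [one_mul, Params.env_L] at w₁
  rw [show 2 ^ π.h = π.w from rfl, Nat.mod_eq_of_lt (by omega)] at w₁
  have b₁ : σ₁.v b = π.b := (p₁'.frame b (by simp)).trans hb
  have md₁ : σ₁.v md = π.P := (p₁'.frame md (by simp)).trans hmd
  have h₁ : σ₁.v h = π.h := (p₁.frame h (by simp)).trans (by simp)
  have i3 : (π.w + π.w) % 2 ^ π.L = π.w + π.w := Nat.mod_eq_of_lt (by omega)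
  have i4 : (π.w + π.w + (π.w + π.w)) % 2 ^ π.L = π.m := by
    rw [Nat.mod_eq_of_lt (by omega)]
    omega
  simp only [wp_seq, wp_copy, wp_add, wp_zero, St.set_v, if_true, reduceCtorEq,
    if_false, Params.env_L, w₁, b₁, md₁, i3, i4]
  refine wp_mul (by simpa) (by simp; omega) (by simp; omega) (by simp; omega) fun σ₂ p₂ t₂ r₂ => ?_
  simp only [St.set_v, if_true, reduceCtorEq, if_false, zero_add, St.set_time, Params.env_L]
    at r₂ t₂ t₁
  rw [mul_comm, show π.m * π.b = π.R from rfl, Nat.mod_eq_of_lt hR] at r₂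
  rw [wp_copy, r₂]
  refine hQ _ ?_ (by simp only [St.set_time]; omega) ?_ ?_ ?_ (by simp)
  · refine Pure.set (Pure.trans ?_ (p₂.mono (by simp))) (by simp) _
    repeat refine Pure.set ?_ (by simp) _
    exact p₁'
  · simp [p₂.frame h (by simp), h₁]
  · simp [p₂.frame w (by simp), w₁]
  · simp [p₂.frame m (by simp)]

/-- Compute the number of levels and the shifted positions of the endpoints. -/
def ends : Prog Var :=
  op (copy ell v1) ;; op (sub ell u1) ;; op (zero a) ;; op (zero pw) ;; op (inc pw) ;;
  loop (lt pw ell) (op (add pw pw) ;; op (inc a)) ;;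
  op (copy a1 a) ;; op (inc a1) ;; op (copy n1 n) ;; op (add n1 w) ;; op (inc n1) ;;
  op (copy us u2) ;; op (add us w) ;; op (copy vs v2) ;; op (add vs w)

theorem wp_ends (hn : σ.v n = π.n) (hu1 : σ.v u1 = π.u1) (hv1 : σ.v v1 = π.v1)
    (hu2 : σ.v u2 = π.u2) (hv2 : σ.v v2 = π.v2) (hw : σ.v w = π.w)
    (hQ : ∀ σ', Pure [ell, a, pw, a1, n1, us, vs] σ σ' → σ'.time ≤ σ.time + (3 * π.L + 20) →
      σ'.v ell = 2 ^ π.a → σ'.v a = π.a → σ'.v a1 = π.a + 1 → σ'.v n1 = π.n + π.w + 1 →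
      σ'.v us = π.u2 + π.w → σ'.v vs = π.v2 + π.w → Q σ') : wp (π.env D) ends Q σ := by
  have hbL := π.b_lt_L
  have hab := π.a_lt
  have hlt : π.L < 2 ^ π.L := Nat.lt_two_pow_self
  have hP := π.P_lt
  have hsz := π.size'
  have hv := π.v1_eq
  have hv' := π.v1_le
  have hap := Nat.two_pow_pos π.a
  have h3 := π.u2_le
  have h4 := π.v2_le
  have i1 : (π.v1 + (2 ^ π.L - π.u1)) % 2 ^ π.L = 2 ^ π.a := by
    rw [sub_wrap (by omega) (by omega)]
    omega
  have i2 : 1 % 2 ^ π.L = 1 := Nat.mod_eq_of_lt (by omega)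
  simp only [ends, wp_seq, wp_copy, wp_sub, wp_zero, wp_inc, St.set_v, if_true, reduceCtorEq,
    if_false, Params.env_L, hv1, hu1, zero_add, i1, i2]
  refine wp_loop_of (fun j σ' => j ≤ π.a ∧ Pure [ell, a, pw] σ σ' ∧
    σ'.time + 3 * j ≤ σ.time + (3 * π.a + 5) ∧ σ'.v pw = 2 ^ (π.a - j) ∧ σ'.v a = π.a - j ∧
    σ'.v ell = 2 ^ π.a) ?_ ?_ π.a ?_
  · rintro j σ₁ ⟨hj, p₁, t₁, w₁, b₁, s₁⟩
    have h2 : 2 ^ (π.a - j) = 2 ^ (π.a - (j + 1)) + 2 ^ (π.a - (j + 1)) := by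
      rw [← two_mul, ← pow_succ']
      congr 1
      omega
    have hp := Nat.two_pow_pos (π.a - (j + 1))
    have h5 : 2 ^ (π.a - j) ≤ 2 ^ π.a := Nat.pow_le_pow_right (by norm_num) (by omega)
    refine ⟨by simp only [eval_lt, w₁, s₁]; omega, ?_⟩
    simp only [wp_seq, wp_add, wp_inc, St.set_v, reduceCtorEq, if_false, St.tick_v, w₁, b₁,
      Params.env_L]
    refine ⟨by omega, (p₁.tick.set (by simp) _).set (by simp) _, ?_, ?_, ?_, by simpa using s₁⟩
    · simp only [St.set_time, St.tick_time]
      omega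
    · simp only [if_true]
      rw [Nat.mod_eq_of_lt (by omega), h2]
    · simp only [if_true]
      rw [Nat.mod_eq_of_lt (by omega)]
      omega
  · rintro σ₁ ⟨-, p₁, t₁, w₁, b₁, s₁⟩
    refine ⟨by simp [Cond.eval, w₁, s₁], ?_⟩
    have f₁ : ∀ x, x ∉ [ell, a, pw] → σ₁.v x = σ.v x := p₁.frame
    have i3 : (π.a + 1) % 2 ^ π.L = π.a + 1 := Nat.mod_eq_of_lt (by omega)
    have i4 : (π.n + π.w) % 2 ^ π.L = π.n + π.w := Nat.mod_eq_of_lt (by omega)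
    have i5 : (π.n + π.w + 1) % 2 ^ π.L = π.n + π.w + 1 := Nat.mod_eq_of_lt (by omega)
    have i6 : (π.u2 + π.w) % 2 ^ π.L = π.u2 + π.w := Nat.mod_eq_of_lt (by omega)
    have i7 : (π.v2 + π.w) % 2 ^ π.L = π.v2 + π.w := Nat.mod_eq_of_lt (by omega)
    simp only [wp_seq, wp_copy, wp_add, wp_inc, St.set_v, if_true, reduceCtorEq, if_false,
      Params.env_L, St.tick_v, b₁, f₁ n (by simp), f₁ u2 (by simp), f₁ v2 (by simp),
      f₁ w (by simp), hn, hu2, hv2, hw, i3, i4, i5, i6, i7, Nat.sub_zero]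
    refine hQ _ ?_ ?_ ?_ ?_ ?_ ?_ ?_ ?_
    · repeat refine Pure.set ?_ (by simp) _
      exact (p₁.mono (by simp)).tick
    · simp only [St.set_time, St.tick_time]
      omega
    all_goals simp [s₁, b₁]
  · refine ⟨le_rfl, ?_, ?_, by simp, by simp, by simp⟩
    · repeat refine Pure.set ?_ (by simp) _
      exact Pure.refl _ _
    · simp only [St.set_time]
      omega

/-- Compute the increment of the counter. -/
def stride : Prog Var :=
  op (copy cnt lv) ;; op (copy d a) ;;
  loop (pos d) (op (dec cnt) ;; op (dec cnt) ;; ite (lt h d) (op (sub cnt g)) skip ;; op (dec d)) ;;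
  op (zero step) ;; op (inc step) ;; double step ;; op (zero acc)

theorem wp_stride (hlv : σ.v lv = π.L) (ha : σ.v a = π.a) (hh : σ.v h = π.h) (hg : σ.v g = π.g)
    (hQ : ∀ σ', Pure [cnt, d, mq, step, acc] σ σ' → σ'.time ≤ σ.time + (9 * π.L + 10) →
      σ'.v step = 2 ^ (π.L - counterBits π.h π.g π.a) % 2 ^ π.L → σ'.v acc = 0 → Q σ') :
    wp (π.env D) stride Q σ := by
  have hbL := π.b_lt_L
  have hab := π.a_lt
  have hlt : π.L < 2 ^ π.L := Nat.lt_two_pow_self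
  have hbits := π.bits_le
  simp only [stride, wp_seq, wp_copy, St.set_v, if_true, reduceCtorEq, if_false, hlv, ha]
  refine wp_loop_of (fun j σ' => j ≤ π.a ∧ Pure [cnt, d, mq] σ σ' ∧
    σ'.time + 6 * j ≤ σ.time + (6 * π.a + 2) ∧ σ'.v d = j ∧
    σ'.v cnt = π.L - (counterBits π.h π.g π.a - counterBits π.h π.g j)) ?_ ?_ π.a ?_
  · rintro j σ₁ ⟨hj, p₁, t₁, d₁, c₁⟩
    have hmono := counterBits_mono π.h π.g hj
    have hsucc : counterBits π.h π.g (j + 1) = counterBits π.h π.g j + digitBits π.h π.g (j + 1) :=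
      rfl
    have hdig : digitBits π.h π.g (j + 1) = 2 + if π.h < j + 1 then π.g else 0 := rfl
    refine ⟨by simp [d₁], ?_⟩
    set C := π.L - (counterBits π.h π.g π.a - counterBits π.h π.g (j + 1)) with hC
    have i1 : (C + (2 ^ π.L - 1)) % 2 ^ π.L = C - 1 := sub_wrap (by omega) (by omega)
    have i2 : (C - 1 + (2 ^ π.L - 1)) % 2 ^ π.L = C - 2 := by
      rw [sub_wrap (by omega) (by omega)]
      omega
    have i4 : (j + 1 + (2 ^ π.L - 1)) % 2 ^ π.L = j := by
      rw [sub_wrap (by omega) (by omega)]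
      omega
    have vh : σ₁.v h = π.h := (p₁.frame h (by simp)).trans hh
    have vg : σ₁.v g = π.g := (p₁.frame g (by simp)).trans hg
    simp only [wp_seq, wp_dec, wp_ite, eval_lt, St.set_v, reduceCtorEq, if_false, if_true,
      St.tick_v, d₁, c₁, vh, Params.env_L, i1, i2]
    split_ifs with hc
    · rw [if_pos hc] at hdig
      have i3 : (C - 2 + (2 ^ π.L - π.g)) % 2 ^ π.L = C - 2 - π.g := sub_wrap (by omega) (by omega)
      simp only [wp_seq, wp_sub, wp_dec, St.set_v, reduceCtorEq, if_false, if_true,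
        St.tick_v, d₁, vg, Params.env_L, i3, i4]
      refine ⟨by omega, ?_, ?_, trivial, by omega⟩
      · exact ((((p₁.tick.set (by simp) _).set (by simp) _).tick).set (by simp) _).set (by simp) _
      · simp only [St.set_time, St.tick_time]
        omega
    · rw [if_neg hc] at hdig
      simp only [wp_skip, wp_dec, St.set_v, reduceCtorEq, if_false, if_true,
        St.tick_v, d₁, Params.env_L, i4]
      refine ⟨by omega, ?_, ?_, trivial, by omega⟩
      · exact ((((p₁.tick.set (by simp) _).set (by simp) _).tick).set (by simp) _).set (by simp) _
      · simp only [St.set_time, St.tick_time]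
        omega
  · rintro σ₁ ⟨-, p₁, t₁, d₁, c₁⟩
    have i2 : 1 % 2 ^ π.L = 1 := Nat.mod_eq_of_lt (Nat.one_lt_two_pow π.L_pos.ne')
    refine ⟨by simp [Cond.eval, d₁], ?_⟩
    simp only [wp_seq, wp_zero, wp_inc, St.set_v, if_true, zero_add, Params.env_L, i2]
    refine wp_double (y := 1) (k := π.L - counterBits π.h π.g π.a) (by decide) (by simp [i2])
      (by simpa [counterBits] using c₁) (by simp) fun σ₂ p₂ t₂ s₂ => ?_
    rw [wp_zero]
    refine hQ _ ?_ ?_ (by simpa using s₂) (by simp)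
    · refine Pure.set (Pure.trans ?_ (p₂.mono (by simp))) (by simp) _
      exact ((p₁.mono (by simp)).tick.set (by simp) _).set (by simp) _
    · simp only [St.set_time, St.tick_time] at t₂ ⊢
      omega
  · refine ⟨le_rfl, ((Pure.refl _ _).set (by simp) _).set (by simp) _, ?_, by simp, by simp⟩
    simp only [St.set_time]
    omega

/-- Read the input and compute the parameters. -/
def init (e : ℕ) : Prog Var :=
  readInput ;; wordSize ;; modulus ;; bitLength ;; blockBits e ;; sizes ;; ends ;; stride

theorem wp_init {e : ℕ} (he : 0 < e) (hbs : π.b = Nat.size π.n) (hg : π.g = Nat.sqrt (π.b / e))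
    (hP : π.P = 2 ^ π.L - ((2 ^ π.L - 1) % π.p + 1)) (hL : 4 * π.b + 4 * e + 1 < 2 ^ π.L)
    (hi : σ.input = Tape.init (encodeList [π.n, π.p, π.u1, π.u2, π.v1, π.v2]))
    (hQ : ∀ σ', σ'.reg = σ.reg → σ'.oracle = σ.oracle → σ'.output = σ.output →
      σ'.time ≤ σ.time + (83 * π.L + e + 130) → π.Holds σ' → σ'.v acc = 0 → Q σ') :
    wp (π.env D) (init e) Q σ := by
  have hbL := π.b_lt_L
  have hPl := π.P_lt
  have hsz := π.size'
  have hv := π.v1_eq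
  have hv' := π.v1_le
  have hap := Nat.two_pow_pos π.a
  have h3 := π.u2_le
  have h4 := π.v2_le
  rw [init, wp_seq]
  refine wp_readInput π.L_pos hi (by simp only [Params.env_L]; omega) π.p_lt
    (by simp only [Params.env_L]; omega) (by simp only [Params.env_L]; omega)
    (by simp only [Params.env_L]; omega) (by simp only [Params.env_L]; omega)
    fun σ₁ r₁ o₁ u₁ t₁ vn vp vu1 vu2 vv1 vv2 => ?_
  rw [wp_seq]
  refine wp_wordSize π.L_pos fun σ₂ p₂ t₂ vlv vhb => ?_
  rw [wp_seq]
  refine wp_modulus (k := π.p) (by rw [p₂.frame p (by simp), vp]) π.two_le_p π.p_lt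
    fun σ₃ p₃ t₃ vmd => ?_
  rw [Params.env_L, ← hP] at vmd
  rw [wp_seq]
  refine wp_bitLength (k := π.n) (by rw [p₃.frame n (by simp), p₂.frame n (by simp), vn])
    (by simp only [Params.env_L]; omega) fun σ₄ p₄ t₄ vb => ?_
  rw [← hbs] at vb
  rw [wp_seq]
  refine wp_blockBits he vb hL fun σ₅ p₅ t₅ vg => ?_
  rw [← hg] at vg
  rw [wp_seq]
  refine wp_sizes (π := π) (by rw [p₅.frame b (by simp), vb]) vg
    (by rw [p₅.frame md (by simp), p₄.frame md (by simp), vmd]) fun σ₆ p₆ t₆ vh vw vm vrr => ?_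
  rw [wp_seq]
  have back : ∀ x, x ∉ [h, w, cnt, m, ac, ma, mx, mm, mq, rr, g, tp, px, kq, b, pw, md, d, lv, hb] →
      σ₆.v x = σ₁.v x := fun x hx => by
    simp only [List.mem_cons, List.not_mem_nil, or_false, not_or] at hx
    rw [p₆.frame x (by simp [hx]), p₅.frame x (by simp [hx]), p₄.frame x (by simp [hx]),
      p₃.frame x (by simp [hx]), p₂.frame x (by simp [hx])]
  refine wp_ends (π := π) ((back n (by simp)).trans vn) ((back u1 (by simp)).trans vu1)
    ((back v1 (by simp)).trans vv1) ((back u2 (by simp)).trans vu2) ((back v2 (by simp)).trans vv2)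
    vw fun σ₇ p₇ t₇ vell va va1 vn1 vus vvs => ?_
  refine wp_stride (π := π)
    (by rw [p₇.frame lv (by simp), p₆.frame lv (by simp), p₅.frame lv (by simp),
      p₄.frame lv (by simp), p₃.frame lv (by simp), vlv, Params.env_L])
    va (by rw [p₇.frame h (by simp), vh])
    (by rw [p₇.frame g (by simp), p₆.frame g (by simp), vg]) fun σ₈ p₈ t₈ vstep vacc => ?_
  have last : ∀ x, x ∉ [cnt, d, mq, step, acc, ell, a, pw, a1, n1, us, vs] → σ₈.v x = σ₆.v x :=
    fun x hx => by
      simp only [List.mem_cons, List.not_mem_nil, or_false, not_or] at hx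
      rw [p₈.frame x (by simp [hx]), p₇.frame x (by simp [hx])]
  refine hQ σ₈ ?_ ?_ ?_ ?_ ?_ vacc
  · rw [p₈.reg, p₇.reg, p₆.reg, p₅.reg, p₄.reg, p₃.reg, p₂.reg, r₁]
  · rw [p₈.oracle, p₇.oracle, p₆.oracle, p₅.oracle, p₄.oracle, p₃.oracle, p₂.oracle, o₁]
  · rw [p₈.output, p₇.output, p₆.output, p₅.output, p₄.output, p₃.output, p₂.output, u₁]
  · simp only [Params.env_L] at t₁ t₂ t₃ t₄
    omega
  · have c1 := ((last n (by simp)).trans (back n (by simp))).trans vn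
    have c2 := ((last p (by simp)).trans (back p (by simp))).trans vp
    have c3 := ((last u1 (by simp)).trans (back u1 (by simp))).trans vu1
    have c4 : σ₈.v lv = π.L := by
      rw [last lv (by simp), p₆.frame lv (by simp), p₅.frame lv (by simp), p₄.frame lv (by simp),
        p₃.frame lv (by simp), vlv, Params.env_L]
    have c5 : σ₈.v hb = 2 ^ (π.L - 1) := by
      rw [last hb (by simp), p₆.frame hb (by simp), p₅.frame hb (by simp), p₄.frame hb (by simp),
        p₃.frame hb (by simp), vhb, Params.env_L]
    have c6 : σ₈.v md = π.P := by
      rw [last md (by simp), p₆.frame md (by simp), p₅.frame md (by simp), p₄.frame md (by simp),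
        vmd]
    have c7 : σ₈.v b = π.b := by
      rw [last b (by simp), p₆.frame b (by simp), p₅.frame b (by simp), vb]
    have c8 : σ₈.v g = π.g := by
      rw [last g (by simp), p₆.frame g (by simp), vg]
    have c9 := (last h (by simp)).trans vh
    have c10 := (last w (by simp)).trans vw
    have c11 := (last m (by simp)).trans vm
    have c12 := (last rr (by simp)).trans vrr
    have c13 := (p₈.frame a (by simp)).trans va
    have c14 := (p₈.frame a1 (by simp)).trans va1
    have c15 := (p₈.frame ell (by simp)).trans vell
    have c16 := (p₈.frame n1 (by simp)).trans vn1
    have c17 := (p₈.frame us (by simp)).trans vus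
    have c18 := (p₈.frame vs (by simp)).trans vvs
    intro x k hx
    cases x <;> first
      | (obtain rfl := Option.some.inj hx; assumption)
      | cases hx

end Code
end CatalyticGrid

namespace CatalyticGrid

open Var

set_option linter.unusedSimpArgs false

/-! ### Searching for a shift -/

/-- There is a multiple of `p` by which all registers can be shifted into `[0, P)`. -/
theorem exists_shift {N P p R : ℕ} (hp : 0 < p) (hP : P < N) (hNP : N ≤ P + p)
    (hR : (R + 2) * p ≤ N) (ρ : ℕ → ℕ) : ∃ i ≤ R, ∀ r < R, (ρ r + i * p) % N < P := by
  by_contra hcon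
  push Not at hcon
  choose! f hf1 hf2 using hcon
  obtain ⟨i, hi, j, hj, hne, hij⟩ := Finset.exists_ne_map_eq_of_card_lt_of_maps_to
    (s := Finset.range (R + 1)) (t := Finset.range R) (by simp) (f := f)
    (fun i hi => by
      simp only [Finset.coe_range, Set.mem_Iio, Finset.mem_coe, Finset.mem_range] at hi ⊢
      exact hf1 i (by omega))
  have key : ∀ i j, i < j → j ≤ R → f i = f j → False := by
    intro i j hlt hj hij
    have h1 := hf2 i (by omega)
    have h2 := hf2 j hj
    rw [← hij] at h2
    have hd : (ρ (f i) + j * p) = (ρ (f i) + i * p) + (j - i) * p := by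
      rw [add_assoc, ← add_mul]
      congr 2
      omega
    rw [hd, ← Nat.mod_add_mod] at h2
    have hN : (ρ (f i) + i * p) % N < N := Nat.mod_lt _ (by omega)
    have h3 : (1 : ℕ) * p ≤ (j - i) * p := Nat.mul_le_mul_right _ (by omega)
    have h4 : (j - i) * p + 2 * p ≤ (R + 2) * p := by
      rw [← add_mul]
      exact Nat.mul_le_mul_right _ (by omega)
    rw [Nat.mod_eq_sub_mod (by omega), Nat.mod_eq_of_lt (by omega)] at h2
    omega
  simp only [Finset.mem_range] at hi hj
  rcases lt_or_gt_of_ne hne with h | h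
  · exact key i j h (by omega) hij
  · exact key j i h (by omega) hij.symm

namespace Code

open Op Cond Prog Var

variable {π : Params} {D : List Bool → List Bool} {Q : St Var → Prop} {σ : St Var}

/-- Test whether some shifted register exceeds the modulus. -/
def check : Prog Var :=
  op (zero bad) ;; op (zero ptr) ;; op (copy ri rr) ;;
  loop (pos ri) (op (load tv ptr) ;; op (add tv sh) ;; ite (lt tv md) skip (op (copy bad lv)) ;;
    op (add ptr lv) ;; op (dec ri))

theorem wp_check {s : ℕ} (hh : π.Holds σ) (hs : σ.v sh = s)
    (hQ : ∀ σ', Pure [bad, ptr, ri, tv, mq] σ σ' → σ'.time ≤ σ.time + (7 * π.R + 4) →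
      (σ'.v bad = 0 ↔ ∀ r < π.R, (σ.reg r + s) % 2 ^ π.L < π.P) → Q σ') :
    wp (π.env D) check Q σ := by
  have hsz := π.size'
  have hP := π.P_lt
  have hR := π.R_lt
  have hL := π.L_pos
  have vrr : σ.v rr = π.R := hh rr _ rfl
  have vlv : σ.v lv = π.L := hh lv _ rfl
  have vmd : σ.v md = π.P := hh md _ rfl
  simp only [check, wp_seq, wp_zero, wp_copy, St.set_v, reduceCtorEq, if_false, vrr]
  refine wp_loop_of (fun j σ' => j ≤ π.R ∧ Pure [bad, ptr, ri, tv, mq] σ σ' ∧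
    σ'.time + 7 * j ≤ σ.time + (7 * π.R + 3) ∧ σ'.v ri = j ∧ σ'.v ptr = (π.R - j) * π.L ∧
    (σ'.v bad = 0 ↔ ∀ r < π.R - j, (σ.reg r + s) % 2 ^ π.L < π.P)) ?_ ?_ π.R ?_
  · rintro j σ₁ ⟨hj, p₁, t₁, r₁, a₁, b₁⟩
    have e₁ : σ₁.reg = σ.reg := p₁.reg
    have s₁ : σ₁.v sh = s := (p₁.frame sh (by simp)).trans hs
    have l₁ : σ₁.v lv = π.L := (p₁.frame lv (by simp)).trans vlv
    have m₁ : σ₁.v md = π.P := (p₁.frame md (by simp)).trans vmd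
    refine ⟨by simp [r₁], ?_⟩
    rw [wp_seq]
    refine wp_load hL (r := π.R - (j + 1)) (by simp only [Params.env_R]; omega)
      (by simpa using a₁) ?_
    have hle : (π.R - j) * π.L ≤ π.R * π.L := Nat.mul_le_mul_right _ (by omega)
    have i1 : ((π.R - (j + 1)) * π.L + π.L) % 2 ^ π.L = (π.R - j) * π.L := by
      rw [← Nat.succ_mul, show (π.R - (j + 1)).succ = π.R - j by omega]
      exact Nat.mod_eq_of_lt (by omega)
    have i2 : (j + 1 + (2 ^ π.L - 1)) % 2 ^ π.L = j := by
      rw [sub_wrap (by omega) (by omega)]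
      omega
    have hall : (∀ r < π.R - j, (σ.reg r + s) % 2 ^ π.L < π.P) ↔
        (∀ r < π.R - (j + 1), (σ.reg r + s) % 2 ^ π.L < π.P) ∧
          (σ.reg (π.R - (j + 1)) + s) % 2 ^ π.L < π.P := by
      rw [show π.R - j = π.R - (j + 1) + 1 by omega]
      exact Nat.forall_lt_succ_right
    have hmul : (π.R - (j + 1)) * π.L / π.L = π.R - (j + 1) := Nat.mul_div_cancel _ hL
    simp only [wp_seq, wp_add, wp_ite, wp_skip, wp_copy, wp_dec, eval_lt, St.set_v, St.tick_v,
      St.tick_reg, reduceCtorEq, if_false, if_true, Params.env_L, e₁, s₁, l₁, m₁, r₁, a₁, i1, i2]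
    split_ifs with hc
    · refine ⟨by omega, ?_, ?_, trivial, trivial, ?_⟩
      · exact ((((((p₁.tick.set (by simp) _).set (by simp) _).tick).set (by simp) _).set
          (by simp) _).set (by simp) _)
      · simp only [St.set_time, St.tick_time]
        omega
      · rw [hall, b₁]
        exact ⟨fun h => ⟨h, hc⟩, fun h => h.1⟩
    · refine ⟨by omega, ?_, ?_, trivial, trivial, ?_⟩
      · exact ((((((p₁.tick.set (by simp) _).set (by simp) _).tick).set (by simp) _).set
          (by simp) _).set (by simp) _)
      · simp only [St.set_time, St.tick_time]
        omega
      · rw [hall]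
        exact ⟨fun h => absurd h hL.ne', fun h => absurd h.2 hc⟩
  · rintro σ₁ ⟨-, p₁, t₁, r₁, a₁, b₁⟩
    exact ⟨by simp [Cond.eval, r₁], hQ _ p₁.tick (by simp; omega) (by simpa using b₁)⟩
  · refine ⟨le_rfl, (((Pure.refl _ _).set (by simp) _).set (by simp) _).set (by simp) _, ?_,
      by simp, by simp, by simp⟩
    simp only [St.set_time]
    omega

/-- Find a multiple of `p` by which all registers can be shifted. -/
def search : Prog Var := op (zero sh) ;; check ;; loop (pos bad) (op (add sh p) ;; check)

theorem wp_search (hh : π.Holds σ)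
    (hQ : ∀ σ', Pure [sh, bad, ptr, ri, tv, mq] σ σ' →
      σ'.time ≤ σ.time + ((π.R + 1) * (7 * π.R + 6) + 1) → σ'.v sh < 2 ^ π.L →
      (∀ r < π.R, (σ.reg r + σ'.v sh) % 2 ^ π.L < π.P) → Q σ') : wp (π.env D) search Q σ := by
  classical
  have hsz := π.size'
  have hP := π.P_lt
  have vp : σ.v p = π.p := hh p _ rfl
  have ex := exists_shift (show 0 < π.p by have := π.two_le_p; omega) hP π.lt_P
    (R := π.R) (by omega) σ.reg
  have hex : ∃ i, ∀ r < π.R, (σ.reg r + i * π.p) % 2 ^ π.L < π.P := by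
    obtain ⟨i, -, h⟩ := ex
    exact ⟨i, h⟩
  set I := Nat.find hex with hI
  have hspec : ∀ r < π.R, (σ.reg r + I * π.p) % 2 ^ π.L < π.P := Nat.find_spec hex
  have hIR : I ≤ π.R := by
    obtain ⟨i, hi, h⟩ := ex
    exact (Nat.find_le h).trans hi
  have hlt : ∀ i ≤ I, i * π.p < 2 ^ π.L := fun i hi => by
    have : i * π.p ≤ (π.R + 2) * π.p := Nat.mul_le_mul_right _ (by omega)
    omega
  rw [search, wp_seq, wp_zero, wp_seq]
  refine wp_check (s := 0) (hh.frame (S := [sh]) ((Pure.refl _ _).set (by simp) _).frame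
    (by simp [Params.const])) (by simp) fun σ₁ p₁ t₁ b₁ => ?_
  refine wp_loop_of (fun j σ' => j ≤ I ∧ Pure [sh, bad, ptr, ri, tv, mq] σ σ' ∧
    σ'.time + j * (7 * π.R + 6) ≤ σ.time + (I + 1) * (7 * π.R + 6) ∧
    σ'.v sh = (I - j) * π.p ∧
    (σ'.v bad = 0 ↔ ∀ r < π.R, (σ.reg r + (I - j) * π.p) % 2 ^ π.L < π.P)) ?_ ?_ I ?_
  · rintro j σ₂ ⟨hj, p₂, t₂, s₂, b₂⟩
    have hmin : ¬ ∀ r < π.R, (σ.reg r + (I - (j + 1)) * π.p) % 2 ^ π.L < π.P :=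
      Nat.find_min hex (by omega)
    rw [← b₂] at hmin
    refine ⟨by simp only [eval_pos]; omega, ?_⟩
    have i1 : ((I - (j + 1)) * π.p + π.p) % 2 ^ π.L = (I - j) * π.p := by
      rw [← Nat.succ_mul, show (I - (j + 1)).succ = I - j by omega]
      exact Nat.mod_eq_of_lt (hlt _ (by omega))
    have vp₂ : σ₂.v p = π.p := (p₂.frame p (by simp)).trans vp
    rw [wp_seq, wp_add]
    simp only [St.tick_v, s₂, vp₂, Params.env_L, i1]
    have p₃ : Pure [sh, bad, ptr, ri, tv, mq] σ (σ₂.tick.set sh ((I - j) * π.p)) :=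
      p₂.tick.set (by simp) _
    refine wp_check (s := (I - j) * π.p) (hh.frame p₃.frame (by simp [Params.const])) (by simp)
      fun σ₄ p₄ t₄ b₄ => ?_
    refine ⟨by omega, p₃.trans (p₄.mono (by simp)), ?_, ?_, ?_⟩
    · simp only [St.set_time, St.tick_time] at t₄
      rw [Nat.succ_mul] at t₂
      omega
    · rw [p₄.frame sh (by simp)]
      simp
    · rw [b₄, St.set_reg, St.tick_reg, p₂.reg]
  · rintro σ₂ ⟨-, p₂, t₂, s₂, b₂⟩
    rw [Nat.sub_zero] at s₂ b₂
    refine ⟨by simp [Cond.eval, b₂.2 hspec], hQ _ p₂.tick ?_ ?_ ?_⟩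
    · have : (I + 1) * (7 * π.R + 6) ≤ (π.R + 1) * (7 * π.R + 6) :=
        Nat.mul_le_mul_right _ (by omega)
      simp only [St.tick_time]
      omega
    · rw [St.tick_v, s₂]
      exact hlt _ le_rfl
    · rw [St.tick_v, s₂]
      exact hspec
  · refine ⟨le_rfl, ?_, ?_, ?_, ?_⟩
    · exact ((Pure.refl _ _).set (by simp) _).trans (p₁.mono (by simp))
    · simp only [St.set_time] at t₁
      rw [Nat.succ_mul I]
      omega
    · rw [p₁.frame sh (by simp)]
      simp
    · simpa using b₁

/-- Write the residue of `acc` modulo `p` on the output tape. -/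
def finish : Prog Var :=
  op (zero ac) ;; op (copy ma acc) ;; op (zero mx) ;; op (inc mx) ;; op (copy mm p) ;; mul ;;
  loop (pos ac) (ite (odd ac) (out true) (out false) ;; op (half ac))

theorem wp_finish (hp : σ.v p = π.p) (hacc : σ.v acc < 2 ^ π.L)
    (hQ : ∀ σ', σ'.reg = σ.reg → σ'.time ≤ σ.time + (15 * π.L + 7) →
      σ'.output = σ.output ++ Nat.bits (σ.v acc % π.p) → Q σ') : wp (π.env D) finish Q σ := by
  have h2 := π.two_le_p
  have hpL := π.p_lt
  have i1 : 1 % 2 ^ π.L = 1 := Nat.mod_eq_of_lt (by omega)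
  simp only [finish, wp_seq, wp_zero, wp_copy, wp_inc, St.set_v, if_true, reduceCtorEq, if_false,
    zero_add, Params.env_L, i1, hp]
  refine wp_mul (by simpa) (by simpa) (by simp; omega) (by simp; omega) fun σ₁ p₁ t₁ r₁ => ?_
  simp only [St.set_v, if_true, reduceCtorEq, if_false, zero_add, mul_one, St.set_time,
    Params.env_L] at r₁ t₁
  have o₁ : σ₁.output = σ.output := p₁.output
  have g₁ : σ₁.reg = σ.reg := p₁.reg
  have key : ∀ N k (σ₂ : St Var), k < 2 ^ N → σ₂.v ac = k →
      wp (π.env D) (loop (pos ac) (ite (odd ac) (out true) (out false) ;; op (half ac)))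
        (fun σ' => σ'.reg = σ₂.reg ∧ σ'.time ≤ σ₂.time + (4 * N + 1) ∧
          σ'.output = σ₂.output ++ Nat.bits k) σ₂ := by
    intro N
    induction N with
    | zero =>
      intro k σ₂ hk e
      have hk0 : k = 0 := by simpa using hk
      rw [wp_loop, if_neg (by simp [e, hk0])]
      exact ⟨rfl, by simp, by simp [hk0]⟩
    | succ N ih =>
      intro k σ₂ hk e
      rw [wp_loop]
      by_cases hpos : 0 < k
      swap
      · have hk0 : k = 0 := by omega
        rw [if_neg (by simp [e, hk0])]
        exact ⟨rfl, by simp, by simp [hk0]⟩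
      rw [if_pos (by simpa [e] using hpos)]
      have fin : ∀ (σ₃ : St Var), σ₃.reg = σ₂.reg → σ₃.time = σ₂.time + 3 → σ₃.v ac = k →
          σ₃.output = σ₂.output ++ [decide (k % 2 = 1)] →
          wp (π.env D) (op (half ac)) (wp (π.env D)
            (loop (pos ac) (ite (odd ac) (out true) (out false) ;; op (half ac)))
            (fun σ' => σ'.reg = σ₂.reg ∧ σ'.time ≤ σ₂.time + (4 * (N + 1) + 1) ∧
              σ'.output = σ₂.output ++ Nat.bits k)) σ₃ := by
        intro σ₃ q1 q2 q3 q4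
        rw [wp_half]
        refine wp_mono (ih (k / 2) _ (by rw [pow_succ] at hk; omega) (by simp [q3])) ?_
        rintro σ' ⟨q5, q6, q7⟩
        refine ⟨q5.trans q1, ?_, ?_⟩
        · simp only [St.set_time] at q6
          omega
        · rw [q7, St.set_output, q4, bits_cons hpos, List.append_assoc]
          rfl
      rw [wp_seq, wp_ite]
      simp only [eval_odd, St.tick_v, e]
      split_ifs with hodd
      · rw [wp_out]
        exact fin _ rfl rfl e (by simp [hodd])
      · rw [wp_out]
        exact fin _ rfl rfl e (by simp [hodd])
  refine wp_mono (key π.L _ σ₁ ?_ r₁) ?_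
  · exact (Nat.mod_lt _ (by omega)).trans hpL
  · rintro σ' ⟨q1, q2, q3⟩
    exact hQ σ' (q1.trans g₁) (by omega) (by rw [q3, o₁])

/-! ### The whole program -/

/-- The program. -/
def program (e : ℕ) : Prog Var := init e ;; search ;; walk ;; finish

/-- The number of steps of the program. -/
def programTime (π : Params) (e : ℕ) : ℕ :=
  98 * π.L + e + 140 + (π.R + 1) * (7 * π.R + 6) +
    2 ^ counterBits π.h π.g π.a * (roundTime π + 1)

/-- The contents of the arrays before the computation. -/
def start (π : Params) (ρ : ℕ → ℕ) (s d i : ℕ) : ZMod π.P :=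
  if d = 0 then 0 else if d = π.a + 1 then 1 else
    (((ρ (d * π.m + i) + s) % 2 ^ π.L : ℕ) : ZMod π.P)

theorem runTask_task (μ : Vertex π.n → Vertex π.n → ℕ) (Y : ℕ → ℕ → ZMod π.P)
    (hY : ∀ i, Y (π.a + 1) i = 1) (hY0 : ∀ i, Y 0 i = 0) :
    (∀ d, d ≠ 0 → runTask (reducedMatrix (ZMod π.P) μ π.p) π.h π.g π.a (task π) Y d = Y d) ∧
    runTask (reducedMatrix (ZMod π.P) μ π.p) π.h π.g π.a (task π) Y 0 ((π.v2 + π.w) % π.m) =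
      prodFrom (reducedMatrix (ZMod π.P) μ π.p) π.u1 (2 ^ π.a)
        ⟨π.u2, Nat.lt_succ_of_le π.u2_le⟩ ⟨π.v2, Nat.lt_succ_of_le π.v2_le⟩ := by
  have hn : π.n < 2 ^ π.g * 2 ^ π.h := by
    rw [← pow_add, add_comm, π.b_eq]
    exact π.n_lt
  rw [runTask_eq _ (reducedMatrix_tridiagonal μ π.p) hn (by simp [task])
    (Or.inr (by simp [task])) (Or.inl rfl) rfl (by simp [task]; exact π.w_pos)]
  set N := prodFrom (reducedMatrix (ZMod π.P) μ π.p) (task π).lay (2 ^ π.a) with hN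
  have e := push_congr (w := 2 ^ π.h) (m := 4 * 2 ^ π.h) (κ := task π) (N := N)
    (N' := Matrix.single ⟨π.u2, Nat.lt_succ_of_le π.u2_le⟩ ⟨π.v2, Nat.lt_succ_of_le π.v2_le⟩
      (N ⟨π.u2, Nat.lt_succ_of_le π.u2_le⟩ ⟨π.v2, Nat.lt_succ_of_le π.v2_le⟩))
    (fun i k h1 h2 h3 h4 => by
      simp only [task, Params.w] at h1 h2 h3 h4
      have e1 : i = ⟨π.u2, Nat.lt_succ_of_le π.u2_le⟩ := Fin.ext (by simp; omega)
      have e2 : k = ⟨π.v2, Nat.lt_succ_of_le π.v2_le⟩ := Fin.ext (by simp; omega)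
      rw [e1, e2]
      simp) Y
  rw [e, push_single _ (by simp [task, Params.w]) (by simp [task, Params.w])
    (by simp [task, Params.w]) (by simp [task, Params.w])]
  refine ⟨fun d hd => by simp [entryUpdate, task, hd], ?_⟩
  simp [entryUpdate, task, hY, hY0, sgn, Params.w, Params.m, hN]

theorem wp_program {e : ℕ} {μ : Vertex π.n → Vertex π.n → ℕ} (he : 0 < e)
    (hb : π.b = Nat.size π.n) (hg : π.g = Nat.sqrt (π.b / e))
    (hP : π.P = 2 ^ π.L - ((2 ^ π.L - 1) % π.p + 1)) (hL : 4 * π.b + 4 * e + 1 < 2 ^ π.L)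
    (hD : IsWeightOracle μ π.p D)
    (hi : σ.input = Tape.init (encodeList [π.n, π.p, π.u1, π.u2, π.v1, π.v2]))
    (hreg : ∀ r < π.R, σ.reg r < 2 ^ π.L)
    (hc : σ.oracle.cells.length = 20 * π.L) (hhead : σ.oracle.head ≤ 20 * π.L + 1)
    (hout : σ.output = []) :
    wp (π.env D) (program e) (fun σ' => (∀ r < π.R, σ'.reg r = σ.reg r) ∧
      σ'.time ≤ σ.time + programTime π e ∧
      ∃ r : ℕ, σ'.output = Nat.bits (r % π.p) ∧ (r : ZMod π.P) =
        prodFrom (reducedMatrix (ZMod π.P) μ π.p) π.u1 (2 ^ π.a)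
          ⟨π.u2, Nat.lt_succ_of_le π.u2_le⟩ ⟨π.v2, Nat.lt_succ_of_le π.v2_le⟩) σ := by
  have hPl := π.P_lt
  have hsz := π.size'
  rw [program, wp_seq]
  refine wp_init he hb hg hP hL hi fun σ₁ r₁ o₁ u₁ t₁ H₁ a₁ => ?_
  rw [wp_seq]
  refine wp_search H₁ fun σ₂ p₂ t₂ s₂ b₂ => ?_
  rw [wp_seq]
  rw [r₁] at b₂
  have reg₂ : σ₂.reg = σ.reg := p₂.reg.trans r₁
  obtain ⟨y₀, y₁⟩ := runTask_task μ (start π σ.reg (σ₂.v sh)) (by simp [start]) (by simp [start])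
  have S₂ : Sim π (20 * π.L) σ.reg (σ₂.v sh) (start π σ.reg (σ₂.v sh)) σ₂ := by
    have a₂ : σ₂.v acc = 0 := (p₂.frame acc (by simp)).trans a₁
    refine ⟨H₁.frame p₂.frame (by simp [Params.const]), rfl, fun r _ => by rw [reg₂], ?_, ?_, ?_,
      by simp [start], ?_, ?_, ?_⟩
    · intro d i h1 h2 h3
      have hlt := Params.index_lt h2 h3
      rw [reg₂]
      refine ⟨hreg _ hlt, b₂ _ hlt, ?_⟩
      rw [start, if_neg (by omega), if_neg (by omega)]
    · rw [a₂]
      omega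
    · simp [a₂, start]
    · rw [p₂.oracle, o₁, hc]
    · rw [p₂.oracle, o₁]
      exact hhead
    · rw [p₂.output, u₁, hout]
  refine wp_walk hD s₂ rfl S₂ fun σ₃ t₃ S₃ => ?_
  refine wp_finish (S₃.holds p _ rfl) (S₃.acc_lt.trans hPl) fun σ₄ g₄ t₄ o₄ => ⟨?_, ?_, ?_⟩
  · intro r hr
    rw [g₄]
    by_cases hex : ∃ d i, 1 ≤ d ∧ d ≤ π.a ∧ i < π.m ∧ r = d * π.m + i
    · obtain ⟨d, i, h1, h2, h3, rfl⟩ := hex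
      obtain ⟨q1, q2, q3⟩ := S₃.inside d i h1 h2 h3
      rw [y₀ d (by omega), start, if_neg (by omega), if_neg (by omega),
        ZMod.natCast_eq_natCast_iff', Nat.mod_eq_of_lt q2, Nat.mod_eq_of_lt (b₂ _ hr)] at q3
      have := Nat.ModEq.add_right_cancel' (σ₂.v sh) (show _ ≡ _ [MOD 2 ^ π.L] from q3)
      exact Nat.ModEq.eq_of_lt_of_lt this q1 (hreg _ hr)
    · refine S₃.outside r fun d i h1 h2 h3 h4 => hex ⟨d, i, h1, h2, h3, h4⟩
  · simp only [programTime]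
    omega
  · refine ⟨σ₃.v acc, ?_, ?_⟩
    · rw [o₄, S₃.output, List.nil_append]
    · rw [S₃.acc_eq, y₁]

end Code
end CatalyticGrid

namespace CatalyticGrid
open Var
set_option linter.unusedSimpArgs false

/-! ### The choice of the parameters -/

/-- The number of bits of a variable. -/
noncomputable def variableBits (e k n : ℕ) : ℕ := (k + 20 + 2 * (e + Fintype.card Var)) * Nat.size n

/-- The number of levels below which a recursive call is made for a single block. -/
def splitDepth (e n : ℕ) : ℕ := Nat.sqrt (Nat.size n / e)

/-- The number of registers. -/
def registerCount (e n : ℕ) : ℕ := 4 * 2 ^ (Nat.size n - splitDepth e n) * Nat.size n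

theorem splitDepth_sq_le (e n : ℕ) : splitDepth e n * splitDepth e n ≤ Nat.size n / e :=
  Nat.sqrt_le _

theorem splitDepth_le (e n : ℕ) : splitDepth e n ≤ Nat.size n :=
  (Nat.sqrt_le_self _).trans (Nat.div_le_self _ _)

theorem two_pow_size_le {n : ℕ} (hn : 0 < n) : 2 ^ Nat.size n ≤ 2 * n := by
  have h0 : 0 < Nat.size n := Nat.size_pos.2 hn
  have h := Nat.lt_size.1 (Nat.sub_lt h0 one_pos)
  calc 2 ^ Nat.size n = 2 * 2 ^ (Nat.size n - 1) := by
        rw [← pow_succ']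
        congr 1
        omega
    _ ≤ 2 * n := by omega

theorem two_le_size {n : ℕ} (hn : 2 ≤ n) : 2 ≤ Nat.size n :=
  Nat.lt_size.2 (by simpa using hn)

theorem counterBits_le (h g a : ℕ) : counterBits h g a ≤ 2 * a + g * (a - h) := by
  induction a with
  | zero => simp [counterBits]
  | succ a ih =>
    rw [counterBits, digitBits]
    split_ifs with h1
    · have : a + 1 - h = a - h + 1 := by omega
      rw [this, mul_add g]
      omega
    · have : g * (a - h) ≤ g * (a + 1 - h) := Nat.mul_le_mul_left _ (by omega)
      omega

theorem counterBits_le_of_lt {e n a : ℕ} (ha : a < Nat.size n) :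
    counterBits (Nat.size n - splitDepth e n) (splitDepth e n) a ≤ 2 * a + Nat.size n / e := by
  have h1 := counterBits_le (Nat.size n - splitDepth e n) (splitDepth e n) a
  have h2 := splitDepth_sq_le e n
  have h3 : splitDepth e n * (a - (Nat.size n - splitDepth e n)) ≤
    splitDepth e n * splitDepth e n := Nat.mul_le_mul_left _ (by omega)
  omega

section Sizes

variable {e k n p : ℕ}

theorem two_pow_variableBits (e k n : ℕ) : ∃ X Z E : ℕ, X = 2 ^ Nat.size n ∧
    Z = 2 ^ (k * Nat.size n) ∧ E = 2 ^ ((e + Fintype.card Var) * Nat.size n) ∧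
    2 ^ variableBits e k n = Z * X ^ 20 * E ^ 2 := by
  refine ⟨_, _, _, rfl, rfl, rfl, ?_⟩
  rw [variableBits, ← pow_mul, ← pow_mul, ← pow_add, ← pow_add]
  congr 1
  ring

theorem pow_le_two_pow_size : n ^ k ≤ 2 ^ (k * Nat.size n) := by
  rw [mul_comm, pow_mul]
  exact Nat.pow_le_pow_left (Nat.lt_size_self n).le k

theorem registerCount_le : registerCount e n ≤ 4 * (2 ^ Nat.size n) ^ 2 := by
  have h1 : 2 ^ (Nat.size n - splitDepth e n) ≤ 2 ^ Nat.size n :=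
    Nat.pow_le_pow_right (by norm_num) (Nat.sub_le _ _)
  have h2 : Nat.size n ≤ 2 ^ Nat.size n := Nat.lt_two_pow_self.le
  calc registerCount e n ≤ 4 * 2 ^ Nat.size n * 2 ^ Nat.size n := by
        unfold registerCount
        gcongr
    _ = _ := by ring

/-- The estimates behind all size conditions. -/
theorem sizes (hn : 2 ≤ n) : ∃ X Z E : ℕ, X = 2 ^ Nat.size n ∧ Z = 2 ^ (k * Nat.size n) ∧
    4 ≤ X ∧ 1 ≤ Z ∧ e + Fintype.card Var + 1 ≤ E ∧
    variableBits e k n ≤ 23 * (X * Z * E) ∧ X ^ 17 * (X ^ 3 * Z * E ^ 2) = 2 ^ variableBits e k n := by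
  obtain ⟨X, Z, E, hX, hZ, hE, h⟩ := two_pow_variableBits e k n
  have hb := two_le_size hn
  have h1 : Nat.size n < X := hX ▸ Nat.lt_two_pow_self
  have h2 : k * Nat.size n < Z := hZ ▸ Nat.lt_two_pow_self
  have h3 : (e + Fintype.card Var) * Nat.size n < E := hE ▸ Nat.lt_two_pow_self
  have h4 : e + Fintype.card Var ≤ (e + Fintype.card Var) * Nat.size n :=
    Nat.le_mul_of_pos_right _ (by omega)
  have hX4 : 4 ≤ X := by
    rw [hX]
    exact Nat.pow_le_pow_right (n := 2) (by norm_num) hb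
  refine ⟨X, Z, E, hX, hZ, hX4, by omega, by omega, ?_, by rw [h]; ring⟩
  have hX1 : 1 ≤ X := by omega
  have hZ1 : 1 ≤ Z := by omega
  have hE1 : 1 ≤ E := by omega
  have a1 : Z ≤ X * Z * E := by
    calc Z = 1 * Z * 1 := by ring
      _ ≤ _ := by gcongr
  have a2 : X ≤ X * Z * E := by
    calc X = X * 1 * 1 := by ring
      _ ≤ _ := by gcongr
  have a3 : E ≤ X * Z * E := by
    calc E = 1 * 1 * E := by ring
      _ ≤ _ := by gcongr
  have : variableBits e k n =
      k * Nat.size n + 20 * Nat.size n + 2 * ((e + Fintype.card Var) * Nat.size n) := by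
    rw [variableBits]
    ring
  omega

theorem size_bound {X Z E L R p n : ℕ} (hX : 4 ≤ X) (hZ : 1 ≤ Z) (hE : 1 ≤ E) (hp : p ≤ Z)
    (hR : R ≤ 4 * X ^ 2) (hL : L ≤ 23 * (X * Z * E)) (hn : n ≤ X) :
    (R + 2) * (L + p) + 8 * X + 2 * n + 4 + p ≤ X ^ 17 * (X ^ 3 * Z * E ^ 2) := by
  have hZE : 1 ≤ Z * E := Nat.mul_pos hZ hE
  have hX2 : 4 * 4 ≤ X ^ 2 := by
    rw [pow_two]
    gcongr
  have h3 : X ≤ X ^ 3 := Nat.le_self_pow (by norm_num) X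
  have b1 : p ≤ X * Z * E := by
    calc p ≤ 1 * Z * 1 := by omega
      _ ≤ _ := by gcongr; omega
  have b2 : (R + 2) * (L + p) ≤ (5 * X ^ 2) * (24 * (X * Z * E)) :=
    Nat.mul_le_mul (by omega) (by omega)
  have b3 : X ≤ X ^ 3 * Z * E := by
    calc X = X * 1 * 1 := by ring
      _ ≤ X ^ 3 * Z * E := by gcongr
  have b4 : X * Z * E ≤ X ^ 3 * Z * E := by gcongr
  have b5 : 4 ^ 17 ≤ X ^ 17 := Nat.pow_le_pow_left hX 17
  calc (R + 2) * (L + p) + 8 * X + 2 * n + 4 + p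
      ≤ (5 * X ^ 2) * (24 * (X * Z * E)) + 8 * X + 2 * X + X + X * Z * E := by omega
    _ ≤ 120 * (X ^ 3 * Z * E) + 12 * (X ^ 3 * Z * E) := by
        have : (5 * X ^ 2) * (24 * (X * Z * E)) = 120 * (X ^ 3 * Z * E) := by ring
        omega
    _ = 132 * (X ^ 3 * Z * E) := by ring
    _ ≤ 4 ^ 17 * (X ^ 3 * Z * E) := Nat.mul_le_mul_right _ (by norm_num)
    _ ≤ _ := by
        refine Nat.mul_le_mul b5 (Nat.mul_le_mul_left _ ?_)
        exact Nat.le_self_pow (by norm_num) E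

theorem registers_size (hn : 2 ≤ n) (hp : p ≤ n ^ k) :
    (registerCount e n + 2) * (variableBits e k n + p) + 8 * 2 ^ (Nat.size n - splitDepth e n) +
      2 * n + 4 + p ≤ 2 ^ variableBits e k n := by
  obtain ⟨X, Z, E, hX, hZ, h4, h1, h2, hL, h⟩ := sizes (e := e) (k := k) hn
  have := size_bound (p := p) (n := n) h4 h1 (by omega) (hZ ▸ hp.trans pow_le_two_pow_size)
    (hX ▸ registerCount_le (e := e) (n := n)) hL (hX ▸ (Nat.lt_size_self n).le)
  have h5 : 2 ^ (Nat.size n - splitDepth e n) ≤ X := by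
    rw [hX]
    exact Nat.pow_le_pow_right (by norm_num) (Nat.sub_le _ _)
  omega

theorem space_size (hn : 2 ≤ n) : registerCount e n * variableBits e k n +
    variableBits e k n * Fintype.card Var + 4 * Nat.size n + 4 * e + 2 ≤
      2 ^ variableBits e k n := by
  obtain ⟨X, Z, E, hX, hZ, h4, h1, h2, hL, h⟩ := sizes (e := e) (k := k) hn
  have hR := hX ▸ registerCount_le (e := e) (n := n)
  have hb : Nat.size n < X := hX ▸ Nat.lt_two_pow_self
  have b5 : 4 ^ 17 ≤ X ^ 17 := Nat.pow_le_pow_left h4 17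
  have hX1 : 1 ≤ X := by omega
  have hE1 : 1 ≤ E := by omega
  have b1 : X * Z * E * X ^ 2 ≤ X ^ 3 * Z * E ^ 2 := by
    calc X * Z * E * X ^ 2 = X ^ 3 * Z * (E * 1) := by ring
      _ ≤ X ^ 3 * Z * (E * E) := by gcongr
      _ = _ := by ring
  have b2 : X * Z * E * E ≤ X ^ 3 * Z * E ^ 2 := by
    calc X * Z * E * E = X * (1 * 1) * Z * E ^ 2 := by ring
      _ ≤ X * (X * X) * Z * E ^ 2 := by gcongr
      _ = _ := by ring
  have b3 : X ≤ X ^ 3 * Z * E ^ 2 := by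
    calc X = X * (1 * 1) * 1 * 1 ^ 2 := by ring
      _ ≤ X * (X * X) * Z * E ^ 2 := by gcongr
      _ = _ := by ring
  have b4 : E ≤ X ^ 3 * Z * E ^ 2 := by
    calc E = 1 ^ 3 * 1 * (E * 1) := by ring
      _ ≤ X ^ 3 * Z * (E * E) := by gcongr
      _ = _ := by ring
  have b6 : registerCount e n * variableBits e k n ≤ 92 * (X ^ 3 * Z * E ^ 2) := by
    calc _ ≤ 4 * X ^ 2 * (23 * (X * Z * E)) := Nat.mul_le_mul hR hL
      _ = 92 * (X * Z * E * X ^ 2) := by ring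
      _ ≤ _ := Nat.mul_le_mul_left _ b1
  have b7 : variableBits e k n * Fintype.card Var ≤ 23 * (X ^ 3 * Z * E ^ 2) := by
    calc _ ≤ 23 * (X * Z * E) * E := Nat.mul_le_mul hL (by omega)
      _ = 23 * (X * Z * E * E) := by ring
      _ ≤ _ := Nat.mul_le_mul_left _ b2
  calc _ ≤ 125 * (X ^ 3 * Z * E ^ 2) := by omega
    _ ≤ 4 ^ 17 * (X ^ 3 * Z * E ^ 2) := Nat.mul_le_mul_right _ (by norm_num)
    _ ≤ X ^ 17 * (X ^ 3 * Z * E ^ 2) := Nat.mul_le_mul_right _ b5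
    _ = _ := h

end Sizes

section Machine

variable {e k n p a : ℕ}

/-- The parameters for given inputs. -/
noncomputable def inputParams (e : ℕ) (hn : 2 ≤ n) (hp : 2 ≤ p) (hpk : p ≤ n ^ k)
    (u v : Vertex n) (huv : (v.1 : ℕ) = u.1 + 2 ^ a) : Params where
  n := n
  p := p
  u1 := u.1
  u2 := u.2
  v1 := v.1
  v2 := v.2
  L := variableBits e k n
  P := 2 ^ variableBits e k n - ((2 ^ variableBits e k n - 1) % p + 1)
  b := Nat.size n
  g := splitDepth e n
  h := Nat.size n - splitDepth e n
  a := a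
  two_le_p := hp
  dvd := by
    have h1 := Nat.dvd_sub_mod (n := p) (2 ^ variableBits e k n - 1)
    rwa [Nat.sub_sub, add_comm 1] at h1
  P_lt := Nat.sub_lt (by positivity) (by positivity)
  lt_P := by
    have := Nat.mod_lt (2 ^ variableBits e k n - 1) (show 0 < p by omega)
    omega
  u2_le := by omega
  v2_le := by omega
  v1_eq := huv
  v1_le := by omega
  b_eq := Nat.sub_add_cancel (splitDepth_le e n)
  n_lt := Nat.lt_size_self n
  le_n := two_pow_size_le (by omega)
  size := by
    have h1 := registers_size (e := e) hn hpk
    have := Nat.mod_lt (2 ^ variableBits e k n - 1) (show 0 < p by omega)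
    rw [registerCount] at h1
    omega
  bits_le := by
    have ha : a < Nat.size n := Nat.lt_size.2 (by omega)
    have h1 := counterBits_le_of_lt (e := e) ha
    have h2 : Nat.size n / e ≤ Nat.size n := Nat.div_le_self _ _
    have h3 : 20 * Nat.size n ≤ variableBits e k n := Nat.mul_le_mul_right _ (by omega)
    omega

/-- The machine for the recursion parameter `e`. -/
noncomputable def catalyticMachine (e : ℕ) : Machine := (Code.program e).frag.toMachine

/-- The value of a block of cells. -/
def blockValue (L : ℕ) (τ : List Bool) (r : ℕ) : ℕ :=
  Nat.ofBits fun i : Fin L => τ.getD (r * L + i) false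

/-- The initial state for the input `w` and the initial contents `τ` of the catalytic tape. -/
def initState (L q : ℕ) (w τ : List Bool) : St Var :=
  ⟨fun _ => 0, blockValue L τ, Tape.init w, Tape.init (List.replicate q false), [], 0⟩

theorem rep_init {E : Env} (M : Machine) (w τ : List Bool) (q : ℕ) (hτ : τ.length = E.R * E.L)
    (hs : E.R * E.L + E.L * Fintype.card Var ≤ 2 ^ E.L) :
    Rep E (initState E.L q w τ) (M.init w (E.L * Fintype.card Var) q τ).mem where
  work_head := rfl
  rows := by
    refine ⟨by simp [Machine.init, Config.mem, Tape.init], fun i hi x => ?_⟩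
    have := cell_lt hi x
    simp [Machine.init, Config.mem, Tape.init, initState, this]
  lt x := Nat.two_pow_pos _
  cat_length := hτ
  cat r hr j hj := by
    have hlt : r * E.L + j < τ.length := by
      rw [hτ]
      calc r * E.L + j < (r + 1) * E.L := by rw [add_mul]; omega
        _ ≤ _ := Nat.mul_le_mul_right _ hr
    simp only [Machine.init, Config.mem, Tape.init, initState, blockValue]
    rw [Nat.testBit_ofBits_lt _ _ hj, List.getD_eq_getElem _ _ hlt, List.getElem?_eq_getElem hlt]
  reg_lt r _ := Nat.ofBits_lt_two_pow _
  address_head := rfl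
  address_le := by
    simp only [Machine.init, Config.mem, Tape.init, List.length_replicate, addressLength, hτ]
    exact Nat.clog_le_of_le_pow hs
  le_address := by
    simp only [Machine.init, Config.mem, Tape.init, List.length_replicate, addressLength, hτ]
    exact (Nat.le_add_right _ _).trans (Nat.le_pow_clog (by norm_num) _)
  input := rfl
  output := rfl
  oracle := rfl

theorem Rep.catalytic_eq {E : Env} {σ σ' : St Var} {m m' : Mem} (h : Rep E σ m) (h' : Rep E σ' m')
    (hreg : ∀ r < E.R, σ'.reg r = σ.reg r) : m'.catalytic.cells = m.catalytic.cells := by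
  refine List.ext_getElem? fun i => ?_
  by_cases hi : i < E.R * E.L
  · have hL : 0 < E.L := Nat.pos_of_ne_zero fun h0 => by simp [h0] at hi
    have hr : i / E.L < E.R := Nat.div_lt_of_lt_mul (by rwa [mul_comm] at hi)
    have h1 := h.cat _ hr _ (Nat.mod_lt i hL)
    have h2 := h'.cat _ hr _ (Nat.mod_lt i hL)
    rw [Nat.div_add_mod'] at h1 h2
    rw [h1, h2, hreg _ hr]
  · rw [List.getElem?_eq_none (by rw [h'.cat_length]; omega),
      List.getElem?_eq_none (by rw [h.cat_length]; omega)]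

theorem catalyticMachine_computes (he : 0 < e) (hn : 2 ≤ n) (hp : 2 ≤ p) (hpk : p ≤ n ^ k)
    {μ : Vertex n → Vertex n → ℕ} {D : List Bool → List Bool} (hD : IsWeightOracle μ p D)
    (u v : Vertex n) (huv : (v.1 : ℕ) = u.1 + 2 ^ a) {T : ℕ}
    (hT : unitTime Var (variableBits e k n) *
      Code.programTime (inputParams e hn hp hpk u v huv) e ≤ T) :
    (catalyticMachine e).ComputesCatalytically D (encodeList [n, p, u.1, u.2, v.1, v.2])
      (Nat.bits (totalPathWeight (grid n) μ u v % p))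
      (variableBits e k n * Fintype.card Var) (20 * variableBits e k n)
      (registerCount e n * variableBits e k n) T T := by
  intro τ hτ
  set π := inputParams e hn hp hpk u v huv with hπ
  have hsp := space_size (e := e) (k := k) hn
  have hL : 0 < variableBits e k n :=
    Nat.mul_pos (by omega) (Nat.size_pos.2 (by omega))
  have hrep := rep_init (E := π.env D) (catalyticMachine e)
    (encodeList [n, p, u.1, u.2, v.1, v.2]) τ (20 * variableBits e k n) hτ (by
      change registerCount e n * variableBits e k n + variableBits e k n * Fintype.card Var ≤
        2 ^ variableBits e k n
      omega)
  obtain ⟨σ', hbig, hreg, htime, r, hout, hr⟩ := Code.wp_program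
    (σ := initState (variableBits e k n) (20 * variableBits e k n)
      (encodeList [n, p, u.1, u.2, v.1, v.2]) τ) (π := π) (μ := μ) he rfl rfl rfl
    (by
      change 4 * Nat.size n + 4 * e + 1 < 2 ^ variableBits e k n
      omega) hD rfl (fun _ _ => Nat.ofBits_lt_two_pow _)
    (by
      change (List.replicate _ false).length = _
      rw [List.length_replicate]
      rfl) (Nat.zero_le _) rfl
  obtain ⟨m', t, ⟨t', htt, hrun⟩, hrep', ht⟩ := Big.run (E := π.env D) hL hbig hrep
  obtain ⟨s', h1, h2⟩ := Frag.exec_toMachine hrun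
  have hq := Frag.queries_exec hrun
  have hle : t' ≤ T := by
    have h3 : t + 1 + unitTime Var (variableBits e k n) * 0 ≤
      unitTime Var (variableBits e k n) * σ'.time := ht
    have h4 : σ'.time ≤ 0 + Code.programTime π e := htime
    have h5 := Nat.mul_le_mul_left (unitTime Var (variableBits e k n)) h4
    rw [zero_add] at h5
    omega
  refine ⟨t', hle, _, h1.symm, h2, ?_, ?_, ?_⟩
  · change m'.output = _
    rw [hrep'.output, hout, mod_eq_of_prodFrom μ π.dvd huv hr]
    rfl
  · exact hrep.catalytic_eq hrep' hreg
  · have h6 : m'.queries ≤ 0 + t' := hq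
    change m'.queries ≤ T
    omega

end Machine

end CatalyticGrid

namespace CatalyticGrid
open Var
set_option linter.unusedSimpArgs false

/-! ### Asymptotic bounds -/

/-- The constant in the time bound. -/
noncomputable def timeConstant (e : ℕ) : ℕ := (22 * Fintype.card Var + 65) * (e + 3570)

/-- The time bound. -/
noncomputable def timeBound (e k n : ℕ) : ℕ :=
  timeConstant e * (n ^ 3 * variableBits e k n ^ 3 * 2 ^ (Nat.size n / e))

theorem unitTime_le {L : ℕ} (hL : 0 < L) : unitTime Var L ≤ (22 * Fintype.card Var + 65) * L := by
  have h1 : Fintype.card Var ≤ Fintype.card Var * L := Nat.le_mul_of_pos_right _ hL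
  have : (22 * Fintype.card Var + 65) * L =
    L * (20 * Fintype.card Var + 25) + 2 * (Fintype.card Var * L) + 40 * L := by ring
  unfold unitTime
  omega

theorem arith_time {n L b a e R rt cb W : ℕ} (hn : 2 ≤ n) (hb : 1 ≤ b) (hbL : b ≤ L)
    (hab : a < b) (hbn : b ≤ 2 * n) (hR : R ≤ 8 * n * b) (hW : 1 ≤ W)
    (hcb : cb ≤ n ^ 2 * W)
    (hrt : rt = a * (17 * L + 35) + (n + 1) * (450 * L + 322) + 18) :
    98 * L + e + 140 + (R + 1) * (7 * R + 6) + cb * (rt + 1) ≤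
      (e + 3570) * (n ^ 3 * L ^ 2 * W) := by
  have hL : 1 ≤ L := hb.trans hbL
  have hn1 : 1 ≤ n := by omega
  have e1 : L ≤ n ^ 3 * L ^ 2 * W := by
    calc L = 1 ^ 3 * (L * 1) * 1 := by ring
      _ ≤ n ^ 3 * (L * L) * W := by gcongr
      _ = _ := by ring
  have e2 : e + 140 ≤ (e + 140) * (n ^ 3 * L ^ 2 * W) :=
    Nat.le_mul_of_pos_right _ (by positivity)
  have e3 : (R + 1) * (7 * R + 6) ≤ 1664 * (n ^ 3 * L ^ 2 * W) := by
    have r1 : R + 1 ≤ 9 * (n * b) := by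
      have : 1 ≤ n * b := Nat.mul_pos hn1 hb
      have : 8 * n * b = 8 * (n * b) := by ring
      omega
    have r2 : 7 * R + 6 ≤ 63 * (n * b) := by omega
    calc (R + 1) * (7 * R + 6) ≤ 9 * (n * b) * (63 * (n * b)) := Nat.mul_le_mul r1 r2
      _ = 567 * (n ^ 2 * 1 * b ^ 2 * 1) := by ring
      _ ≤ 1664 * (n ^ 2 * n * L ^ 2 * W) := by gcongr; norm_num
      _ = _ := by ring
  have e4 : cb * (rt + 1) ≤ 1667 * (n ^ 3 * L ^ 2 * W) := by
    have r1 : rt + 1 ≤ 1667 * (n * L) := by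
      have : 1 ≤ L := hL
      have t1 : a * (17 * L + 35) ≤ 104 * (n * L) := by
        calc a * (17 * L + 35) ≤ (2 * n) * (52 * L) := Nat.mul_le_mul (by omega) (by omega)
          _ = _ := by ring
      have t2 : (n + 1) * (450 * L + 322) ≤ 1544 * (n * L) := by
        calc (n + 1) * (450 * L + 322) ≤ (2 * n) * (772 * L) :=
              Nat.mul_le_mul (by omega) (by omega)
          _ = _ := by ring
      have t3 : 1 ≤ n * L := Nat.mul_pos hn1 hL
      omega
    calc cb * (rt + 1) ≤ n ^ 2 * W * (1667 * (n * L)) := Nat.mul_le_mul hcb r1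
      _ = 1667 * (n ^ 3 * (L * 1) * W) := by ring
      _ ≤ 1667 * (n ^ 3 * (L * L) * W) := by gcongr
      _ = _ := by ring
  have e5 : (e + 3570) * (n ^ 3 * L ^ 2 * W) = (e + 140) * (n ^ 3 * L ^ 2 * W) +
    3430 * (n ^ 3 * L ^ 2 * W) := by ring
  have : 98 * L + e + 140 + (R + 1) * (7 * R + 6) + cb * (rt + 1) =
    98 * L + (e + 140) + ((R + 1) * (7 * R + 6)) + (cb * (rt + 1)) := by ring
  omega

theorem size_le_variableBits (e k n : ℕ) : Nat.size n ≤ variableBits e k n :=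
  Nat.le_mul_of_pos_left _ (by omega)

theorem time_le_timeBound {e k n p a : ℕ} (hn : 2 ≤ n) (hp : 2 ≤ p) (hpk : p ≤ n ^ k)
    (u v : Vertex n) (huv : (v.1 : ℕ) = u.1 + 2 ^ a) :
    unitTime Var (variableBits e k n) *
      Code.programTime (inputParams e hn hp hpk u v huv) e ≤ timeBound e k n := by
  set π := inputParams e hn hp hpk u v huv with hπ
  have hb : 0 < Nat.size n := Nat.size_pos.2 (by omega)
  have hbL := size_le_variableBits e k n
  have han : 2 ^ a ≤ n := by omega
  have ha : a < Nat.size n := Nat.lt_size.2 han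
  have h2b := two_pow_size_le (n := n) (by omega)
  have hbn : Nat.size n ≤ 2 * n := Nat.lt_two_pow_self.le.trans h2b
  have hR : registerCount e n ≤ 8 * n * Nat.size n := by
    have h1 : 2 ^ (Nat.size n - splitDepth e n) ≤ 2 ^ Nat.size n :=
      Nat.pow_le_pow_right (by norm_num) (Nat.sub_le _ _)
    exact Nat.mul_le_mul_right _ (by omega)
  have hcb : 2 ^ counterBits π.h π.g π.a ≤ n ^ 2 * 2 ^ (Nat.size n / e) := by
    calc 2 ^ counterBits π.h π.g π.a ≤ 2 ^ (2 * a + Nat.size n / e) :=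
          Nat.pow_le_pow_right (by norm_num) (counterBits_le_of_lt ha)
      _ = (2 ^ a) ^ 2 * 2 ^ (Nat.size n / e) := by rw [pow_add, ← pow_mul, mul_comm a]
      _ ≤ _ := Nat.mul_le_mul_right _ (Nat.pow_le_pow_left han 2)
  have h1 : Code.programTime π e ≤
      (e + 3570) * (n ^ 3 * variableBits e k n ^ 2 * 2 ^ (Nat.size n / e)) :=
    arith_time (R := registerCount e n) (rt := Code.roundTime π) (a := a) hn hb hbL ha hbn hR
      Nat.one_le_two_pow hcb rfl
  calc _ ≤ (22 * Fintype.card Var + 65) * variableBits e k n *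
      ((e + 3570) * (n ^ 3 * variableBits e k n ^ 2 * 2 ^ (Nat.size n / e))) :=
        Nat.mul_le_mul (unitTime_le (hb.trans_le hbL)) h1
    _ = _ := by
      rw [timeBound, timeConstant]
      ring

section Real

variable {n : ℕ}

theorem size_le_logb (hn : 2 ≤ n) : (Nat.size n : ℝ) ≤ Real.logb 2 n + 1 := by
  have h0 : 0 < Nat.size n := Nat.size_pos.2 (by omega)
  have h := Nat.lt_size.1 (Nat.sub_lt h0 one_pos)
  have h1 : ((Nat.size n - 1 : ℕ) : ℝ) ≤ Real.logb 2 n := by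
    rw [Real.le_logb_iff_rpow_le (by norm_num) (by positivity), Real.rpow_natCast]
    exact_mod_cast h
  rw [Nat.cast_sub h0] at h1
  push_cast at h1
  linarith

theorem logb_le_size (hn : 2 ≤ n) : Real.logb 2 n ≤ Nat.size n := by
  rw [Real.logb_le_iff_le_rpow (by norm_num) (by positivity), Real.rpow_natCast]
  exact_mod_cast (Nat.lt_size_self n).le

theorem one_le_logb (hn : 2 ≤ n) : 1 ≤ Real.logb 2 n := by
  rw [Real.le_logb_iff_rpow_le (by norm_num) (by positivity), Real.rpow_one]
  exact_mod_cast hn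

theorem le_two_rpow {y : ℝ} : y ≤ (2 : ℝ) ^ y := by
  rcases le_or_gt y 0 with h | h
  · exact h.trans (by positivity)
  have h1 : (⌊y⌋₊ : ℝ) + 1 ≤ 2 ^ (⌊y⌋₊ : ℝ) := by
    rw [Real.rpow_natCast]
    exact_mod_cast Nat.lt_two_pow_self (n := ⌊y⌋₊)
  calc y ≤ ⌊y⌋₊ + 1 := (Nat.lt_floor_add_one y).le
    _ ≤ _ := h1
    _ ≤ _ := Real.rpow_le_rpow_of_exponent_le (by norm_num) (Nat.floor_le h.le)

/-- A power is at most a constant times an exponential. -/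
theorem pow_le_mul_two_rpow {c y : ℝ} (hc : 0 < c) (hy : 0 ≤ y) (d : ℕ) :
    y ^ d ≤ (1 / c) ^ d * (2 : ℝ) ^ (d * c * y) := by
  have h : y ≤ 1 / c * (2 : ℝ) ^ (c * y) := by
    rw [one_div, le_inv_mul_iff₀ hc]
    exact le_two_rpow
  calc y ^ d ≤ (1 / c * (2 : ℝ) ^ (c * y)) ^ d := pow_le_pow_left₀ hy h d
    _ = _ := by
      rw [mul_pow, ← Real.rpow_mul_natCast (by norm_num)]
      congr 2
      ring

theorem variableBits_le (e k : ℕ) (hn : 2 ≤ n) : (variableBits e k n : ℝ) ≤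
    (k + 20 + 2 * (e + Fintype.card Var) : ℕ) * (Real.logb 2 n + 1) := by
  rw [variableBits, Nat.cast_mul]
  exact mul_le_mul_of_nonneg_left (size_le_logb hn) (Nat.cast_nonneg _)

theorem freeSpace_bound (e k : ℕ) : ∃ A : ℝ, ∀ n : ℕ, 2 ≤ n →
    (freeSpace (variableBits e k n * Fintype.card Var) (20 * variableBits e k n)
      (registerCount e n * variableBits e k n) : ℝ) ≤ A * Real.logb 2 n := by
  refine ⟨(Fintype.card Var + 21 : ℕ) *
    ((k + 20 + 2 * (e + Fintype.card Var) : ℕ) * 2), fun n hn => ?_⟩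
  have h1 : freeSpace (variableBits e k n * Fintype.card Var) (20 * variableBits e k n)
      (registerCount e n * variableBits e k n) ≤
      (Fintype.card Var + 21) * variableBits e k n := by
    have h2 : addressLength (variableBits e k n * Fintype.card Var)
        (registerCount e n * variableBits e k n) ≤ variableBits e k n := by
      refine Nat.clog_le_of_le_pow ?_
      have := space_size (e := e) (k := k) hn
      omega
    have : (Fintype.card Var + 21) * variableBits e k n = variableBits e k n * Fintype.card Var +
      20 * variableBits e k n + variableBits e k n := by ring
    rw [freeSpace]
    omega
  have h2 := one_le_logb hn
  calc _ ≤ (((Fintype.card Var + 21) * variableBits e k n : ℕ) : ℝ) := by exact_mod_cast h1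
    _ = ((Fintype.card Var + 21 : ℕ) : ℝ) * variableBits e k n := by push_cast; ring
    _ ≤ ((Fintype.card Var + 21 : ℕ) : ℝ) *
        ((k + 20 + 2 * (e + Fintype.card Var) : ℕ) * (Real.logb 2 n + 1)) := by
        gcongr
        exact variableBits_le e k hn
    _ ≤ ((Fintype.card Var + 21 : ℕ) : ℝ) *
        ((k + 20 + 2 * (e + Fintype.card Var) : ℕ) * (2 * Real.logb 2 n)) := by
        gcongr
        linarith
    _ = _ := by ring

theorem sqrt_logb_le_splitDepth {e : ℕ} (he : 0 < e) (hn : 2 ≤ n) :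
    √(Real.logb 2 n) / √e ≤ splitDepth e n + 1 := by
  have he' : (0 : ℝ) < e := by exact_mod_cast he
  rw [← Real.sqrt_div' _ he'.le, Real.sqrt_le_left (by positivity), div_le_iff₀ he']
  have h1 : Nat.size n / e < (splitDepth e n + 1) ^ 2 := by
    exact Nat.lt_succ_sqrt' _
  have h2 : Nat.size n < e * ((splitDepth e n + 1) ^ 2) := by
    rwa [Nat.div_lt_iff_lt_mul he, mul_comm] at h1
  have h3 : (Nat.size n : ℝ) ≤ e * ((splitDepth e n + 1) ^ 2) := by exact_mod_cast h2.le
  have := logb_le_size hn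
  linarith

theorem catalyticSpace_bound {e : ℕ} (k : ℕ) (he : 0 < e) : ∃ A δ : ℝ, 0 < δ ∧
    ∀ n : ℕ, 2 ≤ n → (registerCount e n * variableBits e k n : ℕ) ≤
      A * (n / (2 : ℝ) ^ (δ * √(Real.logb 2 n))) := by
  have he' : (0 : ℝ) < e := by exact_mod_cast he
  set δ : ℝ := 1 / (2 * √e) with hδ
  have hδ0 : 0 < δ := by positivity
  set κ : ℝ := ((k + 20 + 2 * (e + Fintype.card Var) : ℕ) : ℝ) with hκ
  refine ⟨16 * κ * ((1 / (δ / 4)) ^ 4 * 2 ^ δ), δ, hδ0, fun n hn => ?_⟩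
  set x := Real.logb 2 n with hx
  have hx1 : 1 ≤ x := one_le_logb hn
  have hb : (Nat.size n : ℝ) ≤ x + 1 := size_le_logb hn
  have hL : (variableBits e k n : ℝ) ≤ κ * (x + 1) := variableBits_le e k hn
  have hpow : (2 : ℝ) ^ (Nat.size n - splitDepth e n) ≤
      4 * n / (2 : ℝ) ^ (2 * δ * √x) := by
    have h1 : (2 : ℝ) ^ (Nat.size n - splitDepth e n) * 2 ^ splitDepth e n ≤ 2 * n := by
      rw [← pow_add, Nat.sub_add_cancel (splitDepth_le e n)]
      exact_mod_cast two_pow_size_le (n := n) (by omega)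
    have h2 : (2 : ℝ) ^ (2 * δ * √x) ≤ 2 * 2 ^ splitDepth e n := by
      rw [← pow_succ', ← Real.rpow_natCast]
      refine Real.rpow_le_rpow_of_exponent_le (by norm_num) ?_
      have := sqrt_logb_le_splitDepth he hn
      push_cast
      refine le_trans (le_of_eq ?_) this
      rw [hδ, ← hx]
      field_simp
    rw [le_div_iff₀ (by positivity)]
    calc (2 : ℝ) ^ (Nat.size n - splitDepth e n) * 2 ^ (2 * δ * √x)
        ≤ (2 : ℝ) ^ (Nat.size n - splitDepth e n) * (2 * 2 ^ splitDepth e n) := by gcongr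
      _ = 2 * ((2 : ℝ) ^ (Nat.size n - splitDepth e n) * 2 ^ splitDepth e n) := by ring
      _ ≤ 2 * (2 * n) := by gcongr
      _ = _ := by ring
  have hx2 : (x + 1) ^ 2 ≤ (1 / (δ / 4)) ^ 4 * 2 ^ δ * (2 : ℝ) ^ (δ * √x) := by
    have h1 : x + 1 ≤ (√x + 1) ^ 2 := by
      have := Real.sq_sqrt (show 0 ≤ x by linarith)
      nlinarith [Real.sqrt_nonneg x]
    calc (x + 1) ^ 2 ≤ ((√x + 1) ^ 2) ^ 2 := by gcongr
      _ = (√x + 1) ^ 4 := by ring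
      _ ≤ (1 / (δ / 4)) ^ 4 * (2 : ℝ) ^ ((4 : ℕ) * (δ / 4) * (√x + 1)) :=
        pow_le_mul_two_rpow (by positivity) (by positivity) 4
      _ = _ := by
        rw [mul_assoc (_ ^ 4) (2 ^ δ), ← Real.rpow_add (by norm_num)]
        congr 2
        push_cast
        ring
  have hsplit : (2 : ℝ) ^ (2 * δ * √x) = 2 ^ (δ * √x) * 2 ^ (δ * √x) := by
    rw [← Real.rpow_add (by norm_num)]
    congr 1
    ring
  rw [registerCount]
  push_cast
  calc 4 * (2 : ℝ) ^ (Nat.size n - splitDepth e n) * Nat.size n * variableBits e k n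
      ≤ 4 * (4 * n / (2 : ℝ) ^ (2 * δ * √x)) * (x + 1) * (κ * (x + 1)) := by gcongr
    _ = 16 * κ * (n / (2 : ℝ) ^ (2 * δ * √x)) * (x + 1) ^ 2 := by ring
    _ ≤ 16 * κ * (n / (2 : ℝ) ^ (2 * δ * √x)) *
        ((1 / (δ / 4)) ^ 4 * 2 ^ δ * (2 : ℝ) ^ (δ * √x)) := by gcongr
    _ = _ := by
      rw [hsplit]
      field_simp

theorem timeBound_bound {e : ℕ} (k : ℕ) {ε : ℝ} (hε : 0 < ε) (he : 2 ≤ ε * e) :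
    ∃ A : ℝ, ∀ n : ℕ, 2 ≤ n →
      (timeBound e k n : ℝ) ≤
        A * ((n : ℝ) ^ (3 + ε) / (2 : ℝ) ^ (3 * √(Real.logb 2 n))) := by
  set κ : ℝ := ((k + 20 + 2 * (e + Fintype.card Var) : ℕ) : ℝ) with hκ
  refine ⟨timeConstant e * κ ^ 3 * ((1 / (ε / 12)) ^ 3 * 2 ^ (3 / 4 * ε + 9 / ε)),
    fun n hn => ?_⟩
  set x := Real.logb 2 n with hx
  have hx1 : 1 ≤ x := one_le_logb hn
  have hn0 : (0 : ℝ) < n := by exact_mod_cast (by omega : 0 < n)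
  have he0 : (0 : ℝ) < e := by
    by_contra h
    nlinarith
  have hL : (variableBits e k n : ℝ) ≤ κ * (x + 1) := variableBits_le e k hn
  have hb : (2 : ℝ) ^ (Nat.size n / e) ≤ 2 ^ (ε / 2 * (x + 1)) := by
    rw [← Real.rpow_natCast]
    refine Real.rpow_le_rpow_of_exponent_le (by norm_num) ?_
    calc ((Nat.size n / e : ℕ) : ℝ) ≤ Nat.size n / e := Nat.cast_div_le
      _ ≤ (x + 1) / e := by
        gcongr
        exact size_le_logb hn
      _ ≤ _ := by
        rw [div_le_iff₀ he0]
        nlinarith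
  have hp : (x + 1) ^ 3 ≤ (1 / (ε / 12)) ^ 3 * (2 : ℝ) ^ (ε / 4 * (x + 1)) := by
    have := pow_le_mul_two_rpow (c := ε / 12) (y := x + 1) (by positivity) (by linarith) 3
    rwa [show ((3 : ℕ) : ℝ) * (ε / 12) = ε / 4 by push_cast; ring] at this
  have hs : 3 * √x ≤ ε / 4 * x + 9 / ε := by
    have h1 := Real.sq_sqrt (show 0 ≤ x by linarith)
    have h2 : 0 ≤ ε / 4 * (√x - 6 / ε) ^ 2 := by positivity
    have h3 : ε / 4 * (√x - 6 / ε) ^ 2 = ε / 4 * √x ^ 2 - 3 * √x + 9 / ε := by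
      field_simp
      ring
    rw [h3, h1] at h2
    linarith
  have hnx : (n : ℝ) ^ (3 + ε) = n ^ 3 * 2 ^ (ε * x) := by
    rw [Real.rpow_add hn0, mul_comm ε, Real.rpow_mul (by norm_num), hx,
      Real.rpow_logb (by norm_num) (by norm_num) hn0]
    norm_cast
  have hexp : (2 : ℝ) ^ (ε / 4 * (x + 1)) * 2 ^ (ε / 2 * (x + 1)) * 2 ^ (3 * √x) ≤
      2 ^ (3 / 4 * ε + 9 / ε) * 2 ^ (ε * x) := by
    rw [← Real.rpow_add (by norm_num), ← Real.rpow_add (by norm_num),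
      ← Real.rpow_add (by norm_num)]
    refine Real.rpow_le_rpow_of_exponent_le (by norm_num) ?_
    linarith
  have hW : (2 : ℝ) ^ (ε / 4 * (x + 1)) * 2 ^ (ε / 2 * (x + 1)) ≤
      2 ^ (3 / 4 * ε + 9 / ε) * 2 ^ (ε * x) / 2 ^ (3 * √x) := by
    rwa [le_div_iff₀ (by positivity)]
  rw [timeBound, hnx]
  push_cast
  calc (timeConstant e : ℝ) * (n ^ 3 * variableBits e k n ^ 3 * 2 ^ (Nat.size n / e))
      ≤ timeConstant e * (n ^ 3 * (κ * (x + 1)) ^ 3 * 2 ^ (ε / 2 * (x + 1))) := by gcongr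
    _ = timeConstant e * (n ^ 3 * κ ^ 3) * ((x + 1) ^ 3 * 2 ^ (ε / 2 * (x + 1))) := by ring
    _ ≤ timeConstant e * (n ^ 3 * κ ^ 3) *
        ((1 / (ε / 12)) ^ 3 * (2 : ℝ) ^ (ε / 4 * (x + 1)) * 2 ^ (ε / 2 * (x + 1))) := by gcongr
    _ = timeConstant e * (n ^ 3 * κ ^ 3) * (1 / (ε / 12)) ^ 3 *
        ((2 : ℝ) ^ (ε / 4 * (x + 1)) * 2 ^ (ε / 2 * (x + 1))) := by ring
    _ ≤ timeConstant e * (n ^ 3 * κ ^ 3) * (1 / (ε / 12)) ^ 3 *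
        (2 ^ (3 / 4 * ε + 9 / ε) * 2 ^ (ε * x) / 2 ^ (3 * √x)) := by gcongr
    _ = _ := by ring

end Real

end CatalyticGrid

open CatalyticGrid in
theorem mainTheorem4 (ε : ℝ) (hε : 0 < ε) :
    ∃ M : Machine, ∀ k : ℕ, ∃ (A δ : ℝ) (s q c T K : ℕ → ℕ), 0 < δ ∧
      (∀ n : ℕ, 2 ≤ n →
        (freeSpace (s n) (q n) (c n) : ℝ) ≤ A * Real.logb 2 n ∧
        (c n : ℝ) ≤ A * (n / (2 : ℝ) ^ (δ * √(Real.logb 2 n))) ∧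
        (T n : ℝ) ≤ A * (n : ℝ) ^ (3 + ε) ∧
        (K n : ℝ) ≤ A * ((n : ℝ) ^ (3 + ε) / (2 : ℝ) ^ (3 * √(Real.logb 2 n)))) ∧
      ∀ n : ℕ, 2 ≤ n → ∀ p : ℕ, p.Prime → p ≤ n ^ k →
        ∀ (μ : Vertex n → Vertex n → ℕ) (D : List Bool → List Bool), IsWeightOracle μ p D →
        ∀ (u v : Vertex n) (a : ℕ), (v.1 : ℕ) = u.1 + 2 ^ a →
          M.ComputesCatalytically D
            (encodeList [n, p, u.1, u.2, v.1, v.2])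
            (Nat.bits (totalPathWeight (grid n) μ u v % p))
            (s n) (q n) (c n) (T n) (K n) := by
  obtain ⟨e, he⟩ := exists_nat_gt (2 / ε)
  have he0 : 0 < e := by
    have : (0 : ℝ) < e := lt_trans (by positivity) he
    exact_mod_cast this
  have heε : 2 ≤ ε * e := by
    rw [div_lt_iff₀ hε] at he
    linarith
  refine ⟨catalyticMachine e, fun k => ?_⟩
  obtain ⟨A₁, h₁⟩ := freeSpace_bound e k
  obtain ⟨A₂, δ, hδ, h₂⟩ := catalyticSpace_bound k he0
  obtain ⟨A₃, h₃⟩ := timeBound_bound k hε heε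
  refine ⟨max A₁ (max A₂ (max A₃ 0)), δ, fun n => variableBits e k n * Fintype.card Var,
    fun n => 20 * variableBits e k n, fun n => registerCount e n * variableBits e k n,
    timeBound e k, timeBound e k, hδ, fun n hn => ?_, fun n hn p hp hpk μ D hD u v a huv =>
      catalyticMachine_computes he0 hn hp.two_le hpk hD u v huv
        (time_le_timeBound hn hp.two_le hpk u v huv)⟩
  have hx := one_le_logb hn
  have hK : (timeBound e k n : ℝ) ≤ max A₁ (max A₂ (max A₃ 0)) *
      ((n : ℝ) ^ (3 + ε) / (2 : ℝ) ^ (3 * √(Real.logb 2 n))) :=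
    (h₃ n hn).trans (mul_le_mul_of_nonneg_right (by simp) (by positivity))
  refine ⟨(h₁ n hn).trans (mul_le_mul_of_nonneg_right (by simp) (by linarith)),
    (h₂ n hn).trans (mul_le_mul_of_nonneg_right (by simp) (by positivity)), hK.trans ?_, hK⟩
  exact mul_le_mul_of_nonneg_left (div_le_self (by positivity)
    (Real.one_le_rpow (by norm_num) (by positivity))) (by simp)
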